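/- Model. The machine is the unit-cost RAM with $w$-bit words and instructions for constants and the word length, addition, subtraction, multiplication, bitwise Boolean operations, shifts, loads, stores and (conditional) jumps; programs do not depend on $w$. Characters are machine words. Regular expressions are built from single characters by concatenation, union and star. The Thompson automaton (TNFA) $N(R)$ has a start state $\theta$ and an accepting state $\phi$ for each node of the parse tree of $R$, and the following transitions: for a character $\alpha$, an $\alpha$-transition $(\theta_\alpha,\phi_\alpha)$; for $ST$, the $\epsilon$-transitions $(\theta_{ST},\theta_S)$, $(\phi_S,\theta_T)$, $(\phi_T,\phi_{ST})$; for $S|T$, the $\epsilon$-transitions $(\theta_{S|T},\theta_S)$, $(\theta_{S|T},\theta_T)$, $(\phi_S,\phi_{S|T})$, $(\phi_T,\phi_{S|T})$; for $S^*$, the $\epsilon$-transitions $(\theta_{S^*},\theta_S)$, $(\theta_{S^*},\phi_{S^*})$, $(\phi_S,\phi_{S^*})$, $(\phi_S,\theta_S)$. A TNFA is given by the parse tree of $R$, stored in read-only memory as an array in postorder with pointers to the children; the node numbered $i$ has the states $2i$ ($\theta$) and $2i+1$ ($\phi$). A simulation data structure for a TNFA $A$ is built by a preprocessing program. It represents every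 state-set $S$ of $A$ as a bitstring in a constant number of words, in which each state has its own bit position, and it supports any sequence of the following operations, for a character $\alpha$ and a state $s$: $\mathrm{Move}_A(S,\alpha)$ returns the set of states reachable from $S$ by a single $\alpha$-transition; $\mathrm{Close}_A(S)$ returns the set of states reachable from $S$ by zero or more $\epsilon$-transitions; $\mathrm{Member}_A(S,s)$ answers whether $s\in S$; $\mathrm{Insert}_A(S,s)$ returns $S\cup\{s\}$. Lemma. For TNFAs with $m = O(w)$ states there is a simulation data structure that uses $O(m)$ space and $O(m\log m)$ preprocessing time and supports all operations in $O(\log m)$ time. Precisely: for every constant $c$ there are fixed programs for the preprocessing and for the four operations, a fixed number of words per state-set, and a constant $K$, all depending only on $c$, such that for every word length $w$ and every TNFA with $m \le cw$ states such that $Km \le 2^w$ (so that the memory in use can be addressed by words), these programs form a simulation data structure for that TNFA; preprocessing takes at most $K\, m\lfloor\log_2 m\rfloor$ steps, each operation takes at most $K\lfloor\log_2 m\rfloor$ steps, and only the first $Km$ memory cells, the input included, are ever accessed. -/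

import Mathlib

/-! ### Regular expressions and Thompson automata -/

/-- Regular expressions over the alphabet `α` (characters, concatenation, union, star).
A term of this type is the same thing as its parse tree. -/
inductive RegEx (α : Type) : Type
  | char (a : α) : RegEx α
  | cat (S T : RegEx α) : RegEx α
  | alt (S T : RegEx α) : RegEx α
  | star (S : RegEx α) : RegEx α

namespace RegEx

/-- Number of nodes of the parse tree. -/
def size {α : Type} : RegEx α → ℕ
  | char _ => 1
  | cat S T => S.size + T.size + 1
  | alt S T => S.size + T.size + 1
  | star S => S.size + 1

/-- Number of states of the Thompson automaton: two for every node of the parse tree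
(see `RegEx.State.idx_bijOn`). -/
def numStates {α : Type} (R : RegEx α) : ℕ := 2 * R.size

/-- States of the Thompson automaton `N(R)`: a new start state and a new accepting state, and the
states of the automata of the immediate subexpressions. -/
inductive State {α : Type} : RegEx α → Type
  | start (R : RegEx α) : State R
  | accept (R : RegEx α) : State R
  | catL {S T : RegEx α} (s : State S) : State (cat S T)
  | catR {S T : RegEx α} (s : State T) : State (cat S T)
  | altL {S T : RegEx α} (s : State S) : State (alt S T)
  | altR {S T : RegEx α} (s : State T) : State (alt S T)
  | starIn {S : RegEx α} (s : State S) : State (star S)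

open State in
/-- Transitions of `N(R)`. The label `none` stands for `ε`. -/
inductive Trans {α : Type} : (R : RegEx α) → State R → Option α → State R → Prop
  | char (a : α) : Trans (char a) (start _) (some a) (accept _)
  | cat_in (S T : RegEx α) : Trans (cat S T) (start _) none (catL (start S))
  | cat_mid (S T : RegEx α) : Trans (cat S T) (catL (accept S)) none (catR (start T))
  | cat_out (S T : RegEx α) : Trans (cat S T) (catR (accept T)) none (accept _)
  | cat_left {S T : RegEx α} {s t : State S} {x : Option α} (h : Trans S s x t) :
      Trans (cat S T) (catL s) x (catL t)
  | cat_right {S T : RegEx α} {s t : State T} {x : Option α} (h : Trans T s x t) :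
      Trans (cat S T) (catR s) x (catR t)
  | alt_inL (S T : RegEx α) : Trans (alt S T) (start _) none (altL (start S))
  | alt_inR (S T : RegEx α) : Trans (alt S T) (start _) none (altR (start T))
  | alt_outL (S T : RegEx α) : Trans (alt S T) (altL (accept S)) none (accept _)
  | alt_outR (S T : RegEx α) : Trans (alt S T) (altR (accept T)) none (accept _)
  | alt_left {S T : RegEx α} {s t : State S} {x : Option α} (h : Trans S s x t) :
      Trans (alt S T) (altL s) x (altL t)
  | alt_right {S T : RegEx α} {s t : State T} {x : Option α} (h : Trans T s x t) :
      Trans (alt S T) (altR s) x (altR t)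
  | star_in (S : RegEx α) : Trans (star S) (start _) none (starIn (start S))
  | star_skip (S : RegEx α) : Trans (star S) (start _) none (accept _)
  | star_out (S : RegEx α) : Trans (star S) (starIn (accept S)) none (accept _)
  | star_back (S : RegEx α) : Trans (star S) (starIn (accept S)) none (starIn (start S))
  | star_inner {S : RegEx α} {s t : State S} {x : Option α} (h : Trans S s x t) :
      Trans (star S) (starIn s) x (starIn t)

/-- The Thompson automaton (TNFA) `N(R)`. -/
def thompson {α : Type} (R : RegEx α) : εNFA α (State R) where
  step s x := {t | Trans R s x t}
  start := {State.start R}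
  accept := {State.accept R}

/-- `Move(S, a)`: the states reachable from `S` via a single `a`-transition. -/
def move {α : Type} (R : RegEx α) (S : Set (State R)) (a : α) : Set (State R) :=
  ⋃ s ∈ S, R.thompson.step s (some a)

/-- `Close(S)`: the states reachable from `S` via zero or more `ε`-transitions. -/
def close {α : Type} (R : RegEx α) (S : Set (State R)) : Set (State R) :=
  R.thompson.εClosure S

/-- The number of a state. Number the parse tree nodes `0, 1, …` in postorder; the node numbered
`i` has the start state `2 * i` and the accepting state `2 * i + 1`. -/
def State.idx {α : Type} : {R : RegEx α} → State R → ℕ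
  | R, .start _ => 2 * (R.size - 1)
  | R, .accept _ => 2 * (R.size - 1) + 1
  | _, .catL s => s.idx
  | .cat S _, .catR s => 2 * S.size + s.idx
  | _, .altL s => s.idx
  | .alt S _, .altR s => 2 * S.size + s.idx
  | _, .starIn s => s.idx

theorem one_le_size {α : Type} (R : RegEx α) : 1 ≤ R.size := by
  cases R <;> simp [size]

theorem State.idx_lt {α : Type} {R : RegEx α} (s : State R) : s.idx < R.numStates := by
  induction s with
  | start R => have := R.one_le_size; simp only [idx, numStates]; omega
  | accept R => have := R.one_le_size; simp only [idx, numStates]; omega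
  | _ => simp only [idx, numStates, size] at *; omega

theorem State.idx_injective {α : Type} {R : RegEx α} :
    Function.Injective (State.idx : State R → ℕ) := by
  induction R with
  | char a => intro s t h; cases s <;> cases t <;> simp [idx] at h ⊢
  | cat S T hS hT | alt S T hS hT =>
    have h1 := S.one_le_size
    have h2 := T.one_le_size
    intro s t h
    rcases s with _ | _ | s | s | s | s | s <;> rcases t with _ | _ | t | t | t | t | t <;>
      first
      | rfl
      | (have hs := s.idx_lt; have ht := t.idx_lt
         simp only [idx, numStates] at h hs ht
         first | omega | rw [hS h] | rw [hT (by omega : s.idx = t.idx)])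
      | (have hs := s.idx_lt; simp only [idx, numStates, size] at h hs; omega)
      | (have ht := t.idx_lt; simp only [idx, numStates, size] at h ht; omega)
      | (simp only [idx, size] at h; omega)
  | star S hS =>
    have h1 := S.one_le_size
    intro s t h
    rcases s with _ | _ | s | s | s | s | s <;> rcases t with _ | _ | t | t | t | t | t <;>
      first
      | rfl
      | (simp only [idx] at h; rw [hS h])
      | (have hs := s.idx_lt; simp only [idx, numStates, size] at h hs; omega)
      | (have ht := t.idx_lt; simp only [idx, numStates, size] at h ht; omega)
      | (simp only [idx, size] at h; omega)

theorem State.exists_idx_eq {α : Type} (R : RegEx α) :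
    ∀ i < R.numStates, ∃ s : State R, s.idx = i := by
  induction R with
  | char a =>
    intro i hi
    simp only [numStates, size] at hi
    obtain rfl | rfl : i = 0 ∨ i = 1 := by omega
    · exact ⟨.start _, rfl⟩
    · exact ⟨.accept _, rfl⟩
  | cat S T hS hT =>
    intro i hi
    simp only [numStates, size] at hi hS hT
    by_cases h1 : i < 2 * S.size
    · obtain ⟨s, hs⟩ := hS i h1; exact ⟨.catL s, hs⟩
    by_cases h2 : i < 2 * S.size + 2 * T.size
    · obtain ⟨s, hs⟩ := hT (i - 2 * S.size) (by omega)
      exact ⟨.catR s, by simp only [idx]; omega⟩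
    by_cases h3 : i = 2 * (S.size + T.size)
    · exact ⟨.start _, by simp only [idx, size]; omega⟩
    · exact ⟨.accept _, by simp only [idx, size]; omega⟩
  | alt S T hS hT =>
    intro i hi
    simp only [numStates, size] at hi hS hT
    by_cases h1 : i < 2 * S.size
    · obtain ⟨s, hs⟩ := hS i h1; exact ⟨.altL s, hs⟩
    by_cases h2 : i < 2 * S.size + 2 * T.size
    · obtain ⟨s, hs⟩ := hT (i - 2 * S.size) (by omega)
      exact ⟨.altR s, by simp only [idx]; omega⟩
    by_cases h3 : i = 2 * (S.size + T.size)
    · exact ⟨.start _, by simp only [idx, size]; omega⟩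
    · exact ⟨.accept _, by simp only [idx, size]; omega⟩
  | star S hS =>
    intro i hi
    simp only [numStates, size] at hi hS
    by_cases h1 : i < 2 * S.size
    · obtain ⟨s, hs⟩ := hS i h1; exact ⟨.starIn s, hs⟩
    by_cases h3 : i = 2 * S.size
    · exact ⟨.start _, by simp only [idx, size]; omega⟩
    · exact ⟨.accept _, by simp only [idx, size]; omega⟩

/-- The numbering is a bijection from the states onto `{0, …, numStates - 1}`; in particular
`numStates` is the number of states. -/
theorem State.idx_bijOn {α : Type} (R : RegEx α) :
    Set.BijOn (State.idx : State R → ℕ) Set.univ (Set.Iio R.numStates) :=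
  ⟨fun s _ => s.idx_lt, State.idx_injective.injOn, fun i hi => by
    obtain ⟨s, hs⟩ := State.exists_idx_eq R i hi
    exact ⟨s, trivial, hs⟩⟩

/-- The parse tree, laid out in postorder as an array of records of three words (kind of the node,
first field, second field); the nodes are numbered from `b` on, and the fields of an internal node
are the numbers of its children, the first field of a leaf is its character. -/
def encodeFrom {w : ℕ} : RegEx (BitVec w) → ℕ → List (BitVec w)
  | char a, _ => [BitVec.ofNat w 0, a, BitVec.ofNat w 0]
  | cat S T, b => S.encodeFrom b ++ T.encodeFrom (b + S.size) ++
      [BitVec.ofNat w 1, BitVec.ofNat w (b + S.size - 1),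
        BitVec.ofNat w (b + S.size + T.size - 1)]
  | alt S T, b => S.encodeFrom b ++ T.encodeFrom (b + S.size) ++
      [BitVec.ofNat w 2, BitVec.ofNat w (b + S.size - 1),
        BitVec.ofNat w (b + S.size + T.size - 1)]
  | star S, b => S.encodeFrom b ++
      [BitVec.ofNat w 3, BitVec.ofNat w (b + S.size - 1), BitVec.ofNat w 0]

/-- The array representing the parse tree; it has `3 * R.size` words. -/
def encode {w : ℕ} (R : RegEx (BitVec w)) : List (BitVec w) := R.encodeFrom 0

theorem length_encodeFrom {w : ℕ} (R : RegEx (BitVec w)) (b : ℕ) :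
    (R.encodeFrom b).length = 3 * R.size := by
  induction R generalizing b with
  | char a => rfl
  | cat S T hS hT => simp only [encodeFrom, size, List.length_append, hS, hT,
      List.length_cons, List.length_nil]; ring
  | alt S T hS hT => simp only [encodeFrom, size, List.length_append, hS, hT,
      List.length_cons, List.length_nil]; ring
  | star S hS => simp only [encodeFrom, size, List.length_append, hS,
      List.length_cons, List.length_nil]; ring

end RegEx

/-! ### The unit-cost RAM with `w`-bit words -/

namespace WordRAM

/-- Binary word operations: addition and subtraction modulo `2 ^ w`, multiplication (low order
word), bitwise Boolean operations, and unsigned shifts (`0` when shifting by `w` or more). -/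
inductive BinOp : Type
  | add | sub | mul | and | or | xor | shl | shr

def BinOp.eval {w : ℕ} : BinOp → BitVec w → BitVec w → BitVec w
  | add, x, y => x + y
  | sub, x, y => x - y
  | mul, x, y => x * y
  | and, x, y => x &&& y
  | or, x, y => x ||| y
  | xor, x, y => x ^^^ y
  | shl, x, y => x <<< y
  | shr, x, y => x >>> y

/-- Instructions. They do not mention the word length, so that one program runs on the machines of
all word lengths. Registers and jump targets are constants of the program. -/
inductive Instr : Type
  | const (d n : ℕ)
  | wordLength (d : ℕ)
  | copy (d a : ℕ)
  | op (o : BinOp) (d a b : ℕ)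
  | load (d a : ℕ)
  | store (a b : ℕ)
  | jump (l : ℕ)
  | jumpZero (a l : ℕ)
  | jumpLt (a b l : ℕ)

/-- Program counter, registers and memory. -/
structure Config (w : ℕ) : Type where
  pc : ℕ
  reg : ℕ → BitVec w
  mem : BitVec w → BitVec w

/-- Effect of one instruction. -/
def Instr.exec {w : ℕ} (c : Config w) : Instr → Config w
  | const d n => ⟨c.pc + 1, Function.update c.reg d (BitVec.ofNat w n), c.mem⟩
  | wordLength d => ⟨c.pc + 1, Function.update c.reg d (BitVec.ofNat w w), c.mem⟩
  | copy d a => ⟨c.pc + 1, Function.update c.reg d (c.reg a), c.mem⟩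
  | op o d a b => ⟨c.pc + 1, Function.update c.reg d (o.eval (c.reg a) (c.reg b)), c.mem⟩
  | load d a => ⟨c.pc + 1, Function.update c.reg d (c.mem (c.reg a)), c.mem⟩
  | store a b => ⟨c.pc + 1, c.reg, Function.update c.mem (c.reg a) (c.reg b)⟩
  | jump l => ⟨l, c.reg, c.mem⟩
  | jumpZero a l => ⟨if c.reg a = 0 then l else c.pc + 1, c.reg, c.mem⟩
  | jumpLt a b l => ⟨if (c.reg a).toNat < (c.reg b).toNat then l else c.pc + 1, c.reg, c.mem⟩

/-- The instruction reads only memory cells with addresses below `hi` and writes only memory cells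
with addresses in `[lo, hi)`. -/
def Instr.AccessOk {w : ℕ} (lo hi : ℕ) (c : Config w) : Instr → Prop
  | load _ a => (c.reg a).toNat < hi
  | store a _ => lo ≤ (c.reg a).toNat ∧ (c.reg a).toNat < hi
  | _ => True

/-- A program is a finite list of instructions; it halts when the program counter leaves it. -/
abbrev Program : Type := List Instr

/-- `Exec P lo hi t c c'`: started in `c`, the program `P` halts in `c'` after exactly `t`
instructions, reading only cells below `hi` and writing only cells in `[lo, hi)`. -/
inductive Exec {w : ℕ} (P : Program) (lo hi : ℕ) : ℕ → Config w → Config w → Prop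
  | halt (c : Config w) (h : P[c.pc]? = none) : Exec P lo hi 0 c c
  | step (c c' : Config w) (t : ℕ) (i : Instr) (h : P[c.pc]? = some i)
      (hacc : i.AccessOk lo hi c) (ht : Exec P lo hi t (i.exec c) c') :
      Exec P lo hi (t + 1) c c'

/-- Started at its first instruction with registers `reg` and memory `mem`, the program halts in
`c'` after at most `T` instructions, with the memory accesses restricted as in `Exec`. -/
def Runs {w : ℕ} (P : Program) (lo hi T : ℕ) (reg : ℕ → BitVec w) (mem : BitVec w → BitVec w)
    (c' : Config w) : Prop :=
  ∃ t ≤ T, Exec P lo hi t ⟨0, reg, mem⟩ c'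

end WordRAM

/-! ### Simulation data structures -/

/-- The programs of a simulation data structure, and the number of words of a state-set. -/
structure SimPrograms : Type where
  setWords : ℕ
  pre : WordRAM.Program
  move : WordRAM.Program
  close : WordRAM.Program
  member : WordRAM.Program
  insert : WordRAM.Program

/-- Registers `0, …, k - 1` hold the bitstring of the state-set `S`, where `pos` is the mapping of
the states into bit positions: bit `i` of word `j` is the position `j * w + i`. -/
def HoldsSet {w : ℕ} {R : RegEx (BitVec w)} (k : ℕ) (pos : R.State → ℕ)
    (S : Set R.State) (reg : ℕ → BitVec w) : Prop :=
  ∀ j < k, ∀ i < w, (reg j).getLsbD i = true ↔ ∃ s ∈ S, pos s = j * w + i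

/-- The input of the preprocessing: register `0` holds the number of nodes of the parse tree, and
the parse tree is stored from address `0` on. All else is arbitrary. -/
def HoldsTree {w : ℕ} (R : RegEx (BitVec w)) (reg : ℕ → BitVec w)
    (mem : BitVec w → BitVec w) : Prop :=
  reg 0 = BitVec.ofNat w R.size ∧
    ∀ (i : ℕ) (h : i < R.encode.length), mem (BitVec.ofNat w i) = R.encode[i]

/-- On the RAM with `w`-bit words, `D` is a simulation data structure for the TNFA `N(R)` which
uses memory cells with addresses below `space` only (the read-only input included), preprocessing
time `prep`, and time `query` for each of the four operations.

`Valid` describes the memory contents that represent the data structure. Preprocessing establishes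
it and each operation preserves it, so that any sequence of operations can be carried out. The
arguments and results are in registers: the state-set in `0, …, k - 1`, the character or the number
of the state in register `k`, where `k = D.setWords`; the answer of `Member` in register `0`. -/
def IsSimulationDS (D : SimPrograms) {w : ℕ} (R : RegEx (BitVec w))
    (space prep query : ℕ) : Prop :=
  ∃ (pos : R.State → ℕ) (Valid : (BitVec w → BitVec w) → Prop),
    Function.Injective pos ∧
    (∀ s, pos s < D.setWords * w) ∧
    -- preprocessing
    (∀ reg mem, HoldsTree R reg mem →
      ∃ c', WordRAM.Runs D.pre R.encode.length space prep reg mem c' ∧ Valid c'.mem) ∧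
    -- Move
    (∀ reg mem (S : Set R.State) (a : BitVec w), Valid mem →
      HoldsSet D.setWords pos S reg → reg D.setWords = a →
      ∃ c', WordRAM.Runs D.move R.encode.length space query reg mem c' ∧ Valid c'.mem ∧
        HoldsSet D.setWords pos (R.move S a) c'.reg) ∧
    -- Close
    (∀ reg mem (S : Set R.State), Valid mem →
      HoldsSet D.setWords pos S reg →
      ∃ c', WordRAM.Runs D.close R.encode.length space query reg mem c' ∧ Valid c'.mem ∧
        HoldsSet D.setWords pos (R.close S) c'.reg) ∧
    -- Member
    (∀ reg mem (S : Set R.State) (s : R.State), Valid mem →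
      HoldsSet D.setWords pos S reg → reg D.setWords = BitVec.ofNat w s.idx →
      ∃ c', WordRAM.Runs D.member R.encode.length space query reg mem c' ∧ Valid c'.mem ∧
        (s ∈ S → c'.reg 0 = BitVec.ofNat w 1) ∧ (s ∉ S → c'.reg 0 = BitVec.ofNat w 0)) ∧
    -- Insert
    (∀ reg mem (S : Set R.State) (s : R.State), Valid mem →
      HoldsSet D.setWords pos S reg → reg D.setWords = BitVec.ofNat w s.idx →
      ∃ c', WordRAM.Runs D.insert R.encode.length space query reg mem c' ∧ Valid c'.mem ∧
        HoldsSet D.setWords pos (S ∪ {s}) c'.reg)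

/-! Contract every passage through a nullable subexpression, from its start state to its accepting
state, to a single step. Then each state of the closure is reached by climbing through accepting
states of ancestors, turning at most once (from the left to the right factor of a concatenation, or
back to the start inside a star), and descending through start states; at either end a nullable node
may be jumped over. So `Close` is an upward sweep over the parse tree followed by a downward one. To
make the turn visible each node has, besides its end slot (the accepting state on the way up, the
start state on the way down), a hub slot, which stands for the middle transition of a concatenation
or for the loop of a star. That the two sweeps find exactly the closure is `sweepSet_eq`; its core
is `sweepSet_step`.

The tree may have linear depth, so a sweep cannot proceed depth by depth. The nodes are split into
heavy paths instead, the level of a node being the number of light edges above it; there are at most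
log m levels. A subtree is laid out as the heavy subtree, then the light one, then the node itself.
Consequently (`heavyLayout`) only nodes of larger level lie between two neighbours on a heavy path,
and a light child stands immediately before its parent. For all nodes of a level at once, the
passage from the light children is a masked shift by a constant, and the propagation along the heavy
paths is one subtraction: when the reached slots are subtracted from a vector of guards, each borrow
runs upwards to the next guard (`borrow_iff`, `borrow_digit`, `fillDigit`). Guards stand above the
tops of the heavy paths, and between hub and end slot where a factor that is not nullable blocks the
way. By `sweep_eq_image` one shift and one subtraction per level compute reachability in every graph
that is compatible with the levels; `sweep_up` and `sweep_down` are the two instances.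

Borrows run in one direction only, so the downward sweep works on the reflected vector. Bit reversal
takes log U rounds for digits of U bits, U a power of two. Taking U close to the minimum of m and w
makes this O(log m), while a constant number k of digits still suffices because m = O(w)
(`exists_dims`).

`Member` and `Insert` use a table of singletons. For `Move` the nodes are sorted by the first field
of their records; a binary search finds the last rank whose key is at most the given character, and
the row stored for this rank is the set of all leaves with that key. Start and accepting states are
kept in separate vectors with the same layout, so the intersection of the start states with this
row, read as accepting states, is the answer. In the preprocessing only the merge sort needs m log m
steps; the sizes are found in ascending and the layout in descending order of the node numbers.

The programs are written in a small structured language whose compiler is verified once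
(`Cmd.Run.reaches`). The judgement `Ends` measures time as the length of the code times a bound for
the number of executions of an instruction, so that only the numbers of loop rounds have to be
tracked. -/

/-! ### A structured language over natural numbers, compiled to the word RAM -/

namespace WordRAM

/-- Variables of structured programs: scalars and components of vectors. -/
inductive Var : Type
  | s (i : ℕ)
  | v (i : ℕ)
  deriving DecidableEq

/-- Register of a variable. The first `K` registers are the vector components `v 0, …, v (K - 1)`. -/
def Var.register (K : ℕ) : Var → ℕ
  | s i => K + 3 * i + 1
  | v i => if i < K then i else K + 3 * i

/-- From register `K` on, vector components, scalars and temporaries use the three residue classes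
of the offset modulo 3, so they never collide. The first `K` vector components are the argument and
result registers of the operations. -/
theorem Var.register_injective (K : ℕ) : Function.Injective (Var.register K) := by
  intro x y h
  cases x <;> cases y <;> simp only [Var.register] at h <;> (try split_ifs at h) <;>
    first | rfl | (exfalso; omega) | (congr 1; done) | (congr 1; omega)

/-- Registers holding intermediate results. -/
def tmp (K i : ℕ) : ℕ := K + 3 * i + 2

theorem register_ne_tmp (K : ℕ) (x : Var) (i : ℕ) : x.register K ≠ tmp K i := by
  cases x <;> simp only [Var.register, tmp] <;> (try split_ifs) <;> omega

theorem tmp_injective (K : ℕ) : Function.Injective (tmp K) := by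
  intro x y h; simp only [tmp] at h; omega

/-- States of structured programs. -/
structure St : Type where
  reg : Var → ℕ
  mem : ℕ → ℕ

inductive Expr : Type
  | num (n : ℕ)
  | wlen
  | var (x : Var)
  | op (o : BinOp) (a b : Expr)
  | load (a : Expr)

instance : Add Expr := ⟨Expr.op .add⟩
instance : Sub Expr := ⟨Expr.op .sub⟩
instance : Mul Expr := ⟨Expr.op .mul⟩
instance : AndOp Expr := ⟨Expr.op .and⟩
instance : OrOp Expr := ⟨Expr.op .or⟩
instance : XorOp Expr := ⟨Expr.op .xor⟩
instance : HShiftLeft Expr Expr Expr := ⟨Expr.op .shl⟩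
instance : HShiftRight Expr Expr Expr := ⟨Expr.op .shr⟩
instance (n : ℕ) : OfNat Expr n := ⟨Expr.num n⟩
instance : Coe Var Expr := ⟨Expr.var⟩

/-- The word operations on natural numbers. -/
def BinOp.evalNat (w : ℕ) : BinOp → ℕ → ℕ → ℕ
  | add, x, y => (x + y) % 2 ^ w
  | sub, x, y => (2 ^ w - y + x) % 2 ^ w
  | mul, x, y => (x * y) % 2 ^ w
  | and, x, y => x &&& y
  | or, x, y => x ||| y
  | xor, x, y => x ^^^ y
  | shl, x, y => (x <<< y) % 2 ^ w
  | shr, x, y => x >>> y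

theorem BinOp.toNat_eval {w : ℕ} (o : BinOp) (x y : BitVec w) :
    (o.eval x y).toNat = o.evalNat w x.toNat y.toNat := by
  cases o <;> simp [eval, evalNat, BitVec.toNat_add, BitVec.toNat_sub, BitVec.toNat_mul]

namespace Expr

def eval (w : ℕ) (s : St) : Expr → ℕ
  | num n => n % 2 ^ w
  | wlen => w % 2 ^ w
  | var x => s.reg x
  | op o a b => o.evalNat w (a.eval w s) (b.eval w s)
  | load a => s.mem (a.eval w s)

/-- All loads have addresses below `hi`. -/
def Safe (w hi : ℕ) (s : St) : Expr → Prop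
  | op _ a b => a.Safe w hi s ∧ b.Safe w hi s
  | load a => a.Safe w hi s ∧ a.eval w s < hi
  | _ => True

def cost : Expr → ℕ
  | op _ a b => a.cost + b.cost + 1
  | load a => a.cost + 1
  | _ => 1

/-- Code which puts the value of the expression into the temporary register `d`. -/
def code (K d : ℕ) : Expr → List Instr
  | num n => [.const (tmp K d) n]
  | wlen => [.wordLength (tmp K d)]
  | var x => [.copy (tmp K d) (x.register K)]
  | op o a b => a.code K d ++ b.code K (d + 1) ++ [.op o (tmp K d) (tmp K d) (tmp K (d + 1))]
  | load a => a.code K d ++ [.load (tmp K d) (tmp K d)]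

@[simp] theorem length_code (K d : ℕ) (e : Expr) : (e.code K d).length = e.cost := by
  induction e generalizing d <;> simp [code, cost, *, Nat.add_assoc]

section simps
variable (w hi : ℕ) (s : St) (a b : Expr)

@[simp] theorem eval_ofNat (n : ℕ) : eval w s ofNat(n) = n % 2 ^ w := rfl
@[simp] theorem eval_num (n : ℕ) : eval w s (num n) = n % 2 ^ w := rfl
@[simp] theorem eval_wlen : eval w s wlen = w := Nat.mod_eq_of_lt Nat.lt_two_pow_self
@[simp] theorem eval_var (x : Var) : eval w s (var x) = s.reg x := rfl
@[simp] theorem eval_add : eval w s (a + b) = (a.eval w s + b.eval w s) % 2 ^ w := rfl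
@[simp] theorem eval_sub :
    eval w s (a - b) = (2 ^ w - b.eval w s + a.eval w s) % 2 ^ w := rfl
@[simp] theorem eval_mul : eval w s (a * b) = (a.eval w s * b.eval w s) % 2 ^ w := rfl
@[simp] theorem eval_and : eval w s (a &&& b) = a.eval w s &&& b.eval w s := rfl
@[simp] theorem eval_or : eval w s (a ||| b) = a.eval w s ||| b.eval w s := rfl
@[simp] theorem eval_xor : eval w s (a ^^^ b) = a.eval w s ^^^ b.eval w s := rfl
@[simp] theorem eval_shl : eval w s (a <<< b) = (a.eval w s <<< b.eval w s) % 2 ^ w := rfl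
@[simp] theorem eval_shr : eval w s (a >>> b) = a.eval w s >>> b.eval w s := rfl
@[simp] theorem eval_load : eval w s (load a) = s.mem (a.eval w s) := rfl

@[simp] theorem safe_ofNat (n : ℕ) : Safe w hi s ofNat(n) = True := rfl
@[simp] theorem safe_num (n : ℕ) : Safe w hi s (num n) = True := rfl
@[simp] theorem safe_wlen : Safe w hi s wlen = True := rfl
@[simp] theorem safe_var (x : Var) : Safe w hi s (var x) = True := rfl
@[simp] theorem safe_add : Safe w hi s (a + b) = (a.Safe w hi s ∧ b.Safe w hi s) := rfl
@[simp] theorem safe_sub : Safe w hi s (a - b) = (a.Safe w hi s ∧ b.Safe w hi s) := rfl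
@[simp] theorem safe_mul : Safe w hi s (a * b) = (a.Safe w hi s ∧ b.Safe w hi s) := rfl
@[simp] theorem safe_and : Safe w hi s (a &&& b) = (a.Safe w hi s ∧ b.Safe w hi s) := rfl
@[simp] theorem safe_or : Safe w hi s (a ||| b) = (a.Safe w hi s ∧ b.Safe w hi s) := rfl
@[simp] theorem safe_xor : Safe w hi s (a ^^^ b) = (a.Safe w hi s ∧ b.Safe w hi s) := rfl
@[simp] theorem safe_shl : Safe w hi s (a <<< b) = (a.Safe w hi s ∧ b.Safe w hi s) := rfl
@[simp] theorem safe_shr : Safe w hi s (a >>> b) = (a.Safe w hi s ∧ b.Safe w hi s) := rfl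
@[simp] theorem safe_load :
    Safe w hi s (load a) = (a.Safe w hi s ∧ a.eval w s < hi) := rfl

end simps

end Expr

inductive Cmd : Type
  | skip
  | set (x : Var) (e : Expr)
  | store (a e : Expr)
  | seq (c d : Cmd)
  | ite (a b : Expr) (c d : Cmd)
  | loop (a b : Expr) (c : Cmd)

namespace St

def set (s : St) (x : Var) (y : ℕ) : St := ⟨Function.update s.reg x y, s.mem⟩
def store (s : St) (a y : ℕ) : St := ⟨s.reg, Function.update s.mem a y⟩

@[simp] theorem set_reg (s : St) (x y : Var) (z : ℕ) :
    (s.set x z).reg y = if y = x then z else s.reg y := by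
  simp [set, Function.update_apply]
@[simp] theorem set_mem (s : St) (x : Var) (z : ℕ) : (s.set x z).mem = s.mem := rfl
@[simp] theorem store_reg (s : St) (a z : ℕ) : (s.store a z).reg = s.reg := rfl
theorem store_mem (s : St) (a b z : ℕ) :
    (s.store a z).mem b = if b = a then z else s.mem b := by
  simp [store, Function.update_apply]

end St

namespace Cmd

infixr:60 " ;; " => Cmd.seq

def len : Cmd → ℕ
  | skip => 0
  | set _ e => e.cost + 1
  | store a e => a.cost + e.cost + 1
  | seq c d => c.len + d.len
  | ite a b c d => a.cost + b.cost + c.len + d.len + 2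
  | loop a b c => a.cost + b.cost + c.len + 3

/-- The machine code of a command, placed at address `p`. -/
def code (K : ℕ) : ℕ → Cmd → List Instr
  | _, skip => []
  | _, set x e => e.code K 0 ++ [.copy (x.register K) (tmp K 0)]
  | _, store a e => a.code K 0 ++ e.code K 1 ++ [.store (tmp K 0) (tmp K 1)]
  | p, seq c d => c.code K p ++ d.code K (p + c.len)
  | p, ite a b c d =>
    a.code K 0 ++ b.code K 1 ++
      -- The branch for a false condition stands first and jumps over the other one, which is the
      -- target of the conditional jump.
      ([.jumpLt (tmp K 0) (tmp K 1) (p + a.cost + b.cost + d.len + 2)] ++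
        d.code K (p + a.cost + b.cost + 1) ++ 
          [.jump (p + a.cost + b.cost + c.len + d.len + 2)] ++
            c.code K (p + a.cost + b.cost + d.len + 2))
  | p, loop a b c =>
    a.code K 0 ++ b.code K 1 ++
      [.jumpLt (tmp K 0) (tmp K 1) (p + a.cost + b.cost + 2),
        .jump (p + a.cost + b.cost + c.len + 3)] ++
          c.code K (p + a.cost + b.cost + 2) ++ [.jump p]

@[simp] theorem length_code (K p : ℕ) (c : Cmd) : (c.code K p).length = c.len := by
  induction c generalizing p <;> simp [code, len, *] <;> omega

/-- `Run w lo hi c s t s'`: the command `c` started in `s` ends in `s'` after `t` instructions. -/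
inductive Run (w lo hi : ℕ) : Cmd → St → ℕ → St → Prop
  | skip (s : St) : Run w lo hi skip s 0 s
  | set (s : St) (x : Var) (e : Expr) (h : e.Safe w hi s) :
      Run w lo hi (set x e) s (e.cost + 1) (s.set x (e.eval w s))
  | store (s : St) (a e : Expr) (ha : a.Safe w hi s) (he : e.Safe w hi s)
      (h : lo ≤ a.eval w s ∧ a.eval w s < hi) :
      Run w lo hi (store a e) s (a.cost + e.cost + 1) (s.store (a.eval w s) (e.eval w s))
  | seq {s s' s'' : St} {c d : Cmd} {t t' : ℕ} (h : Run w lo hi c s t s')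
      (h' : Run w lo hi d s' t' s'') : Run w lo hi (seq c d) s (t + t') s''
  | iteT {s s' : St} {a b : Expr} {c d : Cmd} {t : ℕ} (ha : a.Safe w hi s) (hb : b.Safe w hi s)
      (h : a.eval w s < b.eval w s) (h' : Run w lo hi c s t s') :
      Run w lo hi (ite a b c d) s (a.cost + b.cost + 1 + t) s'
  | iteF {s s' : St} {a b : Expr} {c d : Cmd} {t : ℕ} (ha : a.Safe w hi s) (hb : b.Safe w hi s)
      (h : ¬ a.eval w s < b.eval w s) (h' : Run w lo hi d s t s') :
      Run w lo hi (ite a b c d) s (a.cost + b.cost + 2 + t) s'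
  | loopT {s s' s'' : St} {a b : Expr} {c : Cmd} {t t' : ℕ} (ha : a.Safe w hi s)
      (hb : b.Safe w hi s) (h : a.eval w s < b.eval w s) (hc : Run w lo hi c s t s')
      (h' : Run w lo hi (loop a b c) s' t' s'') :
      Run w lo hi (loop a b c) s (a.cost + b.cost + 2 + t + t') s''
  | loopF {s : St} {a b : Expr} {c : Cmd} (ha : a.Safe w hi s)
      (hb : b.Safe w hi s) (h : ¬ a.eval w s < b.eval w s) :
      Run w lo hi (loop a b c) s (a.cost + b.cost + 2) s

end Cmd

/-! #### Correctness of the compiler -/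

/-- The code `l` stands at address `p` of the program `P`. -/
def Embeds (P : Program) (p : ℕ) (l : List Instr) : Prop :=
  ∀ i (h : i < l.length), P[p + i]? = some l[i]

theorem embeds_append {P : Program} {p : ℕ} {l l' : List Instr} :
    Embeds P p (l ++ l') ↔ Embeds P p l ∧ Embeds P (p + l.length) l' := by
  constructor
  · intro h
    refine ⟨fun i hi => ?_, fun i hi => ?_⟩
    · rw [h i (by simp; omega), List.getElem_append_left hi]
    · rw [Nat.add_assoc, h (l.length + i) (by simp; omega), List.getElem_append_right (by omega)]
      simp
  · rintro ⟨h, h'⟩ i hi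
    by_cases hl : i < l.length
    · rw [h i hl, List.getElem_append_left hl]
    · have := h' (i - l.length) (by simp at hi; omega)
      rw [List.getElem_append_right (by omega), ← this]
      congr 1; omega

theorem embeds_singleton {P : Program} {p : ℕ} {x : Instr} :
    Embeds P p [x] ↔ P[p]? = some x := by
  constructor
  · intro h; simpa using h 0 (by simp)
  · intro h i hi
    obtain rfl : i = 0 := by simpa using hi
    simpa using h

theorem embeds_cons {P : Program} {p : ℕ} {x : Instr} {l : List Instr} :
    Embeds P p (x :: l) ↔ P[p]? = some x ∧ Embeds P (p + 1) l := by
  rw [show x :: l = [x] ++ l from rfl, embeds_append, embeds_singleton]; rfl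

/-- After `t` instructions, `c` becomes `c'`. -/
def Reaches {w : ℕ} (P : Program) (lo hi t : ℕ) (c c' : Config w) : Prop :=
  -- `Exec` speaks only of complete runs, so an initial segment is expressed by its effect on every
  -- halting continuation.
  ∀ t' f, Exec P lo hi t' c' f → Exec P lo hi (t + t') c f

theorem Reaches.refl {w : ℕ} (P : Program) (lo hi : ℕ) (c : Config w) : Reaches P lo hi 0 c c := by
  intro t' f h; simpa using h

theorem Reaches.trans {w : ℕ} {P : Program} {lo hi t t' : ℕ} {c c' c'' : Config w}
    (h : Reaches P lo hi t c c') (h' : Reaches P lo hi t' c' c'') :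
    Reaches P lo hi (t + t') c c'' := by
  intro u f hu
  rw [Nat.add_assoc]
  exact h _ _ (h' _ _ hu)

theorem Reaches.step {w : ℕ} {P : Program} {lo hi : ℕ} {c : Config w} {i : Instr}
    (h : P[c.pc]? = some i) (hacc : i.AccessOk lo hi c) : Reaches P lo hi 1 c (i.exec c) := by
  intro u f hu
  rw [Nat.add_comm]
  exact Exec.step _ _ _ _ h hacc hu

/-- The state of the structured program represented by a configuration. -/
def Config.abs {w : ℕ} (K : ℕ) (c : Config w) : St :=
  ⟨fun x => (c.reg (x.register K)).toNat,
    fun a => if a < 2 ^ w then (c.mem (BitVec.ofNat w a)).toNat else 0⟩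

/-- No variable lives in a temporary register; the evaluation of an expression is therefore
invisible in the abstract state. -/
theorem Config.abs_congr {w : ℕ} (K : ℕ) {c c' : Config w} (hm : c'.mem = c.mem)
    (hr : ∀ r, (∀ i, r ≠ tmp K i) → c'.reg r = c.reg r) : c'.abs K = c.abs K := by
  simp only [abs, hm, St.mk.injEq, and_true]
  ext x
  rw [hr _ (register_ne_tmp K x)]

/-- The code with parameter `d` changes only temporaries with index at least `d`. Hence the second
operand, evaluated at `d + 1`, does not destroy the first one, which waits at `d`. -/
theorem Expr.reaches {w : ℕ} {P : Program} {lo hi K : ℕ} (e : Expr) :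
    ∀ (p d : ℕ) (c : Config w), Embeds P p (e.code K d) → c.pc = p → e.Safe w hi (c.abs K) →
      ∃ c' : Config w, Reaches P lo hi e.cost c c' ∧ c'.pc = p + e.cost ∧ c'.mem = c.mem ∧
        (∀ r, (∀ i, d ≤ i → r ≠ tmp K i) → c'.reg r = c.reg r) ∧
        (c'.reg (tmp K d)).toNat = e.eval w (c.abs K) := by
  induction e with
  | num n =>
    intro p d c he hp hs
    rw [code, embeds_singleton, ← hp] at he
    refine ⟨_, Reaches.step he trivial, by simp [Instr.exec, cost, hp], rfl, fun r hr => ?_, ?_⟩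
    · simp [Instr.exec, Function.update_of_ne (hr d le_rfl)]
    · simp [Instr.exec, eval]
  | wlen =>
    intro p d c he hp hs
    rw [code, embeds_singleton, ← hp] at he
    refine ⟨_, Reaches.step he trivial, by simp [Instr.exec, cost, hp], rfl, fun r hr => ?_, ?_⟩
    · simp [Instr.exec, Function.update_of_ne (hr d le_rfl)]
    · simp [Instr.exec, eval]
  | var x =>
    intro p d c he hp hs
    rw [code, embeds_singleton, ← hp] at he
    refine ⟨_, Reaches.step he trivial, by simp [Instr.exec, cost, hp], rfl, fun r hr => ?_, ?_⟩
    · simp [Instr.exec, Function.update_of_ne (hr d le_rfl)]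
    · simp [Instr.exec, eval, Config.abs]
  | op o a b iha ihb =>
    intro p d c he hp hs
    rw [code, embeds_append, embeds_append, embeds_singleton] at he
    obtain ⟨⟨ha, hb⟩, hop⟩ := he
    obtain ⟨c1, hr1, hp1, hm1, hf1, hv1⟩ := iha p d c ha hp hs.1
    have habs : c1.abs K = c.abs K :=
      Config.abs_congr K hm1 fun r hr => hf1 r fun i _ => hr i
    obtain ⟨c2, hr2, hp2, hm2, hf2, hv2⟩ := ihb (p + a.cost) (d + 1) c1
      (by simpa using hb) hp1 (habs ▸ hs.2)
    have hop' : P[c2.pc]? = some (.op o (tmp K d) (tmp K d) (tmp K (d + 1))) := by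
      rw [hp2]; simpa [Nat.add_assoc] using hop
    refine ⟨_, (hr1.trans hr2).trans (Reaches.step hop' trivial), ?_, ?_, fun r hr => ?_, ?_⟩
    · simp [Instr.exec, cost, hp2]; omega
    · simp [Instr.exec, hm1, hm2]
    · simp only [Instr.exec, Function.update_of_ne (hr d le_rfl)]
      rw [hf2 r fun i hi => hr i (by omega), hf1 r hr]
    · simp only [Instr.exec, Function.update_self, BinOp.toNat_eval, hv2, eval, habs]
      rw [hf2 (tmp K d) fun i hi h => by have := tmp_injective K h; omega, hv1]
  | load a iha =>
    intro p d c he hp hs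
    rw [code, embeds_append, embeds_singleton] at he
    obtain ⟨ha, hop⟩ := he
    obtain ⟨c1, hr1, hp1, hm1, hf1, hv1⟩ := iha p d c ha hp hs.1
    have hop' : P[c1.pc]? = some (.load (tmp K d) (tmp K d)) := by
      rw [hp1]; simpa [Nat.add_assoc] using hop
    refine ⟨_, hr1.trans (Reaches.step hop' ?_), ?_, ?_, fun r hr => ?_, ?_⟩
    · simpa only [Instr.AccessOk, hv1] using hs.2
    · simp [Instr.exec, cost, hp1]; omega
    · simp [Instr.exec, hm1]
    · simp only [Instr.exec, Function.update_of_ne (hr d le_rfl)]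
      rw [hf1 r hr]
    · simp only [Instr.exec, Function.update_self, eval, hm1]
      have : a.eval w (c.abs K) < 2 ^ w := hv1 ▸ BitVec.isLt _
      rw [← hv1] at this ⊢
      simp [Config.abs, this]

/-- Evaluation of two expressions into the first two temporary registers. -/
theorem Expr.reaches_two {w : ℕ} {P : Program} {lo hi K : ℕ} (a b : Expr) (c : Config w)
    (he : Embeds P c.pc (a.code K 0 ++ b.code K 1)) (ha : a.Safe w hi (c.abs K))
    (hb : b.Safe w hi (c.abs K)) :
    ∃ c' : Config w, Reaches P lo hi (a.cost + b.cost) c c' ∧ c'.pc = c.pc + a.cost + b.cost ∧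
      c'.abs K = c.abs K ∧ (c'.reg (tmp K 0)).toNat = a.eval w (c.abs K) ∧
      (c'.reg (tmp K 1)).toNat = b.eval w (c.abs K) := by
  rw [embeds_append] at he
  obtain ⟨c1, hr1, hp1, hm1, hf1, hv1⟩ := a.reaches (lo := lo) _ 0 c he.1 rfl ha
  have habs : c1.abs K = c.abs K :=
    Config.abs_congr K hm1 fun r hr => hf1 r fun i _ => hr i
  obtain ⟨c2, hr2, hp2, hm2, hf2, hv2⟩ := b.reaches (lo := lo) _ 1 c1
    (by simpa using he.2) hp1 (habs ▸ hb)
  have habs2 : c2.abs K = c1.abs K :=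
    Config.abs_congr K hm2 fun r hr => hf2 r fun i _ => hr i
  refine ⟨c2, hr1.trans hr2, hp2, habs2.trans habs, ?_, by rw [hv2, habs]⟩
  rw [hf2 (tmp K 0) fun i hi h => by have := tmp_injective K h; omega, hv1]

/-- Correctness of the compiler, by induction on the run of the structured program. Jump targets are
absolute, which is why the code is attached to its address `p` throughout. -/
theorem Cmd.Run.reaches {w : ℕ} {P : Program} {lo hi K : ℕ} {c : Cmd} {s s' : St} {t : ℕ}
    (h : c.Run w lo hi s t s') : ∀ (p : ℕ) (g : Config w), Embeds P p (c.code K p) → g.pc = p →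
      g.abs K = s →
      ∃ g' : Config w, Reaches P lo hi t g g' ∧ g'.pc = p + c.len ∧ g'.abs K = s' := by
  induction h with
  | skip s => exact fun p g _ hp hg => ⟨g, Reaches.refl _ _ _ _, by simpa [len] using hp, hg⟩
  | set s x e hs =>
    intro p g he hp hg
    rw [code, embeds_append, embeds_singleton] at he
    obtain ⟨g1, hr1, hp1, hm1, hf1, hv1⟩ := e.reaches (lo := lo) _ 0 g he.1 hp (hg ▸ hs)
    have hop : P[g1.pc]? = some (.copy (x.register K) (tmp K 0)) := by rw [hp1]; simpa using he.2
    refine ⟨_, hr1.trans (Reaches.step hop trivial), by simp [Instr.exec, hp1, len]; omega, ?_⟩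
    rw [← hg]
    simp only [Config.abs, Instr.exec, hm1, St.set, St.mk.injEq, and_true]
    ext y
    by_cases hy : y = x
    · subst hy; simpa [Config.abs] using hv1
    · rw [Function.update_of_ne (fun h => hy (Var.register_injective K h)),
        Function.update_of_ne hy, hf1 _ fun i _ => register_ne_tmp K y i]
  | store s a e ha hs hlo =>
    intro p g he hp hg
    rw [code, embeds_append, embeds_singleton] at he
    subst hp hg
    obtain ⟨g1, hr1, hp1, hg1, hv1, hv2⟩ := Expr.reaches_two (lo := lo) a e g he.1 ha hs
    have hop : P[g1.pc]? = some (.store (tmp K 0) (tmp K 1)) := by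
      rw [hp1]; simpa [Nat.add_assoc] using he.2
    refine ⟨_, hr1.trans (Reaches.step hop ?_), by simp [Instr.exec, hp1, len]; omega, ?_⟩
    · simpa only [Instr.AccessOk, hv1] using hlo
    rw [← hg1] at hv1 hv2
    rw [← hg1, ← hv1, ← hv2]
    simp only [Config.abs, Instr.exec, St.store, St.mk.injEq, true_and]
    ext y
    by_cases hy : y = (g1.reg (tmp K 0)).toNat
    · subst hy; simp [BitVec.isLt]
    · rw [Function.update_of_ne hy]
      -- Different addresses below `2 ^ w` are different words; at larger addresses the abstract
      -- memory is constantly `0`.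
      by_cases hyw : y < 2 ^ w
      · rw [if_pos hyw, if_pos hyw, Function.update_of_ne]
        intro h
        apply hy
        rw [← h, BitVec.toNat_ofNat, Nat.mod_eq_of_lt hyw]
      · rw [if_neg hyw, if_neg hyw]
  | seq _ _ ih ih' =>
    intro p g he hp hg
    rw [code, embeds_append] at he
    obtain ⟨g1, hr1, hp1, hg1⟩ := ih p g he.1 hp hg
    obtain ⟨g2, hr2, hp2, hg2⟩ := ih' _ g1 (by simpa using he.2) hp1 hg1
    exact ⟨g2, hr1.trans hr2, by rw [hp2, len]; omega, hg2⟩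
  | @iteT s s' a b c d t ha hb h _ ih =>
    intro p g he hp hg
    rw [code, embeds_append, embeds_append, embeds_append, embeds_append, embeds_append,
      embeds_singleton] at he
    obtain ⟨he1, ⟨⟨he2, -⟩, -⟩, he5⟩ := he
    subst hp hg
    obtain ⟨g1, hr1, hp1, hg1, hv1, hv2⟩ := Expr.reaches_two (lo := lo) a b g (embeds_append.2 he1) ha hb
    have hop : P[g1.pc]? = some (.jumpLt (tmp K 0) (tmp K 1)
        (g.pc + a.cost + b.cost + d.len + 2)) := by
      rw [hp1]; simpa [Nat.add_assoc] using he2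
    obtain ⟨g2, hr2, hp2, hg2⟩ := ih (g.pc + a.cost + b.cost + d.len + 2)
      ⟨g.pc + a.cost + b.cost + d.len + 2, g1.reg, g1.mem⟩
      (by convert he5 using 1; simp; omega) rfl hg1
    refine ⟨g2, (hr1.trans (Reaches.step hop trivial)).trans ?_, by rw [hp2, len]; omega, hg2⟩
    simpa only [Instr.exec, hv1, hv2, h, if_true] using hr2
  | @iteF s s' a b c d t ha hb h _ ih =>
    intro p g he hp hg
    rw [code, embeds_append, embeds_append, embeds_append, embeds_append, embeds_append,
      embeds_singleton, embeds_singleton] at he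
    obtain ⟨he1, ⟨⟨he2, he3⟩, he4⟩, -⟩ := he
    subst hp hg
    obtain ⟨g1, hr1, hp1, hg1, hv1, hv2⟩ := Expr.reaches_two (lo := lo) a b g (embeds_append.2 he1) ha hb
    have hop : P[g1.pc]? = some (.jumpLt (tmp K 0) (tmp K 1)
        (g.pc + a.cost + b.cost + d.len + 2)) := by
      rw [hp1]; simpa [Nat.add_assoc] using he2
    obtain ⟨g2, hr2, hp2, hg2⟩ := ih (g.pc + a.cost + b.cost + 1)
      ⟨g1.pc + 1, g1.reg, g1.mem⟩
      (by convert he3 using 1; simp; omega) (by simp [hp1]) hg1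
    have hop2 : P[g2.pc]? = some (.jump (g.pc + a.cost + b.cost + c.len + d.len + 2)) := by
      rw [hp2, ← he4]; congr 1; simp; omega
    refine ⟨⟨g.pc + a.cost + b.cost + c.len + d.len + 2, g2.reg, g2.mem⟩, ?_,
      by simp only [len]; omega, hg2⟩
    have h3 := Reaches.step (lo := lo) (hi := hi) hop2 trivial
    have h2 := Reaches.step (lo := lo) (hi := hi) hop trivial
    simp only [Instr.exec, hv1, hv2, h, if_false] at h2
    have := ((hr1.trans h2).trans hr2).trans h3
    rw [show a.cost + b.cost + 2 + t = a.cost + b.cost + 1 + t + 1 by omega]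
    exact this
  | @loopT s s' s'' a b c t t' ha hb h _ _ ih ih' =>
    intro p g he hp hg
    have he' := he
    rw [code, embeds_append, embeds_append, embeds_append, embeds_singleton, embeds_cons] at he
    obtain ⟨⟨⟨he1, he2, -⟩, he4⟩, he5⟩ := he
    subst hp hg
    obtain ⟨g1, hr1, hp1, hg1, hv1, hv2⟩ := Expr.reaches_two (lo := lo) a b g he1 ha hb
    have hop : P[g1.pc]? = some (.jumpLt (tmp K 0) (tmp K 1) (g.pc + a.cost + b.cost + 2)) := by
      rw [hp1]; simpa [Nat.add_assoc] using he2
    obtain ⟨g2, hr2, hp2, hg2⟩ := ih (g.pc + a.cost + b.cost + 2)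
      ⟨g.pc + a.cost + b.cost + 2, g1.reg, g1.mem⟩
      (by convert he4 using 1; simp; omega) rfl hg1
    have hop2 : P[g2.pc]? = some (.jump g.pc) := by
      rw [hp2, ← he5]; congr 1; simp; omega
    obtain ⟨g3, hr3, hp3, hg3⟩ := ih' g.pc ⟨g.pc, g2.reg, g2.mem⟩ he' rfl hg2
    have h2 := Reaches.step (lo := lo) (hi := hi) hop trivial
    simp only [Instr.exec, hv1, hv2, h, if_true] at h2
    have h4 := Reaches.step (lo := lo) (hi := hi) hop2 trivial
    refine ⟨g3, ?_, hp3, hg3⟩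
    have := (((hr1.trans h2).trans hr2).trans h4).trans hr3
    convert this using 1
    omega
  | @loopF s a b c ha hb h =>
    intro p g he hp hg
    rw [code, embeds_append, embeds_append, embeds_append, embeds_cons, embeds_singleton] at he
    obtain ⟨⟨⟨he1, he2, he3⟩, -⟩, -⟩ := he
    subst hp hg
    obtain ⟨g1, hr1, hp1, hg1, hv1, hv2⟩ := Expr.reaches_two (lo := lo) a b g he1 ha hb
    have hop : P[g1.pc]? = some (.jumpLt (tmp K 0) (tmp K 1) (g.pc + a.cost + b.cost + 2)) := by
      rw [hp1]; simpa [Nat.add_assoc] using he2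
    have h2 := Reaches.step (lo := lo) (hi := hi) hop trivial
    simp only [Instr.exec, hv1, hv2, h, if_false] at h2
    have hop2 : P[(⟨g1.pc + 1, g1.reg, g1.mem⟩ : Config w).pc]? =
        some (.jump (g.pc + a.cost + b.cost + c.len + 3)) := by
      rw [← he3]; congr 1; simp [hp1]; omega
    refine ⟨_, (hr1.trans h2).trans (Reaches.step hop2 trivial), ?_, ?_⟩
    · simp only [Instr.exec, len]; omega
    · exact hg1

/-- A structured program. -/
def Cmd.program (K : ℕ) (c : Cmd) : Program := c.code K 0

theorem Cmd.Run.runs {w : ℕ} {lo hi K T : ℕ} {c : Cmd} {s' : St} {t : ℕ}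
    {reg : ℕ → BitVec w} {mem : BitVec w → BitVec w}
    (h : c.Run w lo hi (Config.abs K ⟨0, reg, mem⟩) t s') (ht : t ≤ T) :
    ∃ g' : Config w, Runs (c.program K) lo hi T reg mem g' ∧ g'.abs K = s' := by
  obtain ⟨g', hr, hp, hg⟩ := h.reaches (P := c.program K) 0 ⟨0, reg, mem⟩
    (fun i hi => by simp [Cmd.program, List.getElem?_eq_getElem hi]) rfl rfl
  refine ⟨g', ⟨t, ht, ?_⟩, hg⟩
  have := hr 0 g' (Exec.halt _ ?_)
  · simpa using this
  · rw [hp, List.getElem?_eq_none_iff, Cmd.program, Cmd.length_code]; omega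

/-! #### Total correctness with time bounds -/

namespace Cmd

/-- Started in `s`, the command `c` ends in a state satisfying `Q`. The time is bounded by `X` times
the length of the code; usually every instruction is executed at most `X` times. -/
def Ends (w lo hi X : ℕ) (c : Cmd) (s : St) (Q : St → Prop) : Prop :=
  ∃ t ≤ c.len * X, ∃ s', Run w lo hi c s t s' ∧ Q s'

variable {w lo hi X : ℕ}

theorem Ends.mono {c : Cmd} {s : St} {X' : ℕ} {Q Q' : St → Prop} (h : c.Ends w lo hi X s Q)
    (hX : X ≤ X') (hQ : ∀ s', Q s' → Q' s') : c.Ends w lo hi X' s Q' := by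
  obtain ⟨t, ht, s', hr, hq⟩ := h
  exact ⟨t, ht.trans (Nat.mul_le_mul_left _ hX), s', hr, hQ _ hq⟩

theorem Ends.imp {c : Cmd} {s : St} {Q Q' : St → Prop} (h : c.Ends w lo hi X s Q)
    (hQ : ∀ s', Q s' → Q' s') : c.Ends w lo hi X s Q' := h.mono le_rfl hQ

theorem ends_skip {s : St} {Q : St → Prop} (h : Q s) : skip.Ends w lo hi X s Q :=
  ⟨0, Nat.zero_le _, s, .skip s, h⟩

theorem ends_set {s : St} {x : Var} {e : Expr} {Q : St → Prop} (hX : 1 ≤ X) (he : e.Safe w hi s)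
    (h : Q (s.set x (e.eval w s))) : (Cmd.set x e).Ends w lo hi X s Q :=
  ⟨_, Nat.le_mul_of_pos_right _ hX, _, .set s x e he, h⟩

theorem ends_store {s : St} {a e : Expr} {Q : St → Prop} (hX : 1 ≤ X) (ha : a.Safe w hi s)
    (he : e.Safe w hi s) (hl : lo ≤ a.eval w s ∧ a.eval w s < hi)
    (h : Q (s.store (a.eval w s) (e.eval w s))) :
    (Cmd.store a e).Ends w lo hi X s Q :=
  ⟨_, Nat.le_mul_of_pos_right _ hX, _, .store s a e ha he hl, h⟩

theorem Ends.seq {s : St} {c d : Cmd} {Q : St → Prop}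
    (h : c.Ends w lo hi X s fun s' => d.Ends w lo hi X s' Q) :
    (c ;; d).Ends w lo hi X s Q := by
  obtain ⟨t, ht, s', hr, t', ht', s'', hr', hq⟩ := h
  exact ⟨t + t', by rw [len, Nat.add_mul]; omega, s'', hr.seq hr', hq⟩

theorem ends_ite {s : St} {a b : Expr} {c d : Cmd} {Q : St → Prop} (hX : 1 ≤ X)
    (ha : a.Safe w hi s) (hb : b.Safe w hi s)
    (hc : a.eval w s < b.eval w s → c.Ends w lo hi X s Q)
    (hd : ¬ a.eval w s < b.eval w s → d.Ends w lo hi X s Q) :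
    (ite a b c d).Ends w lo hi X s Q := by
  have h1 : (ite a b c d).len * X = (a.cost + b.cost + 2) * X + c.len * X + d.len * X := by
    simp only [len]; ring
  have h2 := Nat.le_mul_of_pos_right (a.cost + b.cost + 2) hX
  by_cases h : a.eval w s < b.eval w s
  · obtain ⟨t, ht, s', hr, hq⟩ := hc h
    exact ⟨_, by omega, s', .iteT ha hb h hr, hq⟩
  · obtain ⟨t, ht, s', hr, hq⟩ := hd h
    exact ⟨_, by omega, s', .iteF ha hb h hr, hq⟩

/-- There are `N` rounds and `N + 1` tests. Each instruction of the body runs at most `X'` times per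
round, so `X' * (N + 1)` bounds all of them. The invariant is indexed by the number of rounds done,
and the loop condition has to be equivalent to this number being less than `N`. -/
theorem ends_loop {a b : Expr} {c : Cmd} {N X' : ℕ} (I : ℕ → St → Prop) (hX' : 1 ≤ X')
    (hX : X' * (N + 1) ≤ X)
    (hsafe : ∀ i s, i ≤ N → I i s → a.Safe w hi s ∧ b.Safe w hi s)
    (hcond : ∀ i s, i ≤ N → I i s → (a.eval w s < b.eval w s ↔ i < N))
    (hbody : ∀ i s, i < N → I i s → c.Ends w lo hi X' s (I (i + 1))) {s : St} (h0 : I 0 s) :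
    (loop a b c).Ends w lo hi X s (I N) := by
  -- Induction on the number `r` of rounds that remain.
  suffices ∀ r i s, i + r = N → I i s → ∃ t ≤ (a.cost + b.cost + 2 + c.len * X') * (r + 1),
      ∃ s', Run w lo hi (loop a b c) s t s' ∧ I N s' by
    obtain ⟨t, ht, h⟩ := this N 0 s (by omega) h0
    refine ⟨t, ht.trans (le_trans ?_ (Nat.mul_le_mul_left _ hX)), h⟩
    rw [← Nat.mul_assoc]
    refine Nat.mul_le_mul_right _ ?_
    have h1 : (loop a b c).len * X' = (a.cost + b.cost + 2) * X' + c.len * X' + X' := by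
      simp only [len]; ring
    have h2 := Nat.le_mul_of_pos_right (a.cost + b.cost + 2) hX'
    omega
  intro r
  induction r with
  | zero =>
    intro i s hi hI
    obtain rfl : i = N := by omega
    have hs := hsafe i s le_rfl hI
    exact ⟨_, by omega, s, .loopF hs.1 hs.2 (by rw [hcond i s le_rfl hI]; omega), hI⟩
  | succ r ih =>
    intro i s hi hI
    have hs := hsafe i s (by omega) hI
    obtain ⟨t, ht, s', hr, hq⟩ := hbody i s (by omega) hI
    obtain ⟨t', ht', s'', hr', hq'⟩ := ih (i + 1) s' (by omega) hq
    refine ⟨_, ?_, s'', .loopT hs.1 hs.2 (by rw [hcond i s (by omega) hI]; omega) hr hr', hq'⟩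
    rw [Nat.mul_add_one]
    omega

/-- Copies of a command for `j = 0, …, k - 1`. -/
def rep (k : ℕ) (f : ℕ → Cmd) : Cmd :=
  match k with
  | 0 => skip
  | k + 1 => rep k f ;; f k

theorem ends_rep {k : ℕ} {f : ℕ → Cmd} (I : ℕ → St → Prop)
    (h : ∀ j s, j < k → I j s → (f j).Ends w lo hi X s (I (j + 1))) {s : St} (h0 : I 0 s) :
    (rep k f).Ends w lo hi X s (I k) := by
  induction k with
  | zero => exact ends_skip h0
  | succ k ih =>
    exact .seq ((ih fun j s hj => h j s (by omega)).imp fun s' hs' => h k s' (by omega) hs')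

/-- Weakest preconditions of commands without loops. -/
def wp (w lo hi : ℕ) : Cmd → (St → Prop) → St → Prop
  | skip, Q, s => Q s
  | set x e, Q, s => e.Safe w hi s ∧ Q (s.set x (e.eval w s))
  | store a e, Q, s => (a.Safe w hi s ∧ e.Safe w hi s ∧ lo ≤ a.eval w s ∧ a.eval w s < hi) ∧
      Q (s.store (a.eval w s) (e.eval w s))
  | seq c d, Q, s => wp w lo hi c (wp w lo hi d Q) s
  | ite a b c d, Q, s => (a.Safe w hi s ∧ b.Safe w hi s) ∧
      if a.eval w s < b.eval w s then wp w lo hi c Q s else wp w lo hi d Q s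
  | loop _ _ _, _, _ => False

/-- For code without loops, correctness becomes a formula that simplification can evaluate
symbolically. -/
theorem ends_of_wp {c : Cmd} (hX : 1 ≤ X) : ∀ {s : St} {Q : St → Prop}, c.wp w lo hi Q s →
    c.Ends w lo hi X s Q := by
  induction c with
  | skip => exact fun h => ends_skip h
  | set x e => exact fun h => ends_set hX h.1 h.2
  | store a e => exact fun h => ends_store hX h.1.1 h.1.2.1 h.1.2.2 h.2
  | seq c d hc hd => exact fun h => .seq ((hc h).imp fun s' hs' => hd hs')
  | ite a b c d hc hd =>
    intro s Q h
    refine ends_ite hX h.1.1 h.1.2 (fun h' => hc ?_) (fun h' => hd ?_)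
    · simpa [h'] using h.2
    · simpa [h'] using h.2
  | loop => exact fun h => h.elim

/-- The variables which a command may change. -/
def Writes : Cmd → Var → Prop
  | skip, _ => False
  | set x _, y => y = x
  | store _ _, _ => False
  | seq c d, y => c.Writes y ∨ d.Writes y
  | ite _ _ c d, y => c.Writes y ∨ d.Writes y
  | loop _ _ c, y => c.Writes y

theorem writes_rep {k : ℕ} {f : ℕ → Cmd} {x : Var} :
    (rep k f).Writes x ↔ ∃ j < k, (f j).Writes x := by
  induction k with
  | zero => simp [rep, Writes]
  | succ k ih =>
    rw [rep, Writes, ih]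
    constructor
    · rintro (⟨j, hj, h⟩ | h)
      · exact ⟨j, by omega, h⟩
      · exact ⟨k, by omega, h⟩
    · rintro ⟨j, hj, h⟩
      rcases Nat.lt_succ_iff_lt_or_eq.1 hj with h' | rfl
      · exact Or.inl ⟨j, h', h⟩
      · exact Or.inr h

theorem Run.reg_eq {c : Cmd} {s s' : St} {t : ℕ} (h : Run w lo hi c s t s') {x : Var}
    (hx : ¬ c.Writes x) : s'.reg x = s.reg x := by
  induction h with
  | skip | store => rfl
  | set s y e => exact (St.set_reg _ _ _ _).trans (if_neg hx)
  | seq _ _ ih ih' => rw [ih' fun h => hx (Or.inr h), ih fun h => hx (Or.inl h)]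
  | iteT _ _ _ _ ih => exact ih fun h => hx (Or.inl h)
  | iteF _ _ _ _ ih => exact ih fun h => hx (Or.inr h)
  | loopT _ _ _ _ _ ih ih' => rw [ih' hx, ih hx]
  | loopF => rfl

theorem Run.mem_eq {c : Cmd} {s s' : St} {t : ℕ} (h : Run w lo hi c s t s') {a : ℕ}
    (ha : a < lo ∨ hi ≤ a) : s'.mem a = s.mem a := by
  induction h with
  | skip | set | loopF => rfl
  | store s b e _ _ hb => rw [St.store_mem, if_neg (by omega)]
  | seq _ _ ih ih' | loopT _ _ _ _ _ ih ih' => rw [ih', ih]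
  | iteT _ _ _ _ ih | iteF _ _ _ _ ih => exact ih

theorem Expr.Safe.mono {e : Expr} {s : St} {hi' : ℕ} (h : e.Safe w hi s) (hh : hi ≤ hi') :
    e.Safe w hi' s := by
  induction e with
  | op o a b iha ihb => exact ⟨iha h.1, ihb h.2⟩
  | load a iha => exact ⟨iha h.1, h.2.trans_le hh⟩
  | _ => trivial

theorem Run.mono {c : Cmd} {s s' : St} {t : ℕ} (h : Run w lo hi c s t s') {lo' hi' : ℕ}
    (hl : lo' ≤ lo) (hh : hi ≤ hi') : Run w lo' hi' c s t s' := by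
  induction h with
  | skip s => exact .skip s
  | set s x e h => exact .set s x e (Expr.Safe.mono h hh)
  | store s a e ha he h =>
    exact .store s a e (Expr.Safe.mono ha hh) (Expr.Safe.mono he hh) ⟨by omega, by omega⟩
  | seq _ _ ih ih' => exact .seq ih ih'
  | iteT ha hb h _ ih => exact .iteT (Expr.Safe.mono ha hh) (Expr.Safe.mono hb hh) h ih
  | iteF ha hb h _ ih => exact .iteF (Expr.Safe.mono ha hh) (Expr.Safe.mono hb hh) h ih
  | loopT ha hb h _ _ ih ih' =>
    exact .loopT (Expr.Safe.mono ha hh) (Expr.Safe.mono hb hh) h ih ih'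
  | loopF ha hb h => exact .loopF (Expr.Safe.mono ha hh) (Expr.Safe.mono hb hh) h

/-- The frame rule: what a command leaves alone is read off from its text and from its write bounds,
so the specifications need to mention only what changes. -/
theorem Ends.frame {c : Cmd} {s : St} {Q : St → Prop} (h : c.Ends w lo hi X s Q) :
    c.Ends w lo hi X s fun s' => Q s' ∧ (∀ x, ¬ c.Writes x → s'.reg x = s.reg x) ∧
      ∀ a, a < lo ∨ hi ≤ a → s'.mem a = s.mem a := by
  obtain ⟨t, ht, s', hr, hq⟩ := h
  exact ⟨t, ht, s', hr, hq, fun x hx => hr.reg_eq hx, fun a ha => hr.mem_eq ha⟩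

/-- A command which may not write any cell does not change the memory. -/
theorem Ends.frame_readOnly {c : Cmd} {s : St} {Q : St → Prop} (h : c.Ends w hi hi X s Q) :
    c.Ends w hi hi X s fun s' => Q s' ∧ (∀ x, ¬ c.Writes x → s'.reg x = s.reg x) ∧
      s'.mem = s.mem :=
  h.frame.imp fun _ h => ⟨h.1, h.2.1, funext fun a => h.2.2 a (lt_or_ge a hi)⟩

theorem Ends.bounds {c : Cmd} {s : St} {Q : St → Prop} (h : c.Ends w lo hi X s Q) {lo' hi' : ℕ}
    (hl : lo' ≤ lo) (hh : hi ≤ hi') : c.Ends w lo' hi' X s Q := by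
  obtain ⟨t, ht, s', hr, hq⟩ := h
  exact ⟨t, ht, s', hr.mono hl hh, hq⟩

end Cmd

end WordRAM


/-! ### The heavy path layout of a parse tree -/

/-- A node of a parse tree: its subexpression, the number of the first node of its subtree, the
first position of its subtree in the layout, the number of light edges above it, and whether it is
the top of a heavy path. -/
structure TreeNode (α : Type) : Type where
  sub : RegEx α
  off : ℕ
  base : ℕ
  lev : ℕ
  top : Bool

namespace TreeNode

variable {α : Type}

/-- Position in the layout. -/
def pos (N : TreeNode α) : ℕ := N.base + N.sub.size - 1

/-- The number of the left (or only) child. -/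
def leftNum (N : TreeNode α) : ℕ :=
  match N.sub with
  | .char _ => 0
  | .cat S _ | .alt S _ | .star S => N.off + S.size - 1

/-- The number of the right child. -/
def rightNum (N : TreeNode α) : ℕ :=
  match N.sub with
  | .char _ => 0
  | .cat S T | .alt S T => N.off + S.size + T.size - 1
  | .star _ => 0

/-- The left child, or the only one, is the heavy one. -/
def leftHeavy (N : TreeNode α) : Bool :=
  match N.sub with
  | .char _ => false
  | .cat S T | .alt S T => decide (T.size ≤ S.size)
  | .star _ => true

/-- The number of the heavy child. -/
def heavyNum (N : TreeNode α) : ℕ := if N.leftHeavy then N.leftNum else N.rightNum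

/-- The number of the light child. -/
def lightNum (N : TreeNode α) : ℕ := if N.leftHeavy then N.rightNum else N.leftNum

/-- The node has a child. -/
def HasHeavy (N : TreeNode α) : Prop :=
  match N.sub with
  | .char _ => False
  | _ => True

/-- The node has two children. -/
def HasLight (N : TreeNode α) : Prop :=
  match N.sub with
  | .cat _ _ | .alt _ _ => True
  | _ => False

/-- The heavy subtree keeps the base of its parent, the light subtree follows it, and the parent
comes last. In case of equal sizes the left child is heavy. -/
def leftNode (N : TreeNode α) (S T : RegEx α) : TreeNode α :=
  if T.size ≤ S.size then ⟨S, N.off, N.base, N.lev, false⟩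
  else ⟨S, N.off, N.base + T.size, N.lev + 1, true⟩

def rightNode (N : TreeNode α) (S T : RegEx α) : TreeNode α :=
  if T.size ≤ S.size then ⟨T, N.off + S.size, N.base + S.size, N.lev + 1, true⟩
  else ⟨T, N.off + S.size, N.base, N.lev, false⟩

end TreeNode

namespace RegEx

variable {α : Type}

/-- The node with number `i` in a tree whose root node has the given data. -/
def nodeAt : RegEx α → (o b k : ℕ) → Bool → ℕ → TreeNode α
  | char a, o, b, k, t, _ => ⟨char a, o, b, k, t⟩
  | cat S T, o, b, k, t, i =>
    if i < o + S.size then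
      if T.size ≤ S.size then nodeAt S o b k false i else nodeAt S o (b + T.size) (k + 1) true i
    else if i < o + S.size + T.size then
      if T.size ≤ S.size then nodeAt T (o + S.size) (b + S.size) (k + 1) true i
      else nodeAt T (o + S.size) b k false i
    else ⟨cat S T, o, b, k, t⟩
  | alt S T, o, b, k, t, i =>
    if i < o + S.size then
      if T.size ≤ S.size then nodeAt S o b k false i else nodeAt S o (b + T.size) (k + 1) true i
    else if i < o + S.size + T.size then
      if T.size ≤ S.size then nodeAt T (o + S.size) (b + S.size) (k + 1) true i
      else nodeAt T (o + S.size) b k false i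
    else ⟨alt S T, o, b, k, t⟩
  | star S, o, b, k, t, i =>
    if i < o + S.size then nodeAt S o b k false i else ⟨star S, o, b, k, t⟩

theorem nodeAt_root (R : RegEx α) (o b k : ℕ) (t : Bool) (i : ℕ) (h : i + 1 = o + R.size) :
    R.nodeAt o b k t i = ⟨R, o, b, k, t⟩ := by
  cases R with
  | char a => rfl
  | cat S T | alt S T => 
    simp only [size] at h
    rw [nodeAt, if_neg (by omega), if_neg (by omega)]
  | star S =>
    simp only [size] at h
    rw [nodeAt, if_neg (by omega)]

/-- Bounds for the data of the nodes of a subtree. -/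
theorem nodeAt_bounds (R : RegEx α) : ∀ (o b k : ℕ) (t : Bool) (i : ℕ), o ≤ i → i < o + R.size →
    let N := R.nodeAt o b k t i
    N.off + N.sub.size = i + 1 ∧ o ≤ N.off ∧ b ≤ N.base ∧
      N.base + N.sub.size ≤ b + R.size ∧ k ≤ N.lev ∧
      2 ^ N.lev * N.sub.size ≤ 2 ^ k * R.size := by
  induction R with
  | char a => intro o b k t i h1 h2; simp only [size] at h2; simp [nodeAt, size]; omega
  | cat S T hS hT | alt S T hS hT =>
    intro o b k t i h1 h2
    simp only [size] at h2 ⊢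
    simp only [nodeAt]
    have hk : 2 ^ (k + 1) = 2 ^ k + 2 ^ k := by ring
    split_ifs with h3 h4 h5 h6
    · obtain ⟨a1, a2, a3, a4, a5, a6⟩ := hS o b k false i h1 h3
      refine ⟨a1, a2, a3, by omega, a5, a6.trans (Nat.mul_le_mul_left _ (by omega))⟩
    · obtain ⟨a1, a2, a3, a4, a5, a6⟩ := hS o (b + T.size) (k + 1) true i h1 h3
      refine ⟨a1, a2, by omega, by omega, by omega, a6.trans ?_⟩
      -- A light subtree has at most half the size of its parent's subtree, which compensates for
      -- the additional factor two.
      rw [pow_succ, Nat.mul_assoc]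
      exact Nat.mul_le_mul_left _ (by omega)
    · obtain ⟨a1, a2, a3, a4, a5, a6⟩ :=
        hT (o + S.size) (b + S.size) (k + 1) true i (by omega) (by omega)
      refine ⟨a1, by omega, by omega, by omega, by omega, a6.trans ?_⟩
      rw [pow_succ, Nat.mul_assoc]
      exact Nat.mul_le_mul_left _ (by omega)
    · obtain ⟨a1, a2, a3, a4, a5, a6⟩ := hT (o + S.size) b k false i (by omega) (by omega)
      refine ⟨a1, by omega, a3, by omega, a5, a6.trans (Nat.mul_le_mul_left _ (by omega))⟩
    · refine ⟨?_, le_rfl, le_rfl, ?_, le_rfl, le_of_eq ?_⟩ <;> simp only [size] <;> omega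
  | star S hS =>
    intro o b k t i h1 h2
    simp only [size] at h2 ⊢
    simp only [nodeAt]
    split_ifs with h3
    · obtain ⟨a1, a2, a3, a4, a5, a6⟩ := hS o b k false i h1 h3
      refine ⟨a1, a2, a3, by omega, a5, a6.trans (Nat.mul_le_mul_left _ (by omega))⟩
    · refine ⟨?_, le_rfl, le_rfl, ?_, le_rfl, le_of_eq ?_⟩ <;> simp only [size] <;> omega

/-- The nodes of the subtree of a node. -/
theorem nodeAt_subtree (R : RegEx α) : ∀ (o b k : ℕ) (t : Bool) (i : ℕ), o ≤ i → i < o + R.size →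
    let N := R.nodeAt o b k t i
    ∀ j, N.off ≤ j → j ≤ i →
      R.nodeAt o b k t j = N.sub.nodeAt N.off N.base N.lev N.top j := by
  induction R with
  | char a => intro o b k t i _ _ N j _ _; rfl
  | cat S T hS hT | alt S T hS hT =>
    intro o b k t i h1 h2 N j h3 h4
    simp only [size] at h2
    by_cases hl : i < o + S.size
    · by_cases hh : T.size ≤ S.size
      · have := hS o b k false i h1 hl j
        simp only [N, nodeAt, hl, hh, if_true, show j < o + S.size by omega] at h3 ⊢ 
        exact this h3 h4
      · have := hS o (b + T.size) (k + 1) true i h1 hl j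
        simp only [N, nodeAt, hl, hh, if_true, if_false, show j < o + S.size by omega] at h3 ⊢
        exact this h3 h4
    by_cases hr : i < o + S.size + T.size
    · by_cases hh : T.size ≤ S.size
      · have := hT (o + S.size) (b + S.size) (k + 1) true i (by omega) (by omega) j
        have hb := T.nodeAt_bounds (o + S.size) (b + S.size) (k + 1) true i (by omega) (by omega)
        simp only [N, nodeAt, hl, hr, hh, if_true, if_false] at h3 ⊢
        rw [if_neg (by omega), if_pos (by omega)]
        exact this h3 h4
      · have := hT (o + S.size) b k false i (by omega) (by omega) j
        have hb := T.nodeAt_bounds (o + S.size) b k false i (by omega) (by omega)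
        simp only [N, nodeAt, hl, hr, hh, if_true, if_false] at h3 ⊢
        rw [if_neg (by omega), if_pos (by omega)]
        exact this h3 h4
    · simp only [N]
      conv_rhs => rw [nodeAt_root _ o b k t i (by simp only [size]; omega)]
  | star S hS =>
    intro o b k t i h1 h2 N j h3 h4
    simp only [size] at h2
    by_cases hl : i < o + S.size
    · have := hS o b k false i h1 hl j
      simp only [N, nodeAt, hl, if_true, show j < o + S.size by omega] at h3 ⊢
      exact this h3 h4
    · simp only [N]
      conv_rhs => rw [nodeAt_root _ o b k t i (by simp only [size]; omega)]

/-- The positions of the subtree of a node are occupied by nodes of this subtree. -/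
theorem nodeAt_pos_notMem (R : RegEx α) : ∀ (o b k : ℕ) (t : Bool) (i : ℕ), o ≤ i →
    i < o + R.size → ∀ x, o ≤ x → x < o + R.size →
    let N := R.nodeAt o b k t i
    let M := R.nodeAt o b k t x
    (x < N.off ∨ i < x) → M.pos < N.base ∨ N.base + N.sub.size ≤ M.pos := by
  induction R with
  | char a =>
    intro o b k t i h1 h2 x h3 h4 N M h
    simp only [size] at h2 h4; simp only [N, nodeAt] at h; omega
  | cat S T hS hT | alt S T hS hT =>
    intro o b k t i h1 h2 x h3 h4 N M h
    have hbi := nodeAt_bounds _ o b k t i h1 h2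
    have hbx := nodeAt_bounds _ o b k t x h3 h4
    have p1 := N.sub.one_le_size
    have p2 := M.sub.one_le_size
    simp only [M, N] at *
    by_cases hxr : x + 1 = o + (S.size + T.size + 1)
    · rw [nodeAt_root _ o b k t x (by simpa only [size] using hxr)]
      by_cases hir : i + 1 = o + (S.size + T.size + 1)
      · rw [nodeAt_root _ o b k t i (by simpa only [size] using hir)] at h
        simp only at h; omega
      · right
        simp only [size] at h2
        have e1 := S.nodeAt_bounds o
        have e2 := T.nodeAt_bounds (o + S.size)
        simp only [nodeAt, TreeNode.pos, size]
        split_ifs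
        · have := e1 b k false i (by omega) (by omega); omega
        · have := e1 (b + T.size) (k + 1) true i (by omega) (by omega); omega
        · have := e2 (b + S.size) (k + 1) true i (by omega) (by omega); omega
        · have := e2 b k false i (by omega) (by omega); omega
        · omega
    · have hir : i + 1 ≠ o + (S.size + T.size + 1) := by
        intro hir
        rw [nodeAt_root _ o b k t i (by simpa only [size] using hir)] at h
        simp only [size] at h4; simp only at h; omega
      simp only [size] at h2 h4
      have e1 := S.nodeAt_bounds o
      have e2 := T.nodeAt_bounds (o + S.size)
      simp only [nodeAt, TreeNode.pos] at h ⊢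
      by_cases hi : i < o + S.size <;> by_cases hx : x < o + S.size <;>
        by_cases hh : T.size ≤ S.size <;>
        simp only [hi, hx, hh, if_true, if_false, show i < o + S.size + T.size by omega,
          show x < o + S.size + T.size by omega] at h ⊢
      · exact hS o b k false i h1 hi x h3 hx h
      · exact hS o (b + T.size) (k + 1) true i h1 hi x h3 hx h
      · have q1 := e1 b k false i (by omega) (by omega)
        have q2 := e2 (b + S.size) (k + 1) true x (by omega) (by omega)
        have := RegEx.one_le_size (nodeAt T (o + S.size) (b + S.size) (k + 1) true x).sub
        omega
      · have q1 := e1 (b + T.size) (k + 1) true i (by omega) (by omega)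
        have q2 := e2 b k false x (by omega) (by omega)
        have := RegEx.one_le_size (nodeAt T (o + S.size) b k false x).sub
        omega
      · have q1 := e1 b k false x (by omega) (by omega)
        have q2 := e2 (b + S.size) (k + 1) true i (by omega) (by omega)
        have := RegEx.one_le_size (nodeAt S o b k false x).sub
        omega
      · have q1 := e1 (b + T.size) (k + 1) true x (by omega) (by omega)
        have q2 := e2 b k false i (by omega) (by omega)
        have := RegEx.one_le_size (nodeAt S o (b + T.size) (k + 1) true x).sub
        omega
      · exact hT _ _ _ _ i (by omega) (by omega) x (by omega) (by omega) h
      · exact hT _ _ _ _ i (by omega) (by omega) x (by omega) (by omega) h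
  | star S hS =>
    intro o b k t i h1 h2 x h3 h4 N M h
    simp only [size] at h2 h4
    have e1 := S.nodeAt_bounds o b k false
    simp only [N, M, nodeAt, TreeNode.pos] at h ⊢
    by_cases hi : i < o + S.size <;> by_cases hx : x < o + S.size <;>
      simp only [hi, hx, if_true, if_false] at h ⊢
    · exact hS o b k false i h1 hi x h3 hx h
    · have := e1 i h1 hi
      simp only [size]; omega
    · omega
    · omega

/-- Every node but the root is a child. -/
theorem exists_parent (R : RegEx α) : ∀ (o b k : ℕ) (t : Bool) (i : ℕ), o ≤ i →
    i + 1 < o + R.size → ∃ p, i < p ∧ p < o + R.size ∧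
      (((R.nodeAt o b k t p).HasHeavy ∧ i = (R.nodeAt o b k t p).heavyNum) ∨
      ((R.nodeAt o b k t p).HasLight ∧ i = (R.nodeAt o b k t p).lightNum)) := by
  induction R with
  | char a => intro o b k t i h1 h2; simp only [size] at h2; omega
  | cat S T hS hT | alt S T hS hT =>
    intro o b k t i h1 h2
    simp only [size] at h2 ⊢
    by_cases hi : i < o + S.size
    · by_cases hr : i + 1 = o + S.size
      · refine ⟨o + S.size + T.size, by omega, by omega, ?_⟩
        rw [nodeAt_root _ o b k t (o + S.size + T.size) (by simp only [size]; omega)]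
        by_cases hh : T.size ≤ S.size <;>
          simp [TreeNode.HasHeavy, TreeNode.heavyNum, TreeNode.HasLight, TreeNode.lightNum,
            TreeNode.leftHeavy, hh, TreeNode.leftNum, TreeNode.rightNum] <;> omega
      · by_cases hh : T.size ≤ S.size
        · obtain ⟨p, a1, a2, a3⟩ := hS o b k false i h1 (by omega)
          refine ⟨p, a1, by omega, ?_⟩
          simpa only [nodeAt, a2, hh, if_true] using a3
        · obtain ⟨p, a1, a2, a3⟩ := hS o (b + T.size) (k + 1) true i h1 (by omega)
          refine ⟨p, a1, by omega, ?_⟩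
          simpa only [nodeAt, a2, hh, if_true, if_false] using a3
    · by_cases hr : i + 1 = o + S.size + T.size
      · refine ⟨o + S.size + T.size, by omega, by omega, ?_⟩
        rw [nodeAt_root _ o b k t (o + S.size + T.size) (by simp only [size]; omega)]
        by_cases hh : T.size ≤ S.size <;>
          simp [TreeNode.HasHeavy, TreeNode.heavyNum, TreeNode.HasLight, TreeNode.lightNum,
            TreeNode.leftHeavy, hh, TreeNode.leftNum, TreeNode.rightNum] <;> omega
      · by_cases hh : T.size ≤ S.size
        · obtain ⟨p, a1, a2, a3⟩ := hT (o + S.size) (b + S.size) (k + 1) true i (by omega) (by omega)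
          refine ⟨p, a1, by omega, ?_⟩
          simpa only [nodeAt, a2, hh, if_true, if_false, show ¬ p < o + S.size by omega] using a3
        · obtain ⟨p, a1, a2, a3⟩ := hT (o + S.size) b k false i (by omega) (by omega)
          refine ⟨p, a1, by omega, ?_⟩
          simpa only [nodeAt, a2, hh, if_true, if_false, show ¬ p < o + S.size by omega] using a3
  | star S hS =>
    intro o b k t i h1 h2
    simp only [size] at h2 ⊢
    by_cases hr : i + 1 = o + S.size
    · refine ⟨o + S.size, by omega, by omega, ?_⟩
      rw [nodeAt_root _ o b k t (o + S.size) (by simp only [size]; omega)]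
      simp [TreeNode.HasHeavy, TreeNode.heavyNum, TreeNode.leftHeavy, TreeNode.leftNum,
        TreeNode.HasLight]
      omega
    · obtain ⟨p, a1, a2, a3⟩ := hS o b k false i h1 (by omega)
      refine ⟨p, a1, by omega, ?_⟩
      simpa only [nodeAt, a2, if_true] using a3

/-- The node with number `i`. -/
def node (R : RegEx α) (i : ℕ) : TreeNode α := R.nodeAt 0 0 0 true i

variable (R : RegEx α)

theorem node_root : R.node (R.size - 1) = ⟨R, 0, 0, 0, true⟩ :=
  R.nodeAt_root 0 0 0 true _ (by have := R.one_le_size; omega)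

section
variable {R} {i : ℕ} (hi : i < R.size)
include hi

theorem off_add_size : (R.node i).off + (R.node i).sub.size = i + 1 :=
  (R.nodeAt_bounds 0 0 0 true i (Nat.zero_le _) (by omega)).1

theorem base_add_size_le : (R.node i).base + (R.node i).sub.size ≤ R.size := by
  have := (R.nodeAt_bounds 0 0 0 true i (Nat.zero_le _) (by omega)).2.2.2.1
  simpa [node] using this

theorem two_pow_lev_le : 2 ^ (R.node i).lev ≤ R.size := by
  have := (R.nodeAt_bounds 0 0 0 true i (Nat.zero_le _) (by omega)).2.2.2.2.2
  have h1 := (R.node i).sub.one_le_size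
  simp only [pow_zero, one_mul] at this
  exact (Nat.le_mul_of_pos_right _ h1).trans this

theorem pos_lt : (R.node i).pos < R.size := by
  have := base_add_size_le hi
  have := (R.node i).sub.one_le_size
  simp only [TreeNode.pos]; omega

/-- In postorder a child has the last number of its own subtree. By `nodeAt_subtree` the lookup can
be made inside the subtree of `i`, where `nodeAt_root` finishes it. -/
theorem node_children {S T : RegEx α}
    (h : (R.node i).sub = cat S T ∨ (R.node i).sub = alt S T) :
    R.node (R.node i).leftNum = (R.node i).leftNode S T ∧
      R.node (R.node i).rightNum = (R.node i).rightNode S T ∧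
      (R.node i).leftNum = (R.node i).off + S.size - 1 ∧
      (R.node i).rightNum = (R.node i).off + S.size + T.size - 1 ∧
      (R.node i).leftNum < i ∧ (R.node i).rightNum < i := by
  have hs := off_add_size hi
  have ht := R.nodeAt_subtree 0 0 0 true i (Nat.zero_le _) (by omega)
  have h1 := S.one_le_size
  have h2 := T.one_le_size
  simp only [node] at *
  have e1 : (nodeAt R 0 0 0 true i).leftNum = (R.nodeAt 0 0 0 true i).off + S.size - 1 := by
    rcases h with h | h <;> simp [TreeNode.leftNum, h]
  have e2 : (nodeAt R 0 0 0 true i).rightNum =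
      (R.nodeAt 0 0 0 true i).off + S.size + T.size - 1 := by
    rcases h with h | h <;> simp [TreeNode.rightNum, h]
  have e3 : (R.nodeAt 0 0 0 true i).sub.size = S.size + T.size + 1 := by
    rcases h with h | h <;> simp [h, size]
  refine ⟨?_, ?_, e1, e2, by omega, by omega⟩
  · rw [e1, ht _ (by omega) (by omega), TreeNode.leftNode]
    rcases h with h | h <;> rw [h] <;> simp only [nodeAt] <;> rw [if_pos (by omega)] <;> 
      split_ifs <;> apply nodeAt_root <;> omega
  · rw [e2, ht _ (by omega) (by omega), TreeNode.rightNode]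
    rcases h with h | h <;> rw [h] <;> simp only [nodeAt] <;> rw [if_neg (by omega)] <;>
      rw [if_pos (by omega)] <;> split_ifs <;> apply nodeAt_root <;> omega

theorem node_child_star {S : RegEx α} (h : (R.node i).sub = star S) :
    R.node (R.node i).leftNum = ⟨S, (R.node i).off, (R.node i).base, (R.node i).lev, false⟩ ∧
      (R.node i).leftNum = (R.node i).off + S.size - 1 ∧ (R.node i).leftNum < i := by
  have hs := off_add_size hi
  have ht := R.nodeAt_subtree 0 0 0 true i (Nat.zero_le _) (by omega)
  have h1 := S.one_le_size
  simp only [node] at *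
  have e1 : (nodeAt R 0 0 0 true i).leftNum = (R.nodeAt 0 0 0 true i).off + S.size - 1 := by
    simp [TreeNode.leftNum, h]
  have e3 : (R.nodeAt 0 0 0 true i).sub.size = S.size + 1 := by simp [h, size]
  refine ⟨?_, e1, by omega⟩
  rw [e1, ht _ (by omega) (by omega), h]
  simp only [nodeAt]
  rw [if_pos (by omega)]
  apply nodeAt_root
  omega

theorem pos_notMem {x : ℕ} (hx : x < R.size) (h : x < (R.node i).off ∨ i < x) :
    (R.node x).pos < (R.node i).base ∨
      (R.node i).base + (R.node i).sub.size ≤ (R.node x).pos :=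
  R.nodeAt_pos_notMem 0 0 0 true i (Nat.zero_le _) (by omega) x (Nat.zero_le _) (by omega) h

/-- Of two nodes, the one with the larger number is outside the subtree of the other, hence outside
the interval of positions of this subtree, whose last position is that of the other node. -/
theorem pos_injective {x : ℕ} (hx : x < R.size) (h : (R.node i).pos = (R.node x).pos) : 
    i = x := by
  have h1 := off_add_size hi
  have h2 := off_add_size hx
  have h3 := (R.node i).sub.one_le_size
  have h4 := (R.node x).sub.one_le_size
  have h5 : (R.node i).pos = (R.node i).base + (R.node i).sub.size - 1 := rfl
  have h6 : (R.node x).pos = (R.node x).base + (R.node x).sub.size - 1 := rfl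
  by_contra hne
  rcases Nat.lt_or_gt_of_ne hne with h' | h'
  · have := pos_notMem hi hx (Or.inr h'); omega
  · have := pos_notMem hx hi (Or.inr h'); omega

/-- The levels in a subtree are at least the level of its root. -/
theorem lev_le_of_mem {x : ℕ} (h1 : (R.node i).off ≤ x) (h2 : x ≤ i) :
    (R.node i).lev ≤ (R.node x).lev ∧ (R.node x).pos ≤ (R.node i).pos := by
  have hs := off_add_size hi
  have ht := R.nodeAt_subtree 0 0 0 true i (Nat.zero_le _) (by omega) x h1 h2
  simp only [node] at *
  rw [ht]
  have := nodeAt_bounds (R.nodeAt 0 0 0 true i).sub _ (R.nodeAt 0 0 0 true i).base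
    (R.nodeAt 0 0 0 true i).lev (R.nodeAt 0 0 0 true i).top x h1 (by omega)
  refine ⟨this.2.2.2.2.1, ?_⟩
  simp only [TreeNode.pos]; omega

end

end RegEx

/-- The properties of the heavy path layout of `n` nodes with `H` levels. -/
structure HeavyLayout (n H : ℕ) (pos lev : ℕ → ℕ) (top : ℕ → Prop) (heavy light : ℕ → ℕ → Prop) :
    Prop where
  pos_lt : ∀ x < n, pos x < n
  pos_inj : ∀ x < n, ∀ y < n, pos x = pos y → x = y
  lev_lt : ∀ x < n, lev x < H
  heavy_lt : ∀ p h, heavy p h → h < p ∧ p < n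
  heavy_lev : ∀ p h, heavy p h → lev h = lev p
  heavy_top : ∀ p h, heavy p h → ¬ top h
  heavy_pos : ∀ p h, heavy p h → pos h < pos p
  -- Thus the nodes of a heavy path are neighbours among the nodes of their level, and signals along
  -- the path meet nothing else of this level.
  heavy_between : ∀ p h x, heavy p h → x < n → pos h < pos x → pos x < pos p → lev p < lev x
  light_lt : ∀ p l, light p l → l < p ∧ p < n
  light_lev : ∀ p l, light p l → lev l = lev p + 1
  -- The constant distance turns the passage between light children and parents into a shift.
  light_pos : ∀ p l, light p l → pos l + 1 = pos p
  exists_heavy : ∀ x < n, ¬ top x → ∃ p, heavy p x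

namespace RegEx

variable {α : Type} (R : RegEx α)

/-- `h` is the heavy child of `p`. -/
def Heavy (p h : ℕ) : Prop := p < R.size ∧ (R.node p).HasHeavy ∧ h = (R.node p).heavyNum

/-- `l` is the light child of `p`. -/
def Light (p l : ℕ) : Prop := p < R.size ∧ (R.node p).HasLight ∧ l = (R.node p).lightNum

theorem sub_cases (p : ℕ) : (∃ a, (R.node p).sub = char a) ∨
    (∃ S T, (R.node p).sub = cat S T ∨ (R.node p).sub = alt S T) ∨
      (∃ S, (R.node p).sub = star S) := by
  cases h : (R.node p).sub <;> simp

theorem light_cases {p l : ℕ} (h : R.Light p l) : ∃ S T,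
    ((R.node p).sub = cat S T ∨ (R.node p).sub = alt S T) ∧
    ((T.size ≤ S.size ∧ l = (R.node p).rightNum ∧ R.node l = (R.node p).rightNode S T) ∨
      (S.size < T.size ∧ l = (R.node p).leftNum ∧ R.node l = (R.node p).leftNode S T)) := by
  obtain ⟨hp, h1, rfl⟩ := h
  rcases R.sub_cases p with ⟨a, ha⟩ | ⟨S, T, hST⟩ | ⟨S, hS⟩
  · simp [TreeNode.HasLight, ha] at h1
  · refine ⟨S, T, hST, ?_⟩
    obtain ⟨e1, e2, -⟩ := node_children hp hST
    by_cases hh : T.size ≤ S.size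
    · left
      have : (R.node p).lightNum = (R.node p).rightNum := by
        rcases hST with h | h <;> simp [TreeNode.lightNum, TreeNode.leftHeavy, h, hh]
      exact ⟨hh, this, by rw [this, e2]⟩
    · right
      have : (R.node p).lightNum = (R.node p).leftNum := by
        rcases hST with h | h <;> simp [TreeNode.lightNum, TreeNode.leftHeavy, h, hh]
      exact ⟨by omega, this, by rw [this, e1]⟩
  · simp [TreeNode.HasLight, hS] at h1

theorem heavy_cases {p h : ℕ} (hh : R.Heavy p h) :
    (∃ S T, ((R.node p).sub = cat S T ∨ (R.node p).sub = alt S T) ∧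
    ((T.size ≤ S.size ∧ h = (R.node p).leftNum ∧ R.node h = (R.node p).leftNode S T) ∨
      (S.size < T.size ∧ h = (R.node p).rightNum ∧ R.node h = (R.node p).rightNode S T))) ∨
    (∃ S, (R.node p).sub = star S ∧ h = (R.node p).leftNum ∧
      R.node h = ⟨S, (R.node p).off, (R.node p).base, (R.node p).lev, false⟩) := by
  obtain ⟨hp, h1, rfl⟩ := hh
  rcases R.sub_cases p with ⟨a, ha⟩ | ⟨S, T, hST⟩ | ⟨S, hS⟩
  · simp [TreeNode.HasHeavy, ha] at h1
  · left
    refine ⟨S, T, hST, ?_⟩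
    obtain ⟨e1, e2, -⟩ := node_children hp hST
    by_cases hh : T.size ≤ S.size
    · left
      have : (R.node p).heavyNum = (R.node p).leftNum := by
        rcases hST with h | h <;> simp [TreeNode.heavyNum, TreeNode.leftHeavy, h, hh]
      exact ⟨hh, this, by rw [this, e1]⟩
    · right
      have : (R.node p).heavyNum = (R.node p).rightNum := by
        rcases hST with h | h <;> simp [TreeNode.heavyNum, TreeNode.leftHeavy, h, hh]
      exact ⟨by omega, this, by rw [this, e2]⟩
  · right
    have : (R.node p).heavyNum = (R.node p).leftNum := by
      simp [TreeNode.heavyNum, TreeNode.leftHeavy, hS]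
    exact ⟨S, hS, this, by rw [this, (node_child_star hp hS).1]⟩

theorem heavy_base {p h : ℕ} (hh : R.Heavy p h) : h < p ∧ (R.node h).base = (R.node p).base ∧
    (R.node h).lev = (R.node p).lev ∧ (R.node h).top = false ∧
    (R.node h).sub.size < (R.node p).sub.size := by
  have hp := hh.1
  rcases R.heavy_cases hh with ⟨S, T, hST, ⟨h1, h2, h3⟩ | ⟨h1, h2, h3⟩⟩ | ⟨S, hS, h2, h3⟩
  · have := node_children hp hST
    have e : (R.node p).sub.size = S.size + T.size + 1 := by
      rcases hST with h | h <;> simp [h, size]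
    rw [h3, TreeNode.leftNode, if_pos h1, e]
    refine ⟨by omega, rfl, rfl, rfl, ?_⟩
    simp only; omega
  · have := node_children hp hST
    have e : (R.node p).sub.size = S.size + T.size + 1 := by
      rcases hST with h | h <;> simp [h, size]
    rw [h3, TreeNode.rightNode, if_neg (by omega), e]
    refine ⟨by omega, rfl, rfl, rfl, ?_⟩
    simp only; omega
  · have := node_child_star hp hS
    rw [h3, hS]
    exact ⟨by omega, rfl, rfl, rfl, by simp [size]⟩

theorem heavyLayout : HeavyLayout R.size (Nat.log 2 R.numStates) (fun x => (R.node x).pos)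
    (fun x => (R.node x).lev) (fun x => (R.node x).top = true) R.Heavy R.Light where
  pos_lt x hx := pos_lt hx
  pos_inj x hx y hy h := pos_injective hx hy h
  lev_lt x hx := by
    have h := two_pow_lev_le hx
    rw [Nat.lt_iff_add_one_le]
    apply Nat.le_log_of_pow_le (by norm_num)
    -- There are twice as many states as nodes, so one more power of two fits and the bound for the
    -- levels is strict.
    simp only [numStates]
    rw [pow_succ]; omega
  heavy_lt p h hh := ⟨(R.heavy_base hh).1, hh.1⟩
  heavy_lev p h hh := (R.heavy_base hh).2.2.1
  heavy_top p h hh := by simp [(R.heavy_base hh).2.2.2.1]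
  heavy_pos p h hh := by
    obtain ⟨-, h1, -, -, h2⟩ := R.heavy_base hh
    have := (R.node h).sub.one_le_size
    simp only [TreeNode.pos]; omega
  heavy_between p h x hh hx h1 h2 := by
    have hp := hh.1
    have e0 := off_add_size hp
    have hsz := (R.node p).sub.one_le_size
    have hsz' := (R.node h).sub.one_le_size
    have hpx : (R.node p).pos = (R.node p).base + (R.node p).sub.size - 1 := rfl
    have hph : (R.node h).pos = (R.node h).base + (R.node h).sub.size - 1 := rfl
    have hb := R.heavy_base hh
    -- The position of `x` lies in the interval of the subtree of `p` but not in that of `h`. So `x`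
    -- belongs to the light subtree, whose levels all exceed that of `p`.
    have hmem : (R.node p).off ≤ x ∧ x < p := by
      by_contra hcon
      have : x ≠ p := by rintro rfl; omega
      rcases pos_notMem hp hx (by omega) with h | h
      · omega
      · omega
    have hhx : x < (R.node h).off ∨ h < x := by
      by_contra hcon
      have := (lev_le_of_mem (R := R) (i := h) (by omega) (x := x) (by omega) (by omega)).2
      omega
    have e1 := off_add_size (i := h) (by omega : h < R.size)
    rcases R.heavy_cases hh with ⟨S, T, hST, ⟨a1, a2, a3⟩ | ⟨a1, a2, a3⟩⟩ | ⟨S, hS, a2, a3⟩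
    · obtain ⟨c1, c2, c3, c4, c5, c6⟩ := node_children hp hST
      have e : (R.node p).sub.size = S.size + T.size + 1 := by
        rcases hST with h | h <;> simp [h, size]
      rw [TreeNode.rightNode, if_pos a1] at c2
      rw [TreeNode.leftNode, if_pos a1] at a3
      rw [a3] at hhx e1
      simp only at hhx e1
      have := (lev_le_of_mem (R := R) (i := (R.node p).rightNum) (by omega) (x := x)
        (by rw [c2]; simp only; omega) (by omega)).1
      rw [c2] at this
      simp only at this; omega
    · obtain ⟨c1, c2, c3, c4, c5, c6⟩ := node_children hp hST
      have e : (R.node p).sub.size = S.size + T.size + 1 := by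
        rcases hST with h | h <;> simp [h, size]
      rw [TreeNode.leftNode, if_neg (by omega)] at c1
      rw [TreeNode.rightNode, if_neg (by omega)] at a3
      rw [a3] at hhx e1
      simp only at hhx e1
      have := (lev_le_of_mem (R := R) (i := (R.node p).leftNum) (by omega) (x := x)
        (by rw [c1]; simp only; omega) (by omega)).1
      rw [c1] at this
      simp only at this; omega
    -- A star has only one child, so no node is left between it and its parent.
    · exfalso
      rw [a3] at hhx e1
      simp only at hhx e1
      rw [hS] at e0
      simp only [size] at e0
      omega
  light_lt p l hl := by
    have hp := hl.1
    refine ⟨?_, hp⟩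
    obtain ⟨S, T, hST, ⟨h1, h2, h3⟩ | ⟨h1, h2, h3⟩⟩ := R.light_cases hl <;>
    · have := node_children hp hST
      omega
  light_lev p l hl := by
    obtain ⟨S, T, hST, ⟨h1, h2, h3⟩ | ⟨h1, h2, h3⟩⟩ := R.light_cases hl
    · simp [h3, TreeNode.rightNode, h1]
    · simp [h3, TreeNode.leftNode, show ¬ T.size ≤ S.size by omega]
  light_pos p l hl := by
    obtain ⟨S, T, hST, ⟨h1, h2, h3⟩ | ⟨h1, h2, h3⟩⟩ := R.light_cases hl
    · have e : (R.node p).sub.size = S.size + T.size + 1 := by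
        rcases hST with h | h <;> simp [h, size]
      have := T.one_le_size
      simp [h3, TreeNode.rightNode, h1, TreeNode.pos, e]; omega
    · have e : (R.node p).sub.size = S.size + T.size + 1 := by
        rcases hST with h | h <;> simp [h, size]
      have := S.one_le_size
      simp [h3, TreeNode.leftNode, show ¬ T.size ≤ S.size by omega, TreeNode.pos, e]; omega
  exists_heavy x hx ht := by
    have hr : x + 1 ≠ R.size := by
      intro h
      apply ht
      rw [show x = R.size - 1 by omega, R.node_root]
    obtain ⟨p, h1, h2, h3 | h3⟩ := R.exists_parent 0 0 0 true x (Nat.zero_le _) (by omega)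
    · exact ⟨p, by omega, h3.1, h3.2⟩
    · exfalso
      apply ht
      have hl : R.Light p x := ⟨by omega, h3.1, h3.2⟩
      obtain ⟨S, T, hST, ⟨h1, h2, h3⟩ | ⟨h1, h2, h3⟩⟩ := R.light_cases hl
      · simp [h3, TreeNode.rightNode, h1]
      · simp [h3, TreeNode.leftNode, show ¬ T.size ≤ S.size by omega]

end RegEx


/-! ### Reachability along heavy paths, level by level -/

namespace HeavyLayout

open Relation

section edges

variable (n : ℕ) (heavy light : ℕ → ℕ → Prop) (cin gp la lb : ℕ → Prop)

/-- Each node `x` has an end slot `(x, false)` and a hub slot `(x, true)`. The predicates tell which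
connections of the node with its children are present. -/
inductive SlotEdge : ℕ × Bool → ℕ × Bool → Prop
  | hub (p h : ℕ) (hh : heavy p h) (hc : cin p) : SlotEdge (h, false) (p, true)
  | out (p : ℕ) (hp : p < n) (hc : cin p) (hg : ¬ gp p) : SlotEdge (p, true) (p, false)
  | heavy (p h : ℕ) (hh : heavy p h) (hc : ¬ cin p) : SlotEdge (h, false) (p, false)
  | lightHub (p l : ℕ) (hl : light p l) (hc : la p) : SlotEdge (l, false) (p, true)
  | light (p l : ℕ) (hl : light p l) (hc : lb p) : SlotEdge (l, false) (p, false)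

end edges

/-- Position of a slot. -/
def slotPos (pos : ℕ → ℕ) (σ : ℕ × Bool) : ℕ := 4 * pos σ.1 + if σ.2 then 0 else 2

/-- The slots on the heavy paths of level `k`. -/
def pathSlots (n : ℕ) (pos lev : ℕ → ℕ) (cin : ℕ → Prop) (k : ℕ) : Set ℕ :=
  {p | ∃ x < n, lev x = k ∧ (p = 4 * pos x + 2 ∨ cin x ∧ p = 4 * pos x)}

/-- The positions where the heavy paths of level `k` are interrupted. -/
def guardSlots (n : ℕ) (pos lev : ℕ → ℕ) (top gp : ℕ → Prop) (k : ℕ) : Set ℕ :=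
  {p | ∃ x < n, lev x = k ∧ (top x ∧ p = 4 * pos x + 3 ∨ gp x ∧ p = 4 * pos x + 1)}

variable {n H : ℕ} {pos lev : ℕ → ℕ} {top : ℕ → Prop} {heavy light : ℕ → ℕ → Prop}
  {cin gp la lb : ℕ → Prop}

/-- Each node owns four consecutive positions: the hub, a guard between hub and end, the end, and a
guard above the end. Slots are even and guards odd. -/
theorem pathSlots_disjoint (k k' : ℕ) {p : ℕ} (h : p ∈ pathSlots n pos lev cin k) :
    p ∉ guardSlots n pos lev top gp k' := by
  rintro ⟨y, hy, -, h'⟩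
  obtain ⟨x, hx, -, h⟩ := h
  omega

theorem slotPos_mem_pathSlots {σ : ℕ × Bool} (h : σ.1 < n) (hc : σ.2 = true → cin σ.1) :
    slotPos pos σ ∈ pathSlots n pos lev cin (lev σ.1) := by
  refine ⟨σ.1, h, rfl, ?_⟩
  obtain ⟨x, b⟩ := σ
  cases b
  · left; rfl
  · right; exact ⟨hc rfl, rfl⟩

theorem exists_slot {k p : ℕ} (h : p ∈ pathSlots n pos lev cin k) :
    ∃ σ : ℕ × Bool, σ.1 < n ∧ lev σ.1 = k ∧ (σ.2 = true → cin σ.1) ∧ slotPos pos σ = p := by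
  obtain ⟨x, hx, hk, rfl | ⟨hc, rfl⟩⟩ := h
  · exact ⟨(x, false), hx, hk, by simp, rfl⟩
  · exact ⟨(x, true), hx, hk, fun _ => hc, rfl⟩

theorem slotPos_injective (hL : HeavyLayout n H pos lev top heavy light) {σ τ : ℕ × Bool}
    (hσ : σ.1 < n) (hτ : τ.1 < n) (h : slotPos pos σ = slotPos pos τ) : σ = τ := by
  obtain ⟨x, b⟩ := σ
  obtain ⟨y, c⟩ := τ
  simp only [slotPos] at h hσ hτ
  have h1 : pos x = pos y := by split_ifs at h <;> omega
  rw [hL.pos_inj x hσ y hτ h1]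
  cases b <;> cases c <;> simp at h ⊢ <;> omega

/-- Slots of a level which are not separated by a guard are connected. -/
theorem reachable_of_no_guard (hL : HeavyLayout n H pos lev top heavy light)
    (σ τ : ℕ × Bool) (hσ : σ.1 < n) (hτ : τ.1 < n) (hσc : σ.2 = true → cin σ.1)
    (hτc : τ.2 = true → cin τ.1) (hlev : lev σ.1 = lev τ.1)
    (hle : slotPos pos σ ≤ slotPos pos τ)
    (hg : ∀ g, slotPos pos σ < g → g < slotPos pos τ →
      g ∉ guardSlots n pos lev top gp (lev σ.1)) :
    ReflTransGen (SlotEdge n heavy light cin gp la lb) σ τ := by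
  obtain ⟨d, hd⟩ : ∃ d, d = slotPos pos τ - slotPos pos σ := ⟨_, rfl⟩
  -- Induction on the distance: a single edge out of `σ` that does not overshoot `τ` suffices,
  -- because the remaining interval is again free of guards.
  induction d using Nat.strong_induction_on generalizing σ with
  | _ d ih =>
  by_cases heq : slotPos pos σ = slotPos pos τ
  · rw [slotPos_injective hL hσ hτ heq]
  -- it suffices to make one step
  suffices ∃ ρ : ℕ × Bool, SlotEdge n heavy light cin gp la lb σ ρ ∧ ρ.1 < n ∧
      (ρ.2 = true → cin ρ.1) ∧ lev ρ.1 = lev σ.1 ∧ slotPos pos σ < slotPos pos ρ ∧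
      slotPos pos ρ ≤ slotPos pos τ by
    obtain ⟨ρ, h1, h2, h3, h4, h5, h6⟩ := this
    refine (ReflTransGen.single h1).trans (ih _ ?_ ρ h2 h3 (h4.trans hlev) h6 ?_ rfl)
    · omega
    · intro g hg1 hg2
      rw [h4]
      exact hg g (by omega) hg2
  obtain ⟨x, b⟩ := σ
  obtain ⟨y, c⟩ := τ
  simp only at hσ hτ hσc hτc hlev hg
  cases b
  · -- from the end slot to the parent
    simp only [slotPos] at hle heq hg ⊢
    have hpos : pos x < pos y := by cases c <;> simp at hle heq <;> omega
    have hntop : ¬ top x := fun ht => hg (4 * pos x + 3) (by simp) (by split_ifs <;> omega)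
      ⟨x, hσ, rfl, Or.inl ⟨ht, rfl⟩⟩
    obtain ⟨p, hp⟩ := hL.exists_heavy x hσ hntop
    have hpn := (hL.heavy_lt p x hp).2
    have hpl := hL.heavy_lev p x hp
    have hpp := hL.heavy_pos p x hp
    -- Otherwise `y` would lie strictly between heavy neighbours of its own level.
    have hpy : pos p ≤ pos y := by
      by_contra hcon
      have := hL.heavy_between p x y hp hτ hpos (by omega)
      omega
    by_cases hc : cin p
    · exact ⟨(p, true), .hub p x hp hc, hpn, fun _ => hc, hpl.symm, by simp; omega, by simp; omega⟩
    · refine ⟨(p, false), .heavy p x hp hc, hpn, by simp, hpl.symm, by simp; omega, ?_⟩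
      simp
      rcases Nat.lt_or_ge (pos p) (pos y) with h | h
      · omega
      · have : p = y := hL.pos_inj p hpn y hτ (by omega)
        subst this
        cases c
        · simp
        · exact absurd (hτc rfl) hc
  · -- from the hub to the end slot
    have hc := hσc rfl
    simp only [slotPos] at hle heq hg ⊢
    have hpy : pos x ≤ pos y := by split_ifs at hle <;> simp at hle <;> omega
    have h2 : 4 * pos x + 2 ≤ 4 * pos y + if c then 0 else 2 := by
      cases c <;> simp at * <;> omega
    refine ⟨(x, false), .out x hσ hc fun hgx => ?_, hσ, by simp, rfl, by simp, by simpa using h2⟩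
    refine hg (4 * pos x + 1) (by simp) (by split_ifs at h2 ⊢ <;> omega)
      ⟨x, hσ, rfl, Or.inr ⟨hgx, rfl⟩⟩

/-- An edge stays in its level, with no guard between its ends, or goes to the previous level. -/
theorem slotEdge_cases (hL : HeavyLayout n H pos lev top heavy light) 
    (hgp : ∀ x, gp x → cin x) {σ τ : ℕ × Bool}
    (h : SlotEdge n heavy light cin gp la lb σ τ) :
    (σ.1 < n ∧ τ.1 < n ∧ lev σ.1 = lev τ.1 ∧ (σ.2 = true → cin σ.1) ∧ (τ.2 = true → cin τ.1) ∧
      slotPos pos σ ≤ slotPos pos τ ∧ ∀ g, slotPos pos σ < g → g < slotPos pos τ →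
        g ∉ guardSlots n pos lev top gp (lev σ.1)) ∨
    (∃ p l, light p l ∧ la p ∧ σ = (l, false) ∧ τ = (p, true)) ∨
    (∃ p l, light p l ∧ lb p ∧ σ = (l, false) ∧ τ = (p, false)) := by
  cases h with
  | hub p h hh hc =>
    left
    have h1 := hL.heavy_lt p h hh
    have h2 := hL.heavy_pos p h hh
    have h3 := hL.heavy_lev p h hh
    refine ⟨by simp only; omega, h1.2, h3, by simp, fun _ => hc, by simp [slotPos]; omega, ?_⟩
    simp only [slotPos]
    rintro g hg1 hg2 ⟨x, hx, hxl, hxg⟩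
    simp at hg1 hg2
    have hxe : pos x = pos h → x = h := hL.pos_inj x hx h (by omega)
    -- A guard of this level cannot belong to a node strictly between child and parent. At the child
    -- itself only the upper guard lies in the interval, and it is absent because a heavy child is
    -- not the top of a path.
    rcases Nat.lt_trichotomy (pos h) (pos x) with hlt | heq | hgt
    · have := hL.heavy_between p h x hh hx hlt (by omega)
      omega
    · rcases hxg with ⟨ht, rfl⟩ | ⟨-, rfl⟩
      · rw [hxe heq.symm] at ht
        exact hL.heavy_top p h hh ht
      · omega
    · omega
  | out p hp hc hg =>
    left
    refine ⟨hp, hp, rfl, fun _ => hc, by simp, by simp [slotPos], ?_⟩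
    simp only [slotPos]
    rintro g hg1 hg2 ⟨x, hx, hxl, hxg⟩
    simp at hg1 hg2
    have hxe : pos x = pos p → x = p := hL.pos_inj x hx p hp
    rcases hxg with ⟨ht, rfl⟩ | ⟨hgx, rfl⟩
    · omega
    · rw [hxe (by omega)] at hgx
      exact hg hgx
  | heavy p h hh hc =>
    left
    have h1 := hL.heavy_lt p h hh
    have h2 := hL.heavy_pos p h hh
    have h3 := hL.heavy_lev p h hh
    refine ⟨by simp only; omega, h1.2, h3, by simp, by simp, by simp [slotPos]; omega, ?_⟩
    simp only [slotPos]
    rintro g hg1 hg2 ⟨x, hx, hxl, hxg⟩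
    simp at hg1 hg2
    have hxe : pos x = pos h → x = h := hL.pos_inj x hx h (by omega)
    have hxe' : pos x = pos p → x = p := hL.pos_inj x hx p h1.2
    rcases Nat.lt_trichotomy (pos h) (pos x) with hlt | heq | hgt
    · rcases Nat.lt_trichotomy (pos x) (pos p) with h4 | h4 | h4
      · have := hL.heavy_between p h x hh hx hlt h4
        omega
      · rw [hxe' h4] at hxg
        rcases hxg with ⟨-, rfl⟩ | ⟨hgx, rfl⟩
        · omega
        -- A guard of the parent would lie in the interval, but guards between hub and end occur
        -- only at nodes whose hub is on the path.
        · exact hc (hgp _ hgx)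
      · omega
    · rcases hxg with ⟨ht, rfl⟩ | ⟨-, rfl⟩
      · rw [hxe heq.symm] at ht
        exact hL.heavy_top p h hh ht
      · omega
    · omega
  | lightHub p l hl hc => exact Or.inr (Or.inl ⟨p, l, hl, hc, rfl, rfl⟩)
  | light p l hl hc => exact Or.inr (Or.inr ⟨p, l, hl, hc, rfl, rfl⟩)

end HeavyLayout

/-! ### Sweeps over the levels -/

namespace Sweep

open Relation

/-- Transfer to the positions in `La` from two positions below, and to those in `Lb` from four
positions below. -/
def transfer (La Lb A : Set ℕ) : Set ℕ :=
  {p | p ∈ A ∨ (p ∈ La ∧ ∃ q ∈ A, p = q + 2) ∨ (p ∈ Lb ∧ ∃ q ∈ A, p = q + 4)}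

/-- Propagation upwards within `P` up to the next guard. -/
def fill (P G A : Set ℕ) : Set ℕ :=
  {i | i ∈ A ∨ i ∈ P ∧ ∃ j ∈ A, j ∈ P ∧ j ≤ i ∧ ∀ g, j < g → g < i → g ∉ G}

/-- The result of the first `t` steps of a sweep. -/
def sweep (P G La Lb : ℕ → Set ℕ) (A : Set ℕ) : ℕ → Set ℕ
  | 0 => A
  | t + 1 => fill (P t) (G t) (transfer (La t) (Lb t) (sweep P G La Lb A t))

variable {P G La Lb : ℕ → Set ℕ} {A : Set ℕ}

theorem sweep_mono {t t' : ℕ} (h : t ≤ t') : sweep P G La Lb A t ⊆ sweep P G La Lb A t' := by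
  induction h with
  | refl => exact subset_rfl
  | step _ ih => exact fun x hx => Or.inl (Or.inl (ih hx))

/-- Every edge either raises the rank, and is then one of the two shifts, or stays in its rank
without meeting a guard, and is then covered by `fill`. So after step `t` everything of rank at most
`t` is complete: induction on the rank, and inside a rank on the path. Conversely every position
that is added comes from a path by `hfill`, `hLa` and `hLb`. -/
theorem sweep_eq_image {S : Type*} {E : S → S → Prop} {V : S → Prop} {q r : S → ℕ} {H : ℕ}
    (S₀ : Set S) (hV₀ : ∀ σ ∈ S₀, V σ) (hV : ∀ σ τ, V σ → E σ τ → V τ)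
    (hr : ∀ σ, V σ → r σ < H)
    (hfill : ∀ t σ i, t < H → V σ → q σ ∈ P t → i ∈ P t → q σ ≤ i →
      (∀ g, q σ < g → g < i → g ∉ G t) → ∃ τ, q τ = i ∧ ReflTransGen E σ τ)
    (hLa : ∀ t σ, t < H → V σ → q σ + 2 ∈ La t → ∃ τ, q τ = q σ + 2 ∧ ReflTransGen E σ τ)
    (hLb : ∀ t σ, t < H → V σ → q σ + 4 ∈ Lb t → ∃ τ, q τ = q σ + 4 ∧ ReflTransGen E σ τ)
    (hdisj : ∀ t p, p ∈ P t → p ∉ G t)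
    (hE : ∀ σ τ, V σ → E σ τ →
      (r σ = r τ ∧ q σ ∈ P (r τ) ∧ q τ ∈ P (r τ) ∧ q σ ≤ q τ ∧
        ∀ g, q σ < g → g < q τ → g ∉ G (r τ)) ∨
      (r σ < r τ ∧ (q τ = q σ + 2 ∧ q τ ∈ La (r τ) ∨ q τ = q σ + 4 ∧ q τ ∈ Lb (r τ)))) :
    sweep P G La Lb (q '' S₀) H = q '' {τ | ∃ σ ∈ S₀, ReflTransGen E σ τ} := by
  have hVr : ∀ σ τ, V σ → ReflTransGen E σ τ → V τ := by
    intro σ τ hσ h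
    induction h with
    | refl => exact hσ
    | tail _ h ih => exact hV _ _ ih h
  apply Set.Subset.antisymm
  · suffices ∀ t ≤ H, sweep P G La Lb (q '' S₀) t ⊆ q '' {τ | ∃ σ ∈ S₀, ReflTransGen E σ τ} from
      this H le_rfl
    intro t
    induction t with
    | zero =>
      rintro - x ⟨σ, hσ, rfl⟩
      exact ⟨σ, ⟨σ, hσ, .refl⟩, rfl⟩
    | succ t ih =>
      intro ht
      have ih := ih (by omega)
      have htr : transfer (La t) (Lb t) (sweep P G La Lb (q '' S₀) t) ⊆
          q '' {τ | ∃ σ ∈ S₀, ReflTransGen E σ τ} := by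
        rintro p (hp | ⟨hp, p', hp', rfl⟩ | ⟨hp, p', hp', rfl⟩)
        · exact ih hp
        · obtain ⟨τ, ⟨σ, hσ, hστ⟩, rfl⟩ := ih hp'
          obtain ⟨ρ, hρ, hτρ⟩ := hLa t τ (by omega) (hVr σ τ (hV₀ σ hσ) hστ) hp
          exact ⟨ρ, ⟨σ, hσ, hστ.trans hτρ⟩, hρ⟩
        · obtain ⟨τ, ⟨σ, hσ, hστ⟩, rfl⟩ := ih hp'
          obtain ⟨ρ, hρ, hτρ⟩ := hLb t τ (by omega) (hVr σ τ (hV₀ σ hσ) hστ) hp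
          exact ⟨ρ, ⟨σ, hσ, hστ.trans hτρ⟩, hρ⟩
      rintro i (hi | ⟨hi, j, hj, hjP, hji, hg⟩)
      · exact htr hi
      · obtain ⟨τ, ⟨σ, hσ, hστ⟩, rfl⟩ := htr hj
        obtain ⟨ρ, hρ, hτρ⟩ :=
          hfill t τ i (by omega) (hVr σ τ (hV₀ σ hσ) hστ) hjP hi hji hg
        exact ⟨ρ, ⟨σ, hσ, hστ.trans hτρ⟩, hρ⟩
  · suffices ∀ t, ∀ σ ∈ S₀, ∀ τ, ReflTransGen E σ τ → r τ < t →
        q τ ∈ sweep P G La Lb (q '' S₀) t by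
      rintro - ⟨τ, ⟨σ, hσ, hστ⟩, rfl⟩
      exact this H σ hσ τ hστ (hr τ (hVr σ τ (hV₀ σ hσ) hστ))
    intro t
    induction t with
    | zero => intro σ _ τ _ h; omega
    | succ t ih =>
      intro σ hσ τ hστ
      induction hστ with
      | refl => exact fun _ => sweep_mono (Nat.zero_le _) ⟨σ, hσ, rfl⟩
      | @tail τ ρ hστ hτρ ih' =>
        intro hρ
        rcases Nat.lt_succ_iff_lt_or_eq.1 hρ with hlt | heq
        · exact sweep_mono (Nat.le_succ t) (ih σ hσ ρ (hστ.tail hτρ) hlt)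
        · rcases hE τ ρ (hVr σ τ (hV₀ σ hσ) hστ) hτρ with ⟨h1, h2, h3, h4, h5⟩ | ⟨h1, h2⟩
          · have := ih' (by omega)
            rw [heq] at h2 h3 h5
            rcases this with h6 | ⟨h6, j, h7, h8, h9, h10⟩
            · exact Or.inr ⟨h3, q τ, h6, h2, h4, h5⟩
            -- Two intervals without guards are joined. The junction is a slot of the path and hence
            -- no guard.
            · refine Or.inr ⟨h3, j, h7, h8, h9.trans h4, fun g hg1 hg2 => ?_⟩
              rcases Nat.lt_trichotomy g (q τ) with h | h | h
              · exact h10 g hg1 h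
              · rw [h]; exact hdisj t _ h2
              · exact h5 g h hg2
          · have := ih σ hσ τ hστ (by omega)
            rw [heq] at h2
            left
            rcases h2 with ⟨h2, h3⟩ | ⟨h2, h3⟩
            · exact Or.inr (Or.inl ⟨h3, q τ, this, h2⟩)
            · exact Or.inr (Or.inr ⟨h3, q τ, this, h2⟩)

end Sweep

namespace HeavyLayout

open Relation Sweep

variable {n H : ℕ} {pos lev : ℕ → ℕ} {top : ℕ → Prop} {heavy light : ℕ → ℕ → Prop}
  {cin gp la lb : ℕ → Prop}

/-- Hubs of level `k` which are reached from the light child. -/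
def hubTargets (pos lev : ℕ → ℕ) (light : ℕ → ℕ → Prop) (la : ℕ → Prop) (k : ℕ) : Set ℕ :=
  {p | ∃ x l, light x l ∧ lev x = k ∧ la x ∧ p = 4 * pos x}

/-- End slots of level `k` which are reached from the light child. -/
def endTargets (pos lev : ℕ → ℕ) (light : ℕ → ℕ → Prop) (lb : ℕ → Prop) (k : ℕ) : Set ℕ :=
  {p | ∃ x l, light x l ∧ lev x = k ∧ lb x ∧ p = 4 * pos x + 2}

/-- The rank counts the levels from the deepest one. The end slot of a light child is two positions
below the hub and four below the end slot of its parent, in agreement with `transfer`. -/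
theorem sweep_up (hL : HeavyLayout n H pos lev top heavy light) (hgp : ∀ x, gp x → cin x)
    (S₀ : Set (ℕ × Bool)) (hV₀ : ∀ σ ∈ S₀, σ.1 < n) :
    sweep (fun t => pathSlots n pos lev cin (H - 1 - t))
      (fun t => guardSlots n pos lev top gp (H - 1 - t))
      (fun t => hubTargets pos lev light la (H - 1 - t))
      (fun t => endTargets pos lev light lb (H - 1 - t)) (slotPos pos '' S₀) H =
    slotPos pos '' {τ | ∃ σ ∈ S₀, ReflTransGen (SlotEdge n heavy light cin gp la lb) σ τ} := by
  apply sweep_eq_image (V := fun σ => σ.1 < n) (r := fun σ => H - 1 - lev σ.1) S₀ hV₀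
  · intro σ τ hσ h
    rcases slotEdge_cases hL hgp h with h | ⟨p, l, hl, -, -, rfl⟩ | ⟨p, l, hl, -, -, rfl⟩
    · exact h.2.1
    · exact (hL.light_lt p l hl).2
    · exact (hL.light_lt p l hl).2
  · intro σ hσ
    have := hL.lev_lt σ.1 hσ
    omega
  · intro t σ i ht hσ h1 h2 h3 h4
    obtain ⟨σ', a1, a2, a3, a4⟩ := exists_slot h1
    obtain rfl := slotPos_injective hL a1 hσ a4
    obtain ⟨τ, b1, b2, b3, rfl⟩ := exists_slot h2
    exact ⟨τ, rfl, reachable_of_no_guard hL σ' τ hσ b1 a3 b3 (a2.trans b2.symm) h3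
      (by rwa [a2])⟩
  · rintro t ⟨y, b⟩ ht hσ ⟨x, l, h1, h2, h3, h4⟩
    have e1 := hL.light_pos x l h1
    have e2 := hL.light_lt x l h1
    simp only [slotPos] at h4 ⊢
    simp only at hσ
    cases b
    -- The position two below the hub of `x` can only be the end slot of its light child.
    · have : y = l := hL.pos_inj y hσ l (by omega) (by simp at h4; omega)
      subst this
      exact ⟨(x, true), by simpa using h4.symm, .single (.lightHub x y h1 h3)⟩
    · simp at h4; omega
  · rintro t ⟨y, b⟩ ht hσ ⟨x, l, h1, h2, h3, h4⟩
    have e1 := hL.light_pos x l h1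
    have e2 := hL.light_lt x l h1
    simp only [slotPos] at h4 ⊢
    simp only at hσ
    cases b
    · have : y = l := hL.pos_inj y hσ l (by omega) (by simp at h4; omega)
      subst this
      exact ⟨(x, false), by simpa using h4.symm, .single (.light x y h1 h3)⟩
    · simp at h4; omega
  · exact fun t p hp => pathSlots_disjoint _ _ hp
  · intro σ τ hσ h
    rcases slotEdge_cases hL hgp h with h | ⟨p, l, hl, hc, rfl, rfl⟩ | ⟨p, l, hl, hc, rfl, rfl⟩
    · left
      obtain ⟨h1, h2, h3, h4, h5, h6, h7⟩ := h
      have := hL.lev_lt _ h2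
      simp only [h3, show H - 1 - (H - 1 - lev τ.1) = lev τ.1 by omega, true_and]
      exact ⟨h3 ▸ slotPos_mem_pathSlots h1 h4, slotPos_mem_pathSlots h2 h5, h6, h3 ▸ h7⟩
    all_goals
      right
      have e1 := hL.light_pos p l hl
      have e2 := hL.light_lt p l hl
      have e3 := hL.light_lev p l hl
      have e4 := hL.lev_lt l (by omega)
      refine ⟨by simp only; omega, ?_⟩
      simp only [show H - 1 - (H - 1 - lev p) = lev p by omega, slotPos]
    · exact Or.inl ⟨by simp; omega, p, l, hl, rfl, hc, by simp⟩
    · exact Or.inr ⟨by simp; omega, p, l, hl, rfl, hc, by simp⟩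

/-- Reflection of the positions below `N`. -/
def reflect (N : ℕ) (A : Set ℕ) : Set ℕ := {p | p < N ∧ N - 1 - p ∈ A}

/-- End slots of the light children of level `k`, which are reached from some slot of the parent. -/
def childTargets (pos lev : ℕ → ℕ) (light : ℕ → ℕ → Prop) (lc : ℕ → Prop) (k : ℕ) : Set ℕ :=
  {p | ∃ x l, light x l ∧ lev l = k ∧ lc x ∧ p = 4 * pos l + 2}

/-- Reflection turns the reversed edges into edges towards larger positions, so the same two
operations apply. The rank is now the level itself. -/
theorem sweep_down (hL : HeavyLayout n H pos lev top heavy light) (hgp : ∀ x, gp x → cin x)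
    {N : ℕ} (hN : 4 * n ≤ N) (S₀ : Set (ℕ × Bool)) (hV₀ : ∀ σ ∈ S₀, σ.1 < n) :
    sweep (fun t => reflect N (pathSlots n pos lev cin t))
      (fun t => reflect N (guardSlots n pos lev top gp t))
      (fun t => reflect N (childTargets pos lev light la t))
      (fun t => reflect N (childTargets pos lev light lb t))
      ((fun σ => N - 1 - slotPos pos σ) '' S₀) H =
    (fun σ => N - 1 - slotPos pos σ) ''
      {τ | ∃ σ ∈ S₀, ReflTransGen (flip (SlotEdge n heavy light cin gp la lb)) σ τ} := by
  have hsl : ∀ σ : ℕ × Bool, σ.1 < n → slotPos pos σ < N := by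
    intro σ hσ
    have := hL.pos_lt σ.1 hσ
    simp only [slotPos]; split_ifs <;> omega
  have hrr : ∀ σ : ℕ × Bool, σ.1 < n → ∀ B : Set ℕ, slotPos pos σ ∈ B →
      N - 1 - slotPos pos σ ∈ reflect N B := by
    intro σ hσ B hB
    have := hsl σ hσ
    exact ⟨by omega, by rwa [show N - 1 - (N - 1 - slotPos pos σ) = slotPos pos σ by omega]⟩
  apply sweep_eq_image (V := fun σ => σ.1 < n) (r := fun σ => lev σ.1) S₀ hV₀
  · intro σ τ hσ h
    rcases slotEdge_cases hL hgp h with h | ⟨p, l, hl, -, rfl, -⟩ | ⟨p, l, hl, -, rfl, -⟩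
    · exact h.1
    · have := hL.light_lt p l hl; simp only; omega
    · have := hL.light_lt p l hl; simp only; omega
  · exact fun σ hσ => hL.lev_lt σ.1 hσ
  · rintro t σ i ht hσ ⟨h0, h1⟩ ⟨h0', h2⟩ h3 h4
    obtain ⟨σ', a1, a2, a3, a4⟩ := exists_slot h1
    have h5 := hsl σ hσ
    rw [show N - 1 - (N - 1 - slotPos pos σ) = slotPos pos σ by omega] at a4
    obtain rfl := slotPos_injective hL a1 hσ a4
    obtain ⟨τ, b1, b2, b3, b4⟩ := exists_slot h2
    refine ⟨τ, by omega, reflTransGen_swap.2 (reachable_of_no_guard hL τ σ' b1 hσ b3 a3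
      (b2.trans a2.symm) (by omega) ?_)⟩
    intro g hg1 hg2 hg3
    refine h4 (N - 1 - g) (by omega) (by omega) ⟨by omega, ?_⟩
    rwa [show N - 1 - (N - 1 - g) = g by omega, ← b2]
  · rintro t ⟨y, b⟩ ht hσ ⟨h0, x, l, h1, h2, h3, h4⟩
    have e1 := hL.light_pos x l h1
    have e2 := hL.light_lt x l h1
    have e3 := hsl _ hσ
    simp only [slotPos] at h0 h4 e3 ⊢
    simp only at hσ
    -- The distances identify the source: two positions above the end slot of the child is the hub
    -- of the parent, four above is its end slot.
    cases b
    · simp at h4 e3; omega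
    · simp at h4 e3
      have : y = x := hL.pos_inj y hσ x (by omega) (by omega)
      subst this
      exact ⟨(l, false), by simp; omega, .single (.lightHub y l h1 h3)⟩
  · rintro t ⟨y, b⟩ ht hσ ⟨h0, x, l, h1, h2, h3, h4⟩
    have e1 := hL.light_pos x l h1
    have e2 := hL.light_lt x l h1
    have e3 := hsl _ hσ
    simp only [slotPos] at h0 h4 e3 ⊢
    simp only at hσ
    cases b
    · simp at h4 e3
      have : y = x := hL.pos_inj y hσ x (by omega) (by omega)
      subst this
      exact ⟨(l, false), by simp; omega, .single (.light y l h1 h3)⟩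
    · simp at h4 e3; omega
  · exact fun t p hp hp' => pathSlots_disjoint _ _ hp.2 hp'.2
  · intro σ τ hσ h
    rcases slotEdge_cases hL hgp h with h | ⟨p, l, hl, hc, rfl, rfl⟩ | ⟨p, l, hl, hc, rfl, rfl⟩
    · left
      obtain ⟨h1, h2, h3, h4, h5, h6, h7⟩ := h
      have s1 := hsl _ h1
      have s2 := hsl _ h2
      refine ⟨h3.symm, hrr _ hσ _ (h3 ▸ slotPos_mem_pathSlots h2 h5),
        hrr _ h1 _ (slotPos_mem_pathSlots h1 h4), by omega, ?_⟩
      rintro g hg1 hg2 ⟨-, hg3⟩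
      exact h7 (N - 1 - g) (by omega) (by omega) hg3
    all_goals
      right
      have e1 := hL.light_pos p l hl
      have e2 := hL.light_lt p l hl
      have e3 := hL.light_lev p l hl
      have e4 := hL.lev_lt l (by omega)
      have e5 := hL.pos_lt p e2.2
      refine ⟨by simp only; omega, ?_⟩
      have := hrr (l, false) (by simp only; omega)
    · exact Or.inl ⟨by simp [slotPos]; omega, this _ ⟨p, l, hl, rfl, hc, rfl⟩⟩
    · exact Or.inr ⟨by simp [slotPos]; omega, this _ ⟨p, l, hl, rfl, hc, rfl⟩⟩

end HeavyLayout


/-! ### The closure of a state-set in terms of two sweeps -/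

namespace RegEx

variable {α : Type}

/-- The automaton has an `ε`-path from the start state to the accepting state. -/
def null : RegEx α → Bool
  | char _ => false
  | cat S T => S.null && T.null
  | alt S T => S.null || T.null
  | star _ => true

/-- Upward sweep: the hub lies on the heavy path. -/
def upHub : RegEx α → Bool
  | cat S T => decide (T.size ≤ S.size)
  | star _ => true
  | _ => false

/-- Upward sweep: the way from the hub to the accepting state is blocked. -/
def upGuard : RegEx α → Bool
  | cat S T => decide (T.size ≤ S.size) && !T.null
  | _ => false

/-- Upward sweep: the light child is connected with the hub. -/
def upLightHub : RegEx α → Bool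
  | cat S T => !decide (T.size ≤ S.size)
  | _ => false

/-- Upward sweep: the light child is connected with the accepting state. -/
def upLight : RegEx α → Bool
  | cat S T => decide (T.size ≤ S.size) || T.null
  | alt _ _ => true
  | _ => false

/-- Downward sweep: the hub lies on the heavy path. -/
def downHub : RegEx α → Bool
  | cat S T => !decide (T.size ≤ S.size)
  | star _ => true
  | _ => false

/-- Downward sweep: the way from the start state to the hub is blocked. -/
def downGuard : RegEx α → Bool
  | cat S T => !decide (T.size ≤ S.size) && !S.null
  | _ => false

/-- Downward sweep: the hub is connected with the light child. -/
def downLightHub : RegEx α → Bool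
  | cat S T => decide (T.size ≤ S.size)
  | _ => false

/-- Downward sweep: the start state is connected with the light child. -/
def downLight : RegEx α → Bool
  | cat S T => !decide (T.size ≤ S.size) || S.null
  | alt _ _ => true
  | _ => false

/-- Transitions of the nodes, between numbers of states. -/
def LocalTrans (N : TreeNode α) (p : ℕ) (x : Option α) (u v : ℕ) : Prop :=
  match N.sub with
  | char a => x = some a ∧ u = 2 * p ∧ v = 2 * p + 1
  | cat _ _ => x = none ∧ (u = 2 * p ∧ v = 2 * N.leftNum ∨
      u = 2 * N.leftNum + 1 ∧ v = 2 * N.rightNum ∨ u = 2 * N.rightNum + 1 ∧ v = 2 * p + 1)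
  | alt _ _ => x = none ∧ (u = 2 * p ∧ v = 2 * N.leftNum ∨ u = 2 * p ∧ v = 2 * N.rightNum ∨
      u = 2 * N.leftNum + 1 ∧ v = 2 * p + 1 ∨ u = 2 * N.rightNum + 1 ∧ v = 2 * p + 1)
  | star _ => x = none ∧ (u = 2 * p ∧ v = 2 * N.leftNum ∨ u = 2 * p ∧ v = 2 * p + 1 ∨
      u = 2 * N.leftNum + 1 ∧ v = 2 * p + 1 ∨ u = 2 * N.leftNum + 1 ∧ v = 2 * N.leftNum)

/-- Every transition is created at one node of the tree, and there it is a relation between the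
numbers of this node and its children. With the converse below, the inductive automaton is replaced
by arithmetic of node numbers. -/
theorem Trans.localTrans {R : RegEx α} {s t : State R} {x : Option α} (h : Trans R s x t) :
    ∀ (o b k : ℕ) (t' : Bool), ∃ p, o ≤ p ∧ p < o + R.size ∧
      LocalTrans (R.nodeAt o b k t' p) p x (2 * o + s.idx) (2 * o + t.idx) := by
  induction h with
  | char a =>
    intro o b k t'
    exact ⟨o, le_rfl, by simp [size], by simp [LocalTrans, nodeAt, State.idx, size]⟩
  | cat_in S T | cat_mid S T | cat_out S T =>
    intro o b k t'
    have h1 := S.one_le_size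
    have h2 := T.one_le_size
    refine ⟨o + S.size + T.size, by omega, by simp only [size]; omega, ?_⟩
    rw [nodeAt_root _ _ _ _ _ _ (by simp only [size]; omega)]
    simp only [LocalTrans, TreeNode.leftNum, TreeNode.rightNum, State.idx, size, true_and]
    omega
  | alt_inL S T | alt_inR S T | alt_outL S T | alt_outR S T =>
    intro o b k t'
    have h1 := S.one_le_size
    have h2 := T.one_le_size
    refine ⟨o + S.size + T.size, by omega, by simp only [size]; omega, ?_⟩
    rw [nodeAt_root _ _ _ _ _ _ (by simp only [size]; omega)]
    simp only [LocalTrans, TreeNode.leftNum, TreeNode.rightNum, State.idx, size, true_and]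
    omega
  | star_in S | star_skip S | star_out S | star_back S =>
    intro o b k t'
    have h1 := S.one_le_size
    refine ⟨o + S.size, by omega, by simp only [size]; omega, ?_⟩
    rw [nodeAt_root _ _ _ _ _ _ (by simp only [size]; omega)]
    simp only [LocalTrans, TreeNode.leftNum, State.idx, size, true_and]
    omega
  | @cat_left S T _ _ _ _ ih | @alt_left S T _ _ _ _ ih =>
    intro o b k t'
    simp only [State.idx, size, nodeAt]
    by_cases hh : T.size ≤ S.size
    · obtain ⟨p, h1, h2, h3⟩ := ih o b k false
      exact ⟨p, h1, by omega, by simpa only [h2, hh, if_true] using h3⟩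
    · obtain ⟨p, h1, h2, h3⟩ := ih o (b + T.size) (k + 1) true
      exact ⟨p, h1, by omega, by simpa only [h2, hh, if_true, if_false] using h3⟩
  | @cat_right S T _ _ _ _ ih | @alt_right S T _ _ _ _ ih =>
    intro o b k t'
    simp only [State.idx, size, nodeAt]
    by_cases hh : T.size ≤ S.size
    · obtain ⟨p, h1, h2, h3⟩ := ih (o + S.size) (b + S.size) (k + 1) true
      refine ⟨p, by omega, by omega, ?_⟩
      simp only [show ¬ p < o + S.size by omega, h2, hh, if_true, if_false]
      simpa only [Nat.mul_add, Nat.add_assoc] using h3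
    · obtain ⟨p, h1, h2, h3⟩ := ih (o + S.size) b k false
      refine ⟨p, by omega, by omega, ?_⟩
      simp only [show ¬ p < o + S.size by omega, h2, hh, if_true, if_false]
      simpa only [Nat.mul_add, Nat.add_assoc] using h3
  | @star_inner S _ _ _ _ ih =>
    intro o b k t'
    obtain ⟨p, h1, h2, h3⟩ := ih o b k false
    simp only [State.idx, size, nodeAt]
    exact ⟨p, h1, by omega, by simpa only [h2, if_true] using h3⟩

theorem LocalTrans.exists_trans (R : RegEx α) : ∀ (o b k : ℕ) (t' : Bool) (p : ℕ) (x : Option α)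
    (u v : ℕ), o ≤ p → p < o + R.size → LocalTrans (R.nodeAt o b k t' p) p x u v →
    ∃ s t : State R, u = 2 * o + s.idx ∧ v = 2 * o + t.idx ∧ Trans R s x t := by
  induction R with
  | char a =>
    intro o b k t' p x u v h1 h2 h
    simp only [size] at h2
    obtain rfl : p = o := by omega
    simp only [LocalTrans, nodeAt] at h
    obtain ⟨rfl, rfl, rfl⟩ := h
    exact ⟨_, _, by simp [State.idx, size], by simp [State.idx, size], .char a⟩
  | cat S T hS hT =>
    intro o b k t' p x u v h1 h2 h
    have e1 := S.one_le_size
    have e2 := T.one_le_size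
    simp only [size] at h2
    by_cases hr : p = o + S.size + T.size
    · rw [nodeAt_root _ _ _ _ _ _ (by simp only [size]; omega)] at h
      simp only [LocalTrans, TreeNode.leftNum, TreeNode.rightNum] at h
      obtain ⟨rfl, h | h | h⟩ := h
      · exact ⟨_, _, by simp only [State.idx, size]; omega, by simp only [State.idx]; omega,
          .cat_in S T⟩
      · exact ⟨_, _, by simp only [State.idx]; omega, by simp only [State.idx]; omega,
          .cat_mid S T⟩
      · exact ⟨_, _, by simp only [State.idx]; omega, by simp only [State.idx, size]; omega,
          .cat_out S T⟩
    simp only [nodeAt] at h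
    split_ifs at h
    · obtain ⟨s, t, a1, a2, a3⟩ := hS _ _ _ _ _ _ _ _ h1 (by omega) h
      exact ⟨_, _, a1, a2, .cat_left a3⟩
    · obtain ⟨s, t, a1, a2, a3⟩ := hS _ _ _ _ _ _ _ _ h1 (by omega) h
      exact ⟨_, _, a1, a2, .cat_left a3⟩
    · obtain ⟨s, t, a1, a2, a3⟩ := hT _ _ _ _ _ _ _ _ (by omega) (by omega) h
      exact ⟨_, _, by simp only [State.idx]; omega, by simp only [State.idx]; omega, .cat_right a3⟩
    · obtain ⟨s, t, a1, a2, a3⟩ := hT _ _ _ _ _ _ _ _ (by omega) (by omega) h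
      exact ⟨_, _, by simp only [State.idx]; omega, by simp only [State.idx]; omega, .cat_right a3⟩
    · omega
  | alt S T hS hT =>
    intro o b k t' p x u v h1 h2 h
    have e1 := S.one_le_size
    have e2 := T.one_le_size
    simp only [size] at h2
    by_cases hr : p = o + S.size + T.size
    · rw [nodeAt_root _ _ _ _ _ _ (by simp only [size]; omega)] at h
      simp only [LocalTrans, TreeNode.leftNum, TreeNode.rightNum] at h
      obtain ⟨rfl, h | h | h | h⟩ := h
      · exact ⟨_, _, by simp only [State.idx, size]; omega, by simp only [State.idx]; omega,
          .alt_inL S T⟩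
      · exact ⟨_, _, by simp only [State.idx, size]; omega, by simp only [State.idx]; omega,
          .alt_inR S T⟩
      · exact ⟨_, _, by simp only [State.idx]; omega, by simp only [State.idx, size]; omega,
          .alt_outL S T⟩
      · exact ⟨_, _, by simp only [State.idx]; omega, by simp only [State.idx, size]; omega,
          .alt_outR S T⟩
    simp only [nodeAt] at h
    split_ifs at h
    · obtain ⟨s, t, a1, a2, a3⟩ := hS _ _ _ _ _ _ _ _ h1 (by omega) h
      exact ⟨_, _, a1, a2, .alt_left a3⟩
    · obtain ⟨s, t, a1, a2, a3⟩ := hS _ _ _ _ _ _ _ _ h1 (by omega) h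
      exact ⟨_, _, a1, a2, .alt_left a3⟩
    · obtain ⟨s, t, a1, a2, a3⟩ := hT _ _ _ _ _ _ _ _ (by omega) (by omega) h
      exact ⟨_, _, by simp only [State.idx]; omega, by simp only [State.idx]; omega, .alt_right a3⟩
    · obtain ⟨s, t, a1, a2, a3⟩ := hT _ _ _ _ _ _ _ _ (by omega) (by omega) h
      exact ⟨_, _, by simp only [State.idx]; omega, by simp only [State.idx]; omega, .alt_right a3⟩
    · omega
  | star S hS =>
    intro o b k t' p x u v h1 h2 h
    have e1 := S.one_le_size
    simp only [size] at h2
    by_cases hr : p = o + S.size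
    · rw [nodeAt_root _ _ _ _ _ _ (by simp only [size]; omega)] at h
      simp only [LocalTrans, TreeNode.leftNum] at h
      obtain ⟨rfl, h | h | h | h⟩ := h
      · exact ⟨_, _, by simp only [State.idx, size]; omega, by simp only [State.idx]; omega,
          .star_in S⟩
      · exact ⟨_, _, by simp only [State.idx, size]; omega, by simp only [State.idx, size]; omega,
          .star_skip S⟩
      · exact ⟨_, _, by simp only [State.idx]; omega, by simp only [State.idx, size]; omega,
          .star_out S⟩
      · exact ⟨_, _, by simp only [State.idx]; omega, by simp only [State.idx]; omega,
          .star_back S⟩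
    simp only [nodeAt] at h
    rw [if_pos (by omega)] at h
    obtain ⟨s, t, a1, a2, a3⟩ := hS _ _ _ _ _ _ _ _ h1 (by omega) h
    exact ⟨_, _, a1, a2, .star_inner a3⟩

/-- Transitions between numbers of states. -/
def NumTrans (R : RegEx α) (x : Option α) (u v : ℕ) : Prop :=
  ∃ p < R.size, LocalTrans (R.node p) p x u v

theorem trans_iff {R : RegEx α} {s t : State R} {x : Option α} :
    Trans R s x t ↔ R.NumTrans x s.idx t.idx := by
  constructor
  · intro h
    obtain ⟨p, -, h2, h3⟩ := h.localTrans 0 0 0 true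
    exact ⟨p, by omega, by simpa [node] using h3⟩
  · rintro ⟨p, h1, h2⟩
    obtain ⟨s', t', e1, e2, h3⟩ :=
      LocalTrans.exists_trans R 0 0 0 true p x _ _ (Nat.zero_le _) (by omega) h2
    rw [State.idx_injective (show s.idx = s'.idx by omega),
      State.idx_injective (show t.idx = t'.idx by omega)]
    exact h3

theorem NumTrans.exists_state {R : RegEx α} {x : Option α} {u v : ℕ} (h : R.NumTrans x u v) :
    ∃ s t : State R, u = s.idx ∧ v = t.idx ∧ Trans R s x t := by
  obtain ⟨p, h1, h2⟩ := h
  obtain ⟨s', t', e1, e2, h3⟩ :=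
    LocalTrans.exists_trans R 0 0 0 true p x _ _ (Nat.zero_le _) (by omega) h2
  exact ⟨s', t', by omega, by omega, h3⟩

open Relation

/-- From here on closures are reachability in a graph on natural numbers, which is the form the
sweeps are compared with. -/
theorem mem_close_iff {R : RegEx α} {S : Set (State R)} {t : State R} :
    t ∈ R.close S ↔ ∃ s ∈ S, ReflTransGen (R.NumTrans none) s.idx t.idx := by
  constructor
  · intro h
    induction h with
    | base s hs => exact ⟨s, hs, .refl⟩
    | step s t h _ ih =>
      obtain ⟨s0, h0, h1⟩ := ih
      exact ⟨s0, h0, h1.tail (trans_iff.1 h)⟩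
  · rintro ⟨s, hs, h⟩
    obtain ⟨v, hv⟩ : ∃ v, v = t.idx := ⟨_, rfl⟩
    rw [← hv] at h
    induction h generalizing t with
    | refl => rw [← State.idx_injective hv]; exact εNFA.εClosure.base _ hs
    | tail _ h ih =>
      obtain ⟨s', t', e1, e2, h3⟩ := h.exists_state
      obtain rfl := State.idx_injective (e2.symm.trans hv)
      exact εNFA.εClosure.step _ _ h3 (ih e1)

variable (R : RegEx α)

/-- The children of a node for a concatenation or union. -/
theorem children {p : ℕ} (hp : p < R.size) {S T : RegEx α}
    (h : (R.node p).sub = cat S T ∨ (R.node p).sub = alt S T) :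
    (R.node (R.node p).leftNum).sub = S ∧ (R.node (R.node p).rightNum).sub = T ∧
    (R.node p).leftNum < p ∧ (R.node p).rightNum < p ∧
    (R.node p).leftNum ≠ (R.node p).rightNum ∧
    (T.size ≤ S.size → R.Heavy p (R.node p).leftNum ∧ R.Light p (R.node p).rightNum) ∧
    (¬ T.size ≤ S.size → R.Heavy p (R.node p).rightNum ∧ R.Light p (R.node p).leftNum) := by
  obtain ⟨h1, h2, h3, h4, h5, h6⟩ := node_children hp h
  have e1 := S.one_le_size
  have e2 := T.one_le_size
  refine ⟨?_, ?_, h5, h6, by omega, fun hh => ⟨⟨hp, ?_, ?_⟩, hp, ?_, ?_⟩,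
    fun hh => ⟨⟨hp, ?_, ?_⟩, hp, ?_, ?_⟩⟩
  · rw [h1, TreeNode.leftNode]; split_ifs <;> rfl
  · rw [h2, TreeNode.rightNode]; split_ifs <;> rfl
  all_goals
    rcases h with h | h <;>
      simp [TreeNode.HasHeavy, TreeNode.HasLight, TreeNode.heavyNum, TreeNode.lightNum,
        TreeNode.leftHeavy, h, hh]

theorem child_star {p : ℕ} (hp : p < R.size) {S : RegEx α} (h : (R.node p).sub = star S) :
    (R.node (R.node p).leftNum).sub = S ∧ (R.node p).leftNum < p ∧
    R.Heavy p (R.node p).leftNum := by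
  obtain ⟨h1, h2, h3⟩ := node_child_star hp h
  exact ⟨by rw [h1], h3, hp, by simp [TreeNode.HasHeavy, h],
    by simp [TreeNode.heavyNum, TreeNode.leftHeavy, h]⟩

/-- `x` is a child of `p`. -/
def Child (p x : ℕ) : Prop := R.Heavy p x ∨ R.Light p x

-- Of two parents along heavy edges, one would lie between `x` and the other on the same level. A
-- parent along a light edge is determined by its position, next to `x`. The two kinds exclude each
-- other because light children are tops of heavy paths and heavy ones are not.
variable {R} in
theorem Child.unique {p p' x : ℕ} (h : R.Child p x) (h' : R.Child p' x) : p = p' := by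
  have hL := R.heavyLayout
  have hh : ∀ {p p'}, R.Heavy p x → R.Heavy p' x → ¬ (R.node p).pos < (R.node p').pos := by
    intro p p' h h' hlt
    have := hL.heavy_between p' x p h' (hL.heavy_lt _ _ h).2 (hL.heavy_pos _ _ h) hlt
    have := hL.heavy_lev _ _ h
    have := hL.heavy_lev _ _ h'
    omega
  have ht : ∀ {p p'}, R.Heavy p x → ¬ R.Light p' x := by
    intro p p' h h'
    have e1 := (R.heavy_base h).2.2.2.1
    obtain ⟨S, T, -, ⟨h1, -, h2⟩ | ⟨h1, -, h2⟩⟩ := R.light_cases h'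
    · simp [h2, TreeNode.rightNode, h1] at e1
    · simp [h2, TreeNode.leftNode, show ¬ T.size ≤ S.size by omega] at e1
  rcases h with h | h <;> rcases h' with h' | h'
  · have h1 := hh h h'
    have h2 := hh h' h
    exact hL.pos_inj p (hL.heavy_lt _ _ h).2 p' (hL.heavy_lt _ _ h').2 (by omega)
  · exact absurd h' (ht h)
  · exact absurd h (ht h')
  · have h1 := hL.light_pos _ _ h
    have h2 := hL.light_pos _ _ h'
    exact hL.pos_inj p (hL.light_lt _ _ h).2 p' (hL.light_lt _ _ h').2 (by omega)

theorem child_left {p : ℕ} (hp : p < R.size) (h : ∀ a, (R.node p).sub ≠ char a) :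
    R.Child p (R.node p).leftNum := by
  rcases R.sub_cases p with ⟨a, ha⟩ | ⟨S, T, hST⟩ | ⟨S, hS⟩
  · exact absurd ha (h a)
  · have := R.children hp hST
    by_cases hh : T.size ≤ S.size
    · exact Or.inl (this.2.2.2.2.2.1 hh).1
    · exact Or.inr (this.2.2.2.2.2.2 hh).2
  · exact Or.inl (R.child_star hp hS).2.2

theorem child_right {p : ℕ} (hp : p < R.size) {S T : RegEx α}
    (h : (R.node p).sub = cat S T ∨ (R.node p).sub = alt S T) :
    R.Child p (R.node p).rightNum := by
  have := R.children hp h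
  by_cases hh : T.size ≤ S.size
  · exact Or.inr (this.2.2.2.2.2.1 hh).2
  · exact Or.inl (this.2.2.2.2.2.2 hh).1

/-- The connections used by the upward sweep. -/
def UpEdge : ℕ × Bool → ℕ × Bool → Prop :=
  HeavyLayout.SlotEdge R.size R.Heavy R.Light (fun p => (R.node p).sub.upHub = true)
    (fun p => (R.node p).sub.upGuard = true) (fun p => (R.node p).sub.upLightHub = true)
    (fun p => (R.node p).sub.upLight = true)

/-- The connections used, in reverse direction, by the downward sweep. -/
def DownEdge : ℕ × Bool → ℕ × Bool → Prop :=
  HeavyLayout.SlotEdge R.size R.Heavy R.Light (fun p => (R.node p).sub.downHub = true)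
    (fun p => (R.node p).sub.downGuard = true) (fun p => (R.node p).sub.downLightHub = true)
    (fun p => (R.node p).sub.downLight = true)

theorem heavy_eq {p h : ℕ} (hh : R.Heavy p h) :
    (∃ S T, ((R.node p).sub = cat S T ∨ (R.node p).sub = alt S T) ∧
    ((T.size ≤ S.size ∧ h = (R.node p).leftNum) ∨
      (¬ T.size ≤ S.size ∧ h = (R.node p).rightNum))) ∨
    (∃ S, (R.node p).sub = star S ∧ h = (R.node p).leftNum) := by
  rcases R.heavy_cases hh with ⟨S, T, h1, ⟨h2, h3, -⟩ | ⟨h2, h3, -⟩⟩ | ⟨S, h1, h2, -⟩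
  · exact Or.inl ⟨S, T, h1, Or.inl ⟨h2, h3⟩⟩
  · exact Or.inl ⟨S, T, h1, Or.inr ⟨by omega, h3⟩⟩
  · exact Or.inr ⟨S, h1, h2⟩

theorem light_eq {p l : ℕ} (hl : R.Light p l) : ∃ S T,
    ((R.node p).sub = cat S T ∨ (R.node p).sub = alt S T) ∧
    ((T.size ≤ S.size ∧ l = (R.node p).rightNum) ∨
      (¬ T.size ≤ S.size ∧ l = (R.node p).leftNum)) := by
  obtain ⟨S, T, h1, ⟨h2, h3, -⟩ | ⟨h2, h3, -⟩⟩ := R.light_cases hl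
  · exact ⟨S, T, h1, Or.inl ⟨h2, h3⟩⟩
  · exact ⟨S, T, h1, Or.inr ⟨by omega, h3⟩⟩

-- This removes the distinction between heavy and light children. Whichever child of a concatenation
-- is heavy, the same kinds of connections occur; only the detour of the left child through the hub
-- may be contracted.
variable {R} in
theorem UpEdge.cases {σ τ : ℕ × Bool} (h : R.UpEdge σ τ) : ∃ p < R.size,
    (∃ S T, (R.node p).sub = cat S T ∧ (σ = ((R.node p).leftNum, false) ∧ τ = (p, true) ∨
      σ = (p, true) ∧ τ = (p, false) ∧ T.null = true ∨
      σ = ((R.node p).leftNum, false) ∧ τ = (p, false) ∧ T.null = true ∨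
      σ = ((R.node p).rightNum, false) ∧ τ = (p, false))) ∨
    (∃ S T, (R.node p).sub = alt S T ∧ (σ = ((R.node p).leftNum, false) ∧ τ = (p, false) ∨
      σ = ((R.node p).rightNum, false) ∧ τ = (p, false))) ∨
    (∃ S, (R.node p).sub = star S ∧ (σ = ((R.node p).leftNum, false) ∧ τ = (p, true) ∨
      σ = (p, true) ∧ τ = (p, false))) := by
  cases h with
  | hub p h hh hc =>
    refine ⟨p, hh.1, ?_⟩
    rcases R.heavy_eq hh with ⟨S, T, h1, h2⟩ | ⟨S, h1, rfl⟩
    · rcases h1 with h1 | h1 <;> rcases h2 with ⟨h2, rfl⟩ | ⟨h2, rfl⟩ <;>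
        simp [h1, upHub, h2] at hc ⊢
    · simp [h1, upHub] at hc ⊢
  | out p hp hc hg =>
    refine ⟨p, hp, ?_⟩
    cases h1 : (R.node p).sub <;> simp [h1, upHub, upGuard] at hc hg ⊢ <;> simp_all
  | heavy p h hh hc =>
    refine ⟨p, hh.1, ?_⟩
    rcases R.heavy_eq hh with ⟨S, T, h1, h2⟩ | ⟨S, h1, rfl⟩
    · rcases h1 with h1 | h1 <;> rcases h2 with ⟨h2, rfl⟩ | ⟨h2, rfl⟩ <;>
        simp [h1, upHub, h2] at hc ⊢
    · simp [h1, upHub] at hc ⊢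
  | lightHub p l hl hc =>
    refine ⟨p, hl.1, ?_⟩
    rcases R.light_eq hl with ⟨S, T, h1 | h1, ⟨h2, rfl⟩ | ⟨h2, rfl⟩⟩ <;>
      simp [h1, upLightHub, h2] at hc ⊢
  | light p l hl hc =>
    refine ⟨p, hl.1, ?_⟩
    rcases R.light_eq hl with ⟨S, T, h1 | h1, ⟨h2, rfl⟩ | ⟨h2, rfl⟩⟩ <;>
      simp [h1, upLight, h2] at hc ⊢ <;> simp_all

variable {R} in
theorem DownEdge.cases {σ τ : ℕ × Bool} (h : R.DownEdge σ τ) : ∃ p < R.size,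
    (∃ S T, (R.node p).sub = cat S T ∧ (σ = ((R.node p).rightNum, false) ∧ τ = (p, true) ∨
      σ = (p, true) ∧ τ = (p, false) ∧ S.null = true ∨
      σ = ((R.node p).rightNum, false) ∧ τ = (p, false) ∧ S.null = true ∨
      σ = ((R.node p).leftNum, false) ∧ τ = (p, false))) ∨
    (∃ S T, (R.node p).sub = alt S T ∧ (σ = ((R.node p).leftNum, false) ∧ τ = (p, false) ∨
      σ = ((R.node p).rightNum, false) ∧ τ = (p, false))) ∨
    (∃ S, (R.node p).sub = star S ∧ (σ = ((R.node p).leftNum, false) ∧ τ = (p, true) ∨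
      σ = (p, true) ∧ τ = (p, false))) := by
  cases h with
  | hub p h hh hc =>
    refine ⟨p, hh.1, ?_⟩
    rcases R.heavy_eq hh with ⟨S, T, h1, h2⟩ | ⟨S, h1, rfl⟩
    · rcases h1 with h1 | h1 <;> rcases h2 with ⟨h2, rfl⟩ | ⟨h2, rfl⟩ <;>
        simp [h1, downHub, h2] at hc ⊢
    · simp [h1, downHub] at hc ⊢
  | out p hp hc hg =>
    refine ⟨p, hp, ?_⟩
    cases h1 : (R.node p).sub <;> simp [h1, downHub, downGuard] at hc hg ⊢ <;> simp_all
  | heavy p h hh hc =>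
    refine ⟨p, hh.1, ?_⟩
    rcases R.heavy_eq hh with ⟨S, T, h1, h2⟩ | ⟨S, h1, rfl⟩
    · rcases h1 with h1 | h1 <;> rcases h2 with ⟨h2, rfl⟩ | ⟨h2, rfl⟩ <;>
        simp [h1, downHub, h2] at hc ⊢
    · simp [h1, downHub] at hc ⊢
  | lightHub p l hl hc =>
    refine ⟨p, hl.1, ?_⟩
    rcases R.light_eq hl with ⟨S, T, h1 | h1, ⟨h2, rfl⟩ | ⟨h2, rfl⟩⟩ <;>
      simp [h1, downLightHub, h2] at hc ⊢
  | light p l hl hc =>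
    refine ⟨p, hl.1, ?_⟩
    rcases R.light_eq hl with ⟨S, T, h1 | h1, ⟨h2, rfl⟩ | ⟨h2, rfl⟩⟩ <;>
      simp [h1, downLight, h2] at hc ⊢ <;> simp_all

section closed

variable {R} {p : ℕ} (hp : p < R.size) {S T : RegEx α}
include hp

/-- This lemma and the following ones are the converse of the case distinctions: each logical
connection is available for both choices of the heavy child. -/
theorem up_cat_hub (h : (R.node p).sub = cat S T) :
    R.UpEdge ((R.node p).leftNum, false) (p, true) := by
  obtain ⟨-, -, -, -, -, h1, h2⟩ := R.children hp (Or.inl h)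
  by_cases hh : T.size ≤ S.size
  · exact .hub _ _ (h1 hh).1 (by simp [h, upHub, hh])
  · exact .lightHub _ _ (h2 hh).2 (by simp [h, upLightHub, hh])

/-- With a heavy left child the way leads through the hub, whose guard is absent because the right
factor is nullable; with a light one there is a direct connection. -/
theorem up_cat_left (h : (R.node p).sub = cat S T) (hT : T.null = true) :
    ReflTransGen R.UpEdge ((R.node p).leftNum, false) (p, false) := by
  obtain ⟨-, -, -, -, -, h1, h2⟩ := R.children hp (Or.inl h)
  by_cases hh : T.size ≤ S.size
  · exact .tail (.single (up_cat_hub hp h))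
      (.out _ hp (by simp [h, upHub, hh]) (by simp [h, upGuard, hT]))
  · exact .single (.light _ _ (h2 hh).2 (by simp [h, upLight, hT]))

theorem up_cat_right (h : (R.node p).sub = cat S T) :
    R.UpEdge ((R.node p).rightNum, false) (p, false) := by
  obtain ⟨-, -, -, -, -, h1, h2⟩ := R.children hp (Or.inl h)
  by_cases hh : T.size ≤ S.size
  · exact .light _ _ (h1 hh).2 (by simp [h, upLight, hh])
  · exact .heavy _ _ (h2 hh).1 (by simp [h, upHub, hh])

theorem up_alt_left (h : (R.node p).sub = alt S T) :
    R.UpEdge ((R.node p).leftNum, false) (p, false) := by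
  obtain ⟨-, -, -, -, -, h1, h2⟩ := R.children hp (Or.inr h)
  by_cases hh : T.size ≤ S.size
  · exact .heavy _ _ (h1 hh).1 (by simp [h, upHub])
  · exact .light _ _ (h2 hh).2 (by simp [h, upLight])

theorem up_alt_right (h : (R.node p).sub = alt S T) :
    R.UpEdge ((R.node p).rightNum, false) (p, false) := by
  obtain ⟨-, -, -, -, -, h1, h2⟩ := R.children hp (Or.inr h)
  by_cases hh : T.size ≤ S.size
  · exact .light _ _ (h1 hh).2 (by simp [h, upLight])
  · exact .heavy _ _ (h2 hh).1 (by simp [h, upHub])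

theorem up_star_hub (h : (R.node p).sub = star S) :
    R.UpEdge ((R.node p).leftNum, false) (p, true) :=
  .hub _ _ (R.child_star hp h).2.2 (by simp [h, upHub])

theorem up_star_out (h : (R.node p).sub = star S) : R.UpEdge (p, true) (p, false) :=
  .out _ hp (by simp [h, upHub]) (by simp [h, upGuard])

theorem down_cat_hub (h : (R.node p).sub = cat S T) :
    R.DownEdge ((R.node p).rightNum, false) (p, true) := by
  obtain ⟨-, -, -, -, -, h1, h2⟩ := R.children hp (Or.inl h)
  by_cases hh : T.size ≤ S.size
  · exact .lightHub _ _ (h1 hh).2 (by simp [h, downLightHub, hh])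
  · exact .hub _ _ (h2 hh).1 (by simp [h, downHub, hh])

theorem down_cat_right (h : (R.node p).sub = cat S T) (hS : S.null = true) :
    ReflTransGen R.DownEdge ((R.node p).rightNum, false) (p, false) := by
  obtain ⟨-, -, -, -, -, h1, h2⟩ := R.children hp (Or.inl h)
  by_cases hh : T.size ≤ S.size
  · exact .single (.light _ _ (h1 hh).2 (by simp [h, downLight, hS]))
  · exact .tail (.single (down_cat_hub hp h))
      (.out _ hp (by simp [h, downHub, hh]) (by simp [h, downGuard, hS]))

theorem down_cat_left (h : (R.node p).sub = cat S T) :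
    R.DownEdge ((R.node p).leftNum, false) (p, false) := by
  obtain ⟨-, -, -, -, -, h1, h2⟩ := R.children hp (Or.inl h)
  by_cases hh : T.size ≤ S.size
  · exact .heavy _ _ (h1 hh).1 (by simp [h, downHub, hh])
  · exact .light _ _ (h2 hh).2 (by simp [h, downLight, hh])

theorem down_alt_left (h : (R.node p).sub = alt S T) :
    R.DownEdge ((R.node p).leftNum, false) (p, false) := by
  obtain ⟨-, -, -, -, -, h1, h2⟩ := R.children hp (Or.inr h)
  by_cases hh : T.size ≤ S.size
  · exact .heavy _ _ (h1 hh).1 (by simp [h, downHub])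
  · exact .light _ _ (h2 hh).2 (by simp [h, downLight])

theorem down_alt_right (h : (R.node p).sub = alt S T) :
    R.DownEdge ((R.node p).rightNum, false) (p, false) := by
  obtain ⟨-, -, -, -, -, h1, h2⟩ := R.children hp (Or.inr h)
  by_cases hh : T.size ≤ S.size
  · exact .light _ _ (h1 hh).2 (by simp [h, downLight])
  · exact .heavy _ _ (h2 hh).1 (by simp [h, downHub])

theorem down_star_hub (h : (R.node p).sub = star S) :
    R.DownEdge ((R.node p).leftNum, false) (p, true) :=
  .hub _ _ (R.child_star hp h).2.2 (by simp [h, downHub])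

theorem down_star_out (h : (R.node p).sub = star S) : R.DownEdge (p, true) (p, false) :=
  .out _ hp (by simp [h, downHub]) (by simp [h, downGuard])

end closed

section closure

/-- The slots where the upward sweep starts. -/
def upSeeds (σ : Set ℕ) : Set (ℕ × Bool) :=
  {τ | τ.2 = false ∧ τ.1 < R.size ∧
    -- A path can leave a subtree from its start state only through its accepting state. For a given
    -- start state this way is anticipated here.
    (2 * τ.1 + 1 ∈ σ ∨ 2 * τ.1 ∈ σ ∧ (R.node τ.1).sub.null = true)}

/-- The result of the upward sweep. -/
def upSet (σ : Set ℕ) : Set (ℕ × Bool) :=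
  {τ | ∃ ρ ∈ R.upSeeds σ, ReflTransGen R.UpEdge ρ τ}

/-- The slots where the downward sweep starts. -/
def downSeeds (σ : Set ℕ) : Set (ℕ × Bool) :=
  -- The hubs reached on the way up are the turning points: the next state is the start of the right
  -- factor, or of the body of the star.
  {τ | τ.1 < R.size ∧ (τ.2 = false ∧ 2 * τ.1 ∈ σ ∨ τ.2 = true ∧ τ ∈ R.upSet σ)}

/-- The result of the downward sweep. -/
def downSet (σ : Set ℕ) : Set (ℕ × Bool) :=
  {τ | ∃ ρ ∈ R.downSeeds σ, ReflTransGen (flip R.DownEdge) ρ τ}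

/-- The numbers of the states reachable from those with numbers in `σ`. -/
def closeNum (σ : Set ℕ) : Set ℕ := {v | ∃ u ∈ σ, ReflTransGen (R.NumTrans none) u v}

variable {R} {σ : Set ℕ}

theorem closeNum_step {u v : ℕ} (h : R.NumTrans none u v) (hu : u ∈ R.closeNum σ) :
    v ∈ R.closeNum σ := by
  obtain ⟨t, ht, h'⟩ := hu
  exact ⟨t, ht, h'.tail h⟩

theorem upSet_step {ρ τ : ℕ × Bool} (h : R.UpEdge ρ τ) (hu : ρ ∈ R.upSet σ) : τ ∈ R.upSet σ := by
  obtain ⟨t, ht, h'⟩ := hu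
  exact ⟨t, ht, h'.tail h⟩

theorem upSet_steps {ρ τ : ℕ × Bool} (h : ReflTransGen R.UpEdge ρ τ) (hu : ρ ∈ R.upSet σ) :
    τ ∈ R.upSet σ := by
  obtain ⟨t, ht, h'⟩ := hu
  exact ⟨t, ht, h'.trans h⟩

theorem downSet_step {ρ τ : ℕ × Bool} (h : R.DownEdge τ ρ) (hu : ρ ∈ R.downSet σ) :
    τ ∈ R.downSet σ := by
  obtain ⟨t, ht, h'⟩ := hu
  exact ⟨t, ht, h'.tail h⟩

theorem downSet_steps {ρ τ : ℕ × Bool} (h : ReflTransGen R.DownEdge τ ρ) (hu : ρ ∈ R.downSet σ) :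
    τ ∈ R.downSet σ := by
  obtain ⟨t, ht, h'⟩ := hu
  exact ⟨t, ht, h'.trans (reflTransGen_swap.2 h)⟩

/-- Reachability of the accepting state from the start state of a node. -/
theorem reachable_of_null (p : ℕ) (hp : p < R.size) (h : (R.node p).sub.null = true) :
    ReflTransGen (R.NumTrans none) (2 * p) (2 * p + 1) := by
  induction p using Nat.strong_induction_on with
  | _ p ih =>
  have hstep : ∀ u v, LocalTrans (R.node p) p none u v → R.NumTrans none u v :=
    fun u v h => ⟨p, hp, h⟩
  cases hs : (R.node p).sub with
  | char a => simp [hs, null] at h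
  | cat S T =>
    obtain ⟨e1, e2, e3, e4, -⟩ := R.children hp (Or.inl hs)
    simp only [hs, null, Bool.and_eq_true] at h
    simp only [LocalTrans, hs] at hstep
    refine .head (hstep _ (2 * (R.node p).leftNum) (by simp)) (.trans (ih _ e3 (by omega) ?_) ?_)
    · rw [e1]; exact h.1
    refine .head (hstep _ (2 * (R.node p).rightNum) (by simp)) (.trans (ih _ e4 (by omega) ?_) ?_)
    · rw [e2]; exact h.2
    exact .single (hstep _ _ (by simp))
  | alt S T =>
    obtain ⟨e1, e2, e3, e4, -⟩ := R.children hp (Or.inr hs)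
    simp only [hs, null, Bool.or_eq_true] at h
    simp only [LocalTrans, hs] at hstep
    rcases h with h | h
    · refine .head (hstep _ (2 * (R.node p).leftNum) (by simp)) (.trans (ih _ e3 (by omega) ?_) ?_)
      · rw [e1]; exact h
      exact .single (hstep _ _ (by simp))
    · refine .head (hstep _ (2 * (R.node p).rightNum) (by simp)) (.trans (ih _ e4 (by omega) ?_) ?_)
      · rw [e2]; exact h
      exact .single (hstep _ _ (by simp))
  | star S =>
    simp only [LocalTrans, hs] at hstep
    exact .single (hstep _ _ (by simp))

/-- A hub stands for the accepting state of the left or only child. It is recorded in addition that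
the end slot of this child was reached, since the closure proof has to go back from the hub to the
child. -/
theorem upSet_sound {τ : ℕ × Bool} (h : τ ∈ R.upSet σ) :
    if τ.2 then ((R.node τ.1).leftNum, false) ∈ R.upSet σ ∧
      2 * (R.node τ.1).leftNum + 1 ∈ R.closeNum σ
    else 2 * τ.1 + 1 ∈ R.closeNum σ := by
  obtain ⟨ρ, hρ, h⟩ := h
  have hA : ∀ {τ}, ReflTransGen R.UpEdge ρ τ → τ ∈ R.upSet σ := fun h => ⟨ρ, hρ, h⟩
  induction h with
  | refl =>
    obtain ⟨x, b⟩ := ρ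
    obtain ⟨h1, h2, h3⟩ := hρ
    simp only at h1 h2 h3
    subst h1
    rcases h3 with h3 | ⟨h3, h4⟩
    · exact ⟨_, h3, .refl⟩
    · exact ⟨_, h3, reachable_of_null x h2 h4⟩
  | @tail τ τ' h1 h2 ih =>
    have hτ := hA h1
    obtain ⟨p, hp, ⟨S, T, hs, h⟩ | ⟨S, T, hs, h⟩ | ⟨S, hs, h⟩⟩ := h2.cases
    · have hstep : ∀ u v, LocalTrans (R.node p) p none u v → R.NumTrans none u v :=
        fun u v h => ⟨p, hp, h⟩
      simp only [LocalTrans, hs] at hstep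
      -- The contracted step across a nullable right factor is expanded into a path of the
      -- automaton.
      have hnull : T.null = true → 2 * (R.node p).leftNum + 1 ∈ R.closeNum σ →
          2 * p + 1 ∈ R.closeNum σ := by
        intro hT hu
        obtain ⟨-, e2, -, e4, -⟩ := R.children hp (Or.inl hs)
        have h1 := closeNum_step (hstep _ (2 * (R.node p).rightNum) (by simp)) hu
        obtain ⟨t, ht, h1⟩ := h1
        have h2 := h1.trans (reachable_of_null (R.node p).rightNum (by omega) (by rwa [e2]))
        exact ⟨t, ht, h2.tail (hstep _ _ (by simp))⟩
      rcases h with ⟨rfl, rfl⟩ | ⟨rfl, rfl, hT⟩ | ⟨rfl, rfl, hT⟩ | ⟨rfl, rfl⟩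
      · exact ⟨hτ, ih⟩
      · exact hnull hT ih.2
      · exact hnull hT ih
      · exact closeNum_step (hstep _ _ (by simp)) ih
    · have hstep : ∀ u v, LocalTrans (R.node p) p none u v → R.NumTrans none u v :=
        fun u v h => ⟨p, hp, h⟩
      simp only [LocalTrans, hs] at hstep
      rcases h with ⟨rfl, rfl⟩ | ⟨rfl, rfl⟩
      · exact closeNum_step (hstep _ _ (by simp)) ih
      · exact closeNum_step (hstep _ _ (by simp)) ih
    · have hstep : ∀ u v, LocalTrans (R.node p) p none u v → R.NumTrans none u v :=
        fun u v h => ⟨p, hp, h⟩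
      simp only [LocalTrans, hs] at hstep
      rcases h with ⟨rfl, rfl⟩ | ⟨rfl, rfl⟩
      · exact ⟨hτ, ih⟩
      · exact closeNum_step (hstep _ _ (by simp)) ih.2

/-- The state from which the right child, or the only child, is entered through the hub. -/
theorem downSet_sound {τ : ℕ × Bool} (h : τ ∈ R.downSet σ) :
    if τ.2 then ∀ v, (∃ S T, (R.node τ.1).sub = cat S T ∧ v = 2 * (R.node τ.1).rightNum) ∨
        (∃ S, (R.node τ.1).sub = star S ∧ v = 2 * (R.node τ.1).leftNum) → v ∈ R.closeNum σ
    else 2 * τ.1 ∈ R.closeNum σ := by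
  obtain ⟨ρ, hρ, h⟩ := h
  induction h with
  | refl =>
    obtain ⟨x, b⟩ := ρ
    obtain ⟨h1, ⟨h2, h3⟩ | ⟨h2, h3⟩⟩ := hρ
    · simp only at h2 h3
      subst h2
      exact ⟨_, h3, .refl⟩
    · simp only at h1 h2 h3
      subst h2
      have := (upSet_sound h3).2
      simp only at this ⊢
      rintro v (⟨S, T, hs, rfl⟩ | ⟨S, hs, rfl⟩)
      · exact closeNum_step ⟨x, h1, by simp [LocalTrans, hs]⟩ this
      · exact closeNum_step ⟨x, h1, by simp [LocalTrans, hs]⟩ this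
  | @tail τ τ' h1 h2 ih =>
    obtain ⟨p, hp, ⟨S, T, hs, h⟩ | ⟨S, T, hs, h⟩ | ⟨S, hs, h⟩⟩ := DownEdge.cases h2
    · have hstep : ∀ u v, LocalTrans (R.node p) p none u v → R.NumTrans none u v :=
        fun u v h => ⟨p, hp, h⟩
      simp only [LocalTrans, hs] at hstep
      have hnull : S.null = true → 2 * p ∈ R.closeNum σ →
          2 * (R.node p).rightNum ∈ R.closeNum σ := by
        intro hS hu
        obtain ⟨e1, -, e3, -⟩ := R.children hp (Or.inl hs)
        have h1 := closeNum_step (hstep _ (2 * (R.node p).leftNum) (by simp)) hu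
        obtain ⟨t, ht, h1⟩ := h1
        have h2 := h1.trans (reachable_of_null (R.node p).leftNum (by omega) (by rwa [e1]))
        exact ⟨t, ht, h2.tail (hstep _ _ (by simp))⟩
      rcases h with ⟨rfl, rfl⟩ | ⟨rfl, rfl, hS⟩ | ⟨rfl, rfl, hS⟩ | ⟨rfl, rfl⟩
      · exact ih _ (Or.inl ⟨S, T, hs, rfl⟩)
      -- A hub reached from the start slot of its own node: the left factor is crossed by
      -- nullability.
      · rintro v (⟨S', T', -, rfl⟩ | ⟨S', hs', -⟩)
        · exact hnull hS ih
        · simp [hs] at hs'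
      · exact hnull hS ih
      · exact closeNum_step (hstep _ _ (by simp)) ih
    · have hstep : ∀ u v, LocalTrans (R.node p) p none u v → R.NumTrans none u v :=
        fun u v h => ⟨p, hp, h⟩
      simp only [LocalTrans, hs] at hstep
      rcases h with ⟨rfl, rfl⟩ | ⟨rfl, rfl⟩
      · exact closeNum_step (hstep _ _ (by simp)) ih
      · exact closeNum_step (hstep _ _ (by simp)) ih
    · have hstep : ∀ u v, LocalTrans (R.node p) p none u v → R.NumTrans none u v :=
        fun u v h => ⟨p, hp, h⟩
      simp only [LocalTrans, hs] at hstep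
      rcases h with ⟨rfl, rfl⟩ | ⟨rfl, rfl⟩
      · exact ih _ (Or.inr ⟨S, hs, rfl⟩)
      · rintro v (⟨S', T', hs', -⟩ | ⟨S', -, rfl⟩)
        · simp [hs] at hs'
        · exact closeNum_step (hstep _ _ (by simp)) ih

/-- How the downward sweep gets to a hub. -/
theorem hub_mem_downSet {p : ℕ} (h : (p, true) ∈ R.downSet σ) : (p, true) ∈ R.upSet σ ∨
    (p, false) ∈ R.downSet σ ∧ ((∃ S T, (R.node p).sub = cat S T ∧ S.null = true) ∨
      ∃ S, (R.node p).sub = star S) := by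
  obtain ⟨ρ, hρ, h⟩ := h
  rcases ReflTransGen.cases_tail h with h | ⟨τ, h1, h2⟩
  · subst h
    obtain ⟨-, ⟨h2, -⟩ | ⟨-, h3⟩⟩ := hρ
    · simp at h2
    · exact Or.inl h3
  · right
    obtain ⟨q, hq, ⟨S, T, hs, h⟩ | ⟨S, T, hs, h⟩ | ⟨S, hs, h⟩⟩ := DownEdge.cases h2 <;>
      simp only [Prod.mk.injEq, Bool.true_eq_false, and_false, false_and, and_true, false_or,
        or_false] at h
    · obtain ⟨rfl, rfl, h⟩ := h
      exact ⟨⟨ρ, hρ, h1⟩, Or.inl ⟨S, T, hs, h⟩⟩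
    · obtain ⟨rfl, rfl⟩ := h
      exact ⟨⟨ρ, hρ, h1⟩, Or.inr ⟨S, hs⟩⟩

/-- How the downward sweep gets to a start state. -/
theorem start_mem_downSet {x : ℕ} (h : (x, false) ∈ R.downSet σ) : 
    (x < R.size ∧ 2 * x ∈ σ) ∨ ∃ p < R.size, R.Child p x ∧
      ((∃ S T, (R.node p).sub = cat S T ∧ (x = (R.node p).leftNum ∧ (p, false) ∈ R.downSet σ ∨
        x = (R.node p).rightNum ∧ (p, true) ∈ R.downSet σ ∨
        x = (R.node p).rightNum ∧ S.null = true ∧ (p, false) ∈ R.downSet σ)) ∨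
      (∃ S T, (R.node p).sub = alt S T ∧ (p, false) ∈ R.downSet σ) ∨
      (∃ S, (R.node p).sub = star S ∧ (p, true) ∈ R.downSet σ)) := by
  obtain ⟨ρ, hρ, h⟩ := h
  rcases ReflTransGen.cases_tail h with h | ⟨τ, h1, h2⟩
  · subst h
    obtain ⟨h1, ⟨h2, h3⟩ | ⟨h2, h3⟩⟩ := hρ
    · exact Or.inl ⟨h1, h3⟩
    · simp at h2
  · right
    have hτ : τ ∈ R.downSet σ := ⟨ρ, hρ, h1⟩
    obtain ⟨q, hq, ⟨S, T, hs, h⟩ | ⟨S, T, hs, h⟩ | ⟨S, hs, h⟩⟩ := DownEdge.cases h2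
    · have hl := R.child_left hq (by simp [hs])
      have hr := R.child_right hq (Or.inl hs)
      rcases h with ⟨h, rfl⟩ | ⟨h, rfl, hS⟩ | ⟨h, rfl, hS⟩ | ⟨h, rfl⟩ <;>
        simp only [Prod.mk.injEq, and_true, Bool.false_eq_true, and_false] at h
      · exact ⟨q, hq, h ▸ hr, Or.inl ⟨S, T, hs, Or.inr (Or.inl ⟨h, hτ⟩)⟩⟩
      · exact ⟨q, hq, h ▸ hr, Or.inl ⟨S, T, hs, Or.inr (Or.inr ⟨h, hS, hτ⟩)⟩⟩
      · exact ⟨q, hq, h ▸ hl, Or.inl ⟨S, T, hs, Or.inl ⟨h, hτ⟩⟩⟩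
    · have hl := R.child_left hq (by simp [hs])
      have hr := R.child_right hq (Or.inr hs)
      rcases h with ⟨h, rfl⟩ | ⟨h, rfl⟩ <;> simp only [Prod.mk.injEq, and_true] at h
      · exact ⟨q, hq, h ▸ hl, Or.inr (Or.inl ⟨S, T, hs, hτ⟩)⟩
      · exact ⟨q, hq, h ▸ hr, Or.inr (Or.inl ⟨S, T, hs, hτ⟩)⟩
    · have hl := R.child_left hq (by simp [hs])
      rcases h with ⟨h, rfl⟩ | ⟨h, rfl⟩ <;>
        simp only [Prod.mk.injEq, and_true, Bool.false_eq_true, and_false] at h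
      exact ⟨q, hq, h ▸ hl, Or.inr (Or.inr ⟨S, hs, hτ⟩)⟩

/-- The numbers of the states found by the two sweeps. -/
def sweepSet (R : RegEx α) (σ : Set ℕ) : Set ℕ :=
  {v | ∃ x < R.size, v = 2 * x ∧ (x, false) ∈ R.downSet σ ∨
    v = 2 * x + 1 ∧ ((x, false) ∈ R.upSet σ ∨
      (x, false) ∈ R.downSet σ ∧ (R.node x).sub.null = true)}

theorem start_mem_sweepSet {x : ℕ} (hx : x < R.size) :
    2 * x ∈ R.sweepSet σ ↔ (x, false) ∈ R.downSet σ := by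
  constructor
  · rintro ⟨y, hy, ⟨h1, h2⟩ | ⟨h1, h2⟩⟩
    · obtain rfl : x = y := by omega
      exact h2
    · omega
  · exact fun h => ⟨x, hx, Or.inl ⟨rfl, h⟩⟩

theorem accept_mem_sweepSet {x : ℕ} (hx : x < R.size) :
    2 * x + 1 ∈ R.sweepSet σ ↔ (x, false) ∈ R.upSet σ ∨
      (x, false) ∈ R.downSet σ ∧ (R.node x).sub.null = true := by
  constructor
  · rintro ⟨y, hy, ⟨h1, h2⟩ | ⟨h1, h2⟩⟩
    · omega
    · obtain rfl : x = y := by omega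
      exact h2
  · exact fun h => ⟨x, hx, Or.inr ⟨rfl, h⟩⟩

theorem upSeeds_subset : R.upSeeds σ ⊆ R.upSet σ := fun ρ h => ⟨ρ, h, .refl⟩

theorem downSeeds_subset : R.downSeeds σ ⊆ R.downSet σ := fun ρ h => ⟨ρ, h, .refl⟩

/-- The delicate transitions leave an accepting state that was found only because its node is
nullable and its start state was reached downwards. One then looks at how the downward sweep came to
this start state. If it was given initially, the node is a seed of the upward sweep; if it was
entered from the parent or its hub, the situation of the parent provides the target. -/
theorem sweepSet_step {u v : ℕ} (h : R.NumTrans none u v) (hu : u ∈ R.sweepSet σ) :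
    v ∈ R.sweepSet σ := by
  obtain ⟨p, hp, h⟩ := h
  -- the case of a start state which was there from the beginning
  have hseed : ∀ {x}, x < R.size → 2 * x ∈ σ → (R.node x).sub.null = true →
      (x, false) ∈ R.upSet σ := fun h1 h2 h3 => upSeeds_subset ⟨rfl, h1, Or.inr ⟨h2, h3⟩⟩
  have hhub : ∀ {x}, x < R.size → (x, true) ∈ R.upSet σ → (x, true) ∈ R.downSet σ :=
    fun h1 h2 => downSeeds_subset ⟨h1, Or.inr ⟨rfl, h2⟩⟩
  cases hs : (R.node p).sub with
  | char a => simp [LocalTrans, hs] at h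
  | cat S T =>
    simp only [LocalTrans, hs, true_and] at h
    obtain ⟨e1, e2, e3, e4, e5, -⟩ := R.children hp (Or.inl hs)
    have hl : (R.node p).leftNum < R.size := by omega
    have hr : (R.node p).rightNum < R.size := by omega
    rcases h with ⟨rfl, rfl⟩ | ⟨rfl, rfl⟩ | ⟨rfl, rfl⟩
    · rw [start_mem_sweepSet hp] at hu
      rw [start_mem_sweepSet hl]
      exact downSet_step (down_cat_left hp hs) hu
    · rw [accept_mem_sweepSet hl, e1] at hu
      rw [start_mem_sweepSet hr]
      have hup : ((R.node p).leftNum, false) ∈ R.upSet σ →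
          ((R.node p).rightNum, false) ∈ R.downSet σ := fun h =>
        downSet_step (down_cat_hub hp hs) (hhub hp (upSet_step (up_cat_hub hp hs) h))
      rcases hu with h | ⟨h, hS⟩
      · exact hup h
      -- The left factor is nullable and was entered at its start. Unless it was there initially, it
      -- was entered from the start of the concatenation, from which the downward sweep also reaches
      -- the right factor.
      · rcases start_mem_downSet h with ⟨h1, h2⟩ | ⟨q, hq, hc, h3⟩
        · exact hup (hseed hl h2 (by rwa [e1]))
        · obtain rfl := hc.unique (R.child_left hp (by simp [hs]))
          have : (q, false) ∈ R.downSet σ := by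
            rcases h3 with ⟨S', T', hs', h | h | h⟩ | ⟨S', T', hs', h⟩ | ⟨S', hs', h⟩
            · exact h.2
            · exact absurd h.1 e5
            · exact absurd h.1 e5
            · exact h
            · simp [hs] at hs'
          exact downSet_steps (down_cat_right hp hs hS) this
    · rw [accept_mem_sweepSet hr, e2] at hu
      rw [accept_mem_sweepSet hp]
      rcases hu with h | ⟨h, hT⟩
      · exact Or.inl (upSet_step (up_cat_right hp hs) h)
      · rcases start_mem_downSet h with ⟨h1, h2⟩ | ⟨q, hq, hc, h3⟩
        · exact Or.inl (upSet_step (up_cat_right hp hs) (hseed hr h2 (by rwa [e2])))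
        · obtain rfl := hc.unique (R.child_right hp (Or.inl hs))
          rcases h3 with ⟨S', T', hs', h | h | h⟩ | ⟨S', T', hs', h⟩ | ⟨S', hs', h⟩
          · exact absurd h.1.symm e5
          -- The right factor was entered through the hub. If the hub was reached upwards, the
          -- upward sweep crosses the nullable right factor. If it was reached downwards, both
          -- factors are nullable and so is the whole concatenation.
          · rcases hub_mem_downSet h.2 with h | ⟨h, ⟨S'', T'', h1, h2⟩ | ⟨S'', h1⟩⟩
            · exact Or.inl (upSet_steps (up_cat_left hp hs hT) (upSet_sound h).1)
            · rw [hs] at h1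
              obtain ⟨rfl, rfl⟩ := by simpa using h1
              exact Or.inr ⟨h, by simp [hs, null, h2, hT]⟩
            · simp [hs] at h1
          · rw [hs] at hs'
            obtain ⟨rfl, rfl⟩ := by simpa using hs'
            exact Or.inr ⟨h.2.2, by simp [hs, null, h.2.1, hT]⟩
          · simp [hs] at hs'
          · simp [hs] at hs'
  | alt S T =>
    simp only [LocalTrans, hs, true_and] at h
    obtain ⟨e1, e2, e3, e4, e5, -⟩ := R.children hp (Or.inr hs)
    have hl : (R.node p).leftNum < R.size := by omega
    have hr : (R.node p).rightNum < R.size := by omega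
    have hpar : ∀ {x}, R.Child p x → (x, false) ∈ R.downSet σ → 2 * x ∈ σ ∨
        (p, false) ∈ R.downSet σ := by
      intro x hx h
      rcases start_mem_downSet h with ⟨h1, h2⟩ | ⟨q, hq, hc, h3⟩
      · exact Or.inl h2
      · right
        obtain rfl := hc.unique hx
        rcases h3 with ⟨S', T', hs', h⟩ | ⟨S', T', hs', h⟩ | ⟨S', hs', h⟩
        · simp [hs] at hs'
        · exact h
        · simp [hs] at hs'
    rcases h with ⟨rfl, rfl⟩ | ⟨rfl, rfl⟩ | ⟨rfl, rfl⟩ | ⟨rfl, rfl⟩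
    · rw [start_mem_sweepSet hp] at hu
      rw [start_mem_sweepSet hl]
      exact downSet_step (down_alt_left hp hs) hu
    · rw [start_mem_sweepSet hp] at hu
      rw [start_mem_sweepSet hr]
      exact downSet_step (down_alt_right hp hs) hu
    · rw [accept_mem_sweepSet hl, e1] at hu
      rw [accept_mem_sweepSet hp]
      rcases hu with h | ⟨h, hS⟩
      · exact Or.inl (upSet_step (up_alt_left hp hs) h)
      · rcases hpar (R.child_left hp (by simp [hs])) h with h | h
        · exact Or.inl (upSet_step (up_alt_left hp hs) (hseed hl h (by rwa [e1])))
        · exact Or.inr ⟨h, by simp [hs, null, hS]⟩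
    · rw [accept_mem_sweepSet hr, e2] at hu
      rw [accept_mem_sweepSet hp]
      rcases hu with h | ⟨h, hS⟩
      · exact Or.inl (upSet_step (up_alt_right hp hs) h)
      · rcases hpar (R.child_right hp (Or.inr hs)) h with h | h
        · exact Or.inl (upSet_step (up_alt_right hp hs) (hseed hr h (by rwa [e2])))
        · exact Or.inr ⟨h, by simp [hs, null, hS]⟩
  | star S =>
    simp only [LocalTrans, hs, true_and] at h
    obtain ⟨e1, e3, -⟩ := R.child_star hp hs
    have hl : (R.node p).leftNum < R.size := by omega
    have hn : (R.node p).sub.null = true := by simp [hs, null]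
    -- Both transitions out of the accepting state of the body start from the same alternative: it
    -- was reached upwards, or the star was entered at its start.
    have hacc : 2 * (R.node p).leftNum + 1 ∈ R.sweepSet σ → 
        ((R.node p).leftNum, false) ∈ R.upSet σ ∨ (p, false) ∈ R.downSet σ := by
      rw [accept_mem_sweepSet hl, e1]
      rintro (h | ⟨h, hS⟩)
      · exact Or.inl h
      · rcases start_mem_downSet h with ⟨h1, h2⟩ | ⟨q, hq, hc, h3⟩
        · exact Or.inl (hseed hl h2 (by rwa [e1]))
        · obtain rfl := hc.unique (R.child_left hp (by simp [hs]))
          rcases h3 with ⟨S', T', hs', h⟩ | ⟨S', T', hs', h⟩ | ⟨S', hs', h⟩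
          · simp [hs] at hs'
          · simp [hs] at hs'
          · rcases hub_mem_downSet h with h | ⟨h, -⟩
            · exact Or.inl (upSet_sound h).1
            · exact Or.inr h
    have hin : (p, false) ∈ R.downSet σ → ((R.node p).leftNum, false) ∈ R.downSet σ := fun h =>
      downSet_step (down_star_hub hp hs) (downSet_step (down_star_out hp hs) h)
    rcases h with ⟨rfl, rfl⟩ | ⟨rfl, rfl⟩ | ⟨rfl, rfl⟩ | ⟨rfl, rfl⟩
    · rw [start_mem_sweepSet hp] at hu
      rw [start_mem_sweepSet hl]
      exact hin hu
    · rw [start_mem_sweepSet hp] at hu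
      rw [accept_mem_sweepSet hp]
      exact Or.inr ⟨hu, hn⟩
    · rw [accept_mem_sweepSet hp]
      rcases hacc hu with h | h
      · exact Or.inl (upSet_step (up_star_out hp hs) (upSet_step (up_star_hub hp hs) h))
      · exact Or.inr ⟨h, hn⟩
    · rw [start_mem_sweepSet hl]
      rcases hacc hu with h | h
      · exact downSet_step (down_star_hub hp hs) (hhub hp (upSet_step (up_star_hub hp hs) h))
      · exact hin h

/-- Soundness comes from the two sweeps separately; for the other inclusion the found set contains
`σ` and is closed under transitions. The bound on `σ` ensures that its members are numbers of
states. -/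
theorem sweepSet_eq (hσ : ∀ u ∈ σ, u < 2 * R.size) : R.sweepSet σ = R.closeNum σ := by
  apply Set.Subset.antisymm
  · rintro v ⟨x, hx, ⟨rfl, h⟩ | ⟨rfl, h | ⟨h, hn⟩⟩⟩
    · exact downSet_sound h
    · exact upSet_sound h
    · obtain ⟨u, hu, h⟩ := (downSet_sound h : 2 * x ∈ R.closeNum σ)
      exact ⟨u, hu, h.trans (reachable_of_null x hx hn)⟩
  · rintro v ⟨u, hu, h⟩
    induction h with
    | refl =>
      have h1 := hσ u hu
      have hx : u / 2 < R.size := by omega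
      rcases Nat.even_or_odd' u with ⟨x, rfl | rfl⟩
      · rw [start_mem_sweepSet (by omega)]
        exact downSeeds_subset ⟨by simp only; omega, Or.inl ⟨rfl, hu⟩⟩
      · rw [accept_mem_sweepSet (by omega)]
        exact Or.inl (upSeeds_subset ⟨rfl, by simp only; omega, Or.inl hu⟩)
    | tail _ h ih => exact sweepSet_step h ih

end closure

end RegEx


/-! ### Bit vectors of several words -/

namespace BitSet

/-- The digits `f 0, …, f (k - 1)` of `U` bits represent the set `A`. -/
def Digits (U k : ℕ) (f : ℕ → ℕ) (A : Set ℕ) : Prop :=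
  ∀ j < k, ∀ i, (f j).testBit i = true ↔ i < U ∧ U * j + i ∈ A

theorem Digits.lt {U k : ℕ} {f : ℕ → ℕ} {A : Set ℕ} (h : Digits U k f A) {j : ℕ} (hj : j < k) :
    f j < 2 ^ U := by
  apply Nat.lt_pow_two_of_testBit
  intro i hi
  have := h j hj i
  cases hb : (f j).testBit i
  · rfl
  · have := (this.1 hb).1
    omega

theorem Digits.congr {U k : ℕ} {f g : ℕ → ℕ} {A B : Set ℕ} (h : Digits U k f A)
    (hf : ∀ j < k, g j = f j) (hA : ∀ p < U * k, p ∈ A ↔ p ∈ B) : Digits U k g B := by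
  intro j hj i
  rw [hf j hj, h j hj i]
  refine and_congr_right fun hi => hA _ ?_
  calc U * j + i < U * j + U := by omega
    _ = U * (j + 1) := by ring
    _ ≤ U * k := Nat.mul_le_mul_left _ hj

/-- The borrow into each position when `X` is subtracted from `G`. -/
def Borrow (G X : Set ℕ) : ℕ → Prop
  | 0 => False
  | p + 1 => p ∉ G ∧ (p ∈ X ∨ Borrow G X p)

/-- A borrow is created at an element of `X` and survives as long as the minuend has zeros. This is
what lets a subtraction propagate information up to the next guard. -/
theorem borrow_iff {G X : Set ℕ} (p : ℕ) :
    Borrow G X p ↔ ∃ x ∈ X, x < p ∧ ∀ g, x ≤ g → g < p → g ∉ G := by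
  induction p with
  | zero => simp [Borrow]
  | succ p ih =>
    rw [Borrow, ih]
    constructor
    · rintro ⟨h1, h2 | ⟨x, h2, h3, h4⟩⟩
      · refine ⟨p, h2, by omega, fun g hg1 hg2 => ?_⟩
        obtain rfl : g = p := by omega
        exact h1
      · refine ⟨x, h2, by omega, fun g hg1 hg2 => ?_⟩
        rcases Nat.lt_succ_iff_lt_or_eq.1 hg2 with h | rfl
        · exact h4 g hg1 h
        · exact h1
    · rintro ⟨x, h2, h3, h4⟩
      refine ⟨h4 p (by omega) (by omega), ?_⟩
      rcases Nat.lt_succ_iff_lt_or_eq.1 h3 with h | rfl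
      · exact Or.inr ⟨x, h2, h, fun g hg1 hg2 => h4 g hg1 (by omega)⟩
      · exact Or.inl h2

/-- Where the guard bit is `0`, the difference bit is `1` if exactly one of subtrahend bit and
incoming borrow is present; joining the subtrahend bit covers the case of both. The summand `2 ^ U`
is a reserve that is consumed precisely when a borrow leaves the digit. -/
theorem borrow_digit (U : ℕ) : ∀ (g x b : ℕ) (br : ℕ → Prop), g < 2 ^ U → x < 2 ^ U →
    (∀ i, g.testBit i = true → x.testBit i = false) → b ≤ 1 → (br 0 ↔ b = 1) →
    (∀ i, i < U → (br (i + 1) ↔ g.testBit i = false ∧ (x.testBit i = true ∨ br i))) →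
    (∀ i < U, g.testBit i = false →
      (((g + 2 ^ U - x - b).testBit i = true ∨ x.testBit i = true) ↔
        (x.testBit i = true ∨ br i))) ∧
    (br U → (g + 2 ^ U - x - b) / 2 ^ U = 0) ∧ (¬ br U → (g + 2 ^ U - x - b) / 2 ^ U = 1) := by
  induction U with
  | zero =>
    intro g x b br hg hx _ hb h0 _
    obtain rfl : g = 0 := by simpa using hg
    obtain rfl : x = 0 := by simpa using hx
    refine ⟨by simp, fun h => ?_, fun h => ?_⟩
    · simp [h0.1 h]
    · obtain rfl : b = 0 := by
        by_contra hb'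
        exact h (h0.2 (by omega))
      simp
  | succ U ih =>
    intro g x b br hg hx hd hb h0 hs
    have hp : 2 ^ (U + 1) = 2 * 2 ^ U := by ring
    have hd0 := hd 0
    have hs0 := hs 0 (by omega)
    simp only [Nat.testBit_zero, decide_eq_true_eq, decide_eq_false_iff_not] at hd0 hs0
    obtain ⟨b', hb', hbr⟩ : ∃ b' ≤ 1, (br 1 ↔ b' = 1) := by
      by_cases h : br 1
      · exact ⟨1, le_rfl, by simp [h]⟩
      · exact ⟨0, by omega, by simp [h]⟩
    have hb1 : b' = 1 ↔ (¬ g % 2 = 1 ∧ (x % 2 = 1 ∨ b = 1)) := by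
      rw [← hbr, ← h0]; exact hs0
    obtain ⟨h1, h2, h3⟩ := ih (g / 2) (x / 2) b' (fun i => br (i + 1)) (by omega) (by omega)
      (fun i hi => by
        rw [← Nat.testBit_succ] at hi ⊢
        exact hd (i + 1) hi) hb' hbr (fun i hi => by
        rw [← Nat.testBit_succ, ← Nat.testBit_succ]
        exact hs (i + 1) (by omega))
    -- One step of schoolbook subtraction: without the lowest bit the difference is the difference
    -- of the halves with the new borrow. Here it matters that guard and subtrahend bits are
    -- disjoint.
    have hz : (g + 2 ^ (U + 1) - x - b) / 2 = g / 2 + 2 ^ U - x / 2 - b' := by omega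
    have hdiv : (g + 2 ^ (U + 1) - x - b) / 2 ^ (U + 1) =
        (g / 2 + 2 ^ U - x / 2 - b') / 2 ^ U := by
      rw [hp, ← Nat.div_div_eq_div_mul, ← hp, hz]
    refine ⟨fun i hi hgi => ?_, fun h => hdiv ▸ h2 h, fun h => hdiv ▸ h3 h⟩
    cases i with
    | zero =>
      simp only [Nat.testBit_zero, decide_eq_true_eq, decide_eq_false_iff_not] at hgi ⊢
      rw [h0]
      omega
    | succ i =>
      rw [Nat.testBit_succ, Nat.testBit_succ, hz]
      rw [Nat.testBit_succ] at hgi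
      exact h1 i (by omega) hgi

/-- A bit of a digit shifted left, with the bits coming from the previous digit. -/
theorem testBit_shift {U w d x prev i : ℕ} (hd : d ≤ U) (hU : U ≤ w) (hp : prev < 2 ^ U)
    (hi : i < U) :
    ((x <<< d) % 2 ^ w ||| prev >>> (U - d)).testBit i = true ↔
      (d ≤ i ∧ x.testBit (i - d) = true) ∨ (i < d ∧ prev.testBit (U + i - d) = true) := by
  rw [Nat.testBit_or, Nat.testBit_mod_two_pow, Nat.testBit_shiftLeft, Nat.testBit_shiftRight]
  rw [show U - d + i = U + i - d by omega]
  by_cases h : d ≤ i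
  · have : prev.testBit (U + i - d) = false :=
      Nat.testBit_lt_two_pow (hp.trans_le (Nat.pow_le_pow_right (by norm_num) (by omega)))
    simp [h, this, show i < w by omega]
  · simp [h, show i < d by omega]

/-- The nibble `q` at the group `g` of four positions. -/
def nibble (g q : ℕ) : Set ℕ := {p | p / 4 = g ∧ q.testBit (p % 4) = true}

/-- Since 4 divides `U`, a nibble never straddles two digits. If the group lies before digit `j`,
the shift distance wraps around to at least `w`, because `U * k + w ≤ 2 ^ w`, and the result is `0`.
If it lies behind, the mask of `U` bits removes it. -/
theorem testBit_nibble {U w k j g q i : ℕ} (hU : 4 ∣ U) (hUw : U + 4 ≤ w) (hg : 4 * g ≤ U * k)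
    (hk : U * k + w ≤ 2 ^ w) (hj : j < k) (hq : q < 16) :
    (((q <<< ((2 ^ w - U * j + 4 * g) % 2 ^ w)) % 2 ^ w) &&& (2 ^ U - 1)).testBit i = true ↔
      i < U ∧ U * j + i ∈ nibble g q := by
  have hjk : U * j ≤ U * k := Nat.mul_le_mul_left _ hj.le
  have hq' : ∀ t, 4 ≤ t → q.testBit t = false := fun t ht =>
    Nat.testBit_lt_two_pow (hq.trans_le (by
      calc 16 = 2 ^ 4 := by norm_num
        _ ≤ 2 ^ t := Nat.pow_le_pow_right (by norm_num) ht))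
  simp only [Nat.testBit_and, Nat.testBit_mod_two_pow, Nat.testBit_shiftLeft,
    Nat.testBit_two_pow_sub_one, nibble, Set.mem_ofPred_eq]
  obtain ⟨c, rfl⟩ := hU
  by_cases h : 4 * c * j ≤ 4 * g
  · rw [show 2 ^ w - 4 * c * j + 4 * g = 2 ^ w + (4 * g - 4 * c * j) by omega,
      Nat.add_mod_left, Nat.mod_eq_of_lt (by omega)]
    rw [Nat.mul_assoc] at *
    by_cases hi : i < 4 * c
    · simp only [hi, show i < w by omega, decide_true, Bool.true_and, Bool.and_true, true_and,
        Bool.and_eq_true, decide_eq_true_eq]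
      constructor
      · rintro ⟨h1, h2⟩
        have : i - (4 * g - 4 * (c * j)) < 4 := by
          by_contra hcon
          rw [hq' _ (by omega)] at h2
          simp at h2
        refine ⟨by omega, ?_⟩
        rwa [show (4 * (c * j) + i) % 4 = i - (4 * g - 4 * (c * j)) by omega]
      · rintro ⟨h1, h2⟩
        refine ⟨by omega, ?_⟩
        rwa [show i - (4 * g - 4 * (c * j)) = (4 * (c * j) + i) % 4 by omega]
    · simp [hi]
  · rw [Nat.mod_eq_of_lt (by omega)]
    rw [Nat.mul_assoc] at *
    have hjk' : 4 * (c * j) ≤ 4 * (c * k) := by rw [← Nat.mul_assoc, ← Nat.mul_assoc]; exact Nat.mul_le_mul_left _ hj.le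
    have h1 : ¬ (4 * (c * j) + i) / 4 = g := by omega
    simp only [h1, false_and, and_false, iff_false]
    by_cases hi : i < w
    · simp [hi, show ¬ 2 ^ w - 4 * (c * j) + 4 * g ≤ i by omega]
    · simp [hi]

/-- The mask of the lower halves of the blocks of `2 * s` bits. -/
theorem testBit_halfMask {U w s m i : ℕ} (hU : U ≤ w) (hs : 0 < s)
    (hm : ∀ i, m.testBit i = true ↔ i < U ∧ i % (4 * s) < 2 * s) :
    ((m ^^^ ((m <<< s) % 2 ^ w)) &&& (2 ^ U - 1)).testBit i = true ↔ i < U ∧ i % (2 * s) < s := by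
  simp only [Nat.testBit_and, Nat.testBit_xor, Nat.testBit_mod_two_pow, Nat.testBit_shiftLeft,
    Nat.testBit_two_pow_sub_one]
  by_cases hi : i < U
  swap
  · simp [hi]
  simp only [hi, show i < w by omega, decide_true, Bool.true_and, Bool.and_true, true_and]
  obtain ⟨r, hr⟩ : ∃ r, i % (4 * s) = r := ⟨_, rfl⟩
  have hr4 : r < 4 * s := hr ▸ Nat.mod_lt _ (by omega)
  have h2 : i % (2 * s) = r % (2 * s) := by
    rw [← hr, Nat.mod_mod_of_dvd _ ⟨2, by ring⟩]
  have h3 : r % (2 * s) = if r < 2 * s then r else r - 2 * s := by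
    split_ifs with h
    · exact Nat.mod_eq_of_lt h
    · rw [Nat.mod_eq_sub_mod (by omega), Nat.mod_eq_of_lt (by omega)]
  -- Modulo `4 * s` the mask covers the residues below `2 * s` and its shift those from `s` to `3 *
  -- s`. The exclusive or leaves the first and the third quarter, which are the lower halves modulo
  -- `2 * s`. Positions below `s` receive nothing from the shift but already lie in the first
  -- quarter.
  have hA : m.testBit i = true ↔ r < 2 * s := by rw [hm, hr]; simp [hi]
  have hB : s ≤ i → (m.testBit (i - s) = true ↔ s ≤ r ∧ r < 3 * s) := by
    intro hsi
    rw [hm]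
    have : (i - s) % (4 * s) = if s ≤ r then r - s else r + 3 * s := by
      have hdm := Nat.div_add_mod i (4 * s)
      rw [hr] at hdm
      split_ifs with h
      · rw [show i - s = 4 * s * (i / (4 * s)) + (r - s) by omega, Nat.mul_add_mod,
          Nat.mod_eq_of_lt (by omega)]
      · have h0 : 0 < i / (4 * s) := by
          rcases Nat.eq_zero_or_pos (i / (4 * s)) with h0 | h0
          · rw [h0] at hdm; omega
          · exact h0
        obtain ⟨e, he⟩ : ∃ e, i / (4 * s) = e + 1 := ⟨i / (4 * s) - 1, by omega⟩
        rw [he, Nat.mul_add] at hdm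
        rw [show i - s = 4 * s * e + (r + 3 * s) by omega, Nat.mul_add_mod,
          Nat.mod_eq_of_lt (by omega)]
    rw [this]
    split_ifs <;> omega
  rw [h2, h3]
  by_cases hsi : s ≤ i
  · have hB := hB hsi
    cases ha : m.testBit i <;> cases hb : m.testBit (i - s) <;> rw [ha] at hA <;> rw [hb] at hB <;>
      simp at hA hB ⊢ <;> split_ifs <;> omega
  · have hir : i = r := by rw [← hr]; exact (Nat.mod_eq_of_lt (by omega)).symm
    simp only [hsi, decide_false, Bool.false_and, Bool.xor_false, hA]
    split_ifs <;> omega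

/-- Swapping the halves of the blocks of `2 * s` bits, in a word whose blocks of `2 * s` bits have
been reversed as a whole. -/
theorem testBit_swapHalves {U w s m x i : ℕ} {o : ℕ → Bool} (hU : U ≤ w) (hs : 0 < s)
    (hsU : 2 * s ∣ U) (hm : ∀ i, m.testBit i = true ↔ i < U ∧ i % (2 * s) < s)
    (hx : ∀ i, x.testBit i = true ↔ i < U ∧ o (U - 2 * s + 2 * (i % (2 * s)) - i) = true) :
    (((x >>> s) &&& m) ||| (((x &&& m) <<< s) % 2 ^ w)).testBit i = true ↔
      i < U ∧ o (U - s + 2 * (i % s) - i) = true := by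
  -- The index of `o` has the same offset inside its block as `i`, but counts the blocks from the
  -- other end. Exchanging the halves of each block yields the same description with `s` in place of
  -- `2 * s`.
  simp only [Nat.testBit_or, Nat.testBit_and, Nat.testBit_mod_two_pow, Nat.testBit_shiftLeft,
    Nat.testBit_shiftRight, Bool.or_eq_true, Bool.and_eq_true, decide_eq_true_eq, hm, hx]
  obtain ⟨c, rfl⟩ := hsU
  obtain ⟨r, hr⟩ : ∃ r, i % (2 * s) = r := ⟨_, rfl⟩
  have hr2 : r < 2 * s := hr ▸ Nat.mod_lt _ (by omega)
  obtain ⟨e, he⟩ : ∃ e, i / (2 * s) = e := ⟨_, rfl⟩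
  have hdm := Nat.div_add_mod i (2 * s)
  rw [hr, he] at hdm
  have h1 : i % s = if r < s then r else r - s := by
    have : i % s = r % s := by rw [← hr, Nat.mod_mod_of_dvd _ ⟨2, by ring⟩]
    rw [this]
    split_ifs with h
    · exact Nat.mod_eq_of_lt h
    · rw [Nat.mod_eq_sub_mod (by omega), Nat.mod_eq_of_lt (by omega)]
  have hc : i < 2 * s * c ↔ e < c := by
    constructor
    · intro h
      rw [← he]
      exact Nat.div_lt_of_lt_mul h
    · intro h
      have : 2 * s * (e + 1) ≤ 2 * s * c := Nat.mul_le_mul_left _ h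
      rw [Nat.mul_add] at this
      omega
  have hc' : e < c → 2 * s * e + 2 * s ≤ 2 * s * c := by
    intro h
    have : 2 * s * (e + 1) ≤ 2 * s * c := Nat.mul_le_mul_left _ h
    rwa [Nat.mul_add, Nat.mul_one] at this
  by_cases hi : e < c
  swap
  · have : ¬ i < 2 * s * c := by rwa [hc]
    simp only [this, false_and, and_false, false_or, iff_false]
    rintro ⟨h1, h2⟩
    have h3 : (i - s) % (2 * s) < s := h2.2.2.2
    have h4 : i - s < 2 * s * c := h2.2.2.1
    have hce : 2 * s * c ≤ 2 * s * e := Nat.mul_le_mul_left _ (by omega)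
    have : (i - s) % (2 * s) = r + s := by
      obtain ⟨e', rfl⟩ : ∃ e', e = e' + 1 := ⟨e - 1, by
        rcases Nat.eq_zero_or_pos e with h0 | h0
        · subst h0; omega
        · omega⟩
      rw [Nat.mul_add] at hdm hce
      rw [show i - s = 2 * s * e' + (r + s) by omega, Nat.mul_add_mod, Nat.mod_eq_of_lt]
      omega
    omega
  have hi' := hc' hi
  have hiU : i < 2 * s * c := hc.2 hi
  by_cases h : r < s
  · rw [h1, if_pos h]
    have e1 : (s + i) % (2 * s) = r + s := by
      rw [show s + i = 2 * s * e + (r + s) by omega, Nat.mul_add_mod, Nat.mod_eq_of_lt (by omega)]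
    rw [e1, hr]
    have e2 : ∀ h' : s ≤ i, ¬ (i - s) % (2 * s) < s := by
      intro h'
      obtain ⟨e', rfl⟩ : ∃ e', e = e' + 1 := ⟨e - 1, by
        rcases Nat.eq_zero_or_pos e with h0 | h0
        · subst h0; omega
        · omega⟩
      rw [Nat.mul_add] at hdm
      rw [show i - s = 2 * s * e' + (r + s) by omega, Nat.mul_add_mod, Nat.mod_eq_of_lt] <;> omega
    have e3 : 2 * s * c - 2 * s + 2 * (r + s) - (s + i) = 2 * s * c - s + 2 * r - i := by omega
    rw [e3]
    constructor
    · rintro (⟨⟨h1, h2⟩, h3, h4⟩ | ⟨-, h1, -, -, h2⟩)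
      · exact ⟨h3, h2⟩
      · exact absurd h2 (e2 h1)
    · rintro ⟨h1, h2⟩
      exact Or.inl ⟨⟨by omega, h2⟩, h1, h⟩
  · rw [h1, if_neg h]
    have e1 : (i - s) % (2 * s) = r - s := by
      rw [show i - s = 2 * s * e + (r - s) by omega, Nat.mul_add_mod, Nat.mod_eq_of_lt (by omega)]
    rw [e1, hr]
    have e3 : 2 * s * c - 2 * s + 2 * (r - s) - (i - s) = 2 * s * c - s + 2 * (r - s) - i := by omega
    rw [e3]
    constructor
    · rintro (⟨-, -, h4⟩ | ⟨-, -, ⟨-, h1⟩, -⟩)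
      · omega
      · exact ⟨hiU, h1⟩
    · rintro ⟨h1, h2⟩
      exact Or.inr ⟨by omega, by omega, ⟨by omega, h2⟩, by omega, by omega⟩

end BitSet


/-! ### The two steps of a sweep on a single digit. -/

namespace BitSet

/-- A digit after the transfer step of a sweep. -/
def transferDigit (U w x prev la lb : ℕ) : ℕ :=
  x ||| ((((x <<< 2) % 2 ^ w ||| prev >>> (U - 2)) &&& la) |||
    (((x <<< 4) % 2 ^ w ||| prev >>> (U - 4)) &&& lb))

/-- The bits shifted in from below come from the previous digit as it was before the step, hence the
separate value `prev`. -/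
theorem testBit_transferDigit {U w k : ℕ} {f la lb : ℕ → ℕ} {A La Lb : Set ℕ} (hU : 4 ≤ U)
    (hUw : U ≤ w) (hf : Digits U k f A) (hla : Digits U k la La) (hlb : Digits U k lb Lb)
    {j prev : ℕ} (hj : j < k) (hprev : prev = if j = 0 then 0 else f (j - 1)) (i : ℕ) :
    (transferDigit U w (f j) prev (la j) (lb j)).testBit i = true ↔
      i < U ∧ U * j + i ∈ Sweep.transfer La Lb A := by
  have hlt : prev < 2 ^ U := by
    rw [hprev]
    split_ifs
    · positivity
    · exact hf.lt (by omega)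
  have hsh : ∀ d, d ≤ 4 → i < U →
      (((f j <<< d) % 2 ^ w ||| prev >>> (U - d)).testBit i = true ↔
        ∃ q ∈ A, U * j + i = q + d) := by
    intro d hd hi
    rw [testBit_shift (by omega) hUw hlt hi, hf j hj]
    constructor
    · rintro (⟨h1, h2, h3⟩ | ⟨h1, h2⟩)
      · exact ⟨_, h3, by omega⟩
      · rw [hprev] at h2
        split_ifs at h2 with h0
        · simp at h2
        · rw [hf (j - 1) (by omega)] at h2
          refine ⟨_, h2.2, ?_⟩
          obtain ⟨e, rfl⟩ : ∃ e, j = e + 1 := ⟨j - 1, by omega⟩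
          rw [Nat.add_sub_cancel, Nat.mul_add]
          omega
    · rintro ⟨q, hq, h⟩
      by_cases hdi : d ≤ i
      · refine Or.inl ⟨hdi, by omega, ?_⟩
        rwa [show U * j + (i - d) = q by omega]
      · refine Or.inr ⟨by omega, ?_⟩
        rw [hprev, if_neg (by rintro rfl; omega), hf (j - 1) (by omega)]
        refine ⟨by omega, ?_⟩
        obtain ⟨e, rfl⟩ : ∃ e, j = e + 1 := ⟨j - 1, by
          rcases Nat.eq_zero_or_pos j with h0 | h0
          · subst h0; omega
          · omega⟩
        rw [Nat.mul_add] at h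
        rwa [Nat.add_sub_cancel, show U * e + (U + i - d) = q by omega]
  have h2 := hsh 2 (by norm_num)
  have h4 := hsh 4 (by norm_num)
  rw [transferDigit, Nat.testBit_or, Nat.testBit_or, Nat.testBit_and, Nat.testBit_and]
  simp only [Bool.or_eq_true, Bool.and_eq_true, hf j hj, hla j hj, hlb j hj, Sweep.transfer,
    Set.mem_ofPred_eq]
  constructor
  · rintro (h | ⟨h, h5, h6⟩ | ⟨h, h5, h6⟩)
    · exact ⟨h.1, Or.inl h.2⟩
    · exact ⟨h5, Or.inr (Or.inl ⟨h6, (h2 h5).1 h⟩)⟩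
    · exact ⟨h5, Or.inr (Or.inr ⟨h6, (h4 h5).1 h⟩)⟩
  · rintro ⟨h, h5 | ⟨h5, h6⟩ | ⟨h5, h6⟩⟩
    · exact Or.inl ⟨h, h5⟩
    · exact Or.inr (Or.inl ⟨(h2 h).2 h6, h, h5⟩)
    · exact Or.inr (Or.inr ⟨(h4 h).2 h6, h, h5⟩)

/-- A digit of the difference of guards and path slots. -/
theorem fillDigit {U j b x g p : ℕ} {A P G : Set ℕ} (hPG : ∀ q ∈ P, q ∉ G)
    (hx : ∀ i, x.testBit i = true ↔ i < U ∧ U * j + i ∈ A)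
    (hp : ∀ i, p.testBit i = true ↔ i < U ∧ U * j + i ∈ P)
    (hg : ∀ i, g.testBit i = true ↔ i < U ∧ U * j + i ∈ G)
    (hb : b ≤ 1) (hbr : Borrow G (A ∩ P) (U * j) ↔ b = 1) :
    (∀ i, (x ||| ((g + 2 ^ U - (x &&& p) - b) ||| (x &&& p)) &&& p).testBit i = true ↔
      i < U ∧ U * j + i ∈ Sweep.fill P G A) ∧
    ((g + 2 ^ U - (x &&& p) - b) >>> U) ^^^ 1 ≤ 1 ∧
    (Borrow G (A ∩ P) (U * (j + 1)) ↔ ((g + 2 ^ U - (x &&& p) - b) >>> U) ^^^ 1 = 1) := by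
  have hX : ∀ i, (x &&& p).testBit i = true ↔ i < U ∧ U * j + i ∈ A ∩ P := by
    intro i
    rw [Nat.testBit_and, Bool.and_eq_true, hx, hp]
    exact ⟨fun h => ⟨h.1.1, h.1.2, h.2.2⟩, fun h => ⟨⟨h.1, h.2.1⟩, h.1, h.2.2⟩⟩
  have hlt : ∀ {y : ℕ} {B : Set ℕ}, (∀ i, y.testBit i = true ↔ i < U ∧ U * j + i ∈ B) →
      y < 2 ^ U := by
    intro y B h
    apply Nat.lt_pow_two_of_testBit
    intro i hi
    by_contra hcon
    have := (h i).1 (by simpa using hcon)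
    omega
  -- The borrow inside the digit continues the borrow of the long subtraction, shifted by `U * j`.
  obtain ⟨h1, h2, h3⟩ := borrow_digit U g (x &&& p) b (fun i => Borrow G (A ∩ P) (U * j + i))
    (hlt hg) (hlt hX) (fun i hi => by
      by_contra hcon
      exact hPG _ ((hX i).1 (by simpa using hcon)).2.2 ((hg i).1 hi).2) hb hbr
    (fun i hi => by
      have h1 := hX i
      have h2 := hg i
      rw [show U * j + (i + 1) = U * j + i + 1 by ring, Borrow, h1]
      have : U * j + i ∉ G ↔ g.testBit i = false := by
        rw [← Bool.not_eq_true, h2]; tauto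
      rw [this]; tauto)
  refine ⟨fun i => ?_, ?_⟩
  · rw [Nat.testBit_or, Nat.testBit_and, Nat.testBit_or]
    simp only [Bool.or_eq_true, Bool.and_eq_true, hx, hp, Sweep.fill, Set.mem_ofPred_eq]
    have key : i < U → U * j + i ∈ P →
        ((g + 2 ^ U - (x &&& p) - b).testBit i = true ∨ (x &&& p).testBit i = true ↔
        ∃ q ∈ A, q ∈ P ∧ q ≤ U * j + i ∧ ∀ r, q < r → r < U * j + i → r ∉ G) := by
      intro hi hiP
      -- A slot of the path is never a guard, so the description of the difference bits applies at
      -- every position that survives the mask `p`.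
      rw [h1 i hi (by
        by_contra hcon
        exact hPG _ hiP ((hg i).1 (by simpa using hcon)).2), hX, borrow_iff]
      constructor
      · rintro (⟨-, h⟩ | ⟨q, hq, hqi, h⟩)
        · exact ⟨_, h.1, h.2, le_rfl, fun r h1 h2 => by omega⟩
        · exact ⟨q, hq.1, hq.2, hqi.le, fun r h1 h2 => h r h1.le h2⟩
      · rintro ⟨q, hq, hqP, hqi, h⟩
        rcases Nat.eq_or_lt_of_le hqi with h0 | h0
        · exact Or.inl ⟨hi, h0 ▸ hq, hiP⟩
        · refine Or.inr ⟨q, ⟨hq, hqP⟩, h0, fun r h1 h2 => ?_⟩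
          rcases Nat.eq_or_lt_of_le h1 with h3 | h3
          · exact h3 ▸ hPG _ hqP
          · exact h r h3 h2
    constructor
    · rintro (h | ⟨h4, h5, h6⟩)
      · exact ⟨h.1, Or.inl h.2⟩
      · exact ⟨h5, Or.inr ⟨h6, (key h5 h6).1 h4⟩⟩
    · rintro ⟨h, h4 | ⟨h4, h5⟩⟩
      · exact Or.inl ⟨h, h4⟩
      · exact Or.inr ⟨(key h h4).2 h5, h, h4⟩
  · rw [show U * (j + 1) = U * j + U by ring, Nat.shiftRight_eq_div_pow]
    by_cases h : Borrow G (A ∩ P) (U * j + U)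
    · rw [h2 h]; simp [h]
    · rw [h3 h]; simp [h]

end BitSet


/-! ### The data structure in memory, and the programs of the operations -/

namespace WordRAM

open BitSet

/-- Dimensions of a data structure: `n` nodes, `2 ^ H` is the largest power of two which is at most
`2 * n`, bit vectors consist of `k` digits of `2 ^ u` bits, memory cells below `hi` are used. -/
structure Dims (k : ℕ) where
  (w n H u hi : ℕ)
  one_le_n : 1 ≤ n
  n_lt : n < 2 ^ H
  le_two_n : 2 ^ H ≤ 2 * n
  two_le_u : 2 ≤ u
  -- Bit reversal needs `u` rounds, which must be of the order of the number of levels.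
  u_le : u ≤ H + 2
  -- The spare bits of a word hold the reserve of the subtraction and the overhang of a shifted
  -- nibble.
  unit_le : 2 ^ u + 4 ≤ w
  four_n_le : 4 * n ≤ 2 ^ u * k
  space_lt : (14 + 13 * k) * 2 ^ H < hi
  hi_le : hi ≤ 2 ^ w
  -- Negative shift distances become at least `w` modulo `2 ^ w`, so that such shifts give `0`.
  bits_le : 2 ^ u * k + w ≤ 2 ^ w

namespace Dims

variable {k : ℕ} (d : Dims k)

def L : ℕ := 2 ^ d.H

/-- Number of bits of a digit. -/
def U : ℕ := 2 ^ d.u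

/-- Address of digit `j` of row `e` in table `f`. -/
def addr (f e j : ℕ) : ℕ := 14 * d.L + (f * d.L + e) * k + j

variable {d}

theorem addr_lt_space {f e j : ℕ} (hf : f < 13) (he : e < d.L) (hj : j < k) :
    d.addr f e j < (14 + 13 * k) * d.L := by
  have h1 : f * d.L + e + 1 ≤ 13 * d.L := by
    have : (f + 1) * d.L ≤ 13 * d.L := Nat.mul_le_mul_right _ hf
    rw [Nat.add_mul] at this
    omega
  have h2 := Nat.mul_le_mul_right k h1
  have h4 : (14 + 13 * k) * d.L = 14 * d.L + 13 * d.L * k := by ring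
  rw [Nat.add_mul (f * d.L + e)] at h2
  simp only [addr]
  omega

theorem addr_lt {f e j : ℕ} (hf : f < 13) (he : e < d.L) (hj : j < k) : d.addr f e j < d.hi :=
  (addr_lt_space hf he hj).trans d.space_lt

theorem four_le_U : 4 ≤ d.U := by
  calc 4 = 2 ^ 2 := by norm_num
    _ ≤ 2 ^ d.u := Nat.pow_le_pow_right (by norm_num) d.two_le_u

theorem four_dvd_U : 4 ∣ d.U := by
  obtain ⟨e, he⟩ := Nat.exists_eq_add_of_le d.two_le_u
  exact ⟨2 ^ e, by rw [U, he, pow_add]; norm_num⟩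

theorem U_lt : d.U + 4 ≤ d.w := d.unit_le

theorem w_lt : d.w < 2 ^ d.w := Nat.lt_two_pow_self

theorem two_pow_U_lt : 16 * 2 ^ d.U ≤ 2 ^ d.w := by
  calc 16 * 2 ^ d.U = 2 ^ (d.U + 4) := by rw [pow_add]; ring
    _ ≤ 2 ^ d.w := Nat.pow_le_pow_right (by norm_num) d.U_lt

theorem H_lt : d.H < d.L := Nat.lt_two_pow_self

theorem one_le_H : 1 ≤ d.H := by
  have h1 := d.one_le_n
  have h2 := d.n_lt
  rcases Nat.eq_zero_or_pos d.H with h | h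
  · rw [h] at h2; omega
  · exact h

end Dims

/-! #### Variables -/

/-- Number of rows of a table. -/
abbrev vL : Var := .s 0
/-- Number of levels. -/
abbrev vH : Var := .s 1
/-- Number of bits of a digit. -/
abbrev vU : Var := .s 2
/-- The digit with all bits set. -/
abbrev vFull : Var := .s 3
abbrev vT : Var := .s 4
abbrev vPrev : Var := .s 5
abbrev vBorrow : Var := .s 6
abbrev vX : Var := .s 7
abbrev vY : Var := .s 8
abbrev vZ : Var := .s 9

variable {k : ℕ}

/-- The constants are in their variables. -/
structure Loaded (d : Dims k) (s : St) : Prop where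
  hL : s.reg vL = d.L
  hH : s.reg vH = d.H
  hU : s.reg vU = d.U
  hFull : s.reg vFull = 2 ^ d.U - 1

/-- Address of digit `j` of row `e` in table `f`. -/
def rowAddr (k f : ℕ) (e : Expr) (j : ℕ) : Expr :=
  14 * (vL : Expr) + (.num f * (vL : Expr) + e) * .num k + .num j

/-- Digit `j` of row `e` in table `f`. -/
def row (k f : ℕ) (e : Expr) (j : ℕ) : Expr := .load (rowAddr k f e j)

variable {d : Dims k} {s : St}

/-- All cells of the tables lie below `hi ≤ 2 ^ w`, so the address computation modulo `2 ^ w` is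
exact. -/
theorem eval_rowAddr {f j t : ℕ} {e : Expr} (hL : s.reg vL = d.L) (he : e.eval d.w s = t)
    (hf : f < 13) (ht : t < d.L) (hj : j < k) :
    (rowAddr k f e j).eval d.w s = d.addr f t j := by
  have h1 := Dims.addr_lt hf ht hj
  have h2 := d.hi_le
  rw [← Nat.mod_eq_of_lt (h1.trans_le h2)]
  simp [rowAddr, hL, he, Dims.addr, Nat.add_mod, Nat.mul_mod]

theorem safe_rowAddr {hi f j : ℕ} {e : Expr} :
    (rowAddr k f e j).Safe d.w hi s ↔ e.Safe d.w hi s := by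
  simp [rowAddr]

theorem eval_row {f j t : ℕ} {e : Expr} (hL : s.reg vL = d.L) (he : e.eval d.w s = t)
    (hf : f < 13) (ht : t < d.L) (hj : j < k) :
    (row k f e j).eval d.w s = s.mem (d.addr f t j) := by
  rw [row, Expr.eval_load, eval_rowAddr hL he hf ht hj]

theorem safe_row {f j t : ℕ} {e : Expr} (hL : s.reg vL = d.L) (he : e.eval d.w s = t)
    (hs : e.Safe d.w d.hi s) (hf : f < 13) (ht : t < d.L) (hj : j < k) :
    (row k f e j).Safe d.w d.hi s := by
  rw [row, Expr.safe_load, safe_rowAddr, eval_rowAddr hL he hf ht hj]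
  exact ⟨hs, Dims.addr_lt hf ht hj⟩

open Cmd

/-- A step of a sweep with the tables `f, …, f + 3`, for one digit of the vector at `r`. -/
def sweepDigit (k f r j : ℕ) : Cmd :=
  set vX (Var.v (r + j)) ;;
  set vY ((vX : Expr) ||| (((((vX : Expr) <<< (2 : Expr)) ||| ((vPrev : Expr) >>> ((vU : Expr) - 2))) &&& row k (f + 2) vT j) |||
    ((((vX : Expr) <<< (4 : Expr)) ||| ((vPrev : Expr) >>> ((vU : Expr) - 4))) &&& row k (f + 3) vT j))) ;;
  -- The full digit plus one is the reserve `2 ^ U` of the subtraction.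
  set vZ (((row k (f + 1) vT j + (vFull : Expr) + 1) - ((vY : Expr) &&& row k f vT j)) - (vBorrow : Expr)) ;;
  -- Bit `U` of the difference survives exactly when no borrow leaves the digit.
  set vBorrow (((vZ : Expr) >>> (vU : Expr)) ^^^ 1) ;;
  set (Var.v (r + j)) ((vY : Expr) ||| (((vZ : Expr) ||| ((vY : Expr) &&& row k f vT j)) &&& row k f vT j)) ;;
  set vPrev (vX : Expr)

theorem ends_sweepDigit {f r j t : ℕ} {P G La Lb A : Set ℕ} {g : ℕ → ℕ} (hs : Loaded d s)
    (ht : s.reg vT = t) (htL : t < d.L) (hf : f + 3 < 13) (hj : j < k) (hPG : ∀ q ∈ P, q ∉ G)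
    (hP : Digits d.U k (fun j => s.mem (d.addr f t j)) P)
    (hG : Digits d.U k (fun j => s.mem (d.addr (f + 1) t j)) G)
    (hLa : Digits d.U k (fun j => s.mem (d.addr (f + 2) t j)) La)
    (hLb : Digits d.U k (fun j => s.mem (d.addr (f + 3) t j)) Lb)
    (hg : Digits d.U k g A) (hv : s.reg (Var.v (r + j)) = g j)
    (hprev : s.reg vPrev = if j = 0 then 0 else g (j - 1)) (hb : s.reg vBorrow ≤ 1)
    (hbr : Borrow G (Sweep.transfer La Lb A ∩ P) (d.U * j) ↔ s.reg vBorrow = 1) :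
    (sweepDigit k f r j).Ends d.w d.hi d.hi 1 s fun s' =>
      (∀ i, (s'.reg (Var.v (r + j))).testBit i = true ↔
        i < d.U ∧ d.U * j + i ∈ Sweep.fill P G (Sweep.transfer La Lb A)) ∧
      (∀ i, i ≠ j → s'.reg (Var.v (r + i)) = s.reg (Var.v (r + i))) ∧
      s'.reg vPrev = g j ∧ s'.reg vBorrow ≤ 1 ∧
      (Borrow G (Sweep.transfer La Lb A ∩ P) (d.U * (j + 1)) ↔ s'.reg vBorrow = 1) := by
  have hU4 := d.four_le_U
  have hUw := d.U_lt
  have hww := d.w_lt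
  have hpw := d.two_pow_U_lt
  have hpos : 0 < 2 ^ d.U := by positivity
  have ex : (4 : ℕ) % 2 ^ d.w = 4 := Nat.mod_eq_of_lt (by omega)
  have ex2 : (2 : ℕ) % 2 ^ d.w = 2 := Nat.mod_eq_of_lt (by omega)
  have ex1 : (1 : ℕ) % 2 ^ d.w = 1 := Nat.mod_eq_of_lt (by omega)
  have eU4 : (2 ^ d.w - 4 + d.U) % 2 ^ d.w = d.U - 4 := by
    rw [show 2 ^ d.w - 4 + d.U = 2 ^ d.w + (d.U - 4) by omega, Nat.add_mod_left,
      Nat.mod_eq_of_lt (by omega)]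
  have eU2 : (2 ^ d.w - 2 + d.U) % 2 ^ d.w = d.U - 2 := by
    rw [show 2 ^ d.w - 2 + d.U = 2 ^ d.w + (d.U - 2) by omega, Nat.add_mod_left,
      Nat.mod_eq_of_lt (by omega)]
  have hy := testBit_transferDigit (w := d.w) hU4 (by omega) hg hLa hLb hj hprev
  have hfill := fillDigit hPG hy (hP j hj) (hG j hj) hb hbr
  have hXlt : transferDigit d.U d.w (g j) (s.reg vPrev) (s.mem (d.addr (f + 2) t j))
      (s.mem (d.addr (f + 3) t j)) &&& s.mem (d.addr f t j) < 2 ^ d.U :=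
    Nat.and_lt_two_pow _ (hP.lt hj)
  have hGlt := hG.lt hj
  have h0 : f < 13 := by omega
  have h1 : f + 1 < 13 := by omega
  have h2 : f + 2 < 13 := by omega
  have hsafe : ∀ f' < 13, ∀ s' : St, s'.reg vL = d.L → s'.reg vT = t →
      (row k f' vT j).Safe d.w d.hi s' := fun f' hf' s' h1 h2 =>
    safe_row h1 (by simpa using h2) (by simp) hf' htL hj
  have heval : ∀ f' < 13, ∀ s' : St, s'.reg vL = d.L → s'.reg vT = t →
      (row k f' vT j).eval d.w s' = s'.mem (d.addr f' t j) := fun f' hf' s' h1 h2 =>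
    eval_row h1 (by simpa using h2) hf' htL hj
  -- The reserve makes the true difference nonnegative, and it stays below `2 ^ w`; hence the word
  -- operations compute it exactly.
  have hz : (2 ^ d.w - s.reg vBorrow + (2 ^ d.w - (transferDigit d.U d.w (g j) (s.reg vPrev)
      (s.mem (d.addr (f + 2) t j)) (s.mem (d.addr (f + 3) t j)) &&& s.mem (d.addr f t j)) +
      (s.mem (d.addr (f + 1) t j) + (2 ^ d.U - 1) + 1))) % 2 ^ d.w =
      s.mem (d.addr (f + 1) t j) + 2 ^ d.U - (transferDigit d.U d.w (g j) (s.reg vPrev)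
      (s.mem (d.addr (f + 2) t j)) (s.mem (d.addr (f + 3) t j)) &&& s.mem (d.addr f t j)) -
      s.reg vBorrow := by
    generalize transferDigit d.U d.w (g j) (s.reg vPrev) (s.mem (d.addr (f + 2) t j))
      (s.mem (d.addr (f + 3) t j)) &&& s.mem (d.addr f t j) = X at *
    rw [show ∀ a b c : ℕ, a ≤ 1 → b < 2 ^ d.U → 2 ^ d.w - a + (2 ^ d.w - b + (c + (2 ^ d.U - 1) + 1)) =
      c + 2 ^ d.U - b - a + 2 ^ d.w + 2 ^ d.w from fun a b c _ _ => by omega, Nat.add_mod_right,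
      Nat.add_mod_right, Nat.mod_eq_of_lt]
    · omega
    · exact hb
    · exact hXlt
  apply ends_of_wp le_rfl
  obtain ⟨hf1, hf2⟩ := hfill
  simp only [transferDigit] at hz hf1 hf2
  simp [sweepDigit, wp, hsafe, heval, h0, h1, h2, hf, hs.hL, hs.hU, hs.hFull, ht, ex, ex1, ex2,
    eU4, eU2, hv, -Nat.testBit_or, -Nat.testBit_and, hz, hf1]
  refine ⟨fun i hi h => absurd h hi, hf2.1, ?_⟩
  simpa using hf2.2

/-- A step of a sweep for all digits. -/
def sweepStep (k f r : ℕ) : Cmd :=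
  set vPrev 0 ;; set vBorrow 0 ;; rep k (sweepDigit k f r)

/-- The variables which the programs use besides the constants. -/
theorem not_writes_sweepDigit {f r j : ℕ} {i : ℕ} (hi : i < 5 ∨ 10 ≤ i) :
    ¬ (sweepDigit k f r j).Writes (Var.s i) := by
  simp [sweepDigit, Writes]
  omega

theorem ends_sweepStep {f r t : ℕ} {P G La Lb A : Set ℕ} (hs : Loaded d s)
    (ht : s.reg vT = t) (htL : t < d.L) (hf : f + 3 < 13) (hPG : ∀ q ∈ P, q ∉ G)
    (hP : Digits d.U k (fun j => s.mem (d.addr f t j)) P)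
    (hG : Digits d.U k (fun j => s.mem (d.addr (f + 1) t j)) G)
    (hLa : Digits d.U k (fun j => s.mem (d.addr (f + 2) t j)) La)
    (hLb : Digits d.U k (fun j => s.mem (d.addr (f + 3) t j)) Lb)
    (hg : Digits d.U k (fun j => s.reg (Var.v (r + j))) A) :
    (sweepStep k f r).Ends d.w d.hi d.hi 1 s fun s' =>
      Digits d.U k (fun j => s'.reg (Var.v (r + j))) (Sweep.fill P G (Sweep.transfer La Lb A)) := by
  refine .seq (ends_set le_rfl (by simp) (.seq (ends_set le_rfl (by simp) ?_)))
  -- The digits before `j` are new, the others still old, and `vPrev` keeps the old value of the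
  -- digit just overwritten.
  refine (ends_rep (I := fun j s' => Loaded d s' ∧ s'.reg vT = t ∧ s'.mem = s.mem ∧
    (∀ i < j, ∀ p, (s'.reg (Var.v (r + i))).testBit p = true ↔
        p < d.U ∧ d.U * i + p ∈ Sweep.fill P G (Sweep.transfer La Lb A)) ∧
    (∀ i, j ≤ i → i < k → s'.reg (Var.v (r + i)) = s.reg (Var.v (r + i))) ∧
    s'.reg vPrev = (if j = 0 then 0 else s.reg (Var.v (r + (j - 1)))) ∧ s'.reg vBorrow ≤ 1 ∧
    (Borrow G (Sweep.transfer La Lb A ∩ P) (d.U * j) ↔ s'.reg vBorrow = 1)) ?_ ?_).imp ?_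
  · rintro j s1 hj ⟨i1, i2, i3, i4, i5, i6, i7, i8⟩
    rw [← i3] at hP hG hLa hLb
    refine ((ends_sweepDigit (g := fun j => s.reg (Var.v (r + j))) i1 i2 htL hf hj hPG
      hP hG hLa hLb hg (i5 j le_rfl hj) i6 i7 i8).frame_readOnly).imp ?_
    rintro s2 ⟨⟨j1, j2, j3, j4, j5⟩, j6, j7⟩
    have hv : ∀ i, i < 5 ∨ 10 ≤ i → s2.reg (Var.s i) = s1.reg (Var.s i) :=
      fun i hi => j6 _ (not_writes_sweepDigit hi)
    refine ⟨⟨(hv 0 (by omega)).trans i1.hL, (hv 1 (by omega)).trans i1.hH,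
      (hv 2 (by omega)).trans i1.hU, (hv 3 (by omega)).trans i1.hFull⟩,
      (hv 4 (by omega)).trans i2, j7.trans i3, fun i hi => ?_, fun i hi hik => ?_, ?_, j4, j5⟩
    · rcases Nat.lt_succ_iff_lt_or_eq.1 hi with h | rfl
      · rw [j2 i (by omega)]; exact i4 i h
      · exact j1
    · rw [j2 i (by omega)]; exact i5 i (by omega) hik
    · simpa using j3
  · refine ⟨⟨?_, ?_, ?_, ?_⟩, ?_⟩ <;> simp [Borrow, hs.hL, hs.hH, hs.hU, hs.hFull, ht]
  · rintro s' ⟨-, -, -, h, -⟩ j hj i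
    exact h j hj i

end WordRAM


/-! ### Programs for complete sweeps and for the reversal of bit vectors. -/

namespace BitSet

theorem Digits.or {U k : ℕ} {f g : ℕ → ℕ} {A B : Set ℕ} (hf : Digits U k f A)
    (hg : Digits U k g B) : Digits U k (fun j => f j ||| g j) (A ∪ B) := by
  intro j hj i
  rw [Nat.testBit_or, Bool.or_eq_true, hf j hj, hg j hj, Set.mem_union]
  tauto

theorem Digits.and {U k : ℕ} {f g : ℕ → ℕ} {A B : Set ℕ} (hf : Digits U k f A)
    (hg : Digits U k g B) : Digits U k (fun j => f j &&& g j) (A ∩ B) := by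
  intro j hj i
  rw [Nat.testBit_and, Bool.and_eq_true, hf j hj, hg j hj, Set.mem_inter_iff]
  tauto

/-- Reversal of the order of the digits, and of the bits of each digit. -/
theorem Digits.reflect {U k : ℕ} {f g : ℕ → ℕ} {A : Set ℕ} (hf : Digits U k f A)
    (hg : ∀ j < k, ∀ i, (g j).testBit i = true ↔
      i < U ∧ (f (k - 1 - j)).testBit (U - 1 - i) = true) :
    Digits U k g (HeavyLayout.reflect (U * k) A) := by
  intro j hj i
  rw [hg j hj, hf _ (by omega), HeavyLayout.reflect, Set.mem_ofPred_eq]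
  obtain ⟨e, rfl⟩ := Nat.exists_eq_add_of_lt hj
  rw [show j + e + 1 - 1 - j = e by omega,
    show U * (j + e + 1) = U * j + U * e + U by ring]
  refine and_congr_right fun hi => ?_
  rw [show U * j + U * e + U - 1 - (U * j + i) = U * e + (U - 1 - i) by omega]
  constructor
  · exact fun h => ⟨by omega, h.2⟩
  · exact fun h => ⟨by omega, h.2⟩

end BitSet

namespace WordRAM

open BitSet Cmd

variable {k : ℕ} {d : Dims k} {s : St}

theorem Loaded.congr {s' : St} (h : Loaded d s) (h' : ∀ i < 4, s'.reg (.s i) = s.reg (.s i)) :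
    Loaded d s' :=
  ⟨(h' 0 (by omega)).trans h.hL, (h' 1 (by omega)).trans h.hH, (h' 2 (by omega)).trans h.hU,
    (h' 3 (by omega)).trans h.hFull⟩

/-- A sweep with the tables `f, …, f + 3` for the vector at `r`. -/
def sweep (k f r : ℕ) : Cmd :=
  set vT 0 ;; loop vT vH (sweepStep k f r ;; set vT ((vT : Expr) + 1))

theorem not_writes_sweepStep {f r : ℕ} {i : ℕ} (hi : i < 5 ∨ 10 ≤ i) :
    ¬ (sweepStep k f r).Writes (Var.s i) := by
  simp only [sweepStep, Writes, Var.s.injEq, writes_rep, not_or, not_exists]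
  exact ⟨by omega, by omega, fun j h => not_writes_sweepDigit hi h.2⟩

theorem writes_sweep {f r : ℕ} {x : Var} (h : (sweep k f r).Writes x) :
    (∃ i, 4 ≤ i ∧ i < 10 ∧ x = .s i) ∨ ∃ i, r ≤ i ∧ i < r + k ∧ x = .v i := by
  simp only [sweep, sweepStep, Writes, writes_rep, sweepDigit] at h
  rcases h with rfl | ⟨rfl | rfl | ⟨j, hj, h⟩⟩ | rfl
  · exact Or.inl ⟨4, by omega, by omega, rfl⟩
  · exact Or.inl ⟨5, by omega, by omega, rfl⟩
  · exact Or.inl ⟨6, by omega, by omega, rfl⟩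
  · rcases h with rfl | rfl | rfl | rfl | rfl | rfl
    · exact Or.inl ⟨7, by omega, by omega, rfl⟩
    · exact Or.inl ⟨8, by omega, by omega, rfl⟩
    · exact Or.inl ⟨9, by omega, by omega, rfl⟩
    · exact Or.inl ⟨6, by omega, by omega, rfl⟩
    · exact Or.inr ⟨r + j, by omega, by omega, rfl⟩
    · exact Or.inl ⟨5, by omega, by omega, rfl⟩
  · exact Or.inl ⟨4, by omega, by omega, rfl⟩

/-- There are `H` rounds of constant length. The bound `H + 3` is chosen to serve also for the at
most `H + 2` rounds of the reversal and the final test. -/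
theorem ends_sweep {f r : ℕ} {P G La Lb : ℕ → Set ℕ} {A : Set ℕ} (hs : Loaded d s)
    (hf : f + 3 < 13) (hPG : ∀ t, ∀ q ∈ P t, q ∉ G t)
    (hP : ∀ t < d.H, Digits d.U k (fun j => s.mem (d.addr f t j)) (P t))
    (hG : ∀ t < d.H, Digits d.U k (fun j => s.mem (d.addr (f + 1) t j)) (G t))
    (hLa : ∀ t < d.H, Digits d.U k (fun j => s.mem (d.addr (f + 2) t j)) (La t))
    (hLb : ∀ t < d.H, Digits d.U k (fun j => s.mem (d.addr (f + 3) t j)) (Lb t))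
    (hg : Digits d.U k (fun j => s.reg (Var.v (r + j))) A) :
    (sweep k f r).Ends d.w d.hi d.hi (d.H + 3) s fun s' =>
      Digits d.U k (fun j => s'.reg (Var.v (r + j))) (Sweep.sweep P G La Lb A d.H) := by
  have hLw : d.L < 2 ^ d.w := by
    have h1 := d.space_lt
    have h2 := d.hi_le
    have : d.L * 14 ≤ (14 + 13 * k) * 2 ^ d.H := by
      rw [Dims.L, Nat.mul_comm]; exact Nat.mul_le_mul_right _ (by omega)
    have h3 : 0 < d.L := by rw [Dims.L]; positivity
    omega
  have hHL := d.H_lt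
  refine .seq (ends_set (by omega) (by simp) ?_)
  refine (ends_loop (N := d.H) (X' := 1) (I := fun t s' => Loaded d s' ∧ s'.reg vT = t ∧
    s'.mem = s.mem ∧ Digits d.U k (fun j => s'.reg (Var.v (r + j))) (Sweep.sweep P G La Lb A t))
    le_rfl (by omega) (fun _ _ _ _ => by simp) ?_ ?_ ?_).imp fun s' h => h.2.2.2
  · rintro t s1 - ⟨i1, i2, -⟩
    simp [i1.hH, i2]
  · rintro t s1 ht ⟨i1, i2, i3, i4⟩
    rw [← i3] at hP hG hLa hLb
    refine .seq (((ends_sweepStep i1 i2 (ht.trans hHL) hf (hPG t) (hP t ht) (hG t ht) (hLa t ht)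
      (hLb t ht) i4).frame_readOnly).imp ?_)
    rintro s2 ⟨j1, j2, j3⟩
    have hv : ∀ i, i < 5 ∨ 10 ≤ i → s2.reg (Var.s i) = s1.reg (Var.s i) :=
      fun i hi => j2 _ (not_writes_sweepStep hi)
    refine ends_set le_rfl (by simp) ⟨i1.congr fun i hi => ?_, ?_, j3.trans i3, ?_⟩
    · simp [hv i (by omega), show i ≠ 4 by omega]
    · simp [hv 4 (by omega), i2]
      exact Nat.mod_eq_of_lt (by omega)
    · simpa [Sweep.sweep] using j1
  · refine ⟨hs.congr fun i hi => ?_, ?_⟩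
    · simp [show i ≠ 4 by omega]
    · simpa [Sweep.sweep] using hg

/-- Reversal of the bits of the digits of the vector at `r`. -/
def reverseDigits (k r : ℕ) : Cmd :=
  set vX (vU : Expr) ;; set vY (vFull : Expr) ;;
  loop 1 vX (
    set vX ((vX : Expr) >>> (1 : Expr)) ;;
    set vY (((vY : Expr) ^^^ ((vY : Expr) <<< (vX : Expr))) &&& (vFull : Expr)) ;;
    rep k fun j => set (.v (r + j)) ((((Var.v (r + j) : Expr) >>> (vX : Expr)) &&& (vY : Expr)) |||
      (((Var.v (r + j) : Expr) &&& (vY : Expr)) <<< (vX : Expr))))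

theorem writes_reverseDigits {r : ℕ} {x : Var} (h : (reverseDigits k r).Writes x) :
    (∃ i, 4 ≤ i ∧ i < 10 ∧ x = .s i) ∨ ∃ i, r ≤ i ∧ i < r + k ∧ x = .v i := by
  simp only [reverseDigits, Writes, writes_rep] at h
  rcases h with rfl | rfl | rfl | rfl | ⟨j, hj, rfl⟩
  · exact Or.inl ⟨7, by omega, by omega, rfl⟩
  · exact Or.inl ⟨8, by omega, by omega, rfl⟩
  · exact Or.inl ⟨7, by omega, by omega, rfl⟩
  · exact Or.inl ⟨8, by omega, by omega, rfl⟩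
  · exact Or.inr ⟨r + j, by omega, by omega, rfl⟩

theorem ends_reverseDigits {r : ℕ} {g : ℕ → ℕ} (hs : Loaded d s)
    (hv : ∀ j < k, s.reg (Var.v (r + j)) = g j) (hg : ∀ j < k, g j < 2 ^ d.U) :
    (reverseDigits k r).Ends d.w d.hi d.hi (d.H + 3) s fun s' => ∀ j < k, ∀ i,
      (s'.reg (Var.v (r + j))).testBit i = true ↔
        i < d.U ∧ (g j).testBit (d.U - 1 - i) = true := by
  have hu := d.u_le
  have hUw := d.U_lt
  have hww := d.w_lt
  have h1w : 1 % 2 ^ d.w = 1 := Nat.mod_eq_of_lt (by omega)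
  have hUpos : 0 < d.U := by have := d.four_le_U; omega
  refine .seq (ends_set (by omega) (by simp) (.seq (ends_set (by omega) (by simp) ?_)))
  refine (ends_loop (N := d.u) (X' := 1) (I := fun t s' => Loaded d s' ∧
    s'.reg vX = 2 ^ (d.u - t) ∧
    (∀ i, (s'.reg vY).testBit i = true ↔
      i < d.U ∧ i % (2 * 2 ^ (d.u - t)) < 2 ^ (d.u - t)) ∧
    ∀ j < k, ∀ i, (s'.reg (Var.v (r + j))).testBit i = true ↔
      i < d.U ∧ (g j).testBit (d.U - 2 ^ (d.u - t) + 2 * (i % 2 ^ (d.u - t)) - i) = true)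
    le_rfl (by omega) (fun _ _ _ _ => by simp) ?_ ?_ ?_).imp ?_
  · rintro t s1 ht ⟨-, i2, -⟩
    simp [i2, h1w]
    omega
  · rintro t s1 ht ⟨i1, i2, i3, i4⟩
    obtain ⟨e, he⟩ : ∃ e, d.u - t = e + 1 := ⟨d.u - t - 1, by omega⟩
    have he' : d.u - (t + 1) = e := by omega
    have hp : 2 ^ (e + 1) = 2 * 2 ^ e := by ring
    have hspos : 0 < 2 ^ e := by positivity
    have hdvd : 2 * 2 ^ e ∣ d.U := by
      rw [← hp, Dims.U]; exact Nat.pow_dvd_pow 2 (by omega)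
    rw [he, hp] at i2 i3 i4
    rw [he']
    refine .seq (ends_set le_rfl (by simp) (.seq (ends_set le_rfl (by simp) ?_)))
    have hm := fun i => testBit_halfMask (U := d.U) (w := d.w) (m := s1.reg vY) (i := i) (by omega) hspos
      (fun i => by rw [i3, ← Nat.mul_assoc])
    refine (ends_rep (I := fun j s' => Loaded d s' ∧ s'.reg vX = 2 ^ e ∧
      (∀ i, (s'.reg vY).testBit i = true ↔ i < d.U ∧ i % (2 * 2 ^ e) < 2 ^ e) ∧
      (∀ j' < j, ∀ i, (s'.reg (Var.v (r + j'))).testBit i = true ↔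
        i < d.U ∧ (g j').testBit (d.U - 2 ^ e + 2 * (i % 2 ^ e) - i) = true) ∧
      ∀ j', j ≤ j' → j' < k → s'.reg (Var.v (r + j')) = s1.reg (Var.v (r + j'))) ?_ ?_).imp ?_
    · rintro j s2 hj ⟨j1, j2, j3, j4, j5⟩
      refine ends_set le_rfl (by simp) ⟨j1.congr fun i hi => by simp, by simpa using j2,
        by simpa using j3, fun j' hj' => ?_, fun j' hj' hk => ?_⟩
      · rcases Nat.lt_succ_iff_lt_or_eq.1 hj' with h | rfl
        · simpa [show j' ≠ j by omega] using j4 j' h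
        · have := fun i => testBit_swapHalves (i := i) (o := (g j').testBit) (by omega) hspos hdvd j3
            (w := d.w) (x := s2.reg (Var.v (r + j'))) (fun i => by rw [j5 j' le_rfl hj, i4 j' hj])
          simpa [j2, -Nat.testBit_or, -Nat.testBit_and] using this
      · simpa [show j' ≠ j by omega] using j5 j' (by omega) hk
    · refine ⟨i1.congr fun i hi => by simp [show i ≠ 7 by omega, show i ≠ 8 by omega], ?_, ?_, ?_⟩
      · simp [i2, h1w]
        simp [Nat.shiftRight_eq_div_pow]
      · simpa [i2, h1w, i1.hFull, -Nat.testBit_xor, -Nat.testBit_and,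
          Nat.shiftRight_eq_div_pow] using hm
      · simp
    · rintro s' ⟨j1, j2, j3, j4, -⟩
      exact ⟨j1, j2, j3, j4⟩
  · refine ⟨hs.congr fun i hi => by simp [show i ≠ 7 by omega, show i ≠ 8 by omega], ?_, ?_, ?_⟩
    · simp [hs.hU, Dims.U]
    · intro i
      simp only [Nat.sub_zero, ← show d.U = 2 ^ d.u from rfl]
      simp [hs.hFull, Nat.testBit_two_pow_sub_one]
      intro hi
      rw [Nat.mod_eq_of_lt (by omega)]; exact hi
    · intro j hj i
      simp only [Nat.sub_zero, ← show d.U = 2 ^ d.u from rfl]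
      simp [hv j hj]
      constructor
      · intro h
        have hi : i < d.U := by
          by_contra hcon
          rw [Nat.testBit_lt_two_pow] at h
          · simp at h
          · exact (hg j hj).trans_le (Nat.pow_le_pow_right (by norm_num) (by omega))
        refine ⟨hi, ?_⟩
        rwa [Nat.mod_eq_of_lt hi, show 2 * i - i = i by omega]
      · rintro ⟨hi, h⟩
        rwa [Nat.mod_eq_of_lt hi, show 2 * i - i = i by omega] at h
  · rintro s' ⟨-, -, -, h⟩ j hj i
    simpa [Nat.mod_one] using h j hj i

/-- Reversal of the vector at `r`, which is destroyed, into the vector at `r'`. -/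
def reverse (k r r' : ℕ) : Cmd :=
  reverseDigits k r ;; rep k fun j => set (.v (r' + j)) (Var.v (r + (k - 1 - j)))

theorem writes_reverse {r r' : ℕ} {x : Var} (h : (reverse k r r').Writes x) :
    (∃ i, 4 ≤ i ∧ i < 10 ∧ x = .s i) ∨ (∃ i, r ≤ i ∧ i < r + k ∧ x = .v i) ∨
      ∃ i, r' ≤ i ∧ i < r' + k ∧ x = .v i := by
  simp only [reverse, Writes, writes_rep] at h
  rcases h with h | ⟨j, hj, rfl⟩
  · rcases writes_reverseDigits h with h | h
    · exact Or.inl h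
    · exact Or.inr (Or.inl h)
  · exact Or.inr (Or.inr ⟨r' + j, by omega, by omega, rfl⟩)

theorem ends_reverse {r r' : ℕ} {A : Set ℕ} (hs : Loaded d s) (hr : r + k ≤ r' ∨ r' + k ≤ r)
    (hA : Digits d.U k (fun j => s.reg (Var.v (r + j))) A) :
    (reverse k r r').Ends d.w d.hi d.hi (d.H + 3) s fun s' =>
      Digits d.U k (fun j => s'.reg (Var.v (r' + j))) (HeavyLayout.reflect (d.U * k) A) := by
  refine .seq ((ends_reverseDigits hs (fun j _ => rfl) fun j hj => hA.lt hj).imp fun s1 h1 => ?_)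
  refine (ends_rep (I := fun j s' => (∀ i < k, s'.reg (.v (r + i)) = s1.reg (.v (r + i))) ∧
    ∀ i < j, s'.reg (.v (r' + i)) = s1.reg (.v (r + (k - 1 - i)))) ?_ ?_).imp ?_
  · rintro j s2 hj ⟨j1, j2⟩
    refine ends_set (by omega) (by simp) ⟨fun i hi => ?_, fun i hi => ?_⟩
    · simp [show r + i ≠ r' + j by omega, j1 i hi]
    · rcases Nat.lt_succ_iff_lt_or_eq.1 hi with h | rfl
      · simp [show i ≠ j by omega, j2 i h]
      · simp [j1 (k - 1 - i) (by omega)]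
  · exact ⟨fun _ _ => rfl, fun _ h => absurd h (by omega)⟩
  · rintro s2 ⟨-, h2⟩
    refine hA.reflect fun j hj i => ?_
    rw [h2 j hj, h1 _ (by omega)]

end WordRAM


/-- The kind of a node in the input array. -/
def RegEx.kind {α : Type} : RegEx α → ℕ
  | char _ => 0
  | cat _ _ => 1
  | alt _ _ => 2
  | star _ => 3

/-- The first field of a node in the input array. -/
def TreeNode.fst {w : ℕ} (N : TreeNode (BitVec w)) : ℕ :=
  match N.sub with
  | .char a => a.toNat
  | _ => N.leftNum

namespace RegEx

variable {α : Type} (R : RegEx α)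

/-- Position of the end slot of a node. -/
def endPos (x : ℕ) : ℕ := 4 * (R.node x).pos + 2

theorem endPos_lt {x : ℕ} (hx : x < R.size) : R.endPos x < 4 * R.size := by
  have : (R.node x).pos < R.size := pos_lt hx
  rw [endPos]; omega

theorem endPos_injective {x y : ℕ} (hx : x < R.size) (hy : y < R.size)
    (h : R.endPos x = R.endPos y) : x = y :=
  pos_injective hx hy (by simp only [endPos] at h; omega)

/-- The end slots of the nodes with the property `P`. -/
def ends (P : ℕ → Prop) : Set ℕ := {p | ∃ x < R.size, P x ∧ p = R.endPos x}

theorem mem_ends {P : ℕ → Prop} {x : ℕ} (hx : x < R.size) : R.endPos x ∈ R.ends P ↔ P x := by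
  constructor
  · rintro ⟨y, hy, h, e⟩
    rwa [R.endPos_injective hx hy e]
  · exact fun h => ⟨x, hx, h, rfl⟩

theorem ends_union (P Q : ℕ → Prop) : R.ends P ∪ R.ends Q = R.ends fun x => P x ∨ Q x := by
  ext p
  constructor
  · rintro (⟨x, hx, h, e⟩ | ⟨x, hx, h, e⟩)
    · exact ⟨x, hx, Or.inl h, e⟩
    · exact ⟨x, hx, Or.inr h, e⟩
  · rintro ⟨x, hx, h | h, e⟩
    · exact Or.inl ⟨x, hx, h, e⟩
    · exact Or.inr ⟨x, hx, h, e⟩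

theorem ends_inter (P Q : ℕ → Prop) : R.ends P ∩ R.ends Q = R.ends fun x => P x ∧ Q x := by
  ext p
  constructor
  · rintro ⟨⟨x, hx, h, e⟩, h'⟩
    exact ⟨x, hx, ⟨h, (R.mem_ends hx).1 (e ▸ h')⟩, e⟩
  · rintro ⟨x, hx, h, e⟩
    exact ⟨⟨x, hx, h.1, e⟩, ⟨x, hx, h.2, e⟩⟩

theorem ends_congr {P Q : ℕ → Prop} (h : ∀ x < R.size, P x ↔ Q x) : R.ends P = R.ends Q := by
  ext p
  constructor
  · rintro ⟨x, hx, h', e⟩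
    exact ⟨x, hx, (h x hx).1 h', e⟩
  · rintro ⟨x, hx, h', e⟩
    exact ⟨x, hx, (h x hx).2 h', e⟩

end RegEx

namespace WordRAM

open BitSet Cmd HeavyLayout

variable {k : ℕ} {d : Dims k} {s : St}

/-- The parse tree is stored from address `0` on. -/
def IsTree {w : ℕ} (R : RegEx (BitVec w)) (mem : ℕ → ℕ) : Prop :=
  ∀ x < R.size, mem (3 * x) = (R.node x).sub.kind ∧ mem (3 * x + 1) = (R.node x).fst ∧
    mem (3 * x + 2) = (R.node x).rightNum

/-- The memory contains the constants of the data structure. -/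
structure HasConsts (d : Dims k) (mem : ℕ → ℕ) : Prop where
  -- The operations do not receive the number of nodes. They find `L` as the first power of two
  -- whose cell `3 * L` holds `4`, which is no kind of a node. The sentinel matters when the number
  -- of nodes is itself a power of two, since the search then reads the cell just behind the input.
  sentinel : mem (3 * d.n) = 0
  marker : mem (3 * d.L) = 4
  hH : mem (4 * d.L) = d.H
  hU : mem (5 * d.L) = d.U
  hFull : mem (6 * d.L) = 2 ^ d.U - 1

/-- The key of the node with number `x`. -/
def key (mem : ℕ → ℕ) (x : ℕ) : ℕ := mem (3 * x + 1)

/-- The memory contains the sorted list of the nodes. -/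
structure HasOrder (d : Dims k) (mem : ℕ → ℕ) : Prop where
  lt : ∀ t < d.L, mem (7 * d.L + t) < d.n
  mono : ∀ t t', t ≤ t' → t' < d.L → key mem (mem (7 * d.L + t)) ≤ key mem (mem (7 * d.L + t'))
  -- Repetitions are allowed: the list is padded to `L` entries.
  surj : ∀ x < d.n, ∃ t < d.L, mem (7 * d.L + t) = x

/-- Digit `j` of row `e` in table `f`. -/
def tableDigit (d : Dims k) (mem : ℕ → ℕ) (f e j : ℕ) : ℕ := mem (d.addr f e j)

/-- The memory contains the tables of bit vectors. -/
structure HasTables {w : ℕ} (d : Dims k) (R : RegEx (BitVec w)) (mem : ℕ → ℕ) : Prop where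
  upPath : ∀ t < d.H, Digits d.U k (tableDigit d mem 0 t) (pathSlots R.size
    (fun x => (R.node x).pos) (fun x => (R.node x).lev)
    (fun x => (R.node x).sub.upHub = true) (d.H - 1 - t))
  upGuard : ∀ t < d.H, Digits d.U k (tableDigit d mem 1 t) (guardSlots R.size
    (fun x => (R.node x).pos) (fun x => (R.node x).lev) (fun x => (R.node x).top = true)
    (fun x => (R.node x).sub.upGuard = true) (d.H - 1 - t))
  upLightHub : ∀ t < d.H, Digits d.U k (tableDigit d mem 2 t) (hubTargets
    (fun x => (R.node x).pos) (fun x => (R.node x).lev) R.Light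
    (fun x => (R.node x).sub.upLightHub = true) (d.H - 1 - t))
  upLight : ∀ t < d.H, Digits d.U k (tableDigit d mem 3 t) (endTargets
    (fun x => (R.node x).pos) (fun x => (R.node x).lev) R.Light
    (fun x => (R.node x).sub.upLight = true) (d.H - 1 - t))
  downPath : ∀ t < d.H, Digits d.U k (tableDigit d mem 4 t) (reflect (d.U * k) (pathSlots R.size
    (fun x => (R.node x).pos) (fun x => (R.node x).lev)
    (fun x => (R.node x).sub.downHub = true) t))
  downGuard : ∀ t < d.H, Digits d.U k (tableDigit d mem 5 t) (reflect (d.U * k) (guardSlots R.size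
    (fun x => (R.node x).pos) (fun x => (R.node x).lev) (fun x => (R.node x).top = true)
    (fun x => (R.node x).sub.downGuard = true) t))
  downLightHub : ∀ t < d.H, Digits d.U k (tableDigit d mem 6 t) (reflect (d.U * k) (childTargets
    (fun x => (R.node x).pos) (fun x => (R.node x).lev) R.Light
    (fun x => (R.node x).sub.downLightHub = true) t))
  downLight : ∀ t < d.H, Digits d.U k (tableDigit d mem 7 t) (reflect (d.U * k) (childTargets
    (fun x => (R.node x).pos) (fun x => (R.node x).lev) R.Light
    (fun x => (R.node x).sub.downLight = true) t))
  null : Digits d.U k (tableDigit d mem 8 0) (R.ends fun x => (R.node x).sub.null = true)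
  all : Digits d.U k (tableDigit d mem 9 0) (R.ends fun _ => True)
  hub : Digits d.U k (tableDigit d mem 10 0) {p | ∃ x < R.size, p = 4 * (R.node x).pos}
  single : ∀ e < d.n, Digits d.U k (tableDigit d mem 11 e) (R.ends fun x => x = e)

/-- The memory contains the set of the leaves with the same character as the leaf with rank `t`. -/
def HasMasks {w : ℕ} (d : Dims k) (R : RegEx (BitVec w)) (mem : ℕ → ℕ) : Prop :=
  ∀ t < d.L, Digits d.U k (tableDigit d mem 12 t) (R.ends fun x => (R.node x).sub.kind = 0 ∧
    -- The restriction to ranks up to `t` allows a row to be computed from the preceding one. For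
    -- the last rank of a key nothing is lost.
    ∃ t' ≤ t, mem (7 * d.L + t') = x ∧ key mem x = key mem (mem (7 * d.L + t)))

/-- The memory contains the data structure. -/
structure IsStored {w : ℕ} (d : Dims k) (R : RegEx (BitVec w)) (mem : ℕ → ℕ) : Prop where
  tree : IsTree R mem
  consts : HasConsts d mem
  order : HasOrder d mem
  tables : HasTables d R mem
  masks : HasMasks d R mem

/-- The first vectors of registers represent the set of the states with numbers in `σ`. -/
def HoldsNums {w : ℕ} (d : Dims k) (R : RegEx (BitVec w)) (σ : Set ℕ) (s : St) : Prop :=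
  Digits d.U k (fun j => s.reg (.v j)) (R.ends fun x => 2 * x ∈ σ) ∧
  Digits d.U k (fun j => s.reg (.v (k + j))) (R.ends fun x => 2 * x + 1 ∈ σ)

theorem Dims.k_pos (d : Dims k) : 1 ≤ k := by
  rcases Nat.eq_zero_or_pos k with h0 | h0
  · have h1 := d.four_n_le
    have h2 := d.one_le_n
    subst h0
    omega
  · exact h0

theorem Dims.mod_eq {x : ℕ} (h : x ≤ 14 * d.L) : x % 2 ^ d.w = x := by
  apply Nat.mod_eq_of_lt
  have h1 := d.space_lt
  have h2 := d.hi_le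
  have h0 := d.k_pos
  have : 14 * d.L + 13 * d.L ≤ (14 + 13 * k) * 2 ^ d.H := by
    rw [← Nat.add_mul]; exact Nat.mul_le_mul_right _ (by omega)
  have : 0 < d.L := by rw [Dims.L]; positivity
  omega

theorem Dims.le_hi : 14 * d.L ≤ d.hi :=
  (Nat.mul_le_mul_right _ (by omega)).trans d.space_lt.le

theorem Dims.L_pos : 1 < d.L := by
  have := d.n_lt
  have := d.one_le_n
  rw [Dims.L]; omega

/-- Loading of the constants. -/
def locate : Cmd :=
  set vL 1 ;; loop (.load (3 * (vL : Expr))) 4 (set vL ((vL : Expr) + vL)) ;;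
  set vH (.load (4 * (vL : Expr))) ;; set vU (.load (5 * (vL : Expr))) ;;
  set vFull (.load (6 * (vL : Expr)))

theorem writes_locate {x : Var} (h : locate.Writes x) : ∃ i < 4, x = .s i := by
  simp only [locate, Writes] at h
  rcases h with rfl | rfl | rfl | rfl | rfl
  · exact ⟨0, by omega, rfl⟩
  · exact ⟨0, by omega, rfl⟩
  · exact ⟨1, by omega, rfl⟩
  · exact ⟨2, by omega, rfl⟩
  · exact ⟨3, by omega, rfl⟩

theorem kind_lt {α : Type} (R : RegEx α) : R.kind < 4 := by
  cases R <;> simp [RegEx.kind]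

/-- A power of two smaller than `L` is at most `n`. So each cell read before the marker is the kind
of a node or the sentinel, and both are less than `4`. -/
theorem ends_locate {w : ℕ} {R : RegEx (BitVec w)} (hR : R.size = d.n) (ht : IsTree R s.mem)
    (hc : HasConsts d s.mem) : locate.Ends d.w d.hi d.hi (d.H + 3) s (Loaded d) := by
  have hhi := d.le_hi
  have hL := d.L_pos
  have hn := d.n_lt
  have hn' := d.le_two_n
  have e3 := d.mod_eq (x := 3) (by omega)
  have e4 := d.mod_eq (x := 4) (by omega)
  have e5 := d.mod_eq (x := 5) (by omega)
  have e6 := d.mod_eq (x := 6) (by omega)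
  have e1 := d.mod_eq (x := 1) (by omega)
  have e4L := d.mod_eq (x := 4 * d.L) (by omega)
  have e5L := d.mod_eq (x := 5 * d.L) (by omega)
  have e6L := d.mod_eq (x := 6 * d.L) (by omega)
  have hpow : ∀ i ≤ d.H, 2 ^ i ≤ d.L := fun i hi => Nat.pow_le_pow_right (by norm_num) hi
  refine .seq (ends_set (by omega) (by simp) (.seq ?_))
  refine (ends_loop (N := d.H) (X' := 1) (I := fun i s' => s'.reg vL = 2 ^ i ∧ s'.mem = s.mem)
    le_rfl (by omega) ?_ ?_ ?_ ?_).imp ?_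
  · rintro i s1 hi ⟨i1, i2⟩
    have := hpow i hi
    simp [i1, e3]
    rw [d.mod_eq (by omega)]; omega
  · rintro i s1 hi ⟨i1, i2⟩
    have := hpow i hi
    simp [i1, e3, e4, i2]
    rw [d.mod_eq (by omega)]
    constructor
    · intro h
      by_contra hcon
      obtain rfl : i = d.H := by omega
      rw [show 2 ^ d.H = d.L from rfl, hc.marker] at h
      omega
    · intro h
      rcases Nat.lt_or_ge (2 ^ i) d.n with h1 | h1
      · rw [(ht _ (by omega)).1]; exact kind_lt _
      · have : 2 ^ (i + 1) ≤ 2 ^ d.H := Nat.pow_le_pow_right (by norm_num) h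
        rw [pow_succ] at this
        rw [show 2 ^ i = d.n by omega, hc.sentinel]; omega
  · rintro i s1 hi ⟨i1, i2⟩
    have := hpow (i + 1) hi
    rw [pow_succ] at this
    refine ends_set le_rfl (by simp) ⟨?_, i2⟩
    simp [i1]
    rw [d.mod_eq (by omega), pow_succ]; omega
  · simp [e1]
  · rintro s1 ⟨i1, i2⟩
    rw [show 2 ^ d.H = d.L from rfl] at i1
    apply ends_of_wp (by omega)
    simp [wp, i1, e4, e5, e6, e4L, e5L, e6L, i2, show 4 * d.L < d.hi by omega,
      show 5 * d.L < d.hi by omega, show 6 * d.L < d.hi by omega, hc.hH, hc.hU, hc.hFull]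
    constructor <;> simp [i1]

end WordRAM


/-! ### The operation `Close`. -/

namespace WordRAM

open BitSet Cmd HeavyLayout

variable {k : ℕ} {d : Dims k} {s : St}

/-- Of the vector components only those in `V` have been changed, and none of the constants. -/
structure Frame (V : Set ℕ) (s s' : St) : Prop where
  scalar : ∀ i < 4, s'.reg (.s i) = s.reg (.s i)
  vector : ∀ i ∉ V, s'.reg (.v i) = s.reg (.v i)
  mem : s'.mem = s.mem

theorem Frame.digits {V : Set ℕ} {s' : St} {r : ℕ} {A : Set ℕ} (h : Frame V s s')
    (hr : ∀ i, r ≤ i → i < r + k → i ∉ V) (hA : Digits d.U k (fun j => s.reg (.v (r + j))) A) :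
    Digits d.U k (fun j => s'.reg (.v (r + j))) A :=
  hA.congr (fun j hj => h.vector _ (hr _ (by omega) (by omega))) fun _ _ => Iff.rfl

theorem Frame.loaded {V : Set ℕ} {s' : St} (h : Frame V s s') (hs : Loaded d s) : Loaded d s' :=
  hs.congr h.scalar

theorem Frame.of_writes {V : Set ℕ} {s' : St} {c : Cmd}
    (hw : ∀ x, c.Writes x → (∃ i, 4 ≤ i ∧ x = .s i) ∨ ∃ i ∈ V, x = .v i)
    (h : ∀ x, ¬ c.Writes x → s'.reg x = s.reg x) (hm : s'.mem = s.mem) : Frame V s s' where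
  scalar i hi := h _ fun hx => by
    rcases hw _ hx with ⟨j, hj, e⟩ | ⟨j, -, e⟩
    · rw [Var.s.injEq] at e; omega
    · simp at e
  vector i hi := h _ fun hx => by
    rcases hw _ hx with ⟨j, -, e⟩ | ⟨j, hj, e⟩
    · simp at e
    · rw [Var.v.injEq] at e; exact hi (e ▸ hj)
  mem := hm

theorem ends_sweep_frame {f r X : ℕ} {P G La Lb : ℕ → Set ℕ} {A : Set ℕ} (hX : X = d.H + 3)
    (hs : Loaded d s)
    (hf : f + 3 < 13) (hPG : ∀ t, ∀ q ∈ P t, q ∉ G t)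
    (hP : ∀ t < d.H, Digits d.U k (tableDigit d s.mem f t) (P t))
    (hG : ∀ t < d.H, Digits d.U k (tableDigit d s.mem (f + 1) t) (G t))
    (hLa : ∀ t < d.H, Digits d.U k (tableDigit d s.mem (f + 2) t) (La t))
    (hLb : ∀ t < d.H, Digits d.U k (tableDigit d s.mem (f + 3) t) (Lb t))
    (hg : Digits d.U k (fun j => s.reg (Var.v (r + j))) A) :
    (sweep k f r).Ends d.w d.hi d.hi X s fun s' =>
      Digits d.U k (fun j => s'.reg (Var.v (r + j))) (Sweep.sweep P G La Lb A d.H) ∧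
      Frame (Set.Ico r (r + k)) s s' := by
  subst hX
  refine (ends_sweep hs hf hPG hP hG hLa hLb hg).frame_readOnly.imp ?_
  rintro s' ⟨h1, h2, h3⟩
  refine ⟨h1, .of_writes (fun x hx => ?_) h2 h3⟩
  rcases writes_sweep hx with ⟨i, h4, -, e⟩ | ⟨i, h4, h5, e⟩
  · exact Or.inl ⟨i, h4, e⟩
  · exact Or.inr ⟨i, ⟨h4, h5⟩, e⟩

theorem ends_reverse_frame {r r' X : ℕ} {A : Set ℕ} (hX : X = d.H + 3) (hs : Loaded d s)
    (hr : r + k ≤ r' ∨ r' + k ≤ r) (hA : Digits d.U k (fun j => s.reg (Var.v (r + j))) A) :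
    (reverse k r r').Ends d.w d.hi d.hi X s fun s' =>
      Digits d.U k (fun j => s'.reg (Var.v (r' + j))) (HeavyLayout.reflect (d.U * k) A) ∧
      Frame (Set.Ico r (r + k) ∪ Set.Ico r' (r' + k)) s s' := by
  subst hX
  refine (ends_reverse hs hr hA).frame_readOnly.imp ?_
  rintro s' ⟨h1, h2, h3⟩
  refine ⟨h1, .of_writes (fun x hx => ?_) h2 h3⟩
  rcases writes_reverse hx with ⟨i, h4, -, e⟩ | ⟨i, h4, h5, e⟩ | ⟨i, h4, h5, e⟩
  · exact Or.inl ⟨i, h4, e⟩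
  · exact Or.inr ⟨i, Or.inl ⟨h4, h5⟩, e⟩
  · exact Or.inr ⟨i, Or.inr ⟨h4, h5⟩, e⟩

/-- Componentwise computation of the vector at `r`. -/
def mapDigits (k r : ℕ) (e : ℕ → Expr) : Cmd := rep k fun j => set (.v (r + j)) (e j)

/-- When component `j` is computed, only earlier components of the target have been overwritten. So
the expression may read component `j` of the target vector itself. -/
theorem ends_mapDigits {r X : ℕ} {e : ℕ → Expr} {g : ℕ → ℕ} (hX : 1 ≤ X)
    (h : ∀ j < k, ∀ s', (∀ i, s'.reg (.s i) = s.reg (.s i)) → Frame (Set.Ico r (r + j)) s s' →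
      (e j).Safe d.w d.hi s' ∧ (e j).eval d.w s' = g j) :
    (mapDigits k r e).Ends d.w d.hi d.hi X s fun s' =>
      (∀ j < k, s'.reg (Var.v (r + j)) = g j) ∧ Frame (Set.Ico r (r + k)) s s' := by
  refine ends_rep (I := fun j s' => (∀ i < j, s'.reg (Var.v (r + i)) = g i) ∧
    Frame (Set.Ico r (r + j)) s s' ∧ ∀ i, s'.reg (.s i) = s.reg (.s i)) ?_ ?_ |>.imp
      fun _ h => ⟨h.1, h.2.1⟩
  · rintro j s1 hj ⟨i1, i2, i3⟩
    obtain ⟨h1, h2⟩ := h j hj s1 i3 i2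
    refine ends_set hX h1 ⟨fun i hi => ?_, ⟨fun i hi => ?_, fun i hi => ?_, i2.mem⟩, by simpa⟩
    · rcases Nat.lt_succ_iff_lt_or_eq.1 hi with h | rfl
      · simpa [show i ≠ j by omega] using i1 i h
      · simpa using h2
    · simpa using i2.scalar i hi
    · rw [Set.mem_Ico] at hi
      have := i2.vector i (by rw [Set.mem_Ico]; omega)
      simpa [show i ≠ r + j by omega] using this
  · exact ⟨by simp, ⟨fun _ _ => rfl, fun _ _ => rfl, rfl⟩, fun _ => rfl⟩

/-- The vector at `r` becomes the union of the vector at `a` and the intersection of the vector at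
`b` with a row of a table. -/
theorem ends_orAnd {r a b f X : ℕ} {A B C : Set ℕ} (hX : 1 ≤ X) (hs : Loaded d s)
    (ha : a = r ∨ a + k ≤ r ∨ r + k ≤ a) (hb : b = r ∨ b + k ≤ r ∨ r + k ≤ b) (hf : f < 13)
    (hA : Digits d.U k (fun j => s.reg (Var.v (a + j))) A)
    (hB : Digits d.U k (fun j => s.reg (Var.v (b + j))) B)
    (hC : Digits d.U k (tableDigit d s.mem f 0) C) :
    (mapDigits k r fun j => (Var.v (a + j) : Expr) ||| ((Var.v (b + j) : Expr) &&& row k f 0 j)).Ends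
      d.w d.hi d.hi X s fun s' =>
        Digits d.U k (fun j => s'.reg (Var.v (r + j))) (A ∪ B ∩ C) ∧
        Frame (Set.Ico r (r + k)) s s' := by
  refine (ends_mapDigits (g := fun j => s.reg (.v (a + j)) |||
    (s.reg (.v (b + j)) &&& tableDigit d s.mem f 0 j)) hX fun j hj s' _ h => ?_).imp fun s' h =>
      ⟨(hA.or (hB.and hC)).congr h.1 fun _ _ => Iff.rfl, h.2⟩
  have h0 := d.L_pos
  have h1 := (h.loaded hs).hL
  have h2 := h.vector (a + j) (by rw [Set.mem_Ico]; omega)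
  have h3 := h.vector (b + j) (by rw [Set.mem_Ico]; omega)
  constructor
  · simpa using safe_row h1 (t := 0) (by simp) (by simp) hf (by omega) hj
  · simp [eval_row h1 (t := 0) (e := 0) (by simp) hf (by omega) hj, h2, h3, h.mem, tableDigit]

/-- The vector at `r` becomes the intersection of the vector at `b` with a row of a table. -/
theorem ends_and {r b f X t : ℕ} {e : Expr} {B C : Set ℕ} (hX : 1 ≤ X) (hs : Loaded d s)
    (hb : b = r ∨ b + k ≤ r ∨ r + k ≤ b) (hf : f < 13) (ht : t < d.L)
    (he : ∀ s', (∀ i, s'.reg (.s i) = s.reg (.s i)) → e.Safe d.w d.hi s' ∧ e.eval d.w s' = t)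
    (hB : Digits d.U k (fun j => s.reg (Var.v (b + j))) B)
    (hC : Digits d.U k (tableDigit d s.mem f t) C) :
    (mapDigits k r fun j => (Var.v (b + j) : Expr) &&& row k f e j).Ends
      d.w d.hi d.hi X s fun s' =>
        Digits d.U k (fun j => s'.reg (Var.v (r + j))) (B ∩ C) ∧
        Frame (Set.Ico r (r + k)) s s' := by
  refine (ends_mapDigits (g := fun j => 
    (s.reg (.v (b + j)) &&& tableDigit d s.mem f t j)) hX fun j hj s' hsc h => ?_).imp fun s' h =>
      ⟨(hB.and hC).congr h.1 fun _ _ => Iff.rfl, h.2⟩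
  have h1 := (h.loaded hs).hL
  have h3 := h.vector (b + j) (by rw [Set.mem_Ico]; omega)
  obtain ⟨e1, e2⟩ := he s' hsc
  constructor
  · simpa using safe_row h1 e2 e1 hf ht hj
  · simp [eval_row h1 e2 hf ht hj, h3, h.mem, tableDigit]

/-- The program of the operation `Close`. -/
def closeCmd (k : ℕ) : Cmd :=
  locate ;;
  -- The vectors at `0` and `k` hold the start and accepting states, the one at `2 * k + 1` the
  -- upward sweep, those at `3 * k + 1` and `4 * k + 1` the seeds of the downward sweep and their
  -- reflection. Register `2 * k` is the argument register of the other operations.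
  (mapDigits k (2 * k + 1) fun j =>
    (Var.v (k + j) : Expr) ||| ((Var.v (0 + j) : Expr) &&& row k 8 0 j)) ;;
  sweep k 0 (2 * k + 1) ;;
  (mapDigits k (3 * k + 1) fun j =>
    (Var.v (0 + j) : Expr) ||| ((Var.v (2 * k + 1 + j) : Expr) &&& row k 10 0 j)) ;;
  reverse k (3 * k + 1) (4 * k + 1) ;;
  sweep k 4 (4 * k + 1) ;;
  reverse k (4 * k + 1) (3 * k + 1) ;;
  -- Row `9` removes the hubs, which are not states.
  (mapDigits k 0 fun j => (Var.v (3 * k + 1 + j) : Expr) &&& row k 9 0 j) ;;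
  (mapDigits k k fun j => (Var.v (2 * k + 1 + j) : Expr) &&& row k 9 0 j) ;;
  (mapDigits k k fun j =>
    (Var.v (k + j) : Expr) ||| ((Var.v (0 + j) : Expr) &&& row k 8 0 j))

section

variable {w : ℕ} {R : RegEx (BitVec w)} {σ : Set ℕ}

theorem upSeeds_eq : R.ends (fun x => 2 * x + 1 ∈ σ) ∪ R.ends (fun x => 2 * x ∈ σ) ∩
    R.ends (fun x => (R.node x).sub.null = true) =
    slotPos (fun x => (R.node x).pos) '' R.upSeeds σ := by
  rw [RegEx.ends_inter, RegEx.ends_union]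
  ext p
  constructor
  · rintro ⟨x, hx, h, rfl⟩
    exact ⟨(x, false), ⟨rfl, hx, h⟩, by simp [slotPos, RegEx.endPos]⟩
  · rintro ⟨⟨x, b⟩, ⟨rfl, hx, h⟩, rfl⟩
    exact ⟨x, hx, h, by simp [slotPos, RegEx.endPos]⟩

theorem upSet_lt {τ : ℕ × Bool} (h : τ ∈ R.upSet σ) : τ.1 < R.size := by
  obtain ⟨ρ, h1, h2⟩ := h
  induction h2 with
  | refl => exact h1.2.1
  | tail _ h _ =>
    obtain ⟨p, hp, -⟩ := h.cases
    have hL := R.heavyLayout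
    cases h with
    | hub p h hh hc => exact (hL.heavy_lt p h hh).2
    | out p hp hc hg => exact hp
    | heavy p h hh hc => exact (hL.heavy_lt p h hh).2
    | lightHub p l hl hc => exact (hL.light_lt p l hl).2
    | light p l hl hc => exact (hL.light_lt p l hl).2

theorem downSet_lt {τ : ℕ × Bool} (h : τ ∈ R.downSet σ) : τ.1 < R.size := by
  obtain ⟨ρ, h1, h2⟩ := h
  induction h2 with
  | refl => exact h1.1
  | tail _ h _ =>
    have hL := R.heavyLayout
    cases h with
    | hub p h hh hc => exact (hL.heavy_lt p h hh).1.trans (hL.heavy_lt p h hh).2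
    | out p hp hc hg => exact hp
    | heavy p h hh hc => exact (hL.heavy_lt p h hh).1.trans (hL.heavy_lt p h hh).2
    | lightHub p l hl hc => exact (hL.light_lt p l hl).1.trans (hL.light_lt p l hl).2
    | light p l hl hc => exact (hL.light_lt p l hl).1.trans (hL.light_lt p l hl).2

/-- The row of hub positions selects from the upward result precisely the turning points; its end
slots are accepting states and must not be mistaken for start states. -/
theorem downSeeds_eq : R.ends (fun x => 2 * x ∈ σ) ∪
    slotPos (fun x => (R.node x).pos) '' R.upSet σ ∩ {p | ∃ x < R.size, p = 4 * (R.node x).pos} =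
    slotPos (fun x => (R.node x).pos) '' R.downSeeds σ := by
  ext p
  constructor
  · rintro (⟨x, hx, h, rfl⟩ | ⟨⟨⟨x, b⟩, h1, rfl⟩, ⟨y, hy, h2⟩⟩)
    · exact ⟨(x, false), ⟨hx, Or.inl ⟨rfl, h⟩⟩, by simp [slotPos, RegEx.endPos]⟩
    · cases b
      · simp [slotPos] at h2; omega
      · exact ⟨(x, true), ⟨upSet_lt h1, Or.inr ⟨rfl, h1⟩⟩, rfl⟩
  · rintro ⟨⟨x, b⟩, ⟨hx, ⟨rfl, h⟩ | ⟨rfl, h⟩⟩, rfl⟩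
    · exact Or.inl ⟨x, hx, h, by simp [slotPos, RegEx.endPos]⟩
    · exact Or.inr ⟨⟨(x, true), h, rfl⟩, ⟨x, hx, by simp [slotPos]⟩⟩

theorem image_slotPos_inter_ends {V : Set (ℕ × Bool)} (hV : ∀ τ ∈ V, τ.1 < R.size) :
    slotPos (fun x => (R.node x).pos) '' V ∩ R.ends (fun _ => True) =
      R.ends fun x => (x, false) ∈ V := by
  ext p
  constructor
  · rintro ⟨⟨⟨x, b⟩, h1, rfl⟩, ⟨y, hy, -, h2⟩⟩
    cases b
    · exact ⟨x, hV _ h1, h1, by simp [slotPos, RegEx.endPos]⟩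
    · simp [slotPos, RegEx.endPos] at h2; omega
  · rintro ⟨x, hx, h, rfl⟩
    exact ⟨⟨(x, false), h, by simp [slotPos, RegEx.endPos]⟩, ⟨x, hx, trivial, rfl⟩⟩

theorem slotPos_lt {τ : ℕ × Bool} (h : τ.1 < R.size) :
    slotPos (fun x => (R.node x).pos) τ < 4 * R.size := by
  have : (R.node τ.1).pos < R.size := RegEx.pos_lt h
  simp only [slotPos]
  split_ifs <;> omega

theorem reflect_image {N : ℕ} {V : Set (ℕ × Bool)} (hN : 4 * R.size ≤ N)
    (hV : ∀ τ ∈ V, τ.1 < R.size) : reflect N (slotPos (fun x => (R.node x).pos) '' V) =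
      (fun τ => N - 1 - slotPos (fun x => (R.node x).pos) τ) '' V := by
  ext p
  constructor
  · rintro ⟨h1, τ, h2, h3⟩
    exact ⟨τ, h2, by simp only at h3 ⊢; omega⟩
  · rintro ⟨τ, h2, rfl⟩
    have := slotPos_lt (hV τ h2)
    exact ⟨by simp only; omega, τ, h2, by simp only; omega⟩

theorem reflect_image' {N : ℕ} {V : Set (ℕ × Bool)} (hN : 4 * R.size ≤ N)
    (hV : ∀ τ ∈ V, τ.1 < R.size) :
    reflect N ((fun τ => N - 1 - slotPos (fun x => (R.node x).pos) τ) '' V) =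
      slotPos (fun x => (R.node x).pos) '' V := by
  ext p
  constructor
  · rintro ⟨h1, τ, h2, h3⟩
    have := slotPos_lt (hV τ h2)
    exact ⟨τ, h2, by simp only at h3 ⊢; omega⟩
  · rintro ⟨τ, h2, rfl⟩
    have := slotPos_lt (hV τ h2)
    exact ⟨by omega, τ, h2, by simp only⟩

theorem ends_close (hR : R.size = d.n) (hH : Nat.log 2 R.numStates = d.H)
    (hs : IsStored d R s.mem) (hσ : ∀ u ∈ σ, u < 2 * R.size) (hv : HoldsNums d R σ s) :
    (closeCmd k).Ends d.w d.hi d.hi (d.H + 3) s (HoldsNums d R (R.closeNum σ)) := by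
  have hk := d.k_pos
  have hN : 4 * R.size ≤ d.U * k := hR ▸ d.four_n_le
  have hL := R.heavyLayout
  rw [hH] at hL
  refine .seq ((ends_locate hR hs.tree hs.consts).frame_readOnly.imp ?_)
  rintro s1 ⟨l1, h1, m1⟩
  have hv1 : ∀ i, s1.reg (.v i) = s.reg (.v i) := fun i => h1 _ fun h => by
    obtain ⟨j, -, e⟩ := writes_locate h
    simp at e
  rw [← m1] at hs
  have T1 : Digits d.U k (fun j => s1.reg (.v (0 + j))) (R.ends fun x => 2 * x ∈ σ) :=
    hv.1.congr (fun j hj => by simp [hv1]) fun _ _ => Iff.rfl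
  have F1 : Digits d.U k (fun j => s1.reg (.v (k + j))) (R.ends fun x => 2 * x + 1 ∈ σ) :=
    hv.2.congr (fun j hj => by simp [hv1]) fun _ _ => Iff.rfl
  clear hv h1 hv1 m1
  refine .seq ((ends_orAnd (by omega) l1 (by omega) (by omega) (by omega) F1 T1
    hs.tables.null).imp ?_)
  rintro s2 ⟨A2, f2⟩
  -- From here the program is followed alongside the sets: after each command the contents of the
  -- vector are rewritten as the image of a set of slots.
  rw [upSeeds_eq] at A2
  rw [← f2.mem] at hs
  have T2 := f2.digits (r := 0) (by simp; omega) T1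
  have l2 := f2.loaded l1
  refine .seq ((ends_sweep_frame rfl l2 (by omega)
    (fun t q => pathSlots_disjoint _ _) hs.tables.upPath hs.tables.upGuard
    hs.tables.upLightHub hs.tables.upLight A2).imp ?_)
  rintro s3 ⟨A3, f3⟩
  rw [sweep_up hL (fun x h => by
    cases hx : (R.node x).sub <;> simp_all [RegEx.upGuard, RegEx.upHub])
    _ (fun σ h => h.2.1)] at A3
  replace A3 : Digits d.U k (fun j => s3.reg (Var.v (2 * k + 1 + j)))
    (slotPos (fun x => (R.node x).pos) '' R.upSet σ) := A3
  rw [← f3.mem] at hs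
  have T3 := f3.digits (r := 0) (by simp; omega) T2
  have l3 := f3.loaded l2
  refine .seq ((ends_orAnd (by omega) l3 (by omega) (by omega) (by omega) T3 A3
    hs.tables.hub).imp ?_)
  rintro s4 ⟨B4, f4⟩
  rw [downSeeds_eq] at B4
  rw [← f4.mem] at hs
  have A4 := f4.digits (r := 2 * k + 1) (by simp; omega) A3
  have l4 := f4.loaded l3
  refine .seq ((ends_reverse_frame rfl l4 (by omega) B4).imp ?_)
  rintro s5 ⟨B5, f5⟩
  rw [reflect_image hN fun τ h => h.1] at B5
  rw [← f5.mem] at hs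
  have A5 := f5.digits (r := 2 * k + 1) (by simp; omega) A4
  have l5 := f5.loaded l4
  refine .seq ((ends_sweep_frame rfl l5 (by omega) (fun t q h h' => ?_) hs.tables.downPath
    hs.tables.downGuard hs.tables.downLightHub hs.tables.downLight B5).imp ?_)
  · exact pathSlots_disjoint _ _ h.2 h'.2
  rintro s6 ⟨B6, f6⟩
  rw [sweep_down hL (fun x h => by
    cases hx : (R.node x).sub <;> simp_all [RegEx.downGuard, RegEx.downHub]) hN
    _ (fun σ h => h.1)] at B6
  replace B6 : Digits d.U k (fun j => s6.reg (Var.v (4 * k + 1 + j)))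
    ((fun τ => d.U * k - 1 - slotPos (fun x => (R.node x).pos) τ) '' R.downSet σ) := B6
  rw [← f6.mem] at hs
  have A6 := f6.digits (r := 2 * k + 1) (by simp; omega) A5
  have l6 := f6.loaded l5
  refine .seq ((ends_reverse_frame rfl l6 (by omega) B6).imp ?_)
  rintro s7 ⟨B7, f7⟩
  -- Reflecting twice gives back the original positions, as all slots lie below `U * k`.
  rw [reflect_image' hN fun τ h => downSet_lt h] at B7
  rw [← f7.mem] at hs
  have A7 := f7.digits (r := 2 * k + 1) (by simp; omega) A6
  have l7 := f7.loaded l6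
  refine .seq ((ends_and (t := 0) (by omega) l7 (by omega) (by omega) (by have := d.L_pos; omega)
    (by simp) B7 hs.tables.all).imp ?_)
  rintro s8 ⟨T8, f8⟩
  rw [image_slotPos_inter_ends fun τ h => downSet_lt h] at T8
  rw [← f8.mem] at hs
  have A8 := f8.digits (r := 2 * k + 1) (by simp; omega) A7
  have l8 := f8.loaded l7
  refine .seq ((ends_and (t := 0) (by omega) l8 (by omega) (by omega) (by have := d.L_pos; omega)
    (by simp) A8 hs.tables.all).imp ?_)
  rintro s9 ⟨F9, f9⟩
  rw [image_slotPos_inter_ends fun τ h => upSet_lt h] at F9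
  rw [← f9.mem] at hs
  have T9 := f9.digits (r := 0) (by simp; omega) T8
  have l9 := f9.loaded l8
  refine (ends_orAnd (by omega) l9 (by omega) (by omega) (by omega) F9 T9 hs.tables.null).imp ?_
  rintro s10 ⟨F10, f10⟩
  have T10 := f10.digits (r := 0) (by simp; omega) T9
  rw [RegEx.ends_inter, RegEx.ends_union] at F10
  rw [← RegEx.sweepSet_eq hσ]
  constructor
  · rw [RegEx.ends_congr R fun x hx => RegEx.start_mem_sweepSet hx]
    simpa using T10
  · rwa [RegEx.ends_congr R fun x hx => RegEx.accept_mem_sweepSet hx]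

end

end WordRAM


/-! ### The operations `Member`, `Insert` and `Move`. -/

namespace WordRAM

open BitSet Cmd HeavyLayout

variable {k : ℕ} {d : Dims k} {s : St}

/-- The program of the operation `Member`. -/
def memberCmd (k : ℕ) : Cmd :=
  locate ;;
  set vT ((Var.v (2 * k) : Expr) >>> (1 : Expr)) ;;
  set vX 0 ;;
  ite 0 ((Var.v (2 * k) : Expr) &&& 1)
    (rep k fun j => set vX ((vX : Expr) ||| ((Var.v (k + j) : Expr) &&& row k 11 vT j)))
    (rep k fun j => set vX ((vX : Expr) ||| ((Var.v (0 + j) : Expr) &&& row k 11 vT j))) ;;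
  ite 0 vX (set (.v 0) 1) (set (.v 0) 0)

/-- The program of the operation `Insert`. -/
def insertCmd (k : ℕ) : Cmd :=
  locate ;;
  set vT ((Var.v (2 * k) : Expr) >>> (1 : Expr)) ;;
  ite 0 ((Var.v (2 * k) : Expr) &&& 1)
    (mapDigits k k fun j => (Var.v (k + j) : Expr) ||| row k 11 vT j)
    (mapDigits k 0 fun j => (Var.v (0 + j) : Expr) ||| row k 11 vT j)

theorem locate_ends {w : ℕ} {R : RegEx (BitVec w)} (hR : R.size = d.n) (hs : IsStored d R s.mem) :
    locate.Ends d.w d.hi d.hi (d.H + 3) s fun s' => Loaded d s' ∧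
      (∀ i, s'.reg (.v i) = s.reg (.v i)) ∧ s'.mem = s.mem :=
  (ends_locate hR hs.tree hs.consts).frame_readOnly.imp fun s' h =>
    ⟨h.1, fun i => h.2.1 _ fun h => by
      obtain ⟨j, -, e⟩ := writes_locate h
      simp at e, h.2.2⟩

theorem or_pos_iff {a b : ℕ} : 0 < a ||| b ↔ 0 < a ∨ 0 < b := by
  simp only [Nat.pos_iff_ne_zero, ne_eq, Nat.or_eq_zero_iff]
  tauto

/-- The vectors at `r` and in row `x` of the table of singletons intersect. -/
theorem ends_meet {w : ℕ} {R : RegEx (BitVec w)} {X r x : ℕ} {P : ℕ → Prop} (hX : 1 ≤ X)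
    (hR : R.size = d.n)
    (hs : Loaded d s) (hx : s.reg vT = x) (hxn : x < d.n) (h0 : s.reg vX = 0)
    (hA : Digits d.U k (fun j => s.reg (Var.v (r + j))) (R.ends P))
    (hC : Digits d.U k (tableDigit d s.mem 11 x) (R.ends fun y => y = x)) :
    (rep k fun j => set vX ((vX : Expr) ||| ((Var.v (r + j) : Expr) &&& row k 11 vT j))).Ends
      d.w d.hi d.hi X s fun s' => 0 < s'.reg vX ↔ P x := by
  have hxL : x < d.L := hxn.trans d.n_lt
  refine (ends_rep (I := fun j s' => s'.reg vL = d.L ∧ s'.reg vT = x ∧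
    (∀ i, s'.reg (.v i) = s.reg (.v i)) ∧ s'.mem = s.mem ∧ (0 < s'.reg vX ↔ ∃ i < j,
      0 < s.reg (.v (r + i)) &&& tableDigit d s.mem 11 x i)) ?_ ?_).imp ?_
  · rintro j s1 hj ⟨i1, i2, i3, i4, i5⟩
    refine ends_set hX ?_ ⟨by simpa using i1, by simpa using i2, by simpa using i3, i4, ?_⟩
    · simpa using safe_row i1 (e := vT) (by simpa using i2) (by simp) (by omega) hxL hj
    · simp only [Expr.eval_or, Expr.eval_var, Expr.eval_and, eval_row i1 (e := vT) (by simpa using i2)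
        (show 11 < 13 by omega) hxL hj, St.set_reg, if_true, or_pos_iff, i5, i3, i4]
      constructor
      · rintro (⟨i, hi, h⟩ | h)
        · exact ⟨i, by omega, h⟩
        · exact ⟨j, by omega, h⟩
      · rintro ⟨i, hi, h⟩
        rcases Nat.lt_succ_iff_lt_or_eq.1 hi with h' | rfl
        · exact Or.inl ⟨i, h', h⟩
        · exact Or.inr h
  · exact ⟨hs.hL, hx, fun _ => rfl, rfl, by simp [h0]⟩
  · rintro s' ⟨-, -, -, -, h⟩
    rw [h]
    have hAC := hA.and hC
    rw [RegEx.ends_inter] at hAC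
    constructor
    · rintro ⟨i, hi, h⟩
      obtain ⟨p, hp⟩ := Nat.exists_testBit_of_ne_zero h.ne'
      obtain ⟨-, y, -, ⟨h1, rfl⟩, -⟩ := (hAC i hi p).1 hp
      exact h1
    · intro h
      -- The witness is the digit containing the end slot of `x`.
      have hp : R.endPos x < d.U * k := (R.endPos_lt (by omega)).trans_le (hR ▸ d.four_n_le)
      have hU : 0 < d.U := by have := d.four_le_U; omega
      refine ⟨R.endPos x / d.U, Nat.div_lt_of_lt_mul hp, ?_⟩
      by_contra hcon
      have := (hAC _ (Nat.div_lt_of_lt_mul hp) (R.endPos x % d.U)).2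
        ⟨Nat.mod_lt _ hU, x, by omega, ⟨h, rfl⟩, Nat.div_add_mod _ _⟩
      beta_reduce at this
      rw [Nat.eq_zero_of_not_pos hcon] at this
      simp at this

section

variable {w : ℕ} {R : RegEx (BitVec w)} {σ : Set ℕ}

theorem ends_member {u : ℕ} (hR : R.size = d.n) (hs : IsStored d R s.mem)
    (hv : HoldsNums d R σ s) (hu : u < 2 * d.n) (ha : s.reg (.v (2 * k)) = u) :
    (memberCmd k).Ends d.w d.hi d.hi (d.H + 3) s fun s' =>
      (u ∈ σ → s'.reg (.v 0) = 1) ∧ (u ∉ σ → s'.reg (.v 0) = 0) := by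
  have hL := d.L_pos
  have e1 := d.mod_eq (x := 1) (by omega)
  refine .seq ((locate_ends hR hs).imp ?_)
  rintro s1 ⟨l1, v1, m1⟩
  have hdiv : u >>> 1 = u / 2 := by simp [Nat.shiftRight_eq_div_pow]
  have key : ∀ (r : ℕ) (P : ℕ → Prop), Digits d.U k (fun j => s.reg (Var.v (r + j))) (R.ends P) →
      (rep k fun j => set vX ((vX : Expr) ||| ((Var.v (r + j) : Expr) &&& row k 11 vT j))).Ends
        d.w d.hi d.hi (d.H + 3) ((s1.set vT (u / 2)).set vX 0) fun s' => 0 < s'.reg vX ↔ P (u / 2) := by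
    intro r P hP
    refine ends_meet (by omega) hR (l1.congr fun i hi => by
      simp [show i ≠ 4 by omega, show i ≠ 7 by omega]) (by simp) (by omega) (by simp)
      (hP.congr (fun j _ => by simp [v1]) fun _ _ => Iff.rfl) ?_
    have := hs.tables.single (u / 2) (by omega)
    rw [← m1] at this
    exact this
  refine .seq (ends_set (by omega) (by simp) (.seq (ends_set (by omega) (by simp) (.seq ?_))))
  simp only [Expr.eval_shr, Expr.eval_var, v1, ha, Expr.eval_ofNat, e1, hdiv, Nat.zero_mod]
  have fin : ∀ s2 : St, (0 < s2.reg vX ↔ u ∈ σ) →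
      (ite 0 (vX : Expr) (set (.v 0) 1) (set (.v 0) 0)).Ends d.w d.hi d.hi (d.H + 3) s2 fun s' =>
      (u ∈ σ → s'.reg (.v 0) = 1) ∧ (u ∉ σ → s'.reg (.v 0) = 0) := by
    intro s2 h
    apply ends_of_wp (by omega)
    simp only [wp, Expr.safe_ofNat, Expr.safe_var, Expr.eval_ofNat, Expr.eval_var, Nat.zero_mod, h,
      St.set_reg, e1, true_and]
    split_ifs with h0 <;> simp [← h, h0]
  refine ends_ite (by omega) (by simp) (by simp) (fun h => ?_) (fun h => ?_)
  · simp [v1, ha, e1, Nat.and_one_is_mod] at h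
    refine (key k _ hv.2).imp fun s2 h2 => fin s2 (h2.trans ?_)
    rw [show 2 * (u / 2) + 1 = u by omega]
  · simp [v1, ha, e1, Nat.and_one_is_mod] at h
    refine (key 0 _ (by simpa using hv.1)).imp fun s2 h2 => fin s2 (h2.trans ?_)
    rw [show 2 * (u / 2) = u by omega]

theorem ends_orRow {r X f t : ℕ} {B C : Set ℕ} (hX : 1 ≤ X) (hs : Loaded d s)
    (hf : f < 13) (ht : t < d.L) (hT : s.reg vT = t)
    (hB : Digits d.U k (fun j => s.reg (Var.v (r + j))) B)
    (hC : Digits d.U k (tableDigit d s.mem f t) C) :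
    (mapDigits k r fun j => (Var.v (r + j) : Expr) ||| row k f vT j).Ends
      d.w d.hi d.hi X s fun s' =>
        Digits d.U k (fun j => s'.reg (Var.v (r + j))) (B ∪ C) ∧
        Frame (Set.Ico r (r + k)) s s' := by
  refine (ends_rep (I := fun j s' => (∀ i < j, s'.reg (Var.v (r + i)) = 
    (s.reg (Var.v (r + i)) ||| tableDigit d s.mem f t i)) ∧ s'.reg vT = t ∧
    Frame (Set.Ico r (r + j)) s s') ?_ ?_).imp fun s' h =>
      ⟨(hB.or hC).congr h.1 fun _ _ => Iff.rfl, h.2.2⟩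
  · rintro j s1 hj ⟨i1, i2, i3⟩
    have h1 := (i3.loaded hs).hL
    have h3 := i3.vector (r + j) (by rw [Set.mem_Ico]; omega)
    refine ends_set hX (by simpa using safe_row h1 (e := vT) (by simpa using i2) (by simp) hf ht hj)
      ⟨fun i hi => ?_, by simpa using i2, ⟨fun i hi => ?_, fun i hi => ?_, i3.mem⟩⟩
    · rcases Nat.lt_succ_iff_lt_or_eq.1 hi with h | rfl
      · simpa [show i ≠ j by omega] using i1 i h
      · simp [h3, eval_row h1 (e := vT) (by simpa using i2) hf ht hj, i3.mem, tableDigit]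
    · simpa using i3.scalar i hi
    · rw [Set.mem_Ico] at hi
      have := i3.vector i (by rw [Set.mem_Ico]; omega)
      simpa [show i ≠ r + j by omega] using this
  · exact ⟨by simp, hT, fun _ _ => rfl, fun _ _ => rfl, rfl⟩

theorem ends_insert {u : ℕ} (hR : R.size = d.n) (hs : IsStored d R s.mem)
    (hv : HoldsNums d R σ s) (hu : u < 2 * d.n) (ha : s.reg (.v (2 * k)) = u) :
    (insertCmd k).Ends d.w d.hi d.hi (d.H + 3) s (HoldsNums d R (σ ∪ {u})) := by
  have hL := d.L_pos
  have e1 := d.mod_eq (x := 1) (by omega)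
  have hxL : u / 2 < d.L := by have : d.n < d.L := d.n_lt; omega
  refine .seq ((locate_ends hR hs).imp ?_)
  rintro s1 ⟨l1, v1, m1⟩
  have hdiv : u >>> 1 = u / 2 := by simp [Nat.shiftRight_eq_div_pow]
  have hrow := hs.tables.single (u / 2) (by omega)
  rw [← m1] at hrow
  refine .seq (ends_set (by omega) (by simp) ?_)
  simp only [Expr.eval_shr, Expr.eval_var, v1, ha, Expr.eval_ofNat, e1, hdiv]
  have l2 : Loaded d (s1.set vT (u / 2)) := l1.congr fun i hi => by simp [show i ≠ 4 by omega]
  refine ends_ite (by omega) (by simp) (by simp) (fun h => ?_) (fun h => ?_)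
  · simp [v1, ha, e1, Nat.and_one_is_mod] at h
    refine (ends_orRow (by omega) l2 (by omega) hxL (by simp) (hv.2.congr (fun j _ => by simp [v1])
      fun _ _ => Iff.rfl) hrow).imp ?_
    rintro s2 ⟨h2, f2⟩
    rw [RegEx.ends_union] at h2
    constructor
    · refine hv.1.congr (fun j hj => ?_) fun p _ => ?_
      · rw [f2.vector j (by simp; omega)]; simp [v1]
      · rw [RegEx.ends_congr R fun x _ => ?_]
        simp only [Set.mem_union, Set.mem_singleton_iff]
        exact ⟨Or.inl, fun h => h.resolve_right (by omega)⟩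
    · rw [RegEx.ends_congr R fun x _ => ?_]
      · exact h2
      · simp only [Set.mem_union, Set.mem_singleton_iff]
        exact or_congr_right (by omega)
  · simp [v1, ha, e1, Nat.and_one_is_mod] at h
    have hv1 : Digits d.U k (fun j => s.reg (.v (0 + j))) (R.ends fun x => 2 * x ∈ σ) := by
      simpa using hv.1
    refine (ends_orRow (by omega) l2 (by omega) hxL (by simp) (hv1.congr (fun j _ => by simp [v1])
      fun _ _ => Iff.rfl) hrow).imp ?_
    rintro s2 ⟨h2, f2⟩
    rw [RegEx.ends_union] at h2
    constructor
    · rw [RegEx.ends_congr R fun x _ => ?_]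
      · simpa using h2
      · simp only [Set.mem_union, Set.mem_singleton_iff]
        exact or_congr_right (by omega)
    · refine hv.2.congr (fun j hj => ?_) fun p _ => ?_
      · rw [f2.vector (k + j) (by simp)]; simp [v1]
      · rw [RegEx.ends_congr R fun x _ => ?_]
        simp only [Set.mem_union, Set.mem_singleton_iff]
        exact ⟨Or.inl, fun h => h.resolve_right (by omega)⟩

/-- Key of the node with rank `e`. -/
def keyExpr (e : Expr) : Expr := .load (3 * .load (7 * (vL : Expr) + e) + 1)

/-- The program of the operation `Move`. -/
def moveCmd (k : ℕ) : Cmd :=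
  locate ;;
  set vT 0 ;;
  set vX ((vL : Expr) >>> (1 : Expr)) ;;
  loop 0 vX (
    set vY ((vT : Expr) + vX) ;;
    ite (Var.v (2 * k)) (keyExpr vY) skip (set vT vY) ;;
    set vX ((vX : Expr) >>> (1 : Expr))) ;;
  -- Two comparisons exclude inequality, so the row of the table is used only if the key found is
  -- the character itself.
  ite (keyExpr vT) (Var.v (2 * k)) (mapDigits k k fun _ => 0)
    (ite (Var.v (2 * k)) (keyExpr vT) (mapDigits k k fun _ => 0)
      (mapDigits k k fun j => (Var.v (0 + j) : Expr) &&& row k 12 vT j)) ;;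
  (mapDigits k 0 fun _ => 0)

theorem eval_keyExpr {e : Expr} {t : ℕ} {mem : ℕ → ℕ} (hL : s.reg vL = d.L)
    (ho : HasOrder d mem) (hm : s.mem = mem)
    (he : e.eval d.w s = t) (hs : e.Safe d.w d.hi s) (ht : t < d.L) :
    (keyExpr e).eval d.w s = key mem (mem (7 * d.L + t)) ∧ (keyExpr e).Safe d.w d.hi s := by
  have h1 := ho.lt t ht
  have h2 : d.n < d.L := d.n_lt
  have h3 := d.le_hi
  have e1 := d.mod_eq (x := 1) (by omega)
  have e3 := d.mod_eq (x := 3) (by omega)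
  have e7 := d.mod_eq (x := 7) (by omega)
  have e4 := d.mod_eq (x := 7 * d.L) (by omega)
  have e5 := d.mod_eq (x := 7 * d.L + t) (by omega)
  have e6 := d.mod_eq (x := 3 * mem (7 * d.L + t)) (by omega)
  have e8 := d.mod_eq (x := 3 * mem (7 * d.L + t) + 1) (by omega)
  constructor
  · simp [keyExpr, key, hL, he, hm, e1, e3, e4, e5, e6, e7, e8]
  · simp [keyExpr, hL, he, hm, e1, e3, e4, e5, e6, e7, e8, hs]
    omega

theorem ends_zero {r X : ℕ} (hX : 1 ≤ X) :
    (mapDigits k r fun _ => 0).Ends d.w d.hi d.hi X s fun s' =>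
        Digits d.U k (fun j => s'.reg (Var.v (r + j))) ∅ ∧ Frame (Set.Ico r (r + k)) s s' := by
  refine (ends_mapDigits (g := fun _ => 0) hX (by simp)).imp ?_
  rintro s' ⟨h1, h2⟩
  exact ⟨fun j hj i => by simp [h1 j hj], h2⟩

/-- The binary search ends at the last rank whose key is at most the character, or at rank `0`. If
the keys agree, all leaves with the character have rank at most this one, so the stored row contains
all of them. Both states of a leaf share the same place in their vectors; hence the intersection
with the start states is stored directly as the vector of accepting states. -/
theorem ends_move {a : BitVec w} (hR : R.size = d.n) (hs : IsStored d R s.mem)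
    (hv : HoldsNums d R σ s) (ha : s.reg (.v (2 * k)) = a.toNat) :
    (moveCmd k).Ends d.w d.hi d.hi (d.H + 3) s
      (HoldsNums d R {v | ∃ u ∈ σ, R.NumTrans (some a) u v}) := by
  have hL := d.L_pos
  have hk := d.k_pos
  have e1 := d.mod_eq (x := 1) (by omega)
  obtain ⟨A, hA⟩ : ∃ A : ℕ → ℕ, A = fun t => s.mem (7 * d.L + t) := ⟨_, rfl⟩
  refine .seq ((locate_ends hR hs).imp ?_)
  rintro s1 ⟨l1, v1, m1⟩
  refine .seq (ends_set (by omega) (by simp) (.seq (ends_set (by omega) (by simp) (.seq ?_))))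
  -- The candidates form a window of length `2 ^ (H - i)` beginning at `vT`. All later keys are too
  -- large, and the key at `vT` is not, unless `vT` has never moved.
  refine (ends_loop (N := d.H) (X' := 1) (I := fun i s' => Loaded d s' ∧ s'.mem = s.mem ∧
    (∀ j, s'.reg (.v j) = s.reg (.v j)) ∧ s'.reg vX = 2 ^ (d.H - i) / 2 ∧
    s'.reg vT + 2 ^ (d.H - i) ≤ d.L ∧
    (s'.reg vT = 0 ∨ key s.mem (A (s'.reg vT)) ≤ a.toNat) ∧
    (∀ t, s'.reg vT + 2 ^ (d.H - i) ≤ t → t < d.L → a.toNat < key s.mem (A t)))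
    le_rfl (by omega) (fun _ _ _ _ => by simp) ?_ ?_ ?_).imp ?_
  · rintro i s2 hi ⟨-, -, -, i4, -⟩
    simp [i4]
    constructor
    · intro h
      by_contra hcon
      simp [show d.H - i = 0 by omega] at h
    · intro h
      obtain ⟨e, he⟩ : ∃ e, d.H - i = e + 1 := ⟨d.H - i - 1, by omega⟩
      rw [he, pow_succ]
      have : 0 < 2 ^ e := by positivity
      omega
  · rintro i s2 hi ⟨i1, i2, i3, i4, i5, i6, i7⟩
    obtain ⟨e, he⟩ : ∃ e, d.H - i = e + 1 := ⟨d.H - i - 1, by omega⟩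
    have hpos : 0 < 2 ^ e := by positivity
    rw [he, pow_succ] at i4 i5 i7
    rw [show d.H - (i + 1) = e by omega]
    have ey : (s2.reg vT + s2.reg vX) % 2 ^ d.w = s2.reg vT + 2 ^ e := by
      rw [i4, d.mod_eq (by omega)]; omega
    refine .seq (ends_set le_rfl (by simp) ?_)
    simp only [Expr.eval_add, Expr.eval_var, ey]
    obtain ⟨k1, k2⟩ := eval_keyExpr (s := s2.set vY (s2.reg vT + 2 ^ e)) (e := vY)
      (t := s2.reg vT + 2 ^ e) (by simpa using i1.hL) hs.order i2 (by simp) (by simp) (by omega)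
    have step : ∀ s3 : St, s3.reg vX = s2.reg vX → Loaded d s3 → s3.mem = s2.mem →
        (∀ j, s3.reg (.v j) = s2.reg (.v j)) →
        s3.reg vT + 2 ^ e ≤ d.L → (s3.reg vT = 0 ∨ key s.mem (A (s3.reg vT)) ≤ a.toNat) →
        (∀ t, s3.reg vT + 2 ^ e ≤ t → t < d.L → a.toNat < key s.mem (A t)) →
        (set vX ((vX : Expr) >>> (1 : Expr))).Ends d.w d.hi d.hi 1 s3 fun s' => Loaded d s' ∧ s'.mem = s.mem ∧
          (∀ j, s'.reg (.v j) = s.reg (.v j)) ∧ s'.reg vX = 2 ^ e / 2 ∧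
          s'.reg vT + 2 ^ e ≤ d.L ∧
          (s'.reg vT = 0 ∨ key s.mem (A (s'.reg vT)) ≤ a.toNat) ∧
          (∀ t, s'.reg vT + 2 ^ e ≤ t → t < d.L → a.toNat < key s.mem (A t)) := by
      intro s3 j1 j2 j3 j4 j5 j6 j7
      refine ends_set le_rfl (by simp) ⟨j2.congr fun i hi => by simp [show i ≠ 7 by omega],
        j3.trans i2, fun j => by simp [j4, i3], ?_, by simpa using j5, by simpa using j6,
        by simpa using j7⟩
      simp [j1, i4, e1, Nat.shiftRight_eq_div_pow]
    refine .seq (ends_ite le_rfl (by simp) k2 (fun h => ?_) (fun h => ?_))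
    · rw [k1] at h
      refine ends_skip (step _ (by simp) (i1.congr fun i hi => by simp [show i ≠ 8 by omega]) rfl
        (fun j => by simp) (by simp; omega) (by simpa using i6) ?_)
      intro t h1 h2
      simp only [Expr.eval_var, St.set_reg, reduceCtorEq, if_false, i3, ha] at h
      have := hs.order.mono (s2.reg vT + 2 ^ e) t (by simpa using h1) h2
      simp only [hA]
      omega
    · rw [k1] at h
      simp only [Expr.eval_var, St.set_reg, reduceCtorEq, if_false, i3, ha] at h
      refine ends_set le_rfl (by simp) (step _ (by simp) (i1.congr fun i hi => by
        simp [show i ≠ 8 by omega, show i ≠ 4 by omega]) rfl (fun j => by simp) ?_ ?_ ?_)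
      · simp; omega
      · right
        simp [hA]
        omega
      · intro t h1 h2
        refine i7 t ?_ h2
        simp at h1
        omega
  · refine ⟨l1.congr fun i hi => by simp [show i ≠ 7 by omega, show i ≠ 4 by omega], m1,
      fun j => by simp [v1], ?_, ?_, ?_, ?_⟩
    · simp [l1.hL, e1, Nat.shiftRight_eq_div_pow, Dims.L]
    · simp [Dims.L]
    · simp
    · intro t h1 h2
      simp only [St.set_reg] at h1
      simp [← show d.L = 2 ^ d.H from rfl] at h1
      omega
  rintro s2 ⟨l2, m2, v2, -, h1, h2, h3⟩
  rw [Nat.sub_self, pow_zero] at h1 h3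
  obtain ⟨t, ht⟩ : ∃ t, t = s2.reg vT := ⟨_, rfl⟩
  rw [← ht] at h1 h2 h3
  obtain ⟨k1, k2⟩ := eval_keyExpr (s := s2) (e := vT) (t := t) l2.hL hs.order m2
    (by simp [ht]) (by simp) (by omega)
  rw [show s.mem (7 * d.L + t) = A t by rw [hA]] at k1
  -- the vector of accepting states of the answer
  have fin : ∀ s3 : St, Digits d.U k (fun j => s3.reg (Var.v (k + j)))
      (R.ends fun x => (R.node x).sub = .char a ∧ 2 * x ∈ σ) →
      (mapDigits k 0 fun _ => 0).Ends d.w d.hi d.hi (d.H + 3) s3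
      (HoldsNums d R {v | ∃ u ∈ σ, R.NumTrans (some a) u v}) := by
    intro s3 hF
    refine (ends_zero (by omega)).imp ?_
    rintro s4 ⟨h4, f4⟩
    -- Only leaves carry labelled transitions, from their start to their accepting state; so no
    -- start state occurs in the answer.
    have hloc : ∀ u v, R.NumTrans (some a) u v →
        ∃ x < R.size, (R.node x).sub = .char a ∧ u = 2 * x ∧ v = 2 * x + 1 := by
      rintro u v ⟨p, hp, h⟩
      rw [RegEx.LocalTrans] at h
      split at h <;> simp at h
      next b hb =>
        obtain ⟨rfl, h⟩ := h
        exact ⟨p, hp, hb, h.1, h.2⟩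
    constructor
    · have : R.ends (fun x => 2 * x ∈ {v | ∃ u ∈ σ, R.NumTrans (some a) u v}) = ∅ := by
        rw [Set.eq_empty_iff_forall_notMem]
        rintro p ⟨x, -, ⟨u, hu, h⟩, -⟩
        obtain ⟨y, -, -, -, h⟩ := hloc _ _ h
        omega
      rw [this]
      simpa using h4
    · have := f4.digits (r := k) (by simp; omega) hF
      rw [RegEx.ends_congr R fun x hx => ?_]
      · exact this
      constructor
      · rintro ⟨u, hu, h⟩
        obtain ⟨y, hy, hc, rfl, h⟩ := hloc _ _ h
        obtain rfl : x = y := by omega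
        exact ⟨hc, hu⟩
      · rintro ⟨hc, hu⟩
        exact ⟨2 * x, hu, x, hx, by simp [RegEx.LocalTrans, hc]⟩
  -- the key of a leaf
  have hkey : ∀ x < R.size, (R.node x).sub = .char a → key s.mem x = a.toNat := by
    intro x hx h
    rw [key, (hs.tree x hx).2.1, TreeNode.fst, h]
  have hrank : ∀ x < R.size, (R.node x).sub = .char a → key s.mem (A t) = a.toNat ∧
      ∃ t' ≤ t, A t' = x := by
    intro x hx h
    obtain ⟨t', ht', hx'⟩ := hs.order.surj x (by omega)
    have h4 := hkey x hx h
    have hx2 : A t' = x := by rw [hA]; exact hx'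
    have htt : t' ≤ t := by
      by_contra hcon
      have := h3 t' (by omega) ht'
      rw [hx2, h4] at this
      omega
    refine ⟨?_, t', htt, hx2⟩
    have h5 := hs.order.mono t' t htt (by omega)
    rw [hx', h4, show s.mem (7 * d.L + t) = A t by rw [hA]] at h5
    -- At rank `0` the leaf found must itself have rank `0`; otherwise the key is bounded from both
    -- sides.
    rcases h2 with h2 | h2
    · obtain rfl : t' = t := by omega
      rw [hx2, h4]
    · omega
  have none : key s.mem (A t) ≠ a.toNat →
      (mapDigits k k fun _ => 0).Ends d.w d.hi d.hi (d.H + 3) s2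
      fun s3 => (mapDigits k 0 fun _ => 0).Ends d.w d.hi d.hi (d.H + 3) s3
      (HoldsNums d R {v | ∃ u ∈ σ, R.NumTrans (some a) u v}) := by
    intro hne
    refine (ends_zero (by omega)).imp fun s3 h => fin s3 ?_
    convert h.1
    rw [Set.eq_empty_iff_forall_notMem]
    rintro p ⟨x, hx, ⟨hc, -⟩, -⟩
    exact hne (hrank x hx hc).1
  refine .seq (ends_ite (by omega) k2 (by simp) (fun h => ?_) (fun h => ?_))
  · refine none ?_
    rw [k1, Expr.eval_var, v2, ha] at h
    omega
  · rw [k1, Expr.eval_var, v2, ha] at h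
    refine ends_ite (by omega) (by simp) k2 (fun h' => ?_) (fun h' => ?_)
    · rw [k1, Expr.eval_var, v2, ha] at h'
      exact none (by omega)
    · rw [k1, Expr.eval_var, v2, ha] at h'
      have hT : Digits d.U k (fun j => s2.reg (.v (0 + j))) (R.ends fun x => 2 * x ∈ σ) :=
        hv.1.congr (fun j _ => by simp [v2]) fun _ _ => Iff.rfl
      have hM := hs.masks t (by omega)
      rw [← m2] at hM
      refine (ends_and (t := t) (by omega) l2 (by omega) (by omega) (by omega)
        (fun s' hs' => by simp [hs', ht]) hT hM).imp fun s3 h => fin s3 ?_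
      have h1 := h.1
      rw [RegEx.ends_inter] at h1
      rw [RegEx.ends_congr R fun x hx => ?_]
      · exact h1
      rw [m2]
      constructor
      · rintro ⟨hc, hu⟩
        obtain ⟨h4, t', h5, h6⟩ := hrank x hx hc
        exact ⟨hu, by rw [hc, RegEx.kind], t', h5, by rw [← h6, hA],
          by rw [hkey x hx hc, ← h4, hA]⟩
      -- The condition on the kind is needed: the key of an inner node is the number of a child and
      -- may coincide with a character.
      · rintro ⟨hu, hkind, t', -, -, h4⟩
        refine ⟨?_, hu⟩
        rw [show s.mem (7 * d.L + t) = A t by rw [hA], key, (hs.tree x hx).2.1, TreeNode.fst] at h4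
        cases hsub : (R.node x).sub with
        | char b =>
          rw [hsub] at h4
          simp only at h4
          rw [BitVec.eq_of_toNat_eq (show b.toNat = a.toNat by omega)]
        | _ => rw [hsub] at hkind; simp [RegEx.kind] at hkind

end

end WordRAM


/-! ### The preprocessing -/

namespace WordRAM

open BitSet Cmd HeavyLayout

variable {k : ℕ} {d : Dims k} {s : St}

/-- Number of nodes. -/
abbrev vN : Var := .s 10

/-- Computation of the dimensions. -/
def dimCmd : Cmd :=
  set vN (Var.v 0) ;;
  set vL 1 ;; set vH 0 ;;
  loop vL ((vN : Expr) + 1) (set vL ((vL : Expr) + vL) ;; set vH ((vH : Expr) + 1)) ;;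
  set vX (Expr.wlen >>> (2 : Expr)) ;;
  -- The digit length is the least power of two, at least `4`, that is not below the minimum of `4 *
  -- L` and a quarter of the word length.
  ite (4 * (vL : Expr)) vX (set vX (4 * (vL : Expr))) skip ;;
  set vU 4 ;;
  loop vU vX (set vU ((vU : Expr) + vU)) ;;
  set vFull (((1 : Expr) <<< (vU : Expr)) - 1)

/-- Initialization of the memory. -/
def initCmd (k : ℕ) : Cmd :=
  set vX (3 * (vN : Expr)) ;;
  set vY (.num (14 + 13 * k) * (vL : Expr)) ;;
  loop vX vY (store vX 0 ;; set vX ((vX : Expr) + 1)) ;;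
  store (3 * (vL : Expr)) 4 ;; store (4 * (vL : Expr)) vH ;; store (5 * (vL : Expr)) vU ;;
  store (6 * (vL : Expr)) vFull

theorem Dims.mod_eq_of_le_hi {x : ℕ} (h : x < d.hi) : x % 2 ^ d.w = x :=
  Nat.mod_eq_of_lt (h.trans_le d.hi_le)

/-- The unit is the least possible power of two. -/
def Dims.Tight (d : Dims k) : Prop := ∀ i, 2 ≤ i → (2 ^ i < min (4 * d.L) (d.w / 4) ↔ i < d.u)

theorem ends_dimCmd (hd : d.Tight) (h0 : s.reg (.v 0) = d.n) :
    dimCmd.Ends d.w d.hi d.hi (d.H + 3) s fun s' => Loaded d s' ∧ s'.reg vN = d.n := by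
  have hhi := d.le_hi
  have hL := d.L_pos
  have hn : d.n < d.L := d.n_lt
  have hn' : d.L ≤ 2 * d.n := d.le_two_n
  have hw := d.w_lt
  have hu := d.u_le
  have hu2 := d.two_le_u
  have e1 := d.mod_eq (x := 1) (by omega)
  have e2 := d.mod_eq (x := 2) (by omega)
  have e4 := d.mod_eq (x := 4) (by omega)
  have e4L := d.mod_eq (x := 4 * d.L) (by omega)
  have en := d.mod_eq (x := d.n + 1) (by omega)
  refine .seq (ends_set (by omega) (by simp) (.seq (ends_set (by omega) (by simp) (.seq
    (ends_set (by omega) (by simp) (.seq ?_))))))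
  refine (ends_loop (N := d.H) (X' := 1) (I := fun i s' => s'.reg vL = 2 ^ i ∧ s'.reg vH = i ∧
    s'.reg vN = d.n) le_rfl (by omega) (fun _ _ _ _ => by simp) ?_ ?_ ?_).imp ?_
  · rintro i s1 hi ⟨i1, i2, i3⟩
    simp [i1, i3, e1, en]
    constructor
    · intro h
      by_contra hcon
      obtain rfl : i = d.H := by omega
      have : d.L ≤ d.n := h
      omega
    · intro h
      have : 2 ^ (i + 1) ≤ d.L := Nat.pow_le_pow_right (by norm_num) h
      rw [pow_succ] at this
      omega
  · rintro i s1 hi ⟨i1, i2, i3⟩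
    have : 2 ^ (i + 1) ≤ d.L := Nat.pow_le_pow_right (by norm_num) hi
    rw [pow_succ] at this
    have hHL := d.H_lt
    apply ends_of_wp le_rfl
    simp [wp, i1, i2, i3, e1, pow_succ]
    rw [d.mod_eq (by omega), d.mod_eq (by omega)]
    omega
  · simp [e1, h0]
  rintro s1 ⟨i1, i2, i3⟩
  replace i1 : s1.reg vL = d.L := i1
  refine .seq (ends_set (by omega) (by simp) (.seq ?_))
  refine (ends_of_wp (Q := fun s' => s'.reg vL = d.L ∧ s'.reg vH = d.H ∧
    s'.reg vN = d.n ∧ s'.reg vX = min (4 * d.L) (d.w / 4)) (by omega) ?_).imp ?_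
  · simp [wp, i1, i2, i3, e2, e4, e4L, Nat.shiftRight_eq_div_pow]
    split_ifs <;> omega
  rintro s2 ⟨j1, j2, j3, j4⟩
  refine .seq (ends_set (by omega) (by simp) (.seq ?_))
  refine (ends_loop (N := d.u - 2) (X' := 1) (I := fun i s' => s'.reg vL = d.L ∧ s'.reg vH = d.H ∧
    s'.reg vN = d.n ∧ s'.reg vX = min (4 * d.L) (d.w / 4) ∧ s'.reg vU = 2 ^ (2 + i))
    le_rfl (by omega) (fun _ _ _ _ => by simp) ?_ ?_ ?_).imp ?_
  -- This is where `Tight` is used: it identifies the number of doublings with `u - 2`.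
  · rintro i s3 hi ⟨-, -, -, h4, h5⟩
    rw [Expr.eval_var, Expr.eval_var, h4, h5, hd _ (by omega)]
    omega
  · rintro i s3 hi ⟨h1, h2, h3, h4, h5⟩
    have : 2 ^ (2 + (i + 1)) ≤ d.U := Nat.pow_le_pow_right (by norm_num) (by omega)
    have h6 := d.U_lt
    have h7 : 2 ^ (2 + (i + 1)) = 2 ^ (2 + i) * 2 := pow_succ 2 (2 + i)
    refine ends_set le_rfl (by simp) ⟨by simpa, by simpa, by simpa, by simpa, ?_⟩
    simp [h5]
    rw [Nat.mod_eq_of_lt (by omega)]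
    omega
  · simp [j1, j2, j3, j4, e4]
  rintro s3 ⟨h1, h2, h3, -, h5⟩
  rw [show 2 + (d.u - 2) = d.u by omega, show 2 ^ d.u = d.U from rfl] at h5
  have h6 := d.two_pow_U_lt
  have h7 : 0 < 2 ^ d.U := by positivity
  refine ends_set (by omega) (by simp) ⟨⟨by simpa, by simpa, by simpa, ?_⟩, by simpa⟩
  simp [h5, e1, Nat.shiftLeft_eq]
  rw [show 2 ^ d.w - 1 + 2 ^ d.U = 2 ^ d.w + (2 ^ d.U - 1) by omega, Nat.add_mod_left,
    Nat.mod_eq_of_lt (by omega)]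

theorem ends_initCmd (hs : Loaded d s) (hN : s.reg vN = d.n) :
    (initCmd k).Ends d.w (3 * d.n) d.hi ((16 + 13 * k) * d.L) s fun s' =>
      Loaded d s' ∧ s'.reg vN = d.n ∧
      HasConsts d s'.mem ∧ ∀ a, 7 * d.L ≤ a → a < (14 + 13 * k) * d.L → s'.mem a = 0 := by
  have hhi := d.le_hi
  have hL := d.L_pos
  have hn : d.n < d.L := d.n_lt
  have e1 := d.mod_eq (x := 1) (by omega)
  have e3 := d.mod_eq (x := 3) (by omega)
  have e4 := d.mod_eq (x := 4) (by omega)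
  have e5 := d.mod_eq (x := 5) (by omega)
  have e6 := d.mod_eq (x := 6) (by omega)
  have e3L := d.mod_eq (x := 3 * d.L) (by omega)
  have e4L := d.mod_eq (x := 4 * d.L) (by omega)
  have e5L := d.mod_eq (x := 5 * d.L) (by omega)
  have e6L := d.mod_eq (x := 6 * d.L) (by omega)
  have en := d.mod_eq (x := 3 * d.n) (by omega)
  obtain ⟨M, hM⟩ : ∃ M, M = (14 + 13 * k) * d.L := ⟨_, rfl⟩
  have hM1 : M < d.hi := hM ▸ d.space_lt
  have hM2 : 14 * d.L ≤ M := by rw [hM]; exact Nat.mul_le_mul_right _ (by omega)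
  have hM3 : (16 + 13 * k) * d.L = M + 2 * d.L := by rw [hM]; ring
  -- Even if the constant of the program were reduced modulo `2 ^ w`, the product would be right,
  -- since it lies below `hi`.
  have eM : ((14 + 13 * k) % 2 ^ d.w * d.L) % 2 ^ d.w = M := by
    rw [Nat.mod_mul_mod, ← hM]; exact d.mod_eq_of_le_hi hM1
  refine .seq (ends_set (by omega) (by simp) (.seq (ends_set (by omega) (by simp) (.seq ?_))))
  refine (ends_loop (N := M - 3 * d.n) (X' := 1) (I := fun i s' => Loaded d s' ∧
    s'.reg vN = d.n ∧ s'.reg vX = 3 * d.n + i ∧ s'.reg vY = M ∧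
    ∀ a, 3 * d.n ≤ a → a < 3 * d.n + i → s'.mem a = 0)
    le_rfl (by omega) (fun _ _ _ _ => by simp) ?_ ?_ ?_).imp ?_
  · rintro i s1 hi ⟨-, -, i3, i4, -⟩
    rw [Expr.eval_var, Expr.eval_var, i3, i4]
    omega
  · rintro i s1 hi ⟨i1, i2, i3, i4, i5⟩
    have := d.mod_eq_of_le_hi (x := 3 * d.n + i + 1) (by omega)
    apply ends_of_wp le_rfl
    simp [wp, i2, i3, i4, e1, this, St.store_mem]
    refine ⟨by omega, i1.congr fun i hi => by simp [show i ≠ 7 by omega], by omega, fun a h1 h2 h3 => i5 a h1 (by omega)⟩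
  · refine ⟨hs.congr fun i hi => by simp [show i ≠ 7 by omega, show i ≠ 8 by omega], ?_⟩
    simp [hs.hL, hN, e3, en, eM]
    omega
  rintro s1 ⟨i1, i2, -, -, i5⟩
  apply ends_of_wp (by omega)
  simp [wp, i1.hL, i1.hH, i1.hU, i1.hFull, e3, e4, e5, e6, e3L, e4L, e5L, e6L]
  refine ⟨by omega, by omega, by omega, by omega, i1.congr fun i hi => by simp, i2, ?_, ?_⟩
  · refine ⟨?_, ?_, ?_, ?_, ?_⟩ <;> simp [St.store_mem] <;> (try rw [if_neg (by omega)]) <;>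
      (try rw [if_neg (by omega)]) <;> (try rw [if_neg (by omega)]) <;>
      (try rw [if_neg (by omega)]) <;> (try (intro h; omega))
    rw [i5 _ le_rfl (by omega)]
  · intro a h1 h2
    simp [St.store_mem]
    rw [if_neg (by omega), if_neg (by omega), if_neg (by omega), if_neg (by omega)]
    exact i5 a (by omega) (by omega)

end WordRAM


/-! ### Sorting -/

namespace WordRAM

open BitSet Cmd HeavyLayout

variable {k : ℕ} {d : Dims k} {s : St}

/-- The merging of the blocks `[B, B + b)` and `[B + b, B + 2 * b)` of `S` into `D` has arrived at
the positions `I` and `J` of the input, and at the position `t` of the output. -/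
structure MergeInv (κ S D : ℕ → ℕ) (b B t I J : ℕ) : Prop where
  sum : I + J = t + (B + b)
  le_left : B ≤ I
  left_le : I ≤ B + b
  le_right : B + b ≤ J
  right_le : J ≤ B + b + b
  sorted : ∀ p q, B ≤ p → p ≤ q → q < t → κ (D p) ≤ κ (D q)
  -- Every element already written is at most every element still waiting; this keeps the output
  -- sorted when the next element is appended.
  bound : ∀ p q, B ≤ p → p < t → (I ≤ q ∧ q < B + b ∨ J ≤ q ∧ q < B + b + b) → κ (D p) ≤ κ (S q)
  source : ∀ p, B ≤ p → p < t → ∃ q, B ≤ q ∧ q < B + b + b ∧ D p = S q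
  cover : ∀ q, (B ≤ q ∧ q < I ∨ B + b ≤ q ∧ q < J) → ∃ p, B ≤ p ∧ p < t ∧ D p = S q

namespace MergeInv

variable {κ S D D' : ℕ → ℕ} {b B t I J : ℕ}

theorem init : MergeInv κ S D b B B B (B + b) where
  sum := rfl
  le_left := le_rfl
  left_le := by omega
  le_right := le_rfl
  right_le := by omega
  sorted _ _ _ _ _ := by omega
  bound _ _ _ _ _ := by omega
  source _ _ _ := by omega
  cover _ _ := by omega

/-- One step: the element at position `r` is moved to the output. -/
theorem step {r I' J' : ℕ} (h : MergeInv κ S D b B t I J) (hD : ∀ p < t, D' p = D p)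
    (ht : D' t = S r) (hr : I' = I + 1 ∧ J' = J ∧ r = I ∧ I < B + b ∨
      I' = I ∧ J' = J + 1 ∧ r = J ∧ J < B + b + b)
    (hmin : ∀ q, I ≤ q ∧ q < B + b ∨ J ≤ q ∧ q < B + b + b → κ (S r) ≤ κ (S q)) :
    MergeInv κ S D' b B (t + 1) I' J' := by
  obtain ⟨h1, h2, h3, h4, h5, h6, h7, h8, h9⟩ := h
  refine ⟨by omega, by omega, by omega, by omega, by omega, fun p q hp hpq hq => ?_,
    fun p q hp hpt hq => ?_, fun p hp hpt => ?_, fun q hq => ?_⟩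
  · rcases Nat.lt_succ_iff_lt_or_eq.1 hq with hq | rfl
    · rw [hD p (by omega), hD q hq]; exact h6 p q hp hpq hq
    · rcases Nat.lt_or_eq_of_le hpq with hpq | rfl
      · rw [hD p hpq, ht]; exact h7 p r hp hpq (by omega)
      · exact le_rfl
  · rcases Nat.lt_succ_iff_lt_or_eq.1 hpt with hpt | rfl
    · rw [hD p hpt]; exact h7 p q hp hpt (by omega)
    · rw [ht]; exact hmin q (by omega)
  · rcases Nat.lt_succ_iff_lt_or_eq.1 hpt with hpt | rfl
    · rw [hD p hpt]; exact h8 p hp hpt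
    · exact ⟨r, by omega, by omega, ht⟩
  · by_cases hqr : q = r
    · exact ⟨t, by omega, by omega, by rw [ht, hqr]⟩
    · obtain ⟨p, hp, hpt, e⟩ := h9 q (by omega)
      exact ⟨p, hp, by omega, by rw [hD p hpt, e]⟩

end MergeInv

abbrev vB : Var := .s 11
abbrev vI : Var := .s 12
abbrev vJ : Var := .s 13
abbrev vE : Var := .s 14
abbrev vF : Var := .s 15

/-- Key of the element at a position of the list. -/
def keyAt (x : Var) : Expr := .load (3 * .load (7 * (vL : Expr) + (x : Expr)) + 1)

/-- Moving of an element to the output. -/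
def takeCmd (x : Var) : Cmd :=
  store (8 * (vL : Expr) + (vT : Expr)) (.load (7 * (vL : Expr) + (x : Expr))) ;;
  set x ((x : Expr) + 1) ;; set vT ((vT : Expr) + 1)

/-- Merging of two blocks. -/
def mergeCmd : Cmd :=
  set vI (vT : Expr) ;; set vE ((vT : Expr) + (vB : Expr)) ;; set vJ (vE : Expr) ;;
  set vF ((vE : Expr) + (vB : Expr)) ;;
  loop vT vF (ite vI vE (ite vJ vF (ite (keyAt vJ) (keyAt vI) (takeCmd vJ) (takeCmd vI))
    (takeCmd vI)) (takeCmd vJ))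

theorem eval_keyAt {x : Var} {i : ℕ} (hL : s.reg vL = d.L) (hx : s.reg x = i) (hi : i < d.L)
    (hlt : s.mem (7 * d.L + i) < d.n) :
    (keyAt x).eval d.w s = key s.mem (s.mem (7 * d.L + i)) ∧
      (keyAt x).Safe d.w (9 * d.L) s := by
  have hn : d.n < d.L := d.n_lt
  have e3 := d.mod_eq (x := 3) (by omega)
  have e7 := d.mod_eq (x := 7) (by omega)
  have e1 := d.mod_eq (x := 1) (by omega)
  have e7L := d.mod_eq (x := 7 * d.L) (by omega)
  have e := d.mod_eq (x := 7 * d.L + i) (by omega)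
  have e' := d.mod_eq (x := 3 * s.mem (7 * d.L + i)) (by omega)
  have e'' := d.mod_eq (x := 3 * s.mem (7 * d.L + i) + 1) (by omega)
  simp [keyAt, hL, hx, e3, e7, e1, e7L, e, e', e'', key]
  omega

/-- The list is sorted on blocks of length `b`. -/
def SortedBlocks (κ S : ℕ → ℕ) (b L : ℕ) : Prop :=
  ∀ p q, p ≤ q → q < L → p / b = q / b → κ (S p) ≤ κ (S q)

theorem SortedBlocks.on_block {κ S : ℕ → ℕ} {b L i p q : ℕ} (h : SortedBlocks κ S b L)
    (hp : i * b ≤ p) (hpq : p ≤ q) (hq : q < i * b + b) (hL : q < L) : κ (S p) ≤ κ (S q) := by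
  refine h p q hpq hL ?_
  rw [Nat.div_eq_of_lt_le hp (by rw [Nat.add_mul]; omega),
    Nat.div_eq_of_lt_le (k := i) (by omega) (by rw [Nat.add_mul]; omega)]

/-- Writing is confined to the scratch area from the beginning of the current block on. So the keys
and the input list stay readable, and the blocks merged before are preserved by the frame rule. -/
theorem ends_mergeCmd {m : ℕ → ℕ} {b i : ℕ} (hb : 1 ≤ b) (hL : s.reg vL = d.L) (hB : s.reg vB = b)
    (hT : s.reg vT = 2 * i * b) (hi : 2 * i * b + b + b ≤ d.L)
    (hlt : ∀ t < d.L, m (7 * d.L + t) < d.n) (hm : ∀ a < 8 * d.L, s.mem a = m a)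
    (hs : SortedBlocks (key m) (fun t => m (7 * d.L + t)) b d.L) :
    mergeCmd.Ends d.w (8 * d.L + 2 * i * b) (9 * d.L) (2 * b + 1) s fun s' =>
      s'.reg vT = 2 * i * b + b + b ∧
      MergeInv (key m) (fun t => m (7 * d.L + t)) (fun t => s'.mem (8 * d.L + t)) b (2 * i * b)
        (2 * i * b + b + b) (2 * i * b + b) (2 * i * b + b + b) := by
  have hn : d.n < d.L := d.n_lt
  have e1 := d.mod_eq (x := 1) (by omega)
  have e7 := d.mod_eq (x := 7) (by omega)
  have e8 := d.mod_eq (x := 8) (by omega)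
  have e7L := d.mod_eq (x := 7 * d.L) (by omega)
  have e8L := d.mod_eq (x := 8 * d.L) (by omega)
  have h1b : (2 * i + 1) * b = 2 * i * b + b := by ring
  obtain ⟨B, hBdef⟩ : ∃ B, B = 2 * i * b := ⟨_, rfl⟩
  have on1 : ∀ p q, B ≤ p → p ≤ q → q < B + b →
      key m (m (7 * d.L + p)) ≤ key m (m (7 * d.L + q)) := fun p q h1 h2 h3 =>
    hs.on_block (i := 2 * i) (by omega) h2 (by omega) (by omega)
  have on2 : ∀ p q, B + b ≤ p → p ≤ q → q < B + b + b →
      key m (m (7 * d.L + p)) ≤ key m (m (7 * d.L + q)) := fun p q h1 h2 h3 =>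
    hs.on_block (i := 2 * i + 1) (by omega) h2 (by omega) (by omega)
  clear hs
  rw [← hBdef] at hT hi ⊢
  refine .seq (ends_set (by omega) (by simp) (.seq (ends_set (by omega) (by simp) (.seq
    (ends_set (by omega) (by simp) (.seq (ends_set (by omega) (by simp) ?_)))))))
  refine (ends_loop (N := b + b) (X' := 1) (I := fun t s' => s'.reg vL = d.L ∧ s'.reg vT = B + t ∧
    s'.reg vE = B + b ∧ s'.reg vF = B + b + b ∧ (∀ a < 8 * d.L, s'.mem a = m a) ∧
    MergeInv (key m) (fun t => m (7 * d.L + t)) (fun t => s'.mem (8 * d.L + t)) b B (B + t)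
      (s'.reg vI) (s'.reg vJ)) le_rfl (by omega) (fun _ _ _ _ => by simp) ?_ ?_ ?_).imp ?_
  · rintro t s1 ht ⟨-, i2, -, i4, -⟩
    rw [Expr.eval_var, Expr.eval_var, i2, i4]
    omega
  · rintro t s1 ht ⟨i1, i2, i3, i4, i5, i6⟩
    obtain ⟨I, hI⟩ : ∃ I, s1.reg vI = I := ⟨_, rfl⟩
    obtain ⟨J, hJ⟩ : ∃ J, s1.reg vJ = J := ⟨_, rfl⟩
    rw [hI, hJ] at i6
    have hkI : I < B + b → (keyAt vI).eval d.w s1 = key m (m (7 * d.L + I)) ∧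
        (keyAt vI).Safe d.w (9 * d.L) s1 := fun h => by
      have h1 := i5 (7 * d.L + I) (by omega)
      have h2 := hlt I (by omega)
      have := eval_keyAt i1 hI (by omega) (by omega)
      rwa [h1, key, i5 _ (by omega)] at this
    have hkJ : J < B + b + b → (keyAt vJ).eval d.w s1 = key m (m (7 * d.L + J)) ∧
        (keyAt vJ).Safe d.w (9 * d.L) s1 := fun h => by
      have h1 := i5 (7 * d.L + J) (by omega)
      have h2 := hlt J (by omega)
      have := eval_keyAt i1 hJ (by omega) (by omega)
      rwa [h1, key, i5 _ (by omega)] at this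
    have et := d.mod_eq (x := 8 * d.L + (B + t)) (by omega)
    have et1 := d.mod_eq (x := B + t + 1) (by omega)
    have htakeI : I < B + b → (J < B + b + b → key m (m (7 * d.L + I)) ≤ key m (m (7 * d.L + J))) →
        (takeCmd vI).Ends d.w (8 * d.L + B) (9 * d.L) 1 s1 fun s' =>
        s'.reg vL = d.L ∧ s'.reg vT = B + (t + 1) ∧
        s'.reg vE = B + b ∧ s'.reg vF = B + b + b ∧ (∀ a < 8 * d.L, s'.mem a = m a) ∧
        MergeInv (key m) (fun t => m (7 * d.L + t)) (fun t => s'.mem (8 * d.L + t)) b B (B + (t + 1))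
          (s'.reg vI) (s'.reg vJ) := fun h1 h2 => by
      have eI := d.mod_eq (x := 7 * d.L + I) (by omega)
      have eI1 := d.mod_eq (x := I + 1) (by omega)
      apply ends_of_wp le_rfl
      simp [takeCmd, wp, i1, i2, i3, i4, hI, hJ, e1, e7, e8, e7L, e8L, et, et1, eI, eI1, St.store_mem]
      refine ⟨by omega, by omega, fun a ha => by rw [if_neg (by omega), i5 a ha],
        i6.step (fun p hp => ?_) ?_ (Or.inl ⟨rfl, rfl, rfl, h1⟩) fun q hq => ?_⟩
      · exact if_neg (by omega)
      · exact (if_pos rfl).trans (i5 _ (by omega))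
      · rcases hq with ⟨h3, h4⟩ | ⟨h3, h4⟩
        · exact on1 _ _ i6.le_left h3 h4
        · exact (h2 (by omega)).trans (on2 _ _ i6.le_right h3 h4)
    have htakeJ : J < B + b + b → (I < B + b → key m (m (7 * d.L + J)) ≤ key m (m (7 * d.L + I))) →
        (takeCmd vJ).Ends d.w (8 * d.L + B) (9 * d.L) 1 s1 fun s' =>
        s'.reg vL = d.L ∧ s'.reg vT = B + (t + 1) ∧
        s'.reg vE = B + b ∧ s'.reg vF = B + b + b ∧ (∀ a < 8 * d.L, s'.mem a = m a) ∧
        MergeInv (key m) (fun t => m (7 * d.L + t)) (fun t => s'.mem (8 * d.L + t)) b B (B + (t + 1))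
          (s'.reg vI) (s'.reg vJ) := fun h1 h2 => by
      have eJ := d.mod_eq (x := 7 * d.L + J) (by omega)
      have eJ1 := d.mod_eq (x := J + 1) (by omega)
      apply ends_of_wp le_rfl
      simp [takeCmd, wp, i1, i2, i3, i4, hI, hJ, e1, e7, e8, e7L, e8L, et, et1, eJ, eJ1, St.store_mem]
      refine ⟨by omega, by omega, fun a ha => by rw [if_neg (by omega), i5 a ha],
        i6.step (fun p hp => ?_) ?_ (Or.inr ⟨rfl, rfl, rfl, h1⟩) fun q hq => ?_⟩
      · exact if_neg (by omega)
      · exact (if_pos rfl).trans (i5 _ (by omega))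
      · rcases hq with ⟨h3, h4⟩ | ⟨h3, h4⟩
        · exact (h2 (by omega)).trans (on1 _ _ i6.le_left h3 h4)
        · exact on2 _ _ i6.le_right h3 h4
    have hsum := i6.sum
    -- One block is exhausted exactly when its pointer reaches the end; otherwise the smaller key is
    -- taken, and the sortedness of the two blocks makes it minimal among all waiting elements.
    have hle := i6.left_le
    have hle' := i6.right_le
    refine ends_ite le_rfl (by simp) (by simp) (fun h => ?_) (fun h => ?_)
    · simp only [Expr.eval_var, hI, i3] at h
      refine ends_ite le_rfl (by simp) (by simp) (fun h' => ?_) (fun h' => ?_)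
      · simp only [Expr.eval_var, hJ, i4] at h'
        refine ends_ite le_rfl (hkJ h').2 (hkI h).2 (fun h2 => ?_) (fun h2 => ?_)
        · rw [(hkJ h').1, (hkI h).1] at h2
          exact htakeJ h' fun _ => h2.le
        · rw [(hkJ h').1, (hkI h).1] at h2
          exact htakeI h fun _ => not_lt.1 h2
      · simp only [Expr.eval_var, hJ, i4] at h'
        exact htakeI h fun h3 => absurd h3 h'
    · simp only [Expr.eval_var, hI, i3] at h
      exact htakeJ (by omega) fun h3 => absurd h3 h
  · have eb := d.mod_eq (x := B + b) (by omega)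
    have eb2 := d.mod_eq (x := B + b + b) (by omega)
    simp [hL, hT, hB, eb, eb2]
    exact ⟨hm, .init⟩
  · rintro s1 ⟨-, i2, -, -, -, i6⟩
    rw [← Nat.add_assoc] at i2 i6
    have := i6.sum
    have := i6.left_le
    have := i6.right_le
    rw [show s1.reg vI = B + b by omega, show s1.reg vJ = B + b + b by omega] at i6
    exact ⟨i2, i6⟩

/-- Merging of all pairs of blocks. -/
def mergePass : Cmd := set vT 0 ;; loop vT vL mergeCmd

/-- Sorting of the list of the nodes by their keys. -/
def sortCmd : Cmd :=
  set vT 0 ;; loop vT vN (store (7 * (vL : Expr) + (vT : Expr)) vT ;; set vT ((vT : Expr) + 1)) ;;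
  set vB 1 ;;
  loop vB vL (
    mergePass ;;
    set vT 0 ;; loop vT vL (
      store (7 * (vL : Expr) + (vT : Expr)) (.load (8 * (vL : Expr) + (vT : Expr))) ;;
      set vT ((vT : Expr) + 1)) ;;
    set vB ((vB : Expr) + (vB : Expr)))

/-- The list is a list of all nodes, sorted on blocks of length `b`. -/
structure IsList (d : Dims k) (m : ℕ → ℕ) (b : ℕ) : Prop where
  lt : ∀ t < d.L, m (7 * d.L + t) < d.n
  surj : ∀ x < d.n, ∃ t < d.L, m (7 * d.L + t) = x
  sorted : SortedBlocks (key m) (fun t => m (7 * d.L + t)) b d.L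

/-- The list has a power of two as its length, so it splits exactly into pairs of blocks of length
`2 ^ e`. -/
theorem ends_mergePass {e : ℕ} (he : e < d.H) (hs : Loaded d s) (hB : s.reg vB = 2 ^ e)
    (hl : IsList d s.mem (2 ^ e)) :
    mergePass.Ends d.w (8 * d.L) (9 * d.L) (4 * d.L) s fun s' =>
      (∀ t < d.L, s'.mem (8 * d.L + t) < d.n) ∧
      (∀ x < d.n, ∃ t < d.L, s'.mem (8 * d.L + t) = x) ∧
      SortedBlocks (key s.mem) (fun t => s'.mem (8 * d.L + t)) (2 ^ (e + 1)) d.L := by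
  have hL := d.L_pos
  have hn : d.n < d.L := d.n_lt
  obtain ⟨b, hb⟩ : ∃ b, b = 2 ^ e := ⟨_, rfl⟩
  have hb1 : 1 ≤ b := hb ▸ Nat.one_le_two_pow
  obtain ⟨N, hN⟩ : ∃ N, N = 2 ^ (d.H - (e + 1)) := ⟨_, rfl⟩
  have hN1 : 1 ≤ N := hN ▸ Nat.one_le_two_pow
  have hNL : 2 * N * b = d.L := by
    rw [Dims.L, hN, hb, ← pow_succ', ← pow_add]; congr 1; omega
  have hpos : ∀ i < N, 2 * i * b + b + b ≤ d.L := fun i hi => by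
    have := Nat.mul_le_mul_right b (Nat.mul_le_mul_left 2 (show i + 1 ≤ N from hi))
    rw [hNL] at this
    linarith
  -- With `2 * N * b = L` both the `N` merges of length `2 * b` and the overhead of the loops are
  -- linear in `L`.
  have hX : (2 * b + 1) * (N + 1) ≤ 4 * d.L := by
    rw [← hNL]
    nlinarith [Nat.mul_le_mul hb1 hN1]
  rw [pow_succ, ← hb]
  rw [← hb] at hl hB
  refine .seq (ends_set (by omega) (by simp) ?_)
  refine (ends_loop (N := N) (X' := 2 * b + 1) (I := fun i s' => Loaded d s' ∧ s'.reg vB = b ∧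
    s'.reg vT = 2 * i * b ∧ (∀ a < 8 * d.L, s'.mem a = s.mem a) ∧
    (∀ p q, p ≤ q → q < 2 * i * b → p / (b * 2) = q / (b * 2) →
      key s.mem (s'.mem (8 * d.L + p)) ≤ key s.mem (s'.mem (8 * d.L + q))) ∧
    (∀ t < 2 * i * b, s'.mem (8 * d.L + t) < d.n) ∧
    (∀ p < 2 * i * b, ∃ t < 2 * i * b, s'.mem (8 * d.L + t) = s.mem (7 * d.L + p)))
      (by omega) hX (fun _ _ _ _ => by simp) ?_ ?_ ?_).imp ?_
  · rintro i s1 hi ⟨i1, -, i3, -⟩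
    rw [Expr.eval_var, Expr.eval_var, i3, i1.hL, ← hNL]
    constructor
    · intro h
      by_contra hcon
      obtain rfl : i = N := by omega
      omega
    · intro h
      have := hpos i h
      omega
  · rintro i s1 hi ⟨i1, i2, i3, i4, i5, i6, i7⟩
    have hib := hpos i hi
    have hib' : 2 * (i + 1) * b = 2 * i * b + b + b := by ring
    have hib'' : 2 * i * b = i * (b * 2) := by ring
    refine ((ends_mergeCmd hb1 i1.hL i2 i3 hib hl.lt i4 hl.sorted).frame.bounds
      (by omega) le_rfl).imp ?_
    rintro s2 ⟨⟨j1, j2⟩, j3, j4⟩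
    refine ⟨i1.congr fun i hi => j3 _ ?_, (j3 _ ?_).trans i2, by rw [j1, hib'],
      fun a ha => by rw [j4 a (by omega), i4 a ha], fun p q hpq hq hdiv => ?_, fun t ht => ?_,
      fun p hp => ?_⟩
    · simp [mergeCmd, takeCmd, Writes]; omega
    · simp [mergeCmd, takeCmd, Writes]
    · rcases Nat.lt_or_ge q (2 * i * b) with h | h
      · rw [j4 _ (by omega), j4 _ (by omega)]
        exact i5 p q hpq h hdiv
      · refine j2.sorted p q ?_ hpq (by omega)
        have : q / (b * 2) = i := Nat.div_eq_of_lt_le (by omega) (by rw [Nat.add_mul]; omega)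
        rw [this] at hdiv
        have := Nat.div_mul_le_self p (b * 2)
        rw [hdiv] at this
        omega
    · rcases Nat.lt_or_ge t (2 * i * b) with h | h
      · rw [j4 _ (by omega)]; exact i6 t h
      · obtain ⟨q, h1, h2, h3⟩ := j2.source t h (by omega)
        have := hl.lt q (by omega)
        exact h3 ▸ this
    · rcases Nat.lt_or_ge p (2 * i * b) with h | h
      · obtain ⟨t, ht, e⟩ := i7 p h
        exact ⟨t, by omega, by rw [j4 _ (by omega), e]⟩
      · obtain ⟨t, h1, h2, h3⟩ := j2.cover p (by omega)
        exact ⟨t, by omega, h3⟩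
  · refine ⟨hs.congr fun i hi => by simp [show i ≠ 4 by omega], ?_⟩
    simp [hB]
  · rintro s' ⟨-, -, -, i4, i5, i6, i7⟩
    rw [hNL] at i5 i6 i7
    refine ⟨i6, fun x hx => ?_, i5⟩
    obtain ⟨p, hp, rfl⟩ := hl.surj x hx
    exact i7 p hp

theorem ends_sortCmd (hs : Loaded d s) (hN : s.reg vN = d.n) (h0 : ∀ t < d.L, s.mem (7 * d.L + t) = 0) :
    sortCmd.Ends d.w (7 * d.L) (9 * d.L) (4 * d.L * (d.H + 1)) s fun s' => HasOrder d s'.mem := by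
  have hL := d.L_pos
  have hn : d.n < d.L := d.n_lt
  have hn1 := d.one_le_n
  have hH := d.one_le_H
  have hX : 4 * d.L * 1 ≤ 4 * d.L * (d.H + 1) := Nat.mul_le_mul_left _ (by omega)
  have e1 := d.mod_eq (x := 1) (by omega)
  have e7 := d.mod_eq (x := 7) (by omega)
  have e8 := d.mod_eq (x := 8) (by omega)
  have e7L := d.mod_eq (x := 7 * d.L) (by omega)
  have e8L := d.mod_eq (x := 8 * d.L) (by omega)
  refine .seq (ends_set (by omega) (by simp) (.seq ?_))
  -- The list begins as `0, …, n - 1`; the remaining entries are `0` from the initialization and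
  -- repeat the first node.
  refine (ends_loop (N := d.n) (X' := 1) (I := fun i s' => Loaded d s' ∧ s'.reg vN = d.n ∧
    s'.reg vT = i ∧ ∀ t < d.L, s'.mem (7 * d.L + t) = if t < i then t else 0) le_rfl (by omega)
    (fun _ _ _ _ => by simp) ?_ ?_ ?_).imp ?_
  · rintro i s1 hi ⟨-, i2, i3, -⟩
    rw [Expr.eval_var, Expr.eval_var, i2, i3]
  · rintro i s1 hi ⟨i1, i2, i3, i4⟩
    have et := d.mod_eq (x := 7 * d.L + i) (by omega)
    have et1 := d.mod_eq (x := i + 1) (by omega)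
    apply ends_of_wp le_rfl
    simp [wp, i1.hL, i2, i3, e1, e7, e7L, et, et1, St.store_mem]
    refine ⟨by omega, i1.congr fun i hi => by simp [show i ≠ 4 by omega], fun t ht => ?_⟩
    rw [i4 t ht]
    split_ifs <;> omega
  · refine ⟨hs.congr fun i hi => by simp [show i ≠ 4 by omega], ?_⟩
    simpa [hN] using h0
  rintro s1 ⟨i1, i2, -, i4⟩
  refine .seq (ends_set (by omega) (by simp) ?_)
  refine (ends_loop (N := d.H) (X' := 4 * d.L) (I := fun e s' => Loaded d s' ∧ s'.reg vB = 2 ^ e ∧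
    IsList d s'.mem (2 ^ e)) (by omega) le_rfl (fun _ _ _ _ => by simp) ?_ ?_ ?_).imp ?_
  · rintro e s2 he ⟨j1, j2, -⟩
    rw [Expr.eval_var, Expr.eval_var, j2, j1.hL, Dims.L]
    exact Nat.pow_lt_pow_iff_right (by norm_num)
  · rintro e s2 he ⟨j1, j2, j3⟩
    refine .seq (((ends_mergePass he j1 j2 j3).frame.bounds (by omega) le_rfl).imp ?_)
    rintro s3 ⟨⟨k1, k2, k3⟩, k4, k5⟩
    have l1 : Loaded d s3 := j1.congr fun i hi => k4 _ <| by
      simp [mergePass, mergeCmd, takeCmd, Writes]; omega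
    have l2 : s3.reg vB = 2 ^ e := (k4 _ <| by simp [mergePass, mergeCmd, takeCmd, Writes]).trans j2
    have hkey : ∀ x < d.n, key s3.mem x = key s2.mem x := fun x hx => k5 _ (by omega)
    refine .seq (ends_set (by omega) (by simp) (.seq ?_))
    refine (ends_loop (N := d.L) (X' := 1) (I := fun i s' => Loaded d s' ∧ s'.reg vB = 2 ^ e ∧
      s'.reg vT = i ∧ (∀ a < 7 * d.L, s'.mem a = s3.mem a) ∧
      (∀ t < d.L, s'.mem (8 * d.L + t) = s3.mem (8 * d.L + t)) ∧
      ∀ t < i, s'.mem (7 * d.L + t) = s3.mem (8 * d.L + t)) le_rfl (by omega)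
      (fun _ _ _ _ => by simp) ?_ ?_ ?_).imp ?_
    · rintro i s4 hi ⟨m1, -, m3, -⟩
      rw [Expr.eval_var, Expr.eval_var, m1.hL, m3]
    · rintro i s4 hi ⟨m1, m2, m3, m4, m5, m6⟩
      have et := d.mod_eq (x := 7 * d.L + i) (by omega)
      have et' := d.mod_eq (x := 8 * d.L + i) (by omega)
      have et1 := d.mod_eq (x := i + 1) (by omega)
      apply ends_of_wp le_rfl
      simp [wp, m1.hL, m2, m3, e1, e7, e7L, e8, e8L, et, et', et1, St.store_mem]
      refine ⟨by omega, m1.congr fun i hi => by simp [show i ≠ 4 by omega], fun a ha => ?_,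
        fun t ht => ?_, fun t ht => ?_⟩
      · rw [if_neg (by omega), m4 a ha]
      · rw [if_neg (by omega), m5 t ht]
      · split_ifs with h
        · rw [h, m5 i hi]
        · exact m6 t (by omega)
    · refine ⟨l1.congr fun i hi => by simp [show i ≠ 4 by omega], ?_⟩
      simpa using l2
    rintro s4 ⟨m1, m2, -, m4, -, m6⟩
    have hkey' : ∀ x < d.n, key s4.mem x = key s2.mem x := fun x hx =>
      (m4 _ (by omega)).trans (hkey x hx)
    have hle : 2 ^ e * 2 ≤ d.L := by rw [← pow_succ]; exact Nat.pow_le_pow_right (by norm_num) he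
    refine ends_set (by omega) (by simp) ⟨m1.congr fun i hi => by simp [show i ≠ 11 by omega], ?_,
      ⟨fun t ht => ?_, fun x hx => ?_, fun p q hpq hq h => ?_⟩⟩
    · simp [m2]
      rw [d.mod_eq (by omega), pow_succ]; omega
    · rw [St.set_mem, m6 t ht]; exact k1 t ht
    · obtain ⟨t, ht, e⟩ := k2 x hx
      exact ⟨t, ht, by rw [St.set_mem, m6 t ht, e]⟩
    · have := k3 p q hpq hq h
      simp only [St.set_mem]
      rwa [m6 p (by omega), m6 q hq, hkey' _ (k1 p (by omega)), hkey' _ (k1 q hq)]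
  · refine ⟨i1.congr fun i hi => by simp [show i ≠ 11 by omega], by simp [e1], ?_⟩
    rw [St.set_mem]
    refine ⟨fun t ht => ?_, fun x hx => ⟨x, by omega, by rw [i4 x (by omega), if_pos hx]⟩, ?_⟩
    · rw [i4 t ht]
      split_ifs <;> omega
    -- Blocks of length one are sorted for trivial reasons.
    · intro p q hpq hq h
      simp at h
      rw [h]
  · rintro s2 ⟨-, -, h1, h2, h3⟩
    refine ⟨h1, fun p q hpq hq => h3 p q hpq hq ?_, h2⟩
    -- After the last pass there is a single block of length `L`.
    rw [Nat.div_eq_of_lt, Nat.div_eq_of_lt] <;> simp only [Dims.L] at * <;> omega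

end WordRAM


/-! ### Sizes of the subtrees -/

namespace WordRAM

open BitSet Cmd HeavyLayout

variable {k : ℕ} {d : Dims k} {s : St} {w : ℕ} {R : RegEx (BitVec w)}

/-- Size and nullability of the subexpression with number `x` are in the memory. -/
def HasSize (d : Dims k) (R : RegEx (BitVec w)) (m : ℕ → ℕ) (x : ℕ) : Prop :=
  m (9 * d.L + x) = (R.node x).sub.size ∧ m (10 * d.L + x) = (R.node x).sub.null.toNat

/-- Computation of the sizes of all subtrees. -/
def sizeCmd : Cmd :=
  set vT 0 ;;
  loop vT vN (
    set vX (.load (3 * (vT : Expr))) ;; set vI (.load (3 * (vT : Expr) + 1)) ;;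
    set vJ (.load (3 * (vT : Expr) + 2)) ;;
    ite vX 1 (store (9 * (vL : Expr) + (vT : Expr)) 1 ;; store (10 * (vL : Expr) + (vT : Expr)) 0)
      (ite vX 3
        (store (9 * (vL : Expr) + (vT : Expr)) (.load (9 * (vL : Expr) + (vI : Expr)) +
            .load (9 * (vL : Expr) + (vJ : Expr)) + 1) ;;
          ite vX 2 
          (store (10 * (vL : Expr) + (vT : Expr)) (.load (10 * (vL : Expr) + (vI : Expr)) &&&
            .load (10 * (vL : Expr) + (vJ : Expr))))
          (store (10 * (vL : Expr) + (vT : Expr)) (.load (10 * (vL : Expr) + (vI : Expr)) |||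
            .load (10 * (vL : Expr) + (vJ : Expr)))))
        (store (9 * (vL : Expr) + (vT : Expr)) (.load (9 * (vL : Expr) + (vI : Expr)) + 1) ;;
          store (10 * (vL : Expr) + (vT : Expr)) 1)) ;;
    set vT ((vT : Expr) + 1))

-- In postorder the children have smaller numbers than their parent, so one ascending pass finds all
-- sizes and nullabilities.
set_option maxHeartbeats 1000000 in
theorem ends_sizeCmd (hR : R.size = d.n) (hs : Loaded d s) (hN : s.reg vN = d.n)
    (ht : IsTree R s.mem) :
    sizeCmd.Ends d.w (9 * d.L) (11 * d.L) d.L s fun s' => ∀ x < d.n, HasSize d R s'.mem x := by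
  have hL := d.L_pos
  have hn : d.n < d.L := d.n_lt
  have e0 : (0 : ℕ) % 2 ^ d.w = 0 := Nat.zero_mod _
  have e1 := d.mod_eq (x := 1) (by omega)
  have e2 := d.mod_eq (x := 2) (by omega)
  have e3 := d.mod_eq (x := 3) (by omega)
  have e9 := d.mod_eq (x := 9) (by omega)
  have e10 := d.mod_eq (x := 10) (by omega)
  have e9L := d.mod_eq (x := 9 * d.L) (by omega)
  have e10L := d.mod_eq (x := 10 * d.L) (by omega)
  refine .seq (ends_set (by omega) (by simp) ?_)
  refine (ends_loop (N := d.n) (X' := 1) (I := fun i s' => Loaded d s' ∧ s'.reg vN = d.n ∧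
    s'.reg vT = i ∧ (∀ a < 9 * d.L, s'.mem a = s.mem a) ∧ ∀ x < i, HasSize d R s'.mem x) le_rfl
    (by omega) (fun _ _ _ _ => by simp) ?_ ?_ ?_).imp ?_
  · rintro i s1 hi ⟨-, i2, i3, -⟩
    rw [Expr.eval_var, Expr.eval_var, i2, i3]
  · rintro i s1 hi ⟨i1, i2, i3, i4, i5⟩
    obtain ⟨t1, t2, t3⟩ := ht i (by omega)
    rw [← i4 _ (by omega)] at t1 t2 t3
    have f1 := d.mod_eq (x := 3 * i) (by omega)
    have f2 := d.mod_eq (x := 3 * i + 1) (by omega)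
    have f3 := d.mod_eq (x := 3 * i + 2) (by omega)
    have f4 := d.mod_eq (x := 9 * d.L + i) (by omega)
    have f5 := d.mod_eq (x := 10 * d.L + i) (by omega)
    have f6 := d.mod_eq (x := i + 1) (by omega)
    have hk : ∀ x < i, ∀ a b : ℕ, HasSize d R ((s1.store (9 * d.L + i) a).store (10 * d.L + i) b).mem x := by
      intro x hx a b
      simp only [HasSize, St.store_mem]
      rw [if_neg (by omega), if_neg (by omega), if_neg (by omega), if_neg (by omega)]
      exact i5 x hx
    have hfin : ∀ a b : ℕ, a = (R.node i).sub.size → b = (R.node i).sub.null.toNat →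
        ∀ x < i + 1, HasSize d R ((s1.store (9 * d.L + i) a).store (10 * d.L + i) b).mem x := by
      intro a b ha hb x hx
      rcases Nat.lt_succ_iff_lt_or_eq.1 hx with h | rfl
      · exact hk x h a b
      · simp only [HasSize, St.store_mem]
        rw [if_neg (by omega)]
        simpa using ⟨ha, hb⟩
    have hold : ∀ a b : ℕ, ∀ c < 9 * d.L,
        ((s1.store (9 * d.L + i) a).store (10 * d.L + i) b).mem c = s.mem c := by
      intro a b c hc
      simp only [St.store_mem]
      rw [if_neg (by omega), if_neg (by omega), i4 c hc]
    have hbound : 3 * i + 2 < 9 * d.L := by omega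
    apply ends_of_wp le_rfl
    have hi' : i < R.size := by omega
    cases hsub : (R.node i).sub with
    | char a =>
      rw [hsub] at t1
      simp only [hsub, RegEx.size, RegEx.null] at hfin
      simp [wp, i1.hL, i2, i3, e1, e2, e3, e9, e10, e9L, e10L, f1, f2, f3, f4, f5, f6, t1, RegEx.kind]
      refine ⟨by omega, by omega, by omega, by omega, by omega, i1.congr fun i hi => by interval_cases i <;> simp,
        by simpa [St.store_mem] using hold 1 0,
        fun x hx => hfin 1 0 rfl rfl x (by omega)⟩
    | cat S T =>
      obtain ⟨c1, c2, -, -, c5, c6⟩ := RegEx.node_children hi' (Or.inl hsub)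
      have t2' : s1.mem (3 * i + 1) = (R.node i).leftNum := by rw [t2, TreeNode.fst, hsub]
      have f7 := d.mod_eq (x := 9 * d.L + (R.node i).leftNum) (by omega)
      have f8 := d.mod_eq (x := 10 * d.L + (R.node i).leftNum) (by omega)
      have f9 := d.mod_eq (x := 9 * d.L + (R.node i).rightNum) (by omega)
      have f10 := d.mod_eq (x := 10 * d.L + (R.node i).rightNum) (by omega)
      have g1 := i5 _ c5
      have g2 := i5 _ c6
      have hsz := RegEx.off_add_size hi'
      have n1 : ¬ 10 * d.L + (R.node i).leftNum = 9 * d.L + i := by omega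
      have n2 : ¬ 10 * d.L + (R.node i).rightNum = 9 * d.L + i := by omega
      rw [hsub] at t1
      simp only [HasSize, c1, c2, TreeNode.leftNode, TreeNode.rightNode, apply_ite TreeNode.sub,
        ite_self] at g1 g2
      simp only [hsub, RegEx.size, RegEx.null] at hfin hsz
      have f11 := d.mod_eq (x := S.size + T.size) (by omega)
      have f12 := d.mod_eq (x := S.size + T.size + 1) (by omega)
      simp [wp, i1.hL, i2, i3, e1, e2, e3, e9, e10, e9L, e10L, f1, f2, f3, f4, f5, f6, t1, t2', t3,
        f7, f8, f9, f10, g1, g2, f11, f12, n1, n2, RegEx.kind, St.store_mem]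
      refine ⟨by omega, by omega, by omega, by omega, by omega, i1.congr fun i hi => by interval_cases i <;> simp,
        by simpa [St.store_mem] using hold (S.size + T.size + 1) (S.null.toNat &&& T.null.toNat),
        fun x hx => hfin (S.size + T.size + 1) (S.null.toNat &&& T.null.toNat) rfl (by cases S.null <;> cases T.null <;> rfl) x (by omega)⟩
    | alt S T =>
      obtain ⟨c1, c2, -, -, c5, c6⟩ := RegEx.node_children hi' (Or.inr hsub)
      have t2' : s1.mem (3 * i + 1) = (R.node i).leftNum := by rw [t2, TreeNode.fst, hsub]
      have f7 := d.mod_eq (x := 9 * d.L + (R.node i).leftNum) (by omega)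
      have f8 := d.mod_eq (x := 10 * d.L + (R.node i).leftNum) (by omega)
      have f9 := d.mod_eq (x := 9 * d.L + (R.node i).rightNum) (by omega)
      have f10 := d.mod_eq (x := 10 * d.L + (R.node i).rightNum) (by omega)
      have g1 := i5 _ c5
      have g2 := i5 _ c6
      have hsz := RegEx.off_add_size hi'
      have n1 : ¬ 10 * d.L + (R.node i).leftNum = 9 * d.L + i := by omega
      have n2 : ¬ 10 * d.L + (R.node i).rightNum = 9 * d.L + i := by omega
      rw [hsub] at t1
      simp only [HasSize, c1, c2, TreeNode.leftNode, TreeNode.rightNode, apply_ite TreeNode.sub,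
        ite_self] at g1 g2
      simp only [hsub, RegEx.size, RegEx.null] at hfin hsz
      have f11 := d.mod_eq (x := S.size + T.size) (by omega)
      have f12 := d.mod_eq (x := S.size + T.size + 1) (by omega)
      simp [wp, i1.hL, i2, i3, e1, e2, e3, e9, e10, e9L, e10L, f1, f2, f3, f4, f5, f6, t1, t2', t3,
        f7, f8, f9, f10, g1, g2, f11, f12, n1, n2, RegEx.kind, St.store_mem]
      refine ⟨by omega, by omega, by omega, by omega, by omega, i1.congr fun i hi => by interval_cases i <;> simp,
        by simpa [St.store_mem] using hold (S.size + T.size + 1) (S.null.toNat ||| T.null.toNat),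
        fun x hx => hfin (S.size + T.size + 1) (S.null.toNat ||| T.null.toNat) rfl (by cases S.null <;> cases T.null <;> rfl) x (by omega)⟩
    | star S =>
      obtain ⟨c1, -, c5⟩ := RegEx.node_child_star hi' hsub
      have t2' : s1.mem (3 * i + 1) = (R.node i).leftNum := by rw [t2, TreeNode.fst, hsub]
      have f7 := d.mod_eq (x := 9 * d.L + (R.node i).leftNum) (by omega)
      have g1 := i5 _ c5
      have hsz := RegEx.off_add_size hi'
      rw [hsub] at t1
      simp only [HasSize, c1] at g1
      simp only [hsub, RegEx.size, RegEx.null] at hfin hsz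
      have f11 := d.mod_eq (x := S.size + 1) (by omega)
      simp [wp, i1.hL, i2, i3, e1, e2, e3, e9, e10, e9L, e10L, f1, f2, f3, f4, f5, f6, t1, t2', t3,
        f7, g1, f11, RegEx.kind, St.store_mem]
      refine ⟨by omega, by omega, by omega, by omega, by omega, i1.congr fun i hi => by interval_cases i <;> simp,
        by simpa [St.store_mem] using hold (S.size + 1) 1,
        fun x hx => hfin (S.size + 1) 1 rfl rfl x (by omega)⟩
  · refine ⟨hs.congr fun i hi => by simp [show i ≠ 4 by omega], ?_⟩
    simp [hN]
  · rintro s' ⟨-, -, -, -, h⟩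
    exact h

end WordRAM


/-! ### Places of the subtrees, and codes of the nodes -/

namespace RegEx

variable {α : Type} (R : RegEx α)

theorem child_num {p z : ℕ} (h : R.Heavy p z ∨ R.Light p z) :
    (R.node p).HasHeavy ∧ z = (R.node p).leftNum ∨ (R.node p).HasLight ∧ z = (R.node p).rightNum := by
  rcases h with h | h
  · rcases R.heavy_cases h with ⟨S, T, hST, ⟨-, h2, -⟩ | ⟨-, h2, -⟩⟩ | ⟨S, -, h2, -⟩
    · exact Or.inl ⟨h.2.1, h2⟩
    · right
      rcases hST with h | h <;> simp [TreeNode.HasLight, h, h2]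
    · exact Or.inl ⟨h.2.1, h2⟩
  · obtain ⟨S, T, hST, ⟨-, h2, -⟩ | ⟨-, h2, -⟩⟩ := R.light_cases h
    · exact Or.inr ⟨h.2.1, h2⟩
    · left
      rcases hST with h | h <;> simp [TreeNode.HasHeavy, h, h2]

end RegEx

namespace WordRAM

open BitSet Cmd HeavyLayout

variable {k : ℕ} {d : Dims k} {s : St} {w : ℕ} {R : RegEx (BitVec w)}

/-- The place of the node `x` in the layout is in the memory. -/
def HasPlace (d : Dims k) (R : RegEx (BitVec w)) (m : ℕ → ℕ) (x : ℕ) : Prop :=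
  m (11 * d.L + x) = (R.node x).base ∧ m (12 * d.L + x) = (R.node x).lev ∧
    m (13 * d.L + x) = (R.node x).top.toNat

/-- Storing of the place of a node. -/
def placeCmd (x : Var) (b l t : Expr) : Cmd :=
  store (11 * (vL : Expr) + (x : Expr)) b ;; store (12 * (vL : Expr) + (x : Expr)) l ;;
  store (13 * (vL : Expr) + (x : Expr)) t

/-- The three arrays are disjoint. An entry that was correct before stays correct even if it belongs
to the same node, because it is overwritten by the same value. -/
theorem ends_placeCmd {y hi : ℕ} {x : Var} {b l t : Expr} (hh : 14 * d.L ≤ hi) (hL : s.reg vL = d.L)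
    (hx : s.reg x = y) (hy : y < d.n)
    (hb : ∀ s' : St, s'.reg = s.reg → b.Safe d.w hi s' ∧ b.eval d.w s' = (R.node y).base)
    (hl : ∀ s' : St, s'.reg = s.reg → l.Safe d.w hi s' ∧ l.eval d.w s' = (R.node y).lev)
    (ht : ∀ s' : St, s'.reg = s.reg → t.Safe d.w hi s' ∧ t.eval d.w s' = (R.node y).top.toNat) :
    (placeCmd x b l t).Ends d.w (11 * d.L) hi 1 s fun s' => s'.reg = s.reg ∧
      HasPlace d R s'.mem y ∧ ∀ z < d.n, HasPlace d R s.mem z → HasPlace d R s'.mem z := by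
  have hn : d.n < d.L := d.n_lt
  have e11 := d.mod_eq (x := 11) (by have := d.L_pos; omega)
  have e12 := d.mod_eq (x := 12) (by have := d.L_pos; omega)
  have e13 := d.mod_eq (x := 13) (by have := d.L_pos; omega)
  have e11L := d.mod_eq (x := 11 * d.L) (by omega)
  have e12L := d.mod_eq (x := 12 * d.L) (by omega)
  have e13L := d.mod_eq (x := 13 * d.L) (by omega)
  have f11 := d.mod_eq (x := 11 * d.L + y) (by omega)
  have f12 := d.mod_eq (x := 12 * d.L + y) (by omega)
  have f13 := d.mod_eq (x := 13 * d.L + y) (by omega)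
  apply ends_of_wp le_rfl
  simp only [placeCmd, wp, Expr.eval_add, Expr.eval_mul, Expr.eval_var, Expr.eval_ofNat, St.store_reg,
    hL, hx, e11, e12, e13, e11L, e12L, e13L, f11, f12, f13]
  rw [(hb _ rfl).2, (hl (s.store _ _) rfl).2, (ht ((s.store _ _).store _ _) rfl).2]
  refine ⟨⟨by simp, (hb _ rfl).1, by omega, by omega⟩, ⟨by simp, (hl (s.store _ _) rfl).1, by omega, by omega⟩,
    ⟨by simp, (ht ((s.store _ _).store _ _) rfl).1, by omega, by omega⟩, trivial, ?_, fun z hz ⟨z1, z2, z3⟩ => ?_⟩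
  · simp only [HasPlace, St.store_mem]
    refine ⟨?_, ?_, ?_⟩
    · rw [if_neg (by omega), if_neg (by omega), if_pos trivial]
    · rw [if_neg (by omega), if_pos trivial]
    · rw [if_pos trivial]
  · simp only [HasPlace, St.store_mem]
    refine ⟨?_, ?_, ?_⟩
    · rw [if_neg (by omega), if_neg (by omega)]
      split_ifs with h
      · rw [show z = y by omega]
      · exact z1
    · rw [if_neg (by omega)]
      split_ifs with h
      · rw [show z = y by omega]
      · omega
      · exact z2
    · split_ifs with h
      · rw [show z = y by omega]
      · omega
      · omega
      · exact z3

/-- Number of the current node. -/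
abbrev vC : Var := .s 16
abbrev vBase : Var := .s 17
abbrev vLev : Var := .s 18
abbrev vTop : Var := .s 19

/-- Data of the current node. -/
structure AtNode (d : Dims k) (R : RegEx (BitVec w)) (x : ℕ) (s : St) : Prop where
  num : s.reg vC = x
  kind : s.reg vX = (R.node x).sub.kind
  fst : s.reg vI = (R.node x).fst
  snd : s.reg vJ = (R.node x).rightNum
  base : s.reg vBase = (R.node x).base
  lev : s.reg vLev = (R.node x).lev
  top : s.reg vTop = (R.node x).top.toNat
  pos : s.reg vZ = (R.node x).pos

/-- Loading of the data of the next node. -/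
def nodeCmd : Cmd :=
  set vC ((vC : Expr) - 1) ;;
  set vX (.load (3 * (vC : Expr))) ;; set vI (.load (3 * (vC : Expr) + 1)) ;;
  set vJ (.load (3 * (vC : Expr) + 2)) ;; set vBase (.load (11 * (vL : Expr) + (vC : Expr))) ;;
  set vLev (.load (12 * (vL : Expr) + (vC : Expr))) ;;
  set vTop (.load (13 * (vL : Expr) + (vC : Expr))) ;;
  set vZ ((vBase : Expr) + .load (9 * (vL : Expr) + (vC : Expr)) - 1)

theorem ends_nodeCmd {x : ℕ} (hR : R.size = d.n) (hx : x < d.n) (hL : s.reg vL = d.L)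
    (hC : s.reg vC = x + 1) (ht : IsTree R s.mem) (hs : HasSize d R s.mem x)
    (hp : HasPlace d R s.mem x) : nodeCmd.Ends d.w d.hi d.hi 1 s (AtNode d R x) := by
  have hn : d.n < d.L := d.n_lt
  have hhi := d.le_hi
  have e1 := d.mod_eq (x := 1) (by have := d.L_pos; omega)
  have e2 := d.mod_eq (x := 2) (by have := d.L_pos; omega)
  have e3 := d.mod_eq (x := 3) (by have := d.L_pos; omega)
  have e9 := d.mod_eq (x := 9) (by have := d.L_pos; omega)
  have e11 := d.mod_eq (x := 11) (by have := d.L_pos; omega)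
  have e12 := d.mod_eq (x := 12) (by have := d.L_pos; omega)
  have e13 := d.mod_eq (x := 13) (by have := d.L_pos; omega)
  have e9L := d.mod_eq (x := 9 * d.L) (by omega)
  have e11L := d.mod_eq (x := 11 * d.L) (by omega)
  have e12L := d.mod_eq (x := 12 * d.L) (by omega)
  have e13L := d.mod_eq (x := 13 * d.L) (by omega)
  have f9 := d.mod_eq (x := 9 * d.L + x) (by omega)
  have f11 := d.mod_eq (x := 11 * d.L + x) (by omega)
  have f12 := d.mod_eq (x := 12 * d.L + x) (by omega)
  have f13 := d.mod_eq (x := 13 * d.L + x) (by omega)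
  have f1 := d.mod_eq (x := 3 * x) (by omega)
  have f2 := d.mod_eq (x := 3 * x + 1) (by omega)
  have f3 := d.mod_eq (x := 3 * x + 2) (by omega)
  obtain ⟨t1, t2, t3⟩ := ht x (by omega)
  have hbs := RegEx.base_add_size_le (R := R) (i := x) (by omega)
  have hsz := (R.node x).sub.one_le_size
  have hpow : 0 < 2 ^ d.w := by positivity
  have ex : (2 ^ d.w - 1 + (x + 1)) % 2 ^ d.w = x := by
    rw [show 2 ^ d.w - 1 + (x + 1) = x + 2 ^ d.w by omega, Nat.add_mod_right, d.mod_eq (by omega)]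
  have f4 := d.mod_eq (x := (R.node x).base + (R.node x).sub.size) (by omega)
  have f5 : (2 ^ d.w - 1 + ((R.node x).base + (R.node x).sub.size)) % 2 ^ d.w = (R.node x).pos := by
    rw [TreeNode.pos, show 2 ^ d.w - 1 + ((R.node x).base + (R.node x).sub.size) =
      (R.node x).base + (R.node x).sub.size - 1 + 2 ^ d.w by omega, Nat.add_mod_right,
      d.mod_eq (by omega)]
  apply ends_of_wp le_rfl
  simp [nodeCmd, wp, hL, hC, e1, e2, e3, e9, e11, e12, e13, e9L, e11L, e12L, e13L, f1, f2, f3, f9,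
    f11, f12, f13, ex, t1, t2, t3, hs.1, hp.1, hp.2.1, hp.2.2, f4, f5]
  refine ⟨by omega, by omega, by omega, by omega, by omega, by omega, by omega, ?_⟩
  constructor <;> simp

/-- Storing of the places of the children of the current node. -/
def childCmd : Cmd :=
  ite 0 vX
    (ite vX 3
      (set vE (.load (9 * (vL : Expr) + (vI : Expr))) ;;
        set vF (.load (9 * (vL : Expr) + (vJ : Expr))) ;;
        ite vE vF
          (placeCmd vJ vBase vLev 0 ;;
            placeCmd vI ((vBase : Expr) + (vF : Expr)) ((vLev : Expr) + 1) 1)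
          (placeCmd vI vBase vLev 0 ;;
            placeCmd vJ ((vBase : Expr) + (vE : Expr)) ((vLev : Expr) + 1) 1))
      (placeCmd vI vBase vLev 0))
    skip

theorem ends_childCmd {x : ℕ} (hR : R.size = d.n) (hx : x < d.n) (hL : s.reg vL = d.L)
    (hN : AtNode d R x s) (hs : ∀ z < d.n, HasSize d R s.mem z) :
    childCmd.Ends d.w (11 * d.L) (14 * d.L) 1 s fun s' =>
      (∀ z < d.n, HasPlace d R s.mem z → HasPlace d R s'.mem z) ∧
      ∀ z, R.Heavy x z ∨ R.Light x z → HasPlace d R s'.mem z := by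
  have hn : d.n < d.L := d.n_lt
  have hx' : x < R.size := by omega
  have e0 : (0 : ℕ) % 2 ^ d.w = 0 := Nat.zero_mod _
  have e1 := d.mod_eq (x := 1) (by have := d.L_pos; omega)
  have e3 := d.mod_eq (x := 3) (by have := d.L_pos; omega)
  have e9 := d.mod_eq (x := 9) (by have := d.L_pos; omega)
  have e9L := d.mod_eq (x := 9 * d.L) (by omega)
  have hbs := RegEx.base_add_size_le (R := R) (i := x) (by omega)
  -- Levels are less than `n`, so increasing one by `1` cannot overflow.
  have hlev : (R.node x).lev < d.n := by
    have := RegEx.two_pow_lev_le (R := R) (i := x) (by omega)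
    have : (R.node x).lev < 2 ^ (R.node x).lev := Nat.lt_two_pow_self
    omega
  have elev := d.mod_eq (x := (R.node x).lev + 1) (by omega)
  rcases R.sub_cases x with ⟨a, ha⟩ | ⟨S, T, hST⟩ | ⟨S, hS⟩
  · have hk : s.reg vX = 0 := by rw [hN.kind, ha]; rfl
    refine ends_ite le_rfl (by simp) (by simp) (fun h => ?_) (fun _ => ends_skip ⟨fun _ _ h => h, ?_⟩)
    · rw [Expr.eval_var, hk] at h; omega
    · rintro z hz
      rcases R.child_num hz with ⟨h, -⟩ | ⟨h, -⟩
      · simp [TreeNode.HasHeavy, ha] at h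
      · simp [TreeNode.HasLight, ha] at h
  · obtain ⟨c1, c2, -, -, c5, c6⟩ := RegEx.node_children hx' hST
    have hk : 0 < s.reg vX ∧ s.reg vX < 3 := by
      rw [hN.kind]; rcases hST with h | h <;> rw [h] <;> simp [RegEx.kind]
    have hfst : s.reg vI = (R.node x).leftNum := by
      rw [hN.fst, TreeNode.fst]; rcases hST with h | h <;> rw [h]
    have hsum : (R.node x).sub.size = S.size + T.size + 1 := by
      rcases hST with h | h <;> rw [h] <;> rfl
    have g1 := (hs _ (c5.trans hx)).1
    have g2 := (hs _ (c6.trans hx)).1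
    simp only [c1, c2, TreeNode.leftNode, TreeNode.rightNode, apply_ite TreeNode.sub,
        ite_self] at g1 g2
    have f1 := d.mod_eq (x := 9 * d.L + (R.node x).leftNum) (by omega)
    have f2 := d.mod_eq (x := 9 * d.L + (R.node x).rightNum) (by omega)
    have f3 := d.mod_eq (x := (R.node x).base + S.size) (by omega)
    have f4 := d.mod_eq (x := (R.node x).base + T.size) (by omega)
    have hfin : ∀ m : ℕ → ℕ, HasPlace d R m (R.node x).leftNum →
        HasPlace d R m (R.node x).rightNum → ∀ z, R.Heavy x z ∨ R.Light x z → HasPlace d R m z := by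
      rintro m h1 h2 z hz
      rcases R.child_num hz with ⟨-, rfl⟩ | ⟨-, rfl⟩
      · exact h1
      · exact h2
    refine ends_ite le_rfl (by simp) (by simp) (fun _ => ?_) (fun h => ?_)
    swap
    · simp at h; omega
    refine ends_ite le_rfl (by simp) (by simp) (fun _ => ?_) (fun h => ?_)
    swap
    · simp [e3] at h; omega
    have b1 : 9 * d.L + (R.node x).leftNum < 14 * d.L := by omega
    have b2 : 9 * d.L + (R.node x).rightNum < 14 * d.L := by omega
    refine .seq (ends_set le_rfl (by simpa [hL, hfst, e9, e9L, f1] using b1)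
      (.seq (ends_set le_rfl (by simpa [hL, hN.snd, e9, e9L, f2] using b2) ?_)))
    simp only [Expr.eval_load, Expr.eval_add, Expr.eval_mul, Expr.eval_ofNat, Expr.eval_var,
      St.set_reg, hL, hfst, hN.snd, e9, e9L, f1, f2, g1, g2, St.set_mem,
      show vL ≠ vE by simp, show vJ ≠ vE by simp, if_false]
    refine ends_ite le_rfl (by simp) (by simp) (fun h => ?_) (fun h => ?_)
    · have hlt : ¬ T.size ≤ S.size := by simpa using h
      refine .seq ((ends_placeCmd (R := R) (y := (R.node x).rightNum) le_rfl (by simpa) (by simpa using hN.snd)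
        (by omega) (fun s' h => ?_) (fun s' h => ?_) (fun s' h => ?_)).imp ?_)
      · simp [h, c2, TreeNode.rightNode, hlt, hN.base]
      · simp [h, c2, TreeNode.rightNode, hlt, hN.lev]
      · simp [c2, TreeNode.rightNode, hlt]
      rintro s1 ⟨i1, i2, i3⟩
      refine (ends_placeCmd (R := R) (y := (R.node x).leftNum) le_rfl (by simpa [i1]) (by simpa [i1])
        (by omega) (fun s' h => ?_) (fun s' h => ?_) (fun s' h => ?_)).imp ?_
      · simp [h, i1, c1, TreeNode.leftNode, hlt, hN.base, f4]
      · simp [h, i1, c1, TreeNode.leftNode, hlt, hN.lev, e1, elev]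
      · simp [c1, TreeNode.leftNode, hlt, e1]
      rintro s2 ⟨-, j2, j3⟩
      exact ⟨fun z hz h => j3 z hz (i3 z hz (by simpa using h)), hfin _ j2 (j3 _ (by omega) i2)⟩
    · have hlt : T.size ≤ S.size := by simpa using h
      refine .seq ((ends_placeCmd (R := R) (y := (R.node x).leftNum) le_rfl (by simpa) (by simpa)
        (by omega) (fun s' h => ?_) (fun s' h => ?_) (fun s' h => ?_)).imp ?_)
      · simp [h, c1, TreeNode.leftNode, hlt, hN.base]
      · simp [h, c1, TreeNode.leftNode, hlt, hN.lev]
      · simp [c1, TreeNode.leftNode, hlt]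
      rintro s1 ⟨i1, i2, i3⟩
      refine (ends_placeCmd (R := R) (y := (R.node x).rightNum) le_rfl (by simpa [i1])
        (by simpa [i1] using hN.snd)
        (by omega) (fun s' h => ?_) (fun s' h => ?_) (fun s' h => ?_)).imp ?_
      · simp [h, i1, c2, TreeNode.rightNode, hlt, hN.base, f3]
      · simp [h, i1, c2, TreeNode.rightNode, hlt, hN.lev, e1, elev]
      · simp [c2, TreeNode.rightNode, hlt, e1]
      rintro s2 ⟨-, j2, j3⟩
      exact ⟨fun z hz h => j3 z hz (i3 z hz (by simpa using h)), hfin _ (j3 _ (by omega) i2) j2⟩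
  · obtain ⟨c1, -, c5⟩ := RegEx.node_child_star hx' hS
    have hk : s.reg vX = 3 := by rw [hN.kind, hS]; rfl
    have hfst : s.reg vI = (R.node x).leftNum := by
      rw [hN.fst, TreeNode.fst, hS]
    refine ends_ite le_rfl (by simp) (by simp) (fun _ => ?_) (fun h => ?_)
    swap
    · simp at h; omega
    refine ends_ite le_rfl (by simp) (by simp) (fun h => ?_) (fun _ => ?_)
    · simp [e3] at h; omega
    refine (ends_placeCmd (R := R) (y := (R.node x).leftNum) le_rfl hL hfst
        (by omega) (fun s' h => ?_) (fun s' h => ?_) (fun s' h => ?_)).imp ?_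
    · simp [h, c1, hN.base]
    · simp [h, c1, hN.lev]
    · simp [c1]
    rintro s1 ⟨-, i2, i3⟩
    refine ⟨i3, fun z hz => ?_⟩
    rcases R.child_num hz with ⟨-, rfl⟩ | ⟨h, -⟩
    · exact i2
    · simp [TreeNode.HasLight, hS] at h

end WordRAM


/-! ### The four table bits of a node. -/

namespace WordRAM

open BitSet Cmd HeavyLayout

variable {k : ℕ} {d : Dims k} {s : St} {w : ℕ} {R : RegEx (BitVec w)}

/-- The four bits of a node in its rows of the tables. -/
def code {α : Type} (N : TreeNode α) : ℕ → ℕ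
  -- The bits with values `1, 2, 4, 8` are the hub, the guard between hub and end, the end, and the
  -- guard of a top.
  | 0 => 4 + N.sub.upHub.toNat
  | 1 => 8 * N.top.toNat + 2 * N.sub.upGuard.toNat
  | 2 => N.sub.upLightHub.toNat
  | 3 => 4 * N.sub.upLight.toNat
  -- Tables `4` to `7` are reflected, so the four bits appear in reverse order. In tables `6` and
  -- `7` the bit is the end slot of the light child.
  | 4 => 2 + 8 * N.sub.downHub.toNat
  | 5 => N.top.toNat + 4 * N.sub.downGuard.toNat
  | 6 => 2 * N.sub.downLightHub.toNat
  | 7 => 2 * N.sub.downLight.toNat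
  | 8 => 4 * N.sub.null.toNat
  | 9 => 4
  | 10 => 1
  | 11 => 4
  | _ => 0

/-- The code of the current node for a table. -/
abbrev vCode (f : ℕ) : Var := .s (20 + f)

/-- Computation of the codes of the current node. -/
def codeCmd : Cmd :=
  set (vCode 0) 4 ;; set (vCode 1) (8 * (vTop : Expr)) ;; set (vCode 2) 0 ;; set (vCode 3) 0 ;;
  set (vCode 4) 2 ;; set (vCode 5) vTop ;; set (vCode 6) 0 ;; set (vCode 7) 0 ;;
  set (vCode 8) (4 * .load (10 * (vL : Expr) + (vC : Expr))) ;; set (vCode 9) 4 ;;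
  set (vCode 10) 1 ;; set (vCode 11) 4 ;;
  ite vX 1 skip
    (ite vX 2
      (ite (.load (9 * (vL : Expr) + (vI : Expr))) (.load (9 * (vL : Expr) + (vJ : Expr)))
        (set (vCode 2) 1 ;; set (vCode 3) (4 * .load (10 * (vL : Expr) + (vJ : Expr))) ;;
          set (vCode 4) 10 ;;
          set (vCode 5) ((vTop : Expr) + 4 * (.load (10 * (vL : Expr) + (vI : Expr)) ^^^ 1)) ;;
          set (vCode 7) 2)
        (set (vCode 0) 5 ;;
          set (vCode 1) (8 * (vTop : Expr) + 2 * (.load (10 * (vL : Expr) + (vJ : Expr)) ^^^ 1)) ;;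
          set (vCode 3) 4 ;; set (vCode 6) 2 ;;
          set (vCode 7) (2 * .load (10 * (vL : Expr) + (vI : Expr)))))
      (ite vX 3 (set (vCode 3) 4 ;; set (vCode 7) 2) (set (vCode 0) 5 ;; set (vCode 4) 10)))

theorem Dims.mod_small {x : ℕ} (h : x ≤ 16) : x % 2 ^ d.w = x :=
  d.mod_eq (by have := d.L_pos; omega)

set_option maxHeartbeats 1000000 in
theorem ends_codeCmd {x : ℕ} (hR : R.size = d.n) (hx : x < d.n) (hL : s.reg vL = d.L)
    (hN : AtNode d R x s) (hs : ∀ z < d.n, HasSize d R s.mem z) :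
    codeCmd.Ends d.w d.hi d.hi 1 s fun s' => ∀ f < 12, s'.reg (vCode f) = code (R.node x) f := by
  have hn : d.n < d.L := d.n_lt
  have hhi := d.le_hi
  have hx' : x < R.size := by omega
  have e1 := d.mod_small (x := 1) (by omega)
  have e2 := d.mod_small (x := 2) (by omega)
  have e3 := d.mod_small (x := 3) (by omega)
  have e4 := d.mod_small (x := 4) (by omega)
  have e5 := d.mod_small (x := 5) (by omega)
  have e8 := d.mod_small (x := 8) (by omega)
  have e9 := d.mod_small (x := 9) (by omega)
  have e10 := d.mod_small (x := 10) (by omega)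
  have e12 := d.mod_small (x := 12) (by omega)
  have e9L := d.mod_eq (x := 9 * d.L) (by omega)
  have e10L := d.mod_eq (x := 10 * d.L) (by omega)
  have f0 := d.mod_eq (x := 10 * d.L + x) (by omega)
  have e8b : ∀ b : Bool, (8 * b.toNat) % 2 ^ d.w = 8 * b.toNat := fun b =>
    d.mod_small (by cases b <;> simp)
  have e4b : ∀ b : Bool, (4 * b.toNat) % 2 ^ d.w = 4 * b.toNat := fun b =>
    d.mod_small (by cases b <;> simp)
  have e2b : ∀ b : Bool, (2 * b.toNat) % 2 ^ d.w = 2 * b.toNat := fun b =>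
    d.mod_small (by cases b <;> simp)
  have ex : ∀ b : Bool, b.toNat ^^^ 1 = (!b).toNat := fun b => by cases b <;> rfl
  have e82 : ∀ a b : Bool, (8 * a.toNat + 2 * b.toNat) % 2 ^ d.w = 8 * a.toNat + 2 * b.toNat :=
    fun a b => d.mod_small (by cases a <;> cases b <;> simp)
  have e14 : ∀ a b : Bool, (a.toNat + 4 * b.toNat) % 2 ^ d.w = a.toNat + 4 * b.toNat :=
    fun a b => d.mod_small (by cases a <;> cases b <;> simp)
  obtain ⟨s1, s2⟩ := hs x hx
  have hfst : (∀ a, (R.node x).sub ≠ .char a) → s.reg vI = (R.node x).leftNum := by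
    rw [hN.fst, TreeNode.fst]; cases (R.node x).sub <;> simp
  apply ends_of_wp le_rfl
  cases hsub : (R.node x).sub with
  | char a =>
    have hk : s.reg vX = 0 := by rw [hN.kind, hsub]; rfl
    simp [codeCmd, wp, hL, hN.num, hN.top, hk, s2, e1, e2, e4, e8, e10, e10L, f0, e8b, e4b]
    refine ⟨by omega, fun f hf => ?_⟩
    interval_cases f <;>
      simp [code, hsub, RegEx.upHub, RegEx.upGuard, RegEx.upLightHub, RegEx.upLight,
        RegEx.downHub, RegEx.downGuard, RegEx.downLightHub, RegEx.downLight, RegEx.null]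
  | cat S T =>
    obtain ⟨c1, c2, -, -, c5, c6⟩ := RegEx.node_children hx' (Or.inl hsub)
    have hk : s.reg vX = 1 := by rw [hN.kind, hsub]; rfl
    replace hfst := hfst (by simp [hsub])
    have g1 := hs _ (c5.trans hx)
    have g2 := hs _ (c6.trans hx)
    simp only [HasSize, c1, c2, TreeNode.leftNode, TreeNode.rightNode, apply_ite TreeNode.sub,
        ite_self] at g1 g2
    have f1 := d.mod_eq (x := 9 * d.L + (R.node x).leftNum) (by omega)
    have f2 := d.mod_eq (x := 9 * d.L + (R.node x).rightNum) (by omega)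
    have f3 := d.mod_eq (x := 10 * d.L + (R.node x).leftNum) (by omega)
    have f4 := d.mod_eq (x := 10 * d.L + (R.node x).rightNum) (by omega)
    have b1 : 9 * d.L + (R.node x).leftNum < d.hi := by omega
    have b2 : 9 * d.L + (R.node x).rightNum < d.hi := by omega
    have b3 : 10 * d.L + (R.node x).leftNum < d.hi := by omega
    have b4 : 10 * d.L + (R.node x).rightNum < d.hi := by omega
    have b5 : 10 * d.L + x < d.hi := by omega
    simp [codeCmd, wp, hL, hN.num, hN.top, hN.snd, hfst, hk, s2, e1, e2, e4, e5, e8, e9, e10,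
      e9L, e10L, f0, f1, f2, f3, f4, e8b, e4b, e2b, e82, e14, ex, b1, b2, b3, b4, b5, g1, g2]
    by_cases h : S.size < T.size
    · rw [if_pos h]
      have h' : ¬ T.size ≤ S.size := by omega
      refine fun f hf => ?_
      interval_cases f <;>
        simp [code, hsub, RegEx.upHub, RegEx.upGuard, RegEx.upLightHub, RegEx.upLight, h',
          RegEx.downHub, RegEx.downGuard, RegEx.downLightHub, RegEx.downLight, RegEx.null]
    · rw [if_neg h]
      have h' : T.size ≤ S.size := by omega
      refine fun f hf => ?_
      interval_cases f <;>
        simp [code, hsub, RegEx.upHub, RegEx.upGuard, RegEx.upLightHub, RegEx.upLight, h',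
          RegEx.downHub, RegEx.downGuard, RegEx.downLightHub, RegEx.downLight, RegEx.null]
  | alt S T =>
    have hk : s.reg vX = 2 := by rw [hN.kind, hsub]; rfl
    simp [codeCmd, wp, hL, hN.num, hN.top, hk, s2, e1, e2, e3, e4, e8, e10, e10L, f0, e8b, e4b]
    refine ⟨by omega, fun f hf => ?_⟩
    interval_cases f <;>
      simp [code, hsub, RegEx.upHub, RegEx.upGuard, RegEx.upLightHub, RegEx.upLight,
        RegEx.downHub, RegEx.downGuard, RegEx.downLightHub, RegEx.downLight, RegEx.null]
  | star S =>
    have hk : s.reg vX = 3 := by rw [hN.kind, hsub]; rfl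
    simp [codeCmd, wp, hL, hN.num, hN.top, hk, s2, e1, e2, e3, e4, e5, e8, e10, e10L, f0, e8b, e4b]
    refine ⟨by omega, fun f hf => ?_⟩
    interval_cases f <;>
      simp [code, hsub, RegEx.upHub, RegEx.upGuard, RegEx.upLightHub, RegEx.upLight,
        RegEx.downHub, RegEx.downGuard, RegEx.downLightHub, RegEx.downLight, RegEx.null]

end WordRAM


/-! ### The tables -/

namespace WordRAM

open BitSet Cmd HeavyLayout

variable {k : ℕ} {d : Dims k} {s : St} {w : ℕ} {R : RegEx (BitVec w)}

/-- Table, row and digit are the digits of the address in a mixed radix system. -/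
theorem Dims.addr_inj {f e j f' e' j' : ℕ} (he : e < d.L) (hj : j < k) (he' : e' < d.L)
    (hj' : j' < k) (h : d.addr f e j = d.addr f' e' j') : f = f' ∧ e = e' ∧ j = j' := by
  simp only [addr] at h
  have h' : (f * d.L + e) * k + j = (f' * d.L + e') * k + j' := by omega
  have hk : 0 < k := by omega
  have hL : 0 < d.L := by omega
  have h1 : f * d.L + e = f' * d.L + e' := by
    have := congrArg (· / k) h'
    simpa [Nat.mul_comm _ k, Nat.mul_add_div hk, Nat.div_eq_of_lt hj, Nat.div_eq_of_lt hj'] using this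
  have h2 : f = f' := by
    have := congrArg (· / d.L) h1
    simpa [Nat.mul_comm _ d.L, Nat.mul_add_div hL, Nat.div_eq_of_lt he, Nat.div_eq_of_lt he'] using this
  rw [h1] at h'
  subst h2
  omega

theorem Dims.addr_mono {f e j : ℕ} : d.addr f 0 0 ≤ d.addr f e j := by
  have := Nat.mul_le_mul_right k (Nat.le_add_right (f * d.L) e)
  simp only [addr, Nat.add_zero]; omega

/-- The code in `q` is entered into row `vT` of table `f`, at the position in `vY`. -/
def enterCmd (k f : ℕ) (q : Var) : Cmd :=
  rep k fun j => store (rowAddr k f vT j)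
    (row k f vT j ||| (((q : Expr) <<< ((vY : Expr) - (vU : Expr) * .num j)) &&& (vFull : Expr)))

theorem not_writes_enterCmd {f : ℕ} {q x : Var} : ¬ (enterCmd k f q).Writes x := by
  simp [enterCmd, writes_rep, Writes]

theorem ends_enterCmd {f e g b lo X : ℕ} {q : Var} {A : Set ℕ} (hX : 1 ≤ X) (hs : Loaded d s)
    (hT : s.reg vT = e) (hY : s.reg vY = 4 * g) (hq : s.reg q = b) (hb : b < 16) (hf : f < 13)
    (he : e < d.L) (hg : 4 * g ≤ d.U * k) (hlo : lo ≤ d.addr f 0 0)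
    (hD : Digits d.U k (tableDigit d s.mem f e) A) :
    (enterCmd k f q).Ends d.w lo d.hi X s fun s' => s'.reg = s.reg ∧
      Digits d.U k (tableDigit d s'.mem f e) (A ∪ nibble g b) ∧
      ∀ a, (∀ j < k, a ≠ d.addr f e j) → s'.mem a = s.mem a := by
  have hbits : d.U * k + d.w ≤ 2 ^ d.w := d.bits_le
  have hUw := d.U_lt
  refine (ends_rep (I := fun j s' => s'.reg = s.reg ∧
    (∀ i < j, ∀ p, (s'.mem (d.addr f e i)).testBit p = true ↔
      p < d.U ∧ d.U * i + p ∈ A ∪ nibble g b) ∧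
    ∀ a, (∀ i < j, a ≠ d.addr f e i) → s'.mem a = s.mem a) ?_ ?_).imp ?_
  · rintro j s1 hj ⟨i1, i2, i3⟩
    have hUj : d.U * j ≤ d.U * k := Nat.mul_le_mul_left _ hj.le
    have hjU : j ≤ d.U * j := Nat.le_mul_of_pos_left _ (by have := d.four_le_U; omega)
    have hL : s1.reg vL = d.L := by rw [i1]; exact hs.hL
    have hT' : s1.reg vT = e := by rw [i1]; exact hT
    have ea := eval_rowAddr (s := s1) (e := vT) hL (by simpa using hT') hf he hj
    have sr := safe_row (s := s1) (e := vT) hL (by simpa using hT') (by simp) hf he hj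
    have er := eval_row (s := s1) (e := vT) hL (by simpa using hT') hf he hj
    have hne : ∀ i < k, i ≠ j → d.addr f e i ≠ d.addr f e j := fun i hi hij h =>
      hij (Dims.addr_inj he hi he hj h).2.2
    have hold : s1.mem (d.addr f e j) = s.mem (d.addr f e j) :=
      i3 _ fun i hi => (hne i (by omega) (by omega)).symm
    have hnew := fun p => testBit_nibble (i := p) (w := d.w) (U := d.U) (k := k) (j := j) (g := g) (q := b) d.four_dvd_U
      hUw hg hbits hj hb
    -- The subtraction in the shift distance may wrap around, but the subtrahend itself is exact;
    -- the wrapped case is handled by `testBit_nibble`.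
    have ej : (d.U * (j % 2 ^ d.w)) % 2 ^ d.w = d.U * j := by
      rw [Nat.mod_eq_of_lt (a := j), Nat.mod_eq_of_lt] <;> omega
    refine ends_store hX (safe_rowAddr.2 (by simp)) (by simpa using sr)
      ⟨by rw [ea]; exact hlo.trans Dims.addr_mono, by rw [ea]; exact Dims.addr_lt hf he hj⟩ ?_
    rw [ea]
    refine ⟨i1, fun i hi p => ?_, fun a ha => ?_⟩
    · rw [St.store_mem]
      rcases Nat.lt_succ_iff_lt_or_eq.1 hi with h | rfl
      · rw [if_neg (hne i (by omega) (by omega))]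
        exact i2 i h p
      · rw [if_pos rfl, Expr.eval_or, er, hold, Nat.testBit_or, Bool.or_eq_true]
        have := hD i hj p
        rw [tableDigit] at this
        rw [this]
        simp only [Expr.eval_and, Expr.eval_shl, Expr.eval_var, Expr.eval_sub, Expr.eval_mul,
          Expr.eval_num, i1, hq, hY, hs.hU, hs.hFull, ej]
        rw [hnew, Set.mem_union]
        tauto
    · rw [St.store_mem, if_neg (ha j (by omega))]
      exact i3 a fun i hi => ha i (by omega)
  · exact ⟨rfl, fun i hi => by omega, fun _ _ => rfl⟩
  · rintro s1 ⟨i1, i2, i3⟩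
    exact ⟨i1, i2, i3⟩

/-- The row of a node in a table. -/
def entry {α : Type} (d : Dims k) (N : TreeNode α) (x : ℕ) : ℕ → ℕ
  | 0 | 1 | 2 | 3 => d.H - 1 - N.lev
  | 4 | 5 => N.lev
  -- These entries belong to the light child, whose level is one larger.
  | 6 | 7 => N.lev + 1
  | 11 => x
  | _ => 0

/-- The group of four positions for the code of a node in a table. -/
def group {α : Type} (d : Dims k) (N : TreeNode α) : ℕ → ℕ
  | 4 | 5 => d.U * k / 4 - 1 - N.pos
  -- The light child has position `pos - 1`, so its reflected group is one higher than that of the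
  -- node.
  | 6 | 7 => d.U * k / 4 - N.pos
  | _ => N.pos

def entryExpr : ℕ → Expr
  | 0 | 1 | 2 | 3 => (vH : Expr) - 1 - (vLev : Expr)
  | 4 | 5 => vLev
  | 6 | 7 => (vLev : Expr) + 1
  | 11 => vC
  | _ => 0

def shiftExpr (k : ℕ) : ℕ → Expr
  | 4 | 5 => (vU : Expr) * .num k - 4 * ((vZ : Expr) + 1)
  | 6 | 7 => (vU : Expr) * .num k - 4 * (vZ : Expr)
  | _ => 4 * (vZ : Expr)

theorem code_lt {α : Type} (N : TreeNode α) (f : ℕ) : code N f < 16 := by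
  have h : ∀ b : Bool, b.toNat ≤ 1 := fun b => by cases b <;> simp
  have h1 := h N.top
  unfold code
  split
  all_goals first | omega | (have := h N.sub.upHub; omega) | (have := h N.sub.upGuard; omega) |
    (have := h N.sub.upLightHub; omega) | (have := h N.sub.upLight; omega) |
    (have := h N.sub.downHub; omega) | (have := h N.sub.downGuard; omega) |
    (have := h N.sub.downLightHub; omega) | (have := h N.sub.downLight; omega) |
    (have := h N.sub.null; omega)

/-- The positions set in row `e` of table `f` by the nodes with the property `Q`. -/
def tableSet (d : Dims k) (R : RegEx (BitVec w)) (Q : ℕ → Prop) (f e : ℕ) : Set ℕ :=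
  {p | ∃ x < d.n, Q x ∧ entry d (R.node x) x f = e ∧ p ∈ nibble (group d (R.node x) f) (code (R.node x) f)}

/-- The codes of the nodes `x` with `Q f x` have been entered into the tables `f`. -/
def HasRows (d : Dims k) (R : RegEx (BitVec w)) (Q : ℕ → ℕ → Prop) (m : ℕ → ℕ) : Prop :=
  ∀ f < 13, ∀ e < d.L, Digits d.U k (tableDigit d m f e) (tableSet d R (Q f) f e)

/-- The codes of the current node are entered into the tables. -/
def tableCmd (k : ℕ) : Cmd :=
  rep 12 fun f => set vT (entryExpr f) ;; set vY (shiftExpr k f) ;; enterCmd k f (vCode f)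

/-- Each row of a table is the union of the nibbles of the nodes assigned to it. Treating one node
adds its nibble to one row of each of the tables `0` to `11`. -/
theorem ends_tableCmd {x : ℕ} (hR : R.size = d.n) (hH : Nat.log 2 R.numStates = d.H) (hx : x < d.n)
    (hs : Loaded d s) (hN : AtNode d R x s) (hc : ∀ f < 12, s.reg (vCode f) = code (R.node x) f)
    (hr : HasRows d R (fun _ y => x < y) s.mem) :
    (tableCmd k).Ends d.w (14 * d.L) d.hi 1 s fun s' => HasRows d R (fun _ y => x ≤ y) s'.mem := by
  have hn : d.n < d.L := d.n_lt
  have hHL := d.H_lt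
  have hbits : d.U * k + d.w ≤ 2 ^ d.w := d.bits_le
  have hlev : (R.node x).lev < d.H := hH ▸ R.heavyLayout.lev_lt x (by omega)
  have hpos : (R.node x).pos < d.n := hR ▸ RegEx.pos_lt (by omega)
  have h4n : 4 * d.n ≤ d.U * k := d.four_n_le
  obtain ⟨c, hc4⟩ := d.four_dvd_U
  have hdiv : d.U * k / 4 = c * k := by rw [hc4, Nat.mul_assoc]; omega
  have hdiv' : d.U * k = 4 * (c * k) := by rw [hc4, Nat.mul_assoc]
  have e1 := d.mod_small (x := 1) (by omega)
  have e4 := d.mod_small (x := 4) (by omega)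
  have hkU : k ≤ d.U * k := Nat.le_mul_of_pos_left _ (by have := d.four_le_U; omega)
  have hUw := d.U_lt
  have ek : k % 2 ^ d.w = k := Nat.mod_eq_of_lt (by omega)
  have eUk : (d.U * k) % 2 ^ d.w = d.U * k := Nat.mod_eq_of_lt (by omega)
  have hsub : ∀ a b, b ≤ a → a < 2 ^ d.w → (2 ^ d.w - b + a) % 2 ^ d.w = a - b := fun a b h1 h2 => by
    rw [show 2 ^ d.w - b + a = a - b + 2 ^ d.w by omega, Nat.add_mod_right,
      Nat.mod_eq_of_lt (by omega)]
  have hLw : d.L < 2 ^ d.w := by rw [← d.mod_eq (x := d.L) (by omega)]; exact Nat.mod_lt _ (by positivity)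
  refine (ends_rep (I := fun f s' => (∀ i, i ≠ 4 → i ≠ 8 → s'.reg (.s i) = s.reg (.s i)) ∧
    HasRows d R (fun f' y => x < y ∨ f' < f ∧ x = y) s'.mem) ?_ ?_).imp ?_
  · rintro f s1 hf ⟨i1, i2⟩
    have hent : (entryExpr f).Safe d.w d.hi s1 ∧
        (entryExpr f).eval d.w s1 = entry d (R.node x) x f ∧ entry d (R.node x) x f < d.L := by
      have j1 := i1 1 (by omega) (by omega)
      have j16 := i1 16 (by omega) (by omega)
      have j18 := i1 18 (by omega) (by omega)
      have f1 := d.mod_eq (x := (R.node x).lev + 1) (by omega)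
      interval_cases f <;> simp [entryExpr, entry, j1, j16, j18, hs.hH, hN.lev, hN.num, e1, f1] <;>
        first
        | omega
        | (rw [show 2 ^ d.w - (R.node x).lev + (2 ^ d.w - 1 + d.H) = 2 ^ d.w - (R.node x).lev +
            (d.H - 1) + 2 ^ d.w by omega, Nat.add_mod_right, hsub _ _ (by omega) (by omega)]; omega)
    have hshift : (shiftExpr k f).Safe d.w d.hi s1 ∧
        (shiftExpr k f).eval d.w s1 = 4 * group d (R.node x) f ∧
        4 * group d (R.node x) f ≤ d.U * k := by
      have j2 := i1 2 (by omega) (by omega)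
      have j9 := i1 9 (by omega) (by omega)
      have f1 : ((R.node x).pos + 1) % 2 ^ d.w = (R.node x).pos + 1 := d.mod_eq (by omega)
      have f2 : (4 * (R.node x).pos) % 2 ^ d.w = 4 * (R.node x).pos := d.mod_eq (by omega)
      have f3 : (4 * ((R.node x).pos + 1)) % 2 ^ d.w = 4 * ((R.node x).pos + 1) := d.mod_eq (by omega)
      interval_cases f <;> simp [shiftExpr, group, j2, j9, hs.hU, hN.pos, e1, e4, f1, f2, f3, ek,
        eUk, hdiv] <;>
        first
        | omega
        | (rw [hsub _ _ (by omega) (by omega)]; omega)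
    obtain ⟨h1, h2, h3⟩ := hent
    obtain ⟨h4, h5, h6⟩ := hshift
    refine .seq (ends_set le_rfl h1 (.seq (ends_set le_rfl ?_ ?_)))
    · clear * - h4
      revert h4
      unfold shiftExpr
      split <;> simp
    have h7 : (shiftExpr k f).eval d.w (s1.set vT ((entryExpr f).eval d.w s1)) =
        4 * group d (R.node x) f := by
      rw [← h5]
      unfold shiftExpr
      split <;> simp
    rw [h7, h2]
    refine (ends_enterCmd (d := d) (s := (s1.set vT (entry d (R.node x) x f)).set vY
      (4 * group d (R.node x) f)) (e := entry d (R.node x) x f) (g := group d (R.node x) f)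
      (b := code (R.node x) f) (A := tableSet d R (fun y => x < y ∨ f < f ∧ x = y) f
        (entry d (R.node x) x f)) le_rfl (hs.congr fun i hi => ?_) ?_ ?_ ?_
      (code_lt _ _) (by omega) h3 h6 ?_ (i2 f (by omega) _ h3)).imp ?_
    · have := i1 i (by omega) (by omega)
      simpa [show i ≠ 4 by omega, show i ≠ 8 by omega] using this
    · simp
    · simp
    · have := i1 (20 + f) (by omega) (by omega)
      rw [hc f hf] at this
      simpa [show 20 + f ≠ 4 by omega, show 20 + f ≠ 8 by omega] using this
    · simp only [Dims.addr]; omega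
    · rintro s2 ⟨k1, k2, k3⟩
      refine ⟨fun i h4 h8 => ?_, fun f' hf' e' he' => ?_⟩
      · rw [k1]
        simpa [h4, h8] using i1 i h4 h8
      · by_cases hfe : f' = f ∧ e' = entry d (R.node x) x f
        · obtain ⟨rfl, rfl⟩ := hfe
          refine k2.congr (fun _ _ => rfl) fun p _ => ?_
          constructor
          · rintro (⟨y, hy, h | h, h'⟩ | h)
            · exact ⟨y, hy, Or.inl h, h'⟩
            · omega
            · exact ⟨x, hx, Or.inr ⟨by omega, rfl⟩, rfl, h⟩
          · rintro ⟨y, hy, h | ⟨-, rfl⟩, h'⟩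
            · exact Or.inl ⟨y, hy, Or.inl h, h'⟩
            · exact Or.inr h'.2
        · refine (i2 f' hf' e' he').congr (fun j hj => ?_) fun p _ => ?_
          · refine (k3 _ fun j' hj' h => hfe ?_).trans rfl
            have := Dims.addr_inj he' hj h3 hj' h
            exact ⟨this.1, this.2.1⟩
          · constructor
            · rintro ⟨y, hy, h | ⟨h, rfl⟩, h'⟩
              · exact ⟨y, hy, Or.inl h, h'⟩
              · exact ⟨x, hy, Or.inr ⟨by omega, rfl⟩, h'⟩
            · rintro ⟨y, hy, h | ⟨h, rfl⟩, h'⟩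
              · exact ⟨y, hy, Or.inl h, h'⟩
              · refine ⟨x, hy, Or.inr ⟨?_, rfl⟩, h'⟩
                rcases Nat.lt_succ_iff_lt_or_eq.1 h with h | rfl
                · exact h
                · exact absurd ⟨rfl, h'.1.symm⟩ hfe
  · exact ⟨fun _ _ _ => rfl, fun f hf e he => by simpa using hr f hf e he⟩
  · rintro s1 ⟨-, i2⟩ f hf e he
    refine (i2 f hf e he).congr (fun _ _ => rfl) fun p _ => ?_
    rcases Nat.lt_or_ge f 12 with h | h
    · constructor
      · rintro ⟨y, hy, h1, h'⟩
        exact ⟨y, hy, by omega, h'⟩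
      · rintro ⟨y, hy, h1, h'⟩
        exact ⟨y, hy, by omega, h'⟩
    -- Table `12` is filled later; here its nibbles are empty.
    · obtain rfl : f = 12 := by omega
      simp [tableSet, nibble, code]

end WordRAM


/-! ### The layout and the tables, computed from the root downwards. -/

namespace WordRAM

open BitSet Cmd HeavyLayout

variable {k : ℕ} {d : Dims k} {s : St} {w : ℕ} {R : RegEx (BitVec w)}

/-- Computation of the layout and of the tables, from the root downwards. -/
def layoutCmd (k : ℕ) : Cmd :=
  store (13 * (vL : Expr) + ((vN : Expr) - 1)) 1 ;; set vC vN ;;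
  loop 0 vC (nodeCmd ;; childCmd ;; codeCmd ;; tableCmd k)

theorem AtNode.congr {s' : St} {x : ℕ} (h : AtNode d R x s)
    (hr : ∀ i ∈ [7, 9, 12, 13, 16, 17, 18, 19], s'.reg (.s i) = s.reg (.s i)) : AtNode d R x s' where
  num := (hr 16 (by simp)).trans h.num
  kind := (hr 7 (by simp)).trans h.kind
  fst := (hr 12 (by simp)).trans h.fst
  snd := (hr 13 (by simp)).trans h.snd
  base := (hr 17 (by simp)).trans h.base
  lev := (hr 18 (by simp)).trans h.lev
  top := (hr 19 (by simp)).trans h.top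
  pos := (hr 9 (by simp)).trans h.pos

theorem not_writes_childCmd {i : ℕ} (hi : i ≠ 14 ∧ i ≠ 15) : ¬ childCmd.Writes (.s i) := by
  simpa [childCmd, placeCmd, Writes] using hi

theorem not_writes_codeCmd {i : ℕ} (hi : i < 20) : ¬ codeCmd.Writes (.s i) := by
  simp [codeCmd, Writes]; omega

theorem not_writes_tableCmd {i : ℕ} (hi : i ≠ 4 ∧ i ≠ 8) : ¬ (tableCmd k).Writes (.s i) := by
  simp [tableCmd, writes_rep, Writes, not_writes_enterCmd, hi]

theorem not_writes_nodeCmd {i : ℕ} (hi : i < 7) : ¬ nodeCmd.Writes (.s i) := by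
  simp [nodeCmd, Writes]; omega

theorem HasSize.congr {m m' : ℕ → ℕ} {x : ℕ} (h : HasSize d R m x) (hx : x < d.n)
    (hm : ∀ a < 11 * d.L, m' a = m a) : HasSize d R m' x := by
  have hn : d.n < d.L := d.n_lt
  rwa [HasSize, hm _ (by omega), hm _ (by omega)]

theorem IsTree.congr {m m' : ℕ → ℕ} (h : IsTree R m) (hm : ∀ a < 3 * R.size, m' a = m a) :
    IsTree R m' := by
  intro x hx
  rw [hm _ (by omega), hm _ (by omega), hm _ (by omega)]
  exact h x hx

/-- Parents have larger numbers than their children. In descending order, every node therefore finds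
its place already stored, by its parent or by the initialization, and stores those of its children.
-/
theorem ends_layoutCmd (hR : R.size = d.n) (hH : Nat.log 2 R.numStates = d.H)
    (hs : Loaded d s) (hN : s.reg vN = d.n) (ht : IsTree R s.mem) (hsz : ∀ x < d.n, HasSize d R s.mem x)
    (h0 : ∀ a, 11 * d.L ≤ a → a < (14 + 13 * k) * d.L → s.mem a = 0) :
    (layoutCmd k).Ends d.w (11 * d.L) d.hi d.L s fun s' =>
      (∀ x < d.n, HasPlace d R s'.mem x) ∧ HasRows d R (fun _ _ => True) s'.mem := by
  have hn : d.n < d.L := d.n_lt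
  have hn1 := d.one_le_n
  have hL := d.L_pos
  have hhi := d.le_hi
  have hpow : 0 < 2 ^ d.w := by positivity
  have e0 : (0 : ℕ) % 2 ^ d.w = 0 := Nat.zero_mod _
  have e1 := d.mod_small (x := 1) (by omega)
  have e13 := d.mod_small (x := 13) (by omega)
  have e13L := d.mod_eq (x := 13 * d.L) (by omega)
  have en : (2 ^ d.w - 1 + d.n) % 2 ^ d.w = d.n - 1 := by
    rw [show 2 ^ d.w - 1 + d.n = d.n - 1 + 2 ^ d.w by omega, Nat.add_mod_right, d.mod_eq (by omega)]
  have ea := d.mod_eq (x := 13 * d.L + (d.n - 1)) (by omega)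
  refine .seq (ends_store (by omega) (by simp) (by simp) ?_ (.seq (ends_set (by omega) (by simp) ?_)))
  · simp [hs.hL, hN, e1, e13, e13L, en, ea]; omega
  simp only [Expr.eval_add, Expr.eval_mul, Expr.eval_sub, Expr.eval_ofNat, Expr.eval_var, hs.hL, hN,
    e1, e13, e13L, en, ea, St.store_reg]
  refine (ends_loop (N := d.n) (X' := 1) (I := fun i s' => Loaded d s' ∧ s'.reg vC = d.n - i ∧
    (∀ a < 11 * d.L, s'.mem a = s.mem a) ∧
    (∀ z < d.n, (z + 1 = d.n ∨ ∃ p, d.n - i ≤ p ∧ (R.Heavy p z ∨ R.Light p z)) →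
      HasPlace d R s'.mem z) ∧
    HasRows d R (fun _ y => d.n - i ≤ y) s'.mem) le_rfl (by omega) (fun _ _ _ _ => by simp)
    ?_ ?_ ?_).imp ?_
  · rintro i s1 hi ⟨-, i2, -⟩
    rw [Expr.eval_var, Expr.eval_ofNat, i2, e0]
    omega
  · rintro i s1 hi ⟨i1, i2, i3, i4, i5⟩
    obtain ⟨x, hx⟩ : ∃ x, d.n - i = x + 1 := ⟨d.n - i - 1, by omega⟩
    rw [hx] at i2 i4 i5
    rw [show d.n - (i + 1) = x by omega]
    have ht1 : IsTree R s1.mem := ht.congr fun a ha => i3 a (by omega)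
    have hsz1 : ∀ z < d.n, HasSize d R s1.mem z := fun z hz => (hsz z hz).congr hz i3
    have hpl : HasPlace d R s1.mem x := by
      refine i4 x (by omega) ?_
      by_cases hxn : x + 1 = d.n
      · exact Or.inl hxn
      · obtain ⟨p, hp1, hp2, h⟩ := R.exists_parent 0 0 0 true x (Nat.zero_le _) (by omega)
        refine Or.inr ⟨p, hp1, h.imp (fun h => ⟨by omega, h⟩) fun h => ⟨by omega, h⟩⟩
    refine .seq ((((ends_nodeCmd hR (by omega) i1.hL i2 ht1 (hsz1 x (by omega)) hpl).frame_readOnly).bounds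
      (by omega) le_rfl).imp ?_)
    rintro s2 ⟨j1, j2, j3⟩
    have l2 : Loaded d s2 := i1.congr fun i hi => j2 _ (not_writes_nodeCmd (by omega))
    rw [← j3] at hsz1 i4 i5
    refine .seq (((ends_childCmd hR (by omega) l2.hL j1 hsz1).frame.bounds le_rfl hhi).imp ?_)
    rintro s3 ⟨⟨k1, k2⟩, k3, k4⟩
    have l3 : Loaded d s3 := l2.congr fun i hi => k3 _ (not_writes_childCmd (by omega))
    have n3 : AtNode d R x s3 := j1.congr fun i hi => k3 _ (not_writes_childCmd (by
      constructor <;> rintro rfl <;> simp at hi))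
    have hsz3 : ∀ z < d.n, HasSize d R s3.mem z := fun z hz => (hsz1 z hz).congr hz fun a ha =>
      k4 a (by omega)
    refine .seq ((((ends_codeCmd hR (by omega) l3.hL n3 hsz3).frame_readOnly).bounds
      (by omega) le_rfl).imp ?_)
    rintro s4 ⟨m1, m2, m3⟩
    have l4 : Loaded d s4 := l3.congr fun i hi => m2 _ (not_writes_codeCmd (by omega))
    have n4 : AtNode d R x s4 := n3.congr fun i hi => m2 _ (not_writes_codeCmd (by
      simp at hi; omega))
    refine (((ends_tableCmd hR hH (by omega) l4 n4 m1 ?_).frame).bounds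
      (by omega) le_rfl).imp ?_
    · rw [m3]
      intro f hf e he
      refine (i5 f hf e he).congr (fun j hj => k4 _ (Or.inr ?_)) fun p _ => Iff.rfl
      simp only [Dims.addr]; omega
    rintro s5 ⟨q1, q2, q3⟩
    have hmem : ∀ a < 14 * d.L, s5.mem a = s3.mem a := fun a ha => by
      rw [q3 a (Or.inl ha), m3]
    have hplace : ∀ z < d.n, HasPlace d R s3.mem z → HasPlace d R s5.mem z := fun z hz h => by
      rwa [HasPlace, hmem _ (by omega), hmem _ (by omega), hmem _ (by omega)]
    refine ⟨l4.congr fun i hi => q2 _ (not_writes_tableCmd (by omega)),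
      (q2 _ (not_writes_tableCmd (by omega))).trans n4.num, fun a ha => ?_, fun z hz h => ?_, q1⟩
    · rw [hmem a (by omega), k4 a (by omega), j3, i3 a ha]
    · refine hplace z hz ?_
      rcases h with h | ⟨p, hp, h⟩
      · exact k1 z hz (i4 z hz (Or.inl h))
      · rcases Nat.lt_or_eq_of_le hp with hp | rfl
        · exact k1 z hz (i4 z hz (Or.inr ⟨p, hp, h⟩))
        · exact k2 z h
  · refine ⟨hs.congr fun i hi => by simp [show i ≠ 16 by omega], by simp, fun a ha => ?_, ?_, ?_⟩
    · rw [St.set_mem, St.store_mem, if_neg (by omega)]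
    · rintro z hz (h | ⟨p, hp, h⟩)
      · rw [HasPlace, show z = R.size - 1 by omega, R.node_root, hR]
        simp only [St.set_mem, St.store_mem]
        -- Base and level of the root are `0` and come from the cleared memory; only its mark as a
        -- top had to be stored.
        have hM : 14 * d.L ≤ (14 + 13 * k) * d.L := Nat.mul_le_mul_right _ (by omega)
        refine ⟨?_, ?_, if_pos trivial⟩
        · rw [if_neg (by omega)]; exact h0 _ (by omega) (by omega)
        · rw [if_neg (by omega)]; exact h0 _ (by omega) (by omega)
      · have : p < R.size := by rcases h with h | h <;> exact h.1
        omega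
    · intro f hf e he j hj i
      have ha := Dims.addr_lt_space hf he hj
      have h14 : 14 * d.L ≤ d.addr f e j := by simp only [Dims.addr]; omega
      rw [tableDigit, St.set_mem, St.store_mem, if_neg (by omega), h0 _ (by omega) ha]
      simp [tableSet]
      intro _ x hx h
      omega
  · rintro s1 ⟨-, -, -, i4, i5⟩
    refine ⟨fun x hx => i4 x hx ?_, fun f hf e he => (i5 f hf e he).congr (fun _ _ => rfl) fun p _ => ?_⟩
    · by_cases hxn : x + 1 = d.n
      · exact Or.inl hxn
      · obtain ⟨p, hp1, hp2, h⟩ := R.exists_parent 0 0 0 true x (Nat.zero_le _) (by omega)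
        refine Or.inr ⟨p, by omega, h.imp (fun h => ⟨by omega, h⟩) fun h => ⟨by omega, h⟩⟩
    · simp [tableSet]

end WordRAM


/-! ### From the stored nibbles to the sets used by the sweeps. -/

namespace BitSet

theorem mem_nibble {g q p : ℕ} : p ∈ nibble g q ↔
    q.testBit 0 = true ∧ p = 4 * g ∨ q.testBit 1 = true ∧ p = 4 * g + 1 ∨
    q.testBit 2 = true ∧ p = 4 * g + 2 ∨ q.testBit 3 = true ∧ p = 4 * g + 3 := by
  constructor
  · rintro ⟨h1, h2⟩
    have : p % 4 < 4 := Nat.mod_lt _ (by norm_num)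
    have hp := Nat.div_add_mod p 4
    rw [h1] at hp
    generalize p % 4 = r at *
    interval_cases r <;> simp [h2, ← hp]
  · rintro (⟨h, rfl⟩ | ⟨h, rfl⟩ | ⟨h, rfl⟩ | ⟨h, rfl⟩)
    · exact ⟨by omega, by rwa [show 4 * g % 4 = 0 by omega]⟩
    · exact ⟨by omega, by rwa [show (4 * g + 1) % 4 = 1 by omega]⟩
    · exact ⟨by omega, by rwa [show (4 * g + 2) % 4 = 2 by omega]⟩
    · exact ⟨by omega, by rwa [show (4 * g + 3) % 4 = 3 by omega]⟩

end BitSet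

namespace WordRAM

open BitSet Cmd HeavyLayout

variable {k : ℕ} {d : Dims k} {s : St} {w : ℕ} {R : RegEx (BitVec w)}

section codes

variable {α : Type} (N : TreeNode α) (g p : ℕ)

theorem mem_code_zero : p ∈ nibble g (code N 0) ↔
    p = 4 * g + 2 ∨ N.sub.upHub = true ∧ p = 4 * g := by
  rw [mem_nibble, code]
  cases N.sub.upHub <;> simp [Nat.testBit_eq_decide_div_mod_eq]
  tauto

theorem mem_code_one : p ∈ nibble g (code N 1) ↔
    N.top = true ∧ p = 4 * g + 3 ∨ N.sub.upGuard = true ∧ p = 4 * g + 1 := by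
  rw [mem_nibble, code]
  cases N.top <;> cases N.sub.upGuard <;> simp [Nat.testBit_eq_decide_div_mod_eq]
  tauto

theorem mem_code_two : p ∈ nibble g (code N 2) ↔ N.sub.upLightHub = true ∧ p = 4 * g := by
  rw [mem_nibble, code]
  cases N.sub.upLightHub <;> simp [Nat.testBit_eq_decide_div_mod_eq]

theorem mem_code_three : p ∈ nibble g (code N 3) ↔ N.sub.upLight = true ∧ p = 4 * g + 2 := by
  rw [mem_nibble, code]
  cases N.sub.upLight <;> simp [Nat.testBit_eq_decide_div_mod_eq]

theorem mem_code_four : p ∈ nibble g (code N 4) ↔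
    p = 4 * g + 1 ∨ N.sub.downHub = true ∧ p = 4 * g + 3 := by
  rw [mem_nibble, code]
  cases N.sub.downHub <;> simp [Nat.testBit_eq_decide_div_mod_eq]

theorem mem_code_five : p ∈ nibble g (code N 5) ↔
    N.top = true ∧ p = 4 * g ∨ N.sub.downGuard = true ∧ p = 4 * g + 2 := by
  rw [mem_nibble, code]
  cases N.top <;> cases N.sub.downGuard <;> simp [Nat.testBit_eq_decide_div_mod_eq]

theorem mem_code_six : p ∈ nibble g (code N 6) ↔ N.sub.downLightHub = true ∧ p = 4 * g + 1 := by
  rw [mem_nibble, code]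
  cases N.sub.downLightHub <;> simp [Nat.testBit_eq_decide_div_mod_eq]

theorem mem_code_seven : p ∈ nibble g (code N 7) ↔ N.sub.downLight = true ∧ p = 4 * g + 1 := by
  rw [mem_nibble, code]
  cases N.sub.downLight <;> simp [Nat.testBit_eq_decide_div_mod_eq]

theorem mem_code_eight : p ∈ nibble g (code N 8) ↔ N.sub.null = true ∧ p = 4 * g + 2 := by
  rw [mem_nibble, code]
  cases N.sub.null <;> simp [Nat.testBit_eq_decide_div_mod_eq]

theorem mem_nibble_four : p ∈ nibble g 4 ↔ p = 4 * g + 2 := by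
  rw [mem_nibble]
  simp [Nat.testBit_eq_decide_div_mod_eq]

theorem mem_nibble_one : p ∈ nibble g 1 ↔ p = 4 * g := by
  rw [mem_nibble]
  simp [Nat.testBit_eq_decide_div_mod_eq]

end codes

/-- The tables are filled without asking whether a light child exists; a flag set for it guarantees
that it does. -/
theorem light_of_flag {x : ℕ} (hx : x < R.size) (h : (R.node x).sub.upLightHub = true ∨
    (R.node x).sub.upLight = true ∨ (R.node x).sub.downLightHub = true ∨
    (R.node x).sub.downLight = true) : R.Light x (R.node x).lightNum := by
  refine ⟨hx, ?_, rfl⟩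
  rw [TreeNode.HasLight]
  split <;> simp_all [RegEx.upLightHub, RegEx.upLight, RegEx.downLightHub, RegEx.downLight]

/-- Pure arithmetic of positions. In tables `6` and `7` the position and level of the light child
are expressed by those of its parent, through `light_pos` and `light_lev`. -/
theorem hasTables_of_rows {m : ℕ → ℕ} (hR : R.size = d.n) (hH : Nat.log 2 R.numStates = d.H)
    (h : ∀ f < 12, ∀ e < d.L, Digits d.U k (tableDigit d m f e) (tableSet d R (fun _ => True) f e)) :
    HasTables d R m := by
  have hlay := R.heavyLayout
  rw [hH, hR] at hlay
  have hHL := d.H_lt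
  have hn : d.n < d.L := d.n_lt
  have h4n : 4 * d.n ≤ d.U * k := d.four_n_le
  obtain ⟨c, hc4⟩ := d.four_dvd_U
  have hdiv : d.U * k / 4 = c * k := by rw [hc4, Nat.mul_assoc]; omega
  have hdiv' : d.U * k = 4 * (c * k) := by rw [hc4, Nat.mul_assoc]
  have hpos := hlay.pos_lt
  have hlev := hlay.lev_lt
  have hln : ∀ x l, R.Light x l → x < d.n := fun x l hl => hR ▸ hl.1
  constructor
  · intro t ht
    refine (h 0 (by omega) t (by omega)).congr (fun _ _ => rfl) fun p hp => ?_
    simp only [tableSet, pathSlots, Set.mem_ofPred_eq, entry, group, mem_code_zero, true_and, hR]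
    refine exists_congr fun x => and_congr_right fun hx => ?_
    have := hlev x hx
    exact and_congr_left fun _ => by omega
  · intro t ht
    refine (h 1 (by omega) t (by omega)).congr (fun _ _ => rfl) fun p hp => ?_
    simp only [tableSet, guardSlots, Set.mem_ofPred_eq, entry, group, mem_code_one, true_and, hR]
    refine exists_congr fun x => and_congr_right fun hx => ?_
    have := hlev x hx
    exact and_congr_left fun _ => by omega
  · intro t ht
    refine (h 2 (by omega) t (by omega)).congr (fun _ _ => rfl) fun p hp => ?_
    simp only [tableSet, hubTargets, Set.mem_ofPred_eq, entry, group, mem_code_two, true_and]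
    constructor
    · rintro ⟨x, hx, h1, h2, h3⟩
      have := hlev x hx
      exact ⟨x, _, light_of_flag (by omega) (by simp [h2]), by omega, h2, h3⟩
    · rintro ⟨x, l, hl, h1, h2, h3⟩
      have := hlev x (hln x l hl)
      exact ⟨x, hln x l hl, by omega, h2, h3⟩
  · intro t ht
    refine (h 3 (by omega) t (by omega)).congr (fun _ _ => rfl) fun p hp => ?_
    simp only [tableSet, endTargets, Set.mem_ofPred_eq, entry, group, mem_code_three, true_and]
    constructor
    · rintro ⟨x, hx, h1, h2, h3⟩
      have := hlev x hx
      exact ⟨x, _, light_of_flag (by omega) (by simp [h2]), by omega, h2, h3⟩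
    · rintro ⟨x, l, hl, h1, h2, h3⟩
      have := hlev x (hln x l hl)
      exact ⟨x, hln x l hl, by omega, h2, h3⟩
  · intro t ht
    refine (h 4 (by omega) t (by omega)).congr (fun _ _ => rfl) fun p hp => ?_
    simp only [tableSet, reflect, pathSlots, Set.mem_ofPred_eq, entry, group, mem_code_four, true_and,
      hR, hp]
    refine exists_congr fun x => and_congr_right fun hx => and_congr_right fun _ => ?_
    have := hpos x hx
    exact or_congr (by omega) (and_congr_right fun _ => by omega)
  · intro t ht
    refine (h 5 (by omega) t (by omega)).congr (fun _ _ => rfl) fun p hp => ?_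
    simp only [tableSet, reflect, guardSlots, Set.mem_ofPred_eq, entry, group, mem_code_five, true_and,
      hR, hp]
    refine exists_congr fun x => and_congr_right fun hx => and_congr_right fun _ => ?_
    have := hpos x hx
    exact or_congr (and_congr_right fun _ => by omega) (and_congr_right fun _ => by omega)
  · intro t ht
    refine (h 6 (by omega) t (by omega)).congr (fun _ _ => rfl) fun p hp => ?_
    simp only [tableSet, reflect, childTargets, Set.mem_ofPred_eq, entry, group, mem_code_six, true_and,
      hp]
    constructor
    · rintro ⟨x, hx, h1, h2, h3⟩
      have hl := light_of_flag (R := R) (x := x) (by omega) (by simp [h2])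
      have := hpos x hx
      have h4 := hlay.light_lev _ _ hl
      have h5 := hlay.light_pos _ _ hl
      exact ⟨x, _, hl, by omega, h2, by omega⟩
    · rintro ⟨x, l, hl, h1, h2, h3⟩
      have := hpos x (hln x l hl)
      have h4 := hlay.light_lev _ _ hl
      have h5 := hlay.light_pos _ _ hl
      exact ⟨x, hln x l hl, by omega, h2, by omega⟩
  · intro t ht
    refine (h 7 (by omega) t (by omega)).congr (fun _ _ => rfl) fun p hp => ?_
    simp only [tableSet, reflect, childTargets, Set.mem_ofPred_eq, entry, group, mem_code_seven, true_and,
      hp]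
    constructor
    · rintro ⟨x, hx, h1, h2, h3⟩
      have hl := light_of_flag (R := R) (x := x) (by omega) (by simp [h2])
      have := hpos x hx
      have h4 := hlay.light_lev _ _ hl
      have h5 := hlay.light_pos _ _ hl
      exact ⟨x, _, hl, by omega, h2, by omega⟩
    · rintro ⟨x, l, hl, h1, h2, h3⟩
      have := hpos x (hln x l hl)
      have h4 := hlay.light_lev _ _ hl
      have h5 := hlay.light_pos _ _ hl
      exact ⟨x, hln x l hl, by omega, h2, by omega⟩
  · refine (h 8 (by omega) 0 (by omega)).congr (fun _ _ => rfl) fun p hp => ?_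
    simp [tableSet, RegEx.ends, RegEx.endPos, entry, group, mem_code_eight, hR]
  · refine (h 9 (by omega) 0 (by omega)).congr (fun _ _ => rfl) fun p hp => ?_
    simp [tableSet, RegEx.ends, RegEx.endPos, entry, group, code, mem_nibble_four, hR]
  · refine (h 10 (by omega) 0 (by omega)).congr (fun _ _ => rfl) fun p hp => ?_
    simp [tableSet, entry, group, code, mem_nibble_one, hR]
  · intro e he
    refine (h 11 (by omega) e (by omega)).congr (fun _ _ => rfl) fun p hp => ?_
    simp [tableSet, RegEx.ends, RegEx.endPos, entry, group, code, mem_nibble_four, hR]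

/-- Row `vT - 1` of table `12` is copied to row `vT`. -/
def copyCmd (k : ℕ) : Cmd :=
  rep k fun j => store (rowAddr k 12 vT j) (row k 12 ((vT : Expr) - 1) j)

/-- Position and code of the current node, if it is a leaf. -/
def leafCmd : Cmd :=
  set vJ vI ;; ite (.load (3 * (vX : Expr))) 1 (set vZ 4) (set vZ 0) ;;
  set vY (4 * (.load (11 * (vL : Expr) + (vX : Expr)) + .load (9 * (vL : Expr) + (vX : Expr)) - 1))

/-- Computation of the sets of the leaves with equal characters. -/
def maskCmd (k : ℕ) : Cmd :=
  set vT 0 ;;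
  loop vT vL (
    set vX (.load (7 * (vL : Expr) + (vT : Expr))) ;; set vI (.load (3 * (vX : Expr) + 1)) ;;
    ite 0 vT (ite vJ vI skip (copyCmd k)) skip ;;
    leafCmd ;; enterCmd k 12 vZ ;;
    set vT ((vT : Expr) + 1))

theorem not_writes_copyCmd {x : Var} : ¬ (copyCmd k).Writes x := by
  simp [copyCmd, writes_rep, Writes]

/-- Source and target are different rows of the same table, so the source is not disturbed while the
copy is under way. -/
theorem ends_copyCmd {t X : ℕ} (hX : 1 ≤ X) (hL : s.reg vL = d.L) (hT : s.reg vT = t + 1)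
    (ht : t + 1 < d.L) : (copyCmd k).Ends d.w (d.addr 12 0 0) d.hi X s fun s' =>
      (∀ j < k, s'.mem (d.addr 12 (t + 1) j) = s.mem (d.addr 12 t j)) ∧
      ∀ a, (∀ j < k, a ≠ d.addr 12 (t + 1) j) → s'.mem a = s.mem a := by
  have hpow : 0 < 2 ^ d.w := by positivity
  have e1 := d.mod_small (x := 1) (by omega)
  refine (ends_rep (I := fun j s' => s'.reg = s.reg ∧
    (∀ i < j, s'.mem (d.addr 12 (t + 1) i) = s.mem (d.addr 12 t i)) ∧
    ∀ a, (∀ i < j, a ≠ d.addr 12 (t + 1) i) → s'.mem a = s.mem a) ?_ ?_).imp ?_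
  · rintro j s1 hj ⟨i1, i2, i3⟩
    have hL1 : s1.reg vL = d.L := by rw [i1]; exact hL
    have hT1 : s1.reg vT = t + 1 := by rw [i1]; exact hT
    have ha := eval_rowAddr (f := 12) (e := vT) hL1 (by simpa using hT1) (by omega) ht hj
    have hv : ((vT : Expr) - 1).eval d.w s1 = t := by
      simp [hT1, e1]
      rw [show 2 ^ d.w - 1 + (t + 1) = t + 2 ^ d.w by omega, Nat.add_mod_right, d.mod_eq (by omega)]
    have hr := eval_row (f := 12) hL1 hv (by omega) (by omega) hj
    have hsafe := safe_row (f := 12) hL1 hv (by simp) (by omega) (by omega) hj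
    have hne : ∀ i < k, i ≠ j → d.addr 12 (t + 1) i ≠ d.addr 12 (t + 1) j := fun i hi hij h =>
      hij (Dims.addr_inj ht hi ht hj h).2.2
    refine ends_store hX (safe_rowAddr.2 (by simp)) hsafe
      ⟨by rw [ha]; exact Dims.addr_mono, by rw [ha]; exact Dims.addr_lt (by omega) ht hj⟩ ?_
    rw [ha, hr]
    refine ⟨i1, fun i hi => ?_, fun a h => ?_⟩
    · rw [St.store_mem]
      rcases Nat.lt_succ_iff_lt_or_eq.1 hi with h | rfl
      · rw [if_neg (hne i (by omega) (by omega))]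
        exact i2 i h
      · rw [if_pos rfl]
        refine i3 _ fun i' hi' h => ?_
        have := Dims.addr_inj (by omega) hj ht (by omega) h
        omega
    · rw [St.store_mem, if_neg (h j (by omega))]
      exact i3 a fun i hi => h i (by omega)
  · exact ⟨rfl, fun i hi => by omega, fun _ _ => rfl⟩
  · rintro s1 ⟨-, i2, i3⟩
    exact ⟨i2, i3⟩

end WordRAM


/-! ### The sets of leaves with equal characters, and the whole preprocessing. -/

namespace WordRAM

open BitSet Cmd HeavyLayout

variable {k : ℕ} {d : Dims k} {s : St} {w : ℕ} {R : RegEx (BitVec w)}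

theorem Dims.le_addr {f e j : ℕ} : 14 * d.L ≤ d.addr f e j := by
  simp only [addr]; omega

/-- The leaves with the same character as the leaf with rank `t`, up to this rank. -/
def maskSet (d : Dims k) (R : RegEx (BitVec w)) (m : ℕ → ℕ) (t : ℕ) : Set ℕ :=
  R.ends fun x => (R.node x).sub.kind = 0 ∧
    ∃ t' ≤ t, m (7 * d.L + t') = x ∧ key m x = key m (m (7 * d.L + t))

/-- The list is sorted, so the ranks with a given key are consecutive. Hence row `t` arises by
adding the leaf of rank `t` to the preceding row, if the keys agree, and otherwise to the empty set.
-/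
theorem maskSet_eq {m : ℕ → ℕ} {t x b : ℕ} {C : Set ℕ} (hR : R.size = d.n) (ho : HasOrder d m)
    (ht : t < d.L) (hx : m (7 * d.L + t) = x) (hb : b = if (R.node x).sub.kind = 0 then 4 else 0)
    (hC : 0 < t → key m (m (7 * d.L + (t - 1))) = key m x → C = maskSet d R m (t - 1))
    (hC' : (0 < t → key m (m (7 * d.L + (t - 1))) ≠ key m x) → C = ∅) :
    C ∪ nibble (R.node x).pos b = maskSet d R m t := by
  have hxn : x < R.size := by rw [← hx, hR]; exact ho.lt t ht
  have hnib : ∀ p, p ∈ nibble (R.node x).pos b ↔ (R.node x).sub.kind = 0 ∧ p = R.endPos x := by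
    intro p
    rw [hb]
    split_ifs with h
    · simp [mem_nibble_four, RegEx.endPos, h]
    · simp [h, mem_nibble]
  ext p
  rw [Set.mem_union, hnib]
  constructor
  · rintro (h | ⟨h1, h2⟩)
    · by_cases hc : 0 < t ∧ key m (m (7 * d.L + (t - 1))) = key m x
      · rw [hC hc.1 hc.2] at h
        obtain ⟨y, hy, ⟨h1, t', ht', h2, h3⟩, h4⟩ := h
        exact ⟨y, hy, ⟨h1, t', by omega, h2, by rw [h3, hc.2, hx]⟩, h4⟩
      · rw [hC' fun h1 h2 => hc ⟨h1, h2⟩] at h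
        exact h.elim
    · exact ⟨x, hxn, ⟨h1, t, le_rfl, hx, by rw [hx]⟩, h2⟩
  · rintro ⟨y, hy, ⟨h1, t', ht', h2, h3⟩, h4⟩
    rcases Nat.lt_or_eq_of_le ht' with hlt | rfl
    · left
      -- An earlier rank with the same key forces rank `t - 1` to have it too, by monotonicity.
      have k1 := ho.mono t' (t - 1) (by omega) (by omega)
      have k2 := ho.mono (t - 1) t (by omega) ht
      rw [h2, h3] at k1
      have k3 : key m (m (7 * d.L + (t - 1))) = key m x := by rw [← hx]; omega
      rw [hC (by omega) k3]
      exact ⟨y, hy, ⟨h1, t', by omega, h2, by rw [h3, k3, hx]⟩, h4⟩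
    · obtain rfl : x = y := hx.symm.trans h2
      exact Or.inr ⟨h1, h4⟩

theorem ends_maskCmd (hR : R.size = d.n) (hs : Loaded d s) (ht : IsTree R s.mem)
    (ho : HasOrder d s.mem) (hsz : ∀ x < d.n, HasSize d R s.mem x)
    (hp : ∀ x < d.n, HasPlace d R s.mem x)
    (h0 : ∀ e < d.L, Digits d.U k (tableDigit d s.mem 12 e) ∅) :
    (maskCmd k).Ends d.w (d.addr 12 0 0) d.hi (d.L + 1) s fun s' =>
      ∀ t < d.L, Digits d.U k (tableDigit d s'.mem 12 t) (maskSet d R s.mem t) := by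
  have hn : d.n < d.L := d.n_lt
  have hL := d.L_pos
  have hhi := d.le_hi
  have hpow : 0 < 2 ^ d.w := by positivity
  have h4n : 4 * d.n ≤ d.U * k := d.four_n_le
  have e0 : (0 : ℕ) % 2 ^ d.w = 0 := Nat.zero_mod _
  have e1 := d.mod_small (x := 1) (by omega)
  have e3 := d.mod_small (x := 3) (by omega)
  have e4 := d.mod_small (x := 4) (by omega)
  have e7 := d.mod_small (x := 7) (by omega)
  have e9 := d.mod_small (x := 9) (by omega)
  have e11 := d.mod_small (x := 11) (by omega)
  have e7L := d.mod_eq (x := 7 * d.L) (by omega)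
  have e9L := d.mod_eq (x := 9 * d.L) (by omega)
  have e11L := d.mod_eq (x := 11 * d.L) (by omega)
  refine .seq (ends_set (by omega) (by simp) ?_)
  -- `vJ` remembers the key of the previous rank. Rows not yet treated are still empty, so nothing
  -- has to be cleared when a new key begins.
  refine (ends_loop (N := d.L) (X' := 1) (I := fun i s' => Loaded d s' ∧ s'.reg vT = i ∧
    (0 < i → s'.reg vJ = key s.mem (s.mem (7 * d.L + (i - 1)))) ∧
    (∀ a < d.addr 12 0 0, s'.mem a = s.mem a) ∧
    (∀ t < i, Digits d.U k (tableDigit d s'.mem 12 t) (maskSet d R s.mem t)) ∧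
    ∀ t, i ≤ t → t < d.L → Digits d.U k (tableDigit d s'.mem 12 t) ∅) le_rfl (by omega)
    (fun _ _ _ _ => by simp) ?_ ?_ ?_).imp ?_
  · rintro i s1 hi ⟨i1, i2, -⟩
    rw [Expr.eval_var, Expr.eval_var, i1.hL, i2]
  · rintro i s1 hi ⟨i1, i2, i3, i4, i5, i6⟩
    have hadd : 14 * d.L ≤ d.addr 12 0 0 := Dims.le_addr
    obtain ⟨x, hx⟩ : ∃ x, s.mem (7 * d.L + i) = x := ⟨_, rfl⟩
    have hxn : x < d.n := hx ▸ ho.lt i hi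
    have hm1 : s1.mem (7 * d.L + i) = x := (i4 _ (by omega)).trans hx
    have hm2 : s1.mem (3 * x + 1) = key s.mem x := i4 _ (by omega)
    have hm3 : s1.mem (3 * x) = (R.node x).sub.kind := (i4 _ (by omega)).trans (ht x (by omega)).1
    have hm4 : s1.mem (11 * d.L + x) = (R.node x).base := (i4 _ (by omega)).trans (hp x hxn).1
    have hm5 : s1.mem (9 * d.L + x) = (R.node x).sub.size := (i4 _ (by omega)).trans (hsz x hxn).1
    have f1 := d.mod_eq (x := 7 * d.L + i) (by omega)
    have f2 := d.mod_eq (x := 3 * x) (by omega)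
    have f3 := d.mod_eq (x := 3 * x + 1) (by omega)
    have f4 := d.mod_eq (x := 11 * d.L + x) (by omega)
    have f5 := d.mod_eq (x := 9 * d.L + x) (by omega)
    refine .seq (ends_set le_rfl (by simp [i1.hL, i2, e7, e7L, f1]; omega) (.seq (ends_set le_rfl
      (by simp [i1.hL, i2, e7, e7L, f1, hm1, e3, e1, f2, f3]; omega) ?_)))
    simp only [Expr.eval_load, Expr.eval_add, Expr.eval_mul, Expr.eval_ofNat, Expr.eval_var, i1.hL,
      i2, e7, e7L, f1, hm1, St.set_reg, if_true, e3, e1, f2, f3, St.set_mem, hm2]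
    obtain ⟨s2, hs2⟩ : ∃ s2, s2 = (s1.set vX x).set vI (key s.mem x) := ⟨_, rfl⟩
    rw [← hs2]
    have l2 : Loaded d s2 := i1.congr fun i hi => by
      simp [hs2, show i ≠ 12 by omega, show i ≠ 7 by omega]
    have r2 : s2.reg vT = i ∧ s2.reg vI = key s.mem x ∧ s2.reg vX = x ∧
        (0 < i → s2.reg vJ = key s.mem (s.mem (7 * d.L + (i - 1)))) ∧ s2.mem = s1.mem := by
      simp [hs2, i2]
      exact i3
    obtain ⟨r2T, r2I, r2X, r2J, r2m⟩ := r2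
    rw [← r2m] at i4 i5 i6 hm3 hm4 hm5
    refine .seq ?_
    have hstep : (ite 0 vT (ite vJ vI skip (copyCmd k)) skip).Ends d.w (d.addr 12 0 0) d.hi 1 s2
        fun s' => (∃ C, Digits d.U k (tableDigit d s'.mem 12 i) C ∧
          (0 < i → key s.mem (s.mem (7 * d.L + (i - 1))) = key s.mem x →
            C = maskSet d R s.mem (i - 1)) ∧
          ((0 < i → key s.mem (s.mem (7 * d.L + (i - 1))) ≠ key s.mem x) → C = ∅)) ∧
        ∀ a, (∀ j < k, a ≠ d.addr 12 i j) → s'.mem a = s2.mem a := by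
      refine ends_ite le_rfl (by simp) (by simp) (fun h => ?_) (fun h => ends_skip ⟨⟨∅, i6 i le_rfl hi,
        fun h1 => ?_, fun _ => rfl⟩, fun _ _ => rfl⟩)
      · simp [r2T] at h
        refine ends_ite le_rfl (by simp) (by simp) (fun h' => ends_skip ⟨⟨∅, i6 i le_rfl hi,
          fun _ h2 => ?_, fun _ => rfl⟩, fun _ _ => rfl⟩) (fun h' => ?_)
        · simp [r2J h, r2I] at h'; omega
        · simp [r2J h, r2I] at h'
          obtain ⟨t, rfl⟩ : ∃ t, i = t + 1 := ⟨i - 1, by omega⟩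
          refine (ends_copyCmd le_rfl l2.hL r2T hi).imp ?_
          rintro s3 ⟨j1, j2⟩
          -- The keys are monotone, so that one comparison decides equality.
          have hmono := ho.mono t (t + 1) (by omega) hi
          rw [hx] at hmono
          refine ⟨⟨maskSet d R s.mem t, (i5 t (by omega)).congr (fun j hj => j1 j hj) fun _ _ => Iff.rfl,
            fun _ _ => rfl, fun h => absurd (le_antisymm hmono h') (h (by omega))⟩, j2⟩
      · simp [r2T] at h; omega
    refine (hstep.frame).imp ?_
    rintro s3 ⟨⟨⟨C, c1, c2, c3⟩, j2⟩, j3, j4⟩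
    have j3' : ∀ i, s3.reg (.s i) = s2.reg (.s i) := fun i => j3 _ (by simp [Writes, not_writes_copyCmd])
    have l3 : Loaded d s3 := l2.congr fun i _ => j3' i
    have r3X := (j3' 7).trans r2X
    have r3T := (j3' 4).trans r2T
    have r3I := (j3' 12).trans r2I
    rw [← j4 _ (Or.inl (by omega))] at hm3 hm4 hm5
    obtain ⟨b, hb⟩ : ∃ b, b = if (R.node x).sub.kind = 0 then 4 else 0 := ⟨_, rfl⟩
    have hpos : (R.node x).pos < d.n := hR ▸ RegEx.pos_lt (by omega)
    have hsize := (R.node x).sub.one_le_size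
    have hbs := RegEx.base_add_size_le (R := R) (i := x) (by omega)
    have f6 := d.mod_eq (x := (R.node x).base + (R.node x).sub.size) (by omega)
    have f7 : (2 ^ d.w - 1 + ((R.node x).base + (R.node x).sub.size)) % 2 ^ d.w = (R.node x).pos := by
      rw [TreeNode.pos, show 2 ^ d.w - 1 + ((R.node x).base + (R.node x).sub.size) =
        (R.node x).base + (R.node x).sub.size - 1 + 2 ^ d.w by omega, Nat.add_mod_right,
        d.mod_eq (by omega)]
    have f8 : 4 * (R.node x).pos % 2 ^ d.w = 4 * (R.node x).pos := d.mod_eq (by omega)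
    have hregs : leafCmd.Ends d.w d.hi d.hi 1 s3 fun s' =>
        s'.reg vJ = key s.mem x ∧ s'.reg vZ = b ∧ s'.reg vY = 4 * (R.node x).pos := by
      apply ends_of_wp le_rfl
      have b3 : 3 * x < d.hi := by omega
      have b9 : 9 * d.L + x < d.hi := by omega
      have b11 : 11 * d.L + x < d.hi := by omega
      simp [leafCmd, wp, l3.hL, r3X, r3I, e1, e3, e4, e9, e11, e9L, e11L, f2, f4, f5, hm3, hm4, hm5, f6, f7, f8,
        b3, b9, b11, hb]
    refine .seq (((hregs.frame_readOnly).bounds (Dims.addr_lt (by omega) (by omega) d.k_pos).le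
      le_rfl).imp ?_)
    rintro s4 ⟨⟨k1, k2, k3⟩, k4, k5⟩
    have k4' : ∀ i, i ≠ 8 → i ≠ 9 → i ≠ 13 → s4.reg (.s i) = s3.reg (.s i) := fun i h1 h2 h3 =>
      k4 _ (by simp [leafCmd, Writes, h1, h2, h3])
    have l4 : Loaded d s4 := l3.congr fun i _ => k4' i (by omega) (by omega) (by omega)
    have r4T := (k4' 4 (by omega) (by omega) (by omega)).trans r3T
    rw [← k5] at c1
    refine .seq (((ends_enterCmd (b := b) (lo := d.addr 12 0 0) le_rfl l4 r4T k3 k2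
      (by rw [hb]; split_ifs <;> omega) (by omega) hi (by omega) le_rfl c1).frame).imp ?_)
    rintro s5 ⟨⟨m1, m2, m3⟩, -, m5⟩
    rw [maskSet_eq hR ho hi hx hb c2 c3] at m2
    have l5 : Loaded d s5 := l4.congr fun i _ => by rw [m1]
    have r5T : s5.reg vT = i := by rw [m1]; exact r4T
    have hother : ∀ t < d.L, t ≠ i → ∀ j < k,
        s5.mem (d.addr 12 t j) = s2.mem (d.addr 12 t j) := fun t ht hti j hj => by
      have hne : ∀ j' < k, d.addr 12 t j ≠ d.addr 12 i j' := fun j' hj' h =>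
        hti (Dims.addr_inj ht hj hi hj' h).2.1
      rw [m3 _ hne, k5, j2 _ hne]
    have f9 := d.mod_eq (x := i + 1) (by omega)
    refine ends_set le_rfl (by simp) ⟨l5.congr fun i hi => by simp [show i ≠ 4 by omega], ?_, ?_,
      fun a ha => ?_, fun t ht => ?_, fun t ht htL => ?_⟩
    · simp [r5T, e1, f9]
    · simp [m1, k1, hx]
    · rw [St.set_mem, m5 a (Or.inl ha), k5, j4 a (Or.inl ha), i4 a ha]
    · rcases Nat.lt_succ_iff_lt_or_eq.1 ht with h | rfl
      · exact (i5 t h).congr (hother t (by omega) (by omega)) fun _ _ => Iff.rfl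
      · exact m2
    · exact (i6 t (by omega) htL).congr (hother t htL (by omega)) fun _ _ => Iff.rfl
  · refine ⟨hs.congr fun i hi => by simp [show i ≠ 4 by omega], ?_⟩
    simp
    exact h0
  · rintro s1 ⟨-, -, -, -, i5, -⟩
    exact i5

/-- The program of the preprocessing. -/
def preCmd (k : ℕ) : Cmd :=
  dimCmd ;; initCmd k ;; sortCmd ;; sizeCmd ;; layoutCmd k ;; maskCmd k

theorem not_writes_sortCmd {i : ℕ} (hi : i < 4 ∨ i = 10) : ¬ sortCmd.Writes (.s i) := by
  simp [sortCmd, mergePass, mergeCmd, takeCmd, Writes]; omega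

theorem not_writes_sizeCmd {i : ℕ} (hi : i < 4 ∨ i = 10) : ¬ sizeCmd.Writes (.s i) := by
  simp [sizeCmd, Writes]; omega

theorem not_writes_layoutCmd {i : ℕ} (hi : i < 4) : ¬ (layoutCmd k).Writes (.s i) := by
  simp only [layoutCmd, Writes, not_or]
  refine ⟨not_false, by simp; omega, not_writes_nodeCmd (by omega), not_writes_childCmd (by omega),
    not_writes_codeCmd (by omega), not_writes_tableCmd (by omega)⟩

theorem HasOrder.congr {m m' : ℕ → ℕ} (h : HasOrder d m)
    (hm : ∀ a < 9 * d.L, m' a = m a) : HasOrder d m' := by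
  have hn : d.n < d.L := d.n_lt
  have h1 : ∀ t < d.L, m' (7 * d.L + t) = m (7 * d.L + t) := fun t ht => hm _ (by omega)
  have h2 : ∀ t < d.L, key m' (m' (7 * d.L + t)) = key m (m (7 * d.L + t)) := fun t ht => by
    have := h.lt t ht
    rw [h1 t ht, key, hm _ (by omega), key]
  refine ⟨fun t ht => ?_, fun t t' htt ht' => ?_, fun x hx => ?_⟩
  · rw [h1 t ht]; exact h.lt t ht
  · rw [h2 t (by omega), h2 t' ht']; exact h.mono t t' htt ht'
  · obtain ⟨t, ht, e⟩ := h.surj x hx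
    exact ⟨t, ht, by rw [h1 t ht, e]⟩

theorem ends_preCmd (hd : d.Tight) (hR : R.size = d.n) (hH : Nat.log 2 R.numStates = d.H)
    (h0 : s.reg (.v 0) = d.n) (ht : IsTree R s.mem) :
    (preCmd k).Ends d.w (3 * d.n) d.hi ((16 + 13 * k) * d.L * (d.H + 1)) s fun s' =>
      IsStored d R s'.mem := by
  have hn : d.n < d.L := d.n_lt
  have hL := d.L_pos
  have hHL := d.H_lt
  have hhi := d.le_hi
  -- A common bound for all phases; the factor `H + 1` is needed only for sorting.
  have hX1 : d.H + 3 ≤ (16 + 13 * k) * d.L * (d.H + 1) := by nlinarith [Nat.zero_le (k * d.L * (d.H + 1))]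
  have hX2 : (16 + 13 * k) * d.L ≤ (16 + 13 * k) * d.L * (d.H + 1) :=
    Nat.le_mul_of_pos_right _ (by omega)
  have hX3 : 4 * d.L * (d.H + 1) ≤ (16 + 13 * k) * d.L * (d.H + 1) :=
    Nat.mul_le_mul_right _ (Nat.mul_le_mul_right _ (by omega))
  have hX4 : 16 * d.L ≤ (16 + 13 * k) * d.L := Nat.mul_le_mul_right _ (by omega)
  refine .seq ((((ends_dimCmd hd h0).frame_readOnly).bounds (by omega) le_rfl).mono hX1 ?_)
  rintro s1 ⟨⟨a1, a2⟩, -, a3⟩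
  rw [← a3] at ht
  refine .seq (((ends_initCmd a1 a2).frame).mono hX2 ?_)
  rintro s2 ⟨⟨b1, b2, b3, b4⟩, -, b5⟩
  replace ht : IsTree R s2.mem := ht.congr fun a ha => b5 a (Or.inl (by omega))
  refine .seq ((((ends_sortCmd b1 b2 fun t ht => b4 _ (by omega) ?_).frame).bounds
    (by omega) (by omega)).mono hX3 ?_)
  · have : 14 * d.L ≤ (14 + 13 * k) * d.L := Nat.mul_le_mul_right _ (by omega)
    omega
  rintro s3 ⟨c1, c2, c3⟩
  have l3 : Loaded d s3 := b1.congr fun i hi => c2 _ (not_writes_sortCmd (by omega))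
  have n3 := (c2 _ (not_writes_sortCmd (by omega))).trans b2
  have ht3 : IsTree R s3.mem := ht.congr fun a ha => c3 a (by omega)
  refine .seq ((((ends_sizeCmd hR l3 n3 ht3).frame).bounds
    (by omega) (by omega)).mono (by omega) ?_)
  rintro s4 ⟨e1, e2, e3⟩
  have l4 : Loaded d s4 := l3.congr fun i hi => e2 _ (not_writes_sizeCmd (by omega))
  have n4 := (e2 _ (not_writes_sizeCmd (by omega))).trans n3
  have ht4 : IsTree R s4.mem := ht3.congr fun a ha => e3 a (by omega)
  refine .seq ((((ends_layoutCmd hR hH l4 n4 ht4 e1 fun a h1 h2 => ?_).frame).bounds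
    (by omega) le_rfl).mono (by omega) ?_)
  · rw [e3 a (by omega), c3 a (by omega)]
    exact b4 a (by omega) h2
  rintro s5 ⟨⟨f1, f2⟩, f3, f4⟩
  have l5 : Loaded d s5 := l4.congr fun i hi => f3 _ (not_writes_layoutCmd (by omega))
  have ht5 : IsTree R s5.mem := ht4.congr fun a ha => f4 a (by omega)
  have ho5 : HasOrder d s5.mem := c1.congr fun a ha => by rw [f4 a (by omega), e3 a (by omega)]
  have hsz5 : ∀ x < d.n, HasSize d R s5.mem x := fun x hx => (e1 x hx).congr hx fun a ha =>
    f4 a (by omega)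
  have hadd : 14 * d.L ≤ d.addr 12 0 0 := Dims.le_addr
  refine (((ends_maskCmd hR l5 ht5 ho5 hsz5 f1 fun e he => (f2 12 (by omega) e he).congr
    (fun _ _ => rfl) fun p _ => ?_).frame).bounds (by omega) le_rfl).mono (by omega) ?_
  · simp [tableSet, code, mem_nibble]
  rintro s6 ⟨g1, -, g3⟩
  have hm6 : ∀ a < d.addr 12 0 0, s6.mem a = s5.mem a := fun a ha => g3 a (Or.inl ha)
  -- The phases after the initialization write only from address `7 * L` on, so the constants
  -- survive.
  have hcon : ∀ a < 7 * d.L, s6.mem a = s2.mem a := fun a ha => by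
    rw [hm6 a (by omega), f4 a (by omega), e3 a (by omega), c3 a (by omega)]
  have ho6 := ho5.congr (m' := s6.mem) fun a ha => hm6 a (by omega)
  refine ⟨ht5.congr fun a ha => hm6 a (by omega), ⟨?_, ?_, ?_, ?_, ?_⟩, ho6, ?_, ?_⟩
  · rw [hcon _ (by omega), b3.sentinel]
  · rw [hcon _ (by omega), b3.marker]
  · rw [hcon _ (by omega), b3.hH]
  · rw [hcon _ (by omega), b3.hU]
  · rw [hcon _ (by omega), b3.hFull]
  · refine hasTables_of_rows hR hH fun f hf e he =>
      (f2 f (by omega) e he).congr (fun j hj => hm6 _ ?_) fun _ _ => Iff.rfl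
    have h1 : (f * d.L + e + 1) * k ≤ (12 * d.L + 0) * k := by
      refine Nat.mul_le_mul_right _ ?_
      have : (f + 1) * d.L ≤ 12 * d.L := Nat.mul_le_mul_right _ hf
      rw [Nat.add_mul] at this
      omega
    rw [Nat.add_mul (f * d.L + e)] at h1
    simp only [Dims.addr]
    omega
  · intro t ht
    refine (g1 t ht).congr (fun _ _ => rfl) fun p _ => ?_
    rw [maskSet]
    refine iff_of_eq (congrArg (p ∈ ·) (R.ends_congr fun x hx => and_congr_right fun _ => 
      exists_congr fun t' => and_congr_right fun ht' => ?_))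
    have h1 : ∀ t < d.L, s6.mem (7 * d.L + t) = s5.mem (7 * d.L + t) := fun t ht => hm6 _ (by omega)
    have h2 : ∀ x < d.n, key s6.mem x = key s5.mem x := fun x hx => hm6 _ (by omega)
    rw [h1 t' (by omega), h1 t ht, h2 x (by omega), h2 _ (ho5.lt t ht)]

end WordRAM


/-! ### The simulation data structure -/

/-- The record of a node in the input array. -/
def TreeNode.record {w : ℕ} (N : TreeNode (BitVec w)) : List (BitVec w) :=
  [BitVec.ofNat w N.sub.kind,
    match N.sub with
    | .char a => a
    | _ => BitVec.ofNat w N.leftNum,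
    BitVec.ofNat w N.rightNum]

namespace RegEx

/-- The base, level and top mark do not enter the record of a node, hence the arbitrary `b`, `k` and
`t`. -/
theorem encodeFrom_getElem? {w : ℕ} (R : RegEx (BitVec w)) : ∀ (o b k : ℕ) (t : Bool) (i j : ℕ),
    i < R.size → j < 3 →
    (R.encodeFrom o)[3 * i + j]? = (R.nodeAt o b k t (o + i)).record[j]? := by
  induction R with
  | char a =>
    intro o b k t i j hi hj
    simp only [size] at hi
    obtain rfl : i = 0 := by omega
    simp [encodeFrom, nodeAt, TreeNode.record, kind, TreeNode.rightNum]
  | cat S T hS hT | alt S T hS hT =>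
    intro o b k t i j hi hj
    simp only [size] at hi
    simp only [encodeFrom, nodeAt, Nat.add_assoc, Nat.add_lt_add_iff_left]
    have l1 := S.length_encodeFrom o
    have l2 := T.length_encodeFrom (o + S.size)
    by_cases h1 : i < S.size
    · rw [if_pos h1, List.getElem?_append_left (by simp; omega),
        List.getElem?_append_left (by omega)]
      split_ifs <;> exact hS _ _ _ _ i j h1 hj
    rw [if_neg h1]
    by_cases h2 : i < S.size + T.size
    · rw [if_pos h2, List.getElem?_append_left (by simp; omega),
        List.getElem?_append_right (by omega),
        show 3 * i + j - (S.encodeFrom o).length = 3 * (i - S.size) + j by omega,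
        show o + i = o + S.size + (i - S.size) by omega]
      split_ifs <;> exact hT _ _ _ _ (i - S.size) j (by omega) hj
    · rw [if_neg h2, List.getElem?_append_right (by simp; omega)]
      congr 1
      · simp [TreeNode.record, kind, TreeNode.leftNum, TreeNode.rightNum, Nat.add_assoc]
      · rw [List.length_append, l1, l2]
        omega
  | star S hS =>
    intro o b k t i j hi hj
    simp only [size] at hi
    simp only [encodeFrom, nodeAt, Nat.add_lt_add_iff_left]
    have l1 := S.length_encodeFrom o
    by_cases h1 : i < S.size
    · rw [if_pos h1, List.getElem?_append_left (by omega)]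
      exact hS _ _ _ _ i j h1 hj
    · rw [if_neg h1, List.getElem?_append_right (by omega)]
      congr 1
      omega

/-- The node numbers in a record are less than the number of the node. -/
theorem childNum_le {α : Type} {R : RegEx α} {x : ℕ} (hx : x < R.size) :
    (R.node x).leftNum ≤ x ∧ (R.node x).rightNum ≤ x := by
  rcases R.sub_cases x with ⟨a, ha⟩ | ⟨S, T, hST⟩ | ⟨S, hS⟩
  · simp [TreeNode.leftNum, TreeNode.rightNum, ha]
  · obtain ⟨-, -, -, -, h1, h2⟩ := node_children hx hST
    omega
  · have := (node_child_star hx hS).2.2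
    refine ⟨by omega, ?_⟩
    simp [TreeNode.rightNum, hS]

end RegEx

namespace WordRAM

open BitSet Cmd HeavyLayout

variable {k w : ℕ} {R : RegEx (BitVec w)}

/-- Node numbers are less than `2 ^ w`, so nothing is lost when they are stored as words. -/
theorem isTree_of_holdsTree {K p : ℕ} {reg : ℕ → BitVec w} {mem : BitVec w → BitVec w}
    (hw : 3 * R.size < 2 ^ w) (h : HoldsTree R reg mem) :
    IsTree R (Config.abs K ⟨p, reg, mem⟩).mem := by
  have hmem : ∀ x < R.size, ∀ j (hj : j < 3), (Config.abs K ⟨p, reg, mem⟩).mem (3 * x + j) =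
      ((R.node x).record[j]'hj).toNat := by
    intro x hx j hj
    have hlen : R.encode.length = 3 * R.size := R.length_encodeFrom 0
    have h1 := h.2 (3 * x + j) (by omega)
    have h2 := R.encodeFrom_getElem? 0 0 0 true x j hx hj
    rw [List.getElem?_eq_getElem (by rw [RegEx.length_encodeFrom]; omega),
      List.getElem?_eq_getElem (by exact hj), Option.some_inj, Nat.zero_add] at h2
    simp only [Config.abs]
    rw [if_pos (by omega), h1]
    exact congrArg BitVec.toNat h2
  intro x hx
  have hc := RegEx.childNum_le hx
  have hk := kind_lt (R.node x).sub
  refine ⟨?_, ?_, ?_⟩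
  · refine (hmem x hx 0 (by omega)).trans ?_
    simp only [TreeNode.record, List.getElem_cons_zero, BitVec.toNat_ofNat]
    have := R.one_le_size
    refine Nat.mod_eq_of_lt ?_
    -- The kinds need two bits, and `3 ≤ 3 * R.size < 2 ^ w` forces `w` to be at least `2`.
    by_cases h4 : 4 ≤ 2 ^ w
    · omega
    · have h4 : w < 2 := by
        by_contra hcon
        exact h4 (by simpa using Nat.pow_le_pow_right (n := 2) (by norm_num) (not_lt.1 hcon))
      interval_cases w <;> omega
  · refine (hmem x hx 1 (by omega)).trans ?_
    simp only [TreeNode.record, List.getElem_cons_succ, List.getElem_cons_zero, TreeNode.fst]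
    have := Nat.mod_eq_of_lt (show (R.node x).leftNum < 2 ^ w by omega)
    cases (R.node x).sub <;> first | rfl | exact this
  · refine (hmem x hx 2 (by omega)).trans ?_
    simp only [TreeNode.record, List.getElem_cons_succ, List.getElem_cons_zero, BitVec.toNat_ofNat]
    exact Nat.mod_eq_of_lt (by omega)

/-- Bit position of a state: the first `k` words contain the start states. -/
def bitPos (d : Dims k) (R : RegEx (BitVec w)) (s : R.State) : ℕ :=
  (s.idx % 2 * k + R.endPos (s.idx / 2) / d.U) * d.w + R.endPos (s.idx / 2) % d.U

variable {d : Dims k}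

theorem bitPos_bounds (hR : R.size = d.n) (s : R.State) : s.idx / 2 < R.size ∧
    R.endPos (s.idx / 2) / d.U < k ∧ R.endPos (s.idx / 2) % d.U < d.U := by
  have h1 := s.idx_lt
  rw [RegEx.numStates] at h1
  have h2 : s.idx / 2 < R.size := by omega
  have h4n : 4 * d.n ≤ d.U * k := d.four_n_le
  exact ⟨h2, Nat.div_lt_of_lt_mul ((RegEx.endPos_lt R h2).trans_le (by omega)),
    Nat.mod_lt _ (by have := d.four_le_U; omega)⟩

theorem bitPos_eq_iff (hR : R.size = d.n) {s : R.State} {j i : ℕ} (hi : i < d.w) :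
    bitPos d R s = j * d.w + i ↔ s.idx % 2 * k + R.endPos (s.idx / 2) / d.U = j ∧
      R.endPos (s.idx / 2) % d.U = i := by
  obtain ⟨-, -, h3⟩ := bitPos_bounds hR s
  have hU := d.U_lt
  have hw : 0 < d.w := by omega
  constructor
  · intro h
    have h1 := congrArg (· / d.w) h
    simp only [bitPos, Nat.mul_comm _ d.w, Nat.mul_add_div hw, Nat.div_eq_of_lt hi,
      Nat.div_eq_of_lt (show R.endPos (s.idx / 2) % d.U < d.w by omega), Nat.add_zero] at h1
    rw [bitPos, h1] at h
    exact ⟨h1, by omega⟩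
  · rintro ⟨h1, h2⟩
    rw [bitPos, h1, h2]

theorem bitPos_injective (hR : R.size = d.n) : Function.Injective (bitPos d R) := by
  intro s t h
  obtain ⟨s1, s2, s3⟩ := bitPos_bounds hR s
  obtain ⟨t1, t2, t3⟩ := bitPos_bounds hR t
  have hU := d.U_lt
  obtain ⟨h1, h2⟩ := (bitPos_eq_iff hR (i := R.endPos (t.idx / 2) % d.U) (by omega)).1 h
  have hmod : s.idx % 2 = t.idx % 2 := by
    generalize R.endPos (s.idx / 2) / d.U = e at *
    generalize R.endPos (t.idx / 2) / d.U = f at *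
    rcases Nat.mod_two_eq_zero_or_one s.idx with a | a <;>
      rcases Nat.mod_two_eq_zero_or_one t.idx with b | b <;> rw [a, b] at h1 ⊢ <;> omega
  rw [hmod] at h1
  have hdiv : R.endPos (s.idx / 2) / d.U = R.endPos (t.idx / 2) / d.U := by omega
  have := RegEx.endPos_injective R s1 t1 (by
    rw [← Nat.div_add_mod (R.endPos (s.idx / 2)) d.U, hdiv, h2, Nat.div_add_mod])
  exact RegEx.State.idx_injective (by omega)

theorem bitPos_lt (hR : R.size = d.n) (s : R.State) : bitPos d R s < 2 * k * d.w := by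
  obtain ⟨-, h2, h3⟩ := bitPos_bounds hR s
  have hU := d.U_lt
  have h1 : s.idx % 2 * k + R.endPos (s.idx / 2) / d.U + 1 ≤ 2 * k := by
    rcases Nat.mod_two_eq_zero_or_one s.idx with a | a <;> rw [a] <;> omega
  have := Nat.mul_le_mul_right d.w h1
  rw [Nat.add_mul _ 1] at this
  rw [bitPos]; omega

theorem exists_bitPos_iff (hR : R.size = d.n) (S : Set R.State) {b j i : ℕ} (hb : b < 2) (hj : j < k)
    (hi : i < d.w) : (∃ s ∈ S, bitPos d R s = (b * k + j) * d.w + i) ↔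
      i < d.U ∧ d.U * j + i ∈ R.ends fun x => 2 * x + b ∈ RegEx.State.idx '' S := by
  constructor
  · rintro ⟨s, hs, h⟩
    obtain ⟨h1, h2, h3⟩ := bitPos_bounds hR s
    obtain ⟨e1, e2⟩ := (bitPos_eq_iff hR hi).1 h
    have hmod : s.idx % 2 = b := by
      generalize R.endPos (s.idx / 2) / d.U = e at *
      rcases Nat.mod_two_eq_zero_or_one s.idx with a | a <;> rw [a] at e1 ⊢ <;>
        interval_cases b <;> omega
    rw [hmod] at e1
    have hdiv : R.endPos (s.idx / 2) / d.U = j := by omega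
    refine ⟨by omega, s.idx / 2, h1, ⟨s, hs, by omega⟩, ?_⟩
    rw [← hdiv, ← e2, Nat.div_add_mod]
  · rintro ⟨h1, x, hx, ⟨s, hs, e⟩, h2⟩
    have e1 : s.idx / 2 = x := by omega
    have e2 : s.idx % 2 = b := by omega
    have hU : 0 < d.U := by have := d.four_le_U; omega
    refine ⟨s, hs, (bitPos_eq_iff hR hi).2 ⟨?_, ?_⟩⟩
    · rw [e1, e2, ← h2, Nat.mul_add_div hU, Nat.div_eq_of_lt h1]; omega
    · rw [e1, ← h2, Nat.mul_add_mod, Nat.mod_eq_of_lt h1]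

/-- The unused upper bits of each word are the point: a digit has no bits from `U` on, and no state
is mapped to a bit position there, so both descriptions require these bits to be `0`. -/
theorem holdsNums_iff (hR : R.size = d.n) (hw : d.w = w) {S : Set R.State} {p : ℕ}
    {reg : ℕ → BitVec w} {mem : BitVec w → BitVec w} :
    HoldsNums d R (RegEx.State.idx '' S) (Config.abs (2 * k + 1) ⟨p, reg, mem⟩) ↔
      HoldsSet (2 * k) (bitPos d R) S reg := by
  subst hw
  have hreg : ∀ j < 2 * k, (Config.abs (2 * k + 1) ⟨p, reg, mem⟩).reg (.v j) = (reg j).toNat := by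
    intro j hj
    simp [Config.abs, Var.register, hj.le]
  have hU := d.U_lt
  have key : ∀ b < 2, Digits d.U k (fun j => (Config.abs (2 * k + 1) ⟨p, reg, mem⟩).reg (.v (b * k + j)))
      (R.ends fun x => 2 * x + b ∈ RegEx.State.idx '' S) ↔ ∀ j < k, ∀ i < d.w,
        ((reg (b * k + j)).getLsbD i = true ↔ ∃ s ∈ S, bitPos d R s = (b * k + j) * d.w + i) := by
    intro b hb
    refine forall_congr' fun j => forall_congr' fun hj => ?_
    have hbk : b * k + j < 2 * k := by interval_cases b <;> omega
    have htest : ∀ i, ((Config.abs (2 * k + 1) ⟨p, reg, mem⟩).reg (.v (b * k + j))).testBit i =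
        (reg (b * k + j)).getLsbD i := fun i => by rw [hreg _ hbk, BitVec.testBit_toNat]
    simp only [htest]
    constructor
    · intro h i hi
      rw [h i, exists_bitPos_iff hR S hb hj hi]
    · intro h i
      by_cases hi : i < d.w
      · rw [h i hi, exists_bitPos_iff hR S hb hj hi]
      · rw [BitVec.getLsbD_of_ge _ _ (by omega)]
        simp; omega
  have h0 := key 0 (by omega)
  have h1 := key 1 (by omega)
  simp only [Nat.zero_mul, Nat.zero_add, Nat.add_zero, Nat.one_mul] at h0 h1
  rw [HoldsNums, h0, h1]
  constructor
  · rintro ⟨a, b⟩ j hj i hi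
    rcases Nat.lt_or_ge j k with h | h
    · exact a j h i hi
    · have := b (j - k) (by omega) i hi
      rwa [show k + (j - k) = j by omega] at this
  · intro h
    exact ⟨fun j hj => h j (by omega), fun j hj => h (k + j) (by omega)⟩

theorem Cmd.Ends.runs {lo hi X K T : ℕ} {c : Cmd} {Q : St → Prop} {reg : ℕ → BitVec w}
    {mem : BitVec w → BitVec w} (h : c.Ends w lo hi X (Config.abs K ⟨0, reg, mem⟩) Q)
    (hT : c.len * X ≤ T) :
    ∃ g' : Config w, Runs (c.program K) lo hi T reg mem g' ∧ Q (g'.abs K) := by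
  obtain ⟨t, ht, s', hr, hq⟩ := h
  obtain ⟨g', h1, rfl⟩ := hr.runs (ht.trans hT)
  exact ⟨g', h1, hq⟩

end WordRAM


namespace RegEx

open Relation

variable {α : Type} {R : RegEx α}

theorem idx_image_move (S : Set R.State) (a : α) :
    State.idx '' (R.move S a) = {v | ∃ u ∈ State.idx '' S, R.NumTrans (some a) u v} := by
  ext v
  simp only [move, Set.mem_image, Set.mem_iUnion, Set.mem_ofPred_eq, exists_exists_and_eq_and]
  constructor
  · rintro ⟨t, ⟨s, hs, h⟩, rfl⟩
    exact ⟨s, hs, trans_iff.1 h⟩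
  · rintro ⟨s, hs, h⟩
    obtain ⟨s', t, e, rfl, h'⟩ := h.exists_state
    rw [← State.idx_injective e] at h'
    exact ⟨t, ⟨s, hs, h'⟩, rfl⟩

theorem idx_image_close (S : Set R.State) :
    State.idx '' (R.close S) = R.closeNum (State.idx '' S) := by
  ext v
  simp only [closeNum, Set.mem_image, Set.mem_ofPred_eq, exists_exists_and_eq_and]
  constructor
  · rintro ⟨t, ht, rfl⟩
    exact mem_close_iff.1 ht
  · rintro ⟨s, hs, h⟩
    obtain ⟨t, rfl⟩ : ∃ t : R.State, t.idx = v := by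
      rcases h.cases_tail with rfl | ⟨_, _, h⟩
      · exact ⟨s, rfl⟩
      · obtain ⟨-, t, -, e, -⟩ := h.exists_state
        exact ⟨t, e.symm⟩
    exact ⟨t, mem_close_iff.2 ⟨s, hs, h⟩, rfl⟩

theorem idx_mem_image_iff {S : Set R.State} {s : R.State} : s.idx ∈ State.idx '' S ↔ s ∈ S :=
  State.idx_injective.mem_set_image

end RegEx

namespace WordRAM

open BitSet Cmd

theorem two_mul_sq_le_two_pow {w : ℕ} (hw : 8 ≤ w) : 2 * (w * w) ≤ 2 ^ w := by
  induction w, hw using Nat.le_induction with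
  | base => norm_num
  | succ w hw ih => rw [pow_succ]; nlinarith

/-- The digit length is the least admissible power of two. It is at least `4 * 2 ^ H`, which exceeds
`4 * n`, or about a quarter of the word length. In the first case one digit is enough; in the
second, `4 * n = 2 * m ≤ 2 * c * w` bits fit into `16 * c` digits. -/
theorem exists_dims {c k w m K : ℕ} (hk : k = 16 * c + 1) (hm : 2 ≤ m) (hmw : m ≤ c * w) (heven : 2 * (m / 2) = m)
    (hK : K * m ≤ 2 ^ w) (hK1 : 2 ^ (8 * c + 10) ≤ K) (hK2 : 14 + 13 * k < K) :
    ∃ d : Dims k, d.w = w ∧ d.n = m / 2 ∧ d.H = Nat.log 2 m ∧ d.hi = K * m ∧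
      d.Tight := by
  subst hk
  obtain ⟨n, rfl⟩ : ∃ n, m = 2 * n := ⟨_, heven.symm⟩
  rw [Nat.mul_div_cancel_left _ two_pos] at heven ⊢
  -- There are at least two states, so the addressability assumption with a large `K` forces `w` to
  -- be large compared with `c`. This yields room in the words and the bound `U * k + w ≤ 2 * w ^ 2
  -- ≤ 2 ^ w`.
  have hw : 8 * c + 11 ≤ w := by
    refine (Nat.pow_le_pow_iff_right (a := 2) (by norm_num)).1 ?_
    calc 2 ^ (8 * c + 11) = 2 ^ (8 * c + 10) * 2 := pow_succ _ _
      _ ≤ K * (2 * n) := Nat.mul_le_mul hK1 hm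
      _ ≤ 2 ^ w := hK
  obtain ⟨H, hH⟩ : ∃ H, H = Nat.log 2 (2 * n) := ⟨_, rfl⟩
  have hL1 : 2 ^ H ≤ 2 * n := hH ▸ Nat.pow_log_le_self 2 (by omega)
  have hL2 : 2 * n < 2 ^ H * 2 := by
    rw [hH, ← pow_succ]; exact Nat.lt_pow_succ_log_self (by norm_num) _
  have hH1 : 1 ≤ H := hH ▸ Nat.log_pos (by norm_num) hm
  obtain ⟨M, hM⟩ : ∃ M, M = min (4 * 2 ^ H) (w / 4) := ⟨_, rfl⟩
  have hM1 : M ≤ 4 * 2 ^ H := hM ▸ min_le_left _ _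
  have hM2 : M ≤ w / 4 := hM ▸ min_le_right _ _
  have hsq := two_mul_sq_le_two_pow (show 8 ≤ w by omega)
  have hclog : M ≤ 2 ^ Nat.clog 2 M := Nat.le_pow_clog (by norm_num) M
  have hunit : 2 ^ max 2 (Nat.clog 2 M) + 4 ≤ w := by
    rcases le_total (Nat.clog 2 M) 2 with h | h
    · rw [max_eq_left h]; omega
    · rw [max_eq_right h]
      obtain ⟨v, hv⟩ : ∃ v, Nat.clog 2 M = v + 1 := ⟨_, (Nat.sub_add_cancel (by omega)).symm⟩
      -- By minimality half the unit is less than a quarter of the word length, so the unit leaves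
      -- about half the word free.
      have : 2 ^ v < M := (Nat.lt_clog_iff_pow_lt (by norm_num)).1 (by omega)
      rw [hv, pow_succ]; omega
  refine ⟨{
    w := w, n := n, H := H, u := max 2 (Nat.clog 2 M), hi := K * (2 * n)
    one_le_n := by omega
    n_lt := by omega
    le_two_n := hL1
    two_le_u := le_max_left _ _
    u_le := max_le (by omega) (Nat.clog_le_of_le_pow (by rw [pow_add]; omega))
    unit_le := hunit
    four_n_le := ?_
    space_lt := by nlinarith [Nat.pow_pos (n := H) (a := 2) two_pos]
    hi_le := hK
    bits_le := by nlinarith }, rfl, rfl, hH, rfl, ?_⟩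
  · have h1 : M ≤ 2 ^ max 2 (Nat.clog 2 M) :=
      hclog.trans (Nat.pow_le_pow_right two_pos (le_max_right _ _))
    have h2 := Nat.mul_le_mul_right (16 * c + 1) h1
    rcases min_choice (4 * 2 ^ H) (w / 4) with h | h
    · have := Nat.le_mul_of_pos_right M (show 0 < 16 * c + 1 by omega)
      omega
    -- Rounding down the quarter of the word length costs at most a factor two; this is the origin
    -- of `16 * c`.
    · have h3 : w ≤ 8 * M := by omega
      have := Nat.mul_le_mul_left (2 * c) h3
      nlinarith
  · intro i hi
    change 2 ^ i < min (4 * 2 ^ H) (w / 4) ↔ i < max 2 (Nat.clog 2 M)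
    rw [← hM, ← Nat.lt_clog_iff_pow_lt (by norm_num), lt_max_iff]
    omega

/-- The programs, with `2 * k` words for a state-set. -/
def simPrograms (k : ℕ) : SimPrograms where
  setWords := 2 * k
  pre := (preCmd k).program (2 * k + 1)
  move := (moveCmd k).program (2 * k + 1)
  close := (closeCmd k).program (2 * k + 1)
  member := (memberCmd k).program (2 * k + 1)
  insert := (insertCmd k).program (2 * k + 1)

/-- A memory is valid when its abstraction stores the data structure. The programs of the operations
run with empty write bounds, so they preserve validity for free. -/
theorem isSimulationDS {k w : ℕ} {R : RegEx (BitVec w)} (d : Dims k) (hw : d.w = w)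
    (hn : d.n = R.size) (hH : d.H = Nat.log 2 R.numStates) (hd : d.Tight) {prep query : ℕ}
    (hprep : (preCmd k).len * ((16 + 13 * k) * d.L * (d.H + 1)) ≤ prep)
    (hmove : (moveCmd k).len * (d.H + 3) ≤ query) (hclose : (closeCmd k).len * (d.H + 3) ≤ query)
    (hmember : (memberCmd k).len * (d.H + 3) ≤ query)
    (hinsert : (insertCmd k).len * (d.H + 3) ≤ query) :
    IsSimulationDS (simPrograms k) R d.hi prep query := by
  subst hw
  have hR := hn.symm
  have hlen : R.encode.length = 3 * d.n := (R.length_encodeFrom 0).trans (by rw [hn])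
  have hle : 3 * d.n < d.hi := by
    have h1 : d.n < 2 ^ d.H := d.n_lt
    have := d.space_lt
    nlinarith [Nat.zero_le (k * 2 ^ d.H)]
  have hhi := d.hi_le
  have hstates : R.numStates = 2 * d.n := by rw [RegEx.numStates, hR]
  have hlt : ∀ (S : Set R.State), ∀ u ∈ RegEx.State.idx '' S, u < 2 * R.size := by
    rintro S _ ⟨s, -, rfl⟩
    exact s.idx_lt
  have harg : ∀ {s : R.State} {reg : ℕ → BitVec d.w} {mem : BitVec d.w → BitVec d.w},
      reg (2 * k) = BitVec.ofNat d.w s.idx →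
      (Config.abs (2 * k + 1) ⟨0, reg, mem⟩).reg (.v (2 * k)) = s.idx := by
    intro s reg mem h
    have := s.idx_lt
    have h1 : s.idx < 2 ^ d.w := by omega
    simp [Config.abs, Var.register, h, Nat.mod_eq_of_lt h1]
  have hquery : ∀ (reg : ℕ → BitVec d.w) {C : Cmd} {mem : BitVec d.w → BitVec d.w} {Q : St → Prop},
      C.len * (d.H + 3) ≤ query → IsStored d R (Config.abs (2 * k + 1) ⟨0, fun _ => 0, mem⟩).mem →
      C.Ends d.w d.hi d.hi (d.H + 3) (Config.abs (2 * k + 1) ⟨0, reg, mem⟩) Q →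
      ∃ g' : Config d.w, Runs (C.program (2 * k + 1)) R.encode.length d.hi query reg mem g' ∧
        IsStored d R (Config.abs (2 * k + 1) ⟨0, fun _ => 0, g'.mem⟩).mem ∧
        Q (Config.abs (2 * k + 1) g') := by
    intro reg C mem Q hq hs h
    obtain ⟨g', h1, h2, -, h3⟩ :=
      (h.frame_readOnly.bounds (show R.encode.length ≤ d.hi by omega) le_rfl).runs hq
    refine ⟨g', h1, ?_, h2⟩
    -- The abstract memory does not depend on registers or program counter, so the dummy values in
    -- the definition of validity are harmless.
    change IsStored d R (Config.abs (2 * k + 1) g').mem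
    rw [h3]
    exact hs
  refine ⟨bitPos d R, fun mem => IsStored d R (Config.abs (2 * k + 1) ⟨0, fun _ => 0, mem⟩).mem,
    bitPos_injective hR, bitPos_lt hR, ?_, ?_, ?_, ?_, ?_⟩
  · intro reg mem h
    have h0 : (Config.abs (2 * k + 1) ⟨0, reg, mem⟩).reg (.v 0) = d.n := by
      have h1 : R.size < 2 ^ d.w := by omega
      simp [Config.abs, Var.register, h.1, hn, Nat.mod_eq_of_lt h1]
    have := ends_preCmd hd hR hH.symm h0 (isTree_of_holdsTree (by omega) h)
    rw [← hlen] at this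
    obtain ⟨g', h1, h2⟩ := this.runs hprep
    exact ⟨g', h1, h2⟩
  · intro reg mem S a hs hS ha
    obtain ⟨g', h1, h2, h3⟩ := hquery reg hmove hs (ends_move (a := a) hR hs
      ((holdsNums_iff hR rfl).2 hS) (by
        change reg (2 * k) = a at ha
        simp [Config.abs, Var.register, ha]))
    refine ⟨g', h1, h2, (holdsNums_iff hR rfl (p := g'.pc) (mem := g'.mem)).1 ?_⟩
    rw [RegEx.idx_image_move]
    exact h3
  · intro reg mem S hs hS
    obtain ⟨g', h1, h2, h3⟩ := hquery reg hclose hs (ends_close hR hH.symm hs (hlt S)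
      ((holdsNums_iff hR rfl).2 hS))
    refine ⟨g', h1, h2, (holdsNums_iff hR rfl (p := g'.pc) (mem := g'.mem)).1 ?_⟩
    rw [RegEx.idx_image_close]
    exact h3
  · intro reg mem S s hs hS ha
    obtain ⟨g', h1, h2, h3⟩ := hquery reg hmember hs (ends_member hR hs
      ((holdsNums_iff hR rfl).2 hS) (hstates ▸ s.idx_lt) (harg ha))
    rw [RegEx.idx_mem_image_iff] at h3
    have hreg : (Config.abs (2 * k + 1) g').reg (.v 0) = (g'.reg 0).toNat := by
      simp [Config.abs, Var.register]
    rw [hreg] at h3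
    have h2w : 1 < 2 ^ d.w := by have := d.one_le_n; omega
    refine ⟨g', h1, h2, fun hm => ?_, fun hm => ?_⟩
    · exact BitVec.eq_of_toNat_eq ((h3.1 hm).trans (by simp [Nat.mod_eq_of_lt h2w]))
    · exact BitVec.eq_of_toNat_eq ((h3.2 hm).trans (by simp))
  · intro reg mem S s hs hS ha
    obtain ⟨g', h1, h2, h3⟩ := hquery reg hinsert hs (ends_insert hR hs
      ((holdsNums_iff hR rfl).2 hS) (hstates ▸ s.idx_lt) (harg ha))
    refine ⟨g', h1, h2, (holdsNums_iff hR rfl (p := g'.pc) (mem := g'.mem)).1 ?_⟩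
    rw [Set.image_union, Set.image_singleton]
    exact h3

end WordRAM

open WordRAM in
theorem lemma10 (c : ℕ) :
    ∃ (D : SimPrograms) (K : ℕ), ∀ (w : ℕ) (R : RegEx (BitVec w)),
      -- the number `m = R.numStates` of states is `O(w)`
      R.numStates ≤ c * w →
      -- the `O(m)` memory cells can be addressed by words
      K * R.numStates ≤ 2 ^ w →
      IsSimulationDS D R
        (K * R.numStates)
        (K * (R.numStates * Nat.log 2 R.numStates))
        (K * Nat.log 2 R.numStates) := by
  obtain ⟨k, hk⟩ : ∃ k, k = 16 * c + 1 := ⟨_, rfl⟩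
  obtain ⟨A, hA⟩ : ∃ A, A = (preCmd k).len * (16 + 13 * k) * 2 := ⟨_, rfl⟩
  obtain ⟨B, hB⟩ : ∃ B, B = (moveCmd k).len + (closeCmd k).len + (memberCmd k).len +
    (insertCmd k).len := ⟨_, rfl⟩
  obtain ⟨E, hE⟩ : ∃ E, E = 2 ^ (8 * c + 10) := ⟨_, rfl⟩
  -- The summands of `K` serve separate purposes: `E` makes the word length large, the second one
  -- provides the space of the tables, `A` pays for the preprocessing and `4 * B` for the
  -- operations.
  refine ⟨simPrograms k, E + (14 + 13 * k + 1) + A + 4 * B, fun w R hw hK => ?_⟩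
  generalize hKdef : E + (14 + 13 * k + 1) + A + 4 * B = K at hK ⊢
  have hEK : E ≤ K := by omega
  have hsize := R.one_le_size
  have hnum : R.numStates = 2 * R.size := rfl
  obtain ⟨d, h1, h2, h3, h4, h5⟩ := exists_dims hk (by omega) hw (by omega) hK (hE ▸ hEK) (by omega)
  have hH : 1 ≤ d.H := h3 ▸ Nat.log_pos (by norm_num) (by omega)
  have hL : d.L ≤ R.numStates := by
    have : 2 ^ d.H ≤ 2 * d.n := d.le_two_n
    rw [Dims.L]; omega
  rw [← h4]
  have hop : ∀ l ≤ B, l * (d.H + 3) ≤ K * Nat.log 2 R.numStates := by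
    intro l hl
    rw [← h3]
    -- Since `H ≥ 1`, the additive constants in the bounds `H + 3` here and `H + 1` below are
    -- absorbed.
    calc l * (d.H + 3) ≤ B * (4 * d.H) := Nat.mul_le_mul hl (by omega)
      _ = 4 * B * d.H := by ring
      _ ≤ K * d.H := Nat.mul_le_mul_right _ (by omega)
  refine isSimulationDS d h1 (by omega) h3 h5 ?_ (hop _ (by omega)) (hop _ (by omega))
    (hop _ (by omega)) (hop _ (by omega))
  rw [← h3]
  calc (preCmd k).len * ((16 + 13 * k) * d.L * (d.H + 1))
      ≤ (preCmd k).len * ((16 + 13 * k) * R.numStates * (2 * d.H)) := by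
        gcongr; omega
    _ = A * (R.numStates * d.H) := by rw [hA]; ring
    _ ≤ K * (R.numStates * d.H) := Nat.mul_le_mul_right _ (by omega)
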